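/- **Setting.** A Feynman category consists of a groupoid $\mathsf V$, a symmetric monoidal category $(\mathsf F,\otimes)$ and a functor $\iota:\mathsf V\to\mathsf F$ such that the induced functors from the free symmetric monoidal category on $\mathsf V$ to $\mathrm{Iso}(\mathsf F)$, and from the free symmetric monoidal category on $\mathrm{Iso}(\mathsf F\downarrow\mathsf V)$ to $\mathrm{Iso}(\mathsf F\downarrow\mathsf F)$, are equivalences. A basic morphism is a morphism $v_1\otimes\dots\otimes v_m\to v_0$ with all $v_i\in\mathsf V$ (we write $v$ for $\iota v$). A proper degree function is $\deg:\mathrm{Mor}(\mathsf F)\to\mathbb Z_{\ge0}$, additive under $\otimes$ and under composition, with $\deg f=0$ iff $f$ is an isomorphism, and such that every basic morphism is a composite of morphisms of degree $0$ and $1$. Let $C_n^+(X,Y)$ be the set of chains of composable morphisms from $X$ to $Y$ of degree $0$ or $1$, exactly $n$ of which have nonzero degree, modulo the equivalence relation generated by composing degree $0$ morphisms. The Feynman category is cubical if it is equipped with a proper degree function and with free $S_n$-actions on the sets $C_n^+(X,Y)$ that are compatible with the concatenation of chains, such that composition induces bijections $C_n^+(X,Y)_{S_n}\cong \mathrm{Hom}_{\mathsf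 F}(X,Y)_n$ onto the morphisms of degree $n$. Let $k$ be a field of characteristic $0$ and $n\ge1$. Consider the following filtered chain complexes over $k$. * $C_*(P_n)$ has as basis the totally ordered partitions $\alpha=(B_1>\dots>B_s)$ of $\{1,\dots,n\}$ into nonempty blocks, in degree $n-s$. The differential is the sum over all ways to subdivide one block $B_j$ into two nonempty blocks $B'>B''$, with sign $(-1)^{j-1}$. It is filtered by width, the width of $\alpha$ being the size of the least block $B_s$. * $C_*(\Delta^{n-1})$ is the simplicial chain complex with basis the nonempty subsets $X\subset\{1,\dots,n\}$ in degree $|X|-1$, filtered by $|X|$. * For a basic morphism $\varphi:v_1\otimes\dots\otimes v_m\to v_0$ of a cubical Feynman category, $C_*(\varphi)$ is spanned by the trees with inputs $v_1,\dots,v_m$ and output $v_0$ whose vertices are labeled by basic morphisms of nonzero degree and which compose to $\varphi$, with a mod 2 order of the set of internal edges. Isomorphic trees are identified; here the color of an internal edge may be changed along an isomorphism of $\mathsf V$, acting on the labels at both ends. Reversing the mod 2 order changes the sign. A tree with $r$ internal edges has degree $-(r+1)$. The differential is the sum over all edge expansions (into vertices with labels of nonzero degree), the new edge being placed last in the order.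 It is filtered by width, the width of a tree being the degree of the label of its root vertex. Let $\pi:C_*(P_n)\to C_*(\Delta^{n-1})$ be the linear map with $$\pi(\{y_1\}>\dots>\{y_q\}>X)=(-1)^{\mathrm{inv}+\binom q2}\,X,$$ where $\mathrm{inv}$ is the number of pairs $i<i'$ in $\{1,\dots,n\}$ such that the block of $i'$ stands strictly to the left of the block of $i$, and $\pi(\alpha)=0$ if some block of $\alpha$ other than the least one has more than one element. **Statement.** For every basic morphism $\varphi$ of degree $n\ge1$ of a cubical Feynman category there are chain maps $$C_*(P_n)\stackrel{f}{\longrightarrow}\Sigma^nC_*(\varphi)\stackrel{g}{\longrightarrow}C_*(\Delta^{n-1}),$$ both of which preserve the filtrations, are surjective in each degree and are quasi-isomorphisms, and which satisfy $g\circ f=\pi$. -/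

import Mathlib

open CategoryTheory MonoidalCategory

universe w v u v₁ u₁ t

namespace Feyn

section Tensor

variable {C : Type u} [Category.{v} C] [MonoidalCategory C]

/-- The right-bracketed tensor product `X x₁ ⊗ (X x₂ ⊗ ( … ⊗ 𝟙))` of a list of objects. -/
def tens {A : Type*} (X : A → C) : List A → C
  | [] => 𝟙_ C
  | x :: l => X x ⊗ tens X l

/-- The coherence isomorphism between the tensor product of a concatenated list and the
tensor product of the two tensor products. -/
def tensAppend {A : Type*} (X : A → C) :
    ∀ l m : List A, tens X (l ++ m) ≅ tens X l ⊗ tens X m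
  | [], m => (λ_ (tens X m)).symm
  | x :: l, m => whiskerLeftIso (X x) (tensAppend X l m) ≪≫ (α_ (X x) (tens X l) (tens X m)).symm

/-- The morphism `b ⊗ s` on lists. -/
def consHom {A B : Type*} {X : A → C} {Y : B → C} {x : A} {y : B} {l : List A} {m : List B}
    (b : X x ⟶ Y y) (s : tens X l ⟶ tens Y m) : tens X (x :: l) ⟶ tens Y (y :: m) :=
  b ⊗ₘ s

/-- The morphism `s ⊗ t` from a concatenated list to a concatenated list. -/
def appendHom {A B : Type*} {X : A → C} {Y : B → C} {l m : List A} {l' m' : List B}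
    (s : tens X l ⟶ tens Y l') (t : tens X m ⟶ tens Y m') :
    tens X (l ++ m) ⟶ tens Y (l' ++ m') :=
  (tensAppend X l m).hom ≫ (s ⊗ₘ t) ≫ (tensAppend Y l' m').inv

/-- The morphism `g ⊗ s`, where `g` merges an initial segment of the source list into one factor. -/
def spliceHom {A B : Type*} {X : A → C} {Y : B → C} {l m : List A} {y : B} {m' : List B}
    (g : tens X l ⟶ Y y) (s : tens X m ⟶ tens Y m') : tens X (l ++ m) ⟶ tens Y (y :: m') :=
  (tensAppend X l m).hom ≫ (g ⊗ₘ s)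

variable [SymmetricCategory C]

/-- The symmetry exchanging the first two factors. -/
def swapHom {A : Type*} (X : A → C) (x y : A) (l : List A) :
    tens X (x :: y :: l) ⟶ tens X (y :: x :: l) :=
  (α_ (X x) (X y) (tens X l)).inv ≫ (β_ (X x) (X y)).hom ▷ tens X l ≫
    (α_ (X y) (X x) (tens X l)).hom

/-- The symmetry exchanging two adjacent initial blocks of factors. -/
def blockSwap {A : Type*} (X : A → C) (l m k : List A) :
    tens X (l ++ (m ++ k)) ⟶ tens X (m ++ (l ++ k)) :=
  (tensAppend X l (m ++ k)).hom ≫ tens X l ◁ (tensAppend X m k).hom ≫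
    (α_ _ _ _).inv ≫ (β_ (tens X l) (tens X m)).hom ▷ tens X k ≫ (α_ _ _ _).hom ≫
      tens X m ◁ (tensAppend X l k).inv ≫ (tensAppend X m (l ++ k)).inv

/-- The canonical isomorphisms between the tensor products of two orderings of the same list:
those generated by the exchanges of adjacent factors. -/
inductive Canonical {A : Type*} (X : A → C) :
    ∀ L L' : List A, (tens X L ⟶ tens X L') → Prop
  | nil : Canonical X [] [] (𝟙 _)
  | cons (x : A) {L L' : List A} {s : tens X L ⟶ tens X L'} (h : Canonical X L L' s) :
      Canonical X (x :: L) (x :: L') (consHom (𝟙 (X x)) s)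
  | swap (x y : A) (L : List A) : Canonical X (x :: y :: L) (y :: x :: L) (swapHom X x y L)
  | trans {L L' L'' : List A} {s : tens X L ⟶ tens X L'} {t : tens X L' ⟶ tens X L''}
      (h : Canonical X L L' s) (h' : Canonical X L' L'' t) : Canonical X L L'' (s ≫ t)

/-- `Ins x l m` is the type of ways in which the list `m` arises from `l` by inserting `x`. -/
inductive Ins {A : Type*} (x : A) : List A → List A → Type _
  | here (l : List A) : Ins x l (x :: l)
  | there (y : A) {l m : List A} (i : Ins x l m) : Ins x (y :: l) (y :: m)

/-- The symmetry that moves the first factor to the place prescribed by the insertion. -/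
def Ins.map {A : Type*} (X : A → C) {x : A} :
    ∀ {l m : List A}, Ins x l m → (tens X (x :: l) ⟶ tens X m)
  | _, _, .here _ => 𝟙 _
  | _, _, .there y (l := l) i => swapHom X x y l ≫ consHom (𝟙 (X y)) (i.map X)

/-- A morphism between two words in the free symmetric monoidal category on the isomorphisms of
`W`: a bijection of the letters together with an isomorphism between corresponding letters.
An element is given by the image of the first letter and a morphism on the remaining ones, so that
every such morphism is represented exactly once. -/
inductive SymHom (W : Type*) [Category W] : List W → List W → Type _
  | nil : SymHom W [] []
  | cons {x y : W} {l m m' : List W} (f : x ≅ y) (h : SymHom W l m) (i : Ins y m m') :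
      SymHom W (x :: l) m'

/-- The isomorphism of tensor products induced by a morphism of words. -/
def SymHom.map {W : Type*} [Category W] (G : W ⥤ C) :
    ∀ {l m : List W}, SymHom W l m → (tens G.obj l ⟶ tens G.obj m)
  | _, _, .nil => 𝟙 _
  | _, _, .cons f h i => consHom (G.map f.hom) (h.map G) ≫ i.map G.obj

/-- The tensor product `φ₁ ⊗ ⋯ ⊗ φₘ` of morphisms `φⱼ : Xⱼ ⟶ ι vⱼ`. -/
def tensArrow {V : Type*} [Category V] (ι : V ⥤ C) :
    ∀ L : List (Comma (𝟭 C) ι),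
      tens (Comma.fst (𝟭 C) ι).obj L ⟶ tens (Comma.snd (𝟭 C) ι ⋙ ι).obj L
  | [] => 𝟙 _
  | φ :: L => consHom (X := (Comma.fst (𝟭 C) ι).obj) (Y := (Comma.snd (𝟭 C) ι ⋙ ι).obj) φ.hom (tensArrow ι L)

end Tensor

/-- A Feynman category with groupoid of vertices `V` and underlying symmetric monoidal category `C`:
a functor `ι : V ⥤ C` such that

* the induced functor from the free symmetric monoidal category on `V` to the groupoid of
  isomorphisms of `C` is an equivalence (`exists_tens`, `existsUnique_iso`), and
* the induced functor from the free symmetric monoidal category on the isomorphisms of the comma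
  category of arrows `X ⟶ ι v` to the groupoid of isomorphisms of the arrow category of `C` is an
  equivalence (`exists_tensArrow`, `existsUnique_arrowIso`). -/
structure FeynmanCategory (V : Type u₁) [Groupoid.{v₁} V] (C : Type u) [Category.{v} C]
    [MonoidalCategory C] [SymmetricCategory C] where
  ι : V ⥤ C
  exists_tens (X : C) : ∃ l : List V, Nonempty (tens ι.obj l ≅ X)
  existsUnique_iso {l m : List V} (f : tens ι.obj l ≅ tens ι.obj m) :
    ∃! s : SymHom V l m, s.map ι = f.hom
  exists_tensArrow {X Y : C} (f : X ⟶ Y) : ∃ L : List (Comma (𝟭 C) ι),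
    Nonempty (Arrow.mk (tensArrow ι L) ≅ Arrow.mk f)
  existsUnique_arrowIso {L M : List (Comma (𝟭 C) ι)}
    (f : Arrow.mk (tensArrow ι L) ≅ Arrow.mk (tensArrow ι M)) :
    ∃! s : SymHom (Comma (𝟭 C) ι) L M,
      s.map (Comma.fst (𝟭 C) ι) = f.hom.left ∧ s.map (Comma.snd (𝟭 C) ι ⋙ ι) = f.hom.right

variable {V : Type u₁} [Groupoid.{v₁} V] {C : Type u} [Category.{v} C]
    [MonoidalCategory C] [SymmetricCategory C]

namespace FeynmanCategory
/-- The source `v₁ ⊗ ⋯ ⊗ vₙ` of a basic morphism with inputs `v₁, …, vₙ`. -/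
def source (𝔉 : FeynmanCategory V C) {n : ℕ} (a : Fin n → V) : C :=
  tens (fun i => 𝔉.ι.obj (a i)) (List.finRange n)
end FeynmanCategory

/-- Every arrow of the path has degree at most one. -/
def Elementary (deg : ∀ {X Y : C}, (X ⟶ Y) → ℕ) : ∀ {X Y : C}, Quiver.Path X Y → Prop
  | _, _, .nil => True
  | _, _, .cons p f => Elementary deg p ∧ deg f ≤ 1

/-- A proper degree function. The last field says that every basic morphism is a composition of
morphisms of degree zero and one. -/
structure ProperDegree (𝔉 : FeynmanCategory V C) where
  deg : ∀ {X Y : C}, (X ⟶ Y) → ℕ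
  deg_tensor {X Y X' Y' : C} (f : X ⟶ Y) (g : X' ⟶ Y') : deg (f ⊗ₘ g) = deg f + deg g
  deg_comp {X Y Z : C} (f : X ⟶ Y) (g : Y ⟶ Z) : deg (f ≫ g) = deg f + deg g
  deg_eq_zero_iff {X Y : C} (f : X ⟶ Y) : deg f = 0 ↔ IsIso f
  exists_factorization {l : List V} {v : V} (f : tens 𝔉.ι.obj l ⟶ 𝔉.ι.obj v) :
    ∃ p : Quiver.Path (tens 𝔉.ι.obj l) (𝔉.ι.obj v), Elementary deg p ∧ composePath p = f

variable {𝔉 : FeynmanCategory V C} (δ : ProperDegree 𝔉) {n : ℕ} (a : Fin n → V)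

/-- Ordered lists of planar trees whose inputs (leaves) are labelled by elements `i : Fin n`, of
colour `a i`, and whose vertices are labelled by basic morphisms of positive degree. The index is the
list of output colours. A tree is either a bare input `i`, or a vertex labelled by `f` together with
the forest `ch` of its inputs; the vertex carries the name `e : ℕ` of the edge leaving it. -/
inductive Forest : List V → Type (max u₁ v)
  | nil : Forest []
  | leaf (i : Fin n) {m : List V} (F : Forest m) : Forest (a i :: m)
  | node (e : ℕ) {l : List V} {v : V} (f : tens 𝔉.ι.obj l ⟶ 𝔉.ι.obj v) (hf : 0 < δ.deg f)
      (ch : Forest l) {m : List V} (F : Forest m) : Forest (v :: m)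

variable {δ a}
namespace Forest
/-- Juxtaposition of forests. -/
def append : ∀ {l m : List V}, Forest δ a l → Forest δ a m → Forest δ a (l ++ m)
  | _, _, .nil, G => G
  | _, _, .leaf i F, G => .leaf i (F.append G)
  | _, _, .node e f hf ch F, G => .node e f hf ch (F.append G)

/-- The names of the edges leaving the vertices. -/
def names : ∀ {l : List V}, Forest δ a l → List ℕ
  | _, .nil => []
  | _, .leaf _ F => F.names
  | _, .node e _ _ ch F => e :: (ch.names ++ F.names)

/-- The labels of the inputs, from left to right. -/
def leaves : ∀ {l : List V}, Forest δ a l → List (Fin n)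
  | _, .nil => []
  | _, .leaf i F => i :: F.leaves
  | _, .node _ _ _ ch F => ch.leaves ++ F.leaves

/-- The morphism obtained by reading the forest as a flow chart. -/
def comp : ∀ {l : List V} (F : Forest δ a l),
    tens (fun i => 𝔉.ι.obj (a i)) F.leaves ⟶ tens 𝔉.ι.obj l
  | _, .nil => 𝟙 _
  | _, .leaf i F => consHom (X := fun i => 𝔉.ι.obj (a i)) (𝟙 (𝔉.ι.obj (a i))) F.comp
  | _, .node _ f _ ch F => spliceHom (ch.comp ≫ f) F.comp

/-- Change the names of the edges. -/
def rename (ρ : ℕ → ℕ) : ∀ {l : List V}, Forest δ a l → Forest δ a l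
  | _, .nil => .nil
  | _, .leaf i F => .leaf i (F.rename ρ)
  | _, .node e f hf ch F => .node (ρ e) f hf (ch.rename ρ) (F.rename ρ)

end Forest

variable (δ a) in
/-- A forest followed by a layer of morphisms. -/
structure Subst (l : List V) where
  dom : List V
  layer : tens 𝔉.ι.obj dom ⟶ tens 𝔉.ι.obj l
  forest : Forest δ a dom

theorem ProperDegree.deg_comp_pos_right (δ : ProperDegree 𝔉) {X Y Z : C} (r : X ⟶ Y)
    {f : Y ⟶ Z} (hf : 0 < δ.deg f) : 0 < δ.deg (r ≫ f) := by
  rw [δ.deg_comp]; omega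

/-- Contraction of the edge named `e`, which may also be one of the edges at the bottom of the
forest. Contracting an edge that enters a vertex of the forest composes the labels of its two ends.
Contracting an edge at the bottom removes the vertex above it, and its label is recorded in `layer`,
to be composed with the label of the vertex below. -/
def Forest.contract (e : ℕ) : ∀ {l : List V}, Forest δ a l → Subst δ a l
  | _, .nil => ⟨[], 𝟙 _, .nil⟩
  | _, .leaf i F =>
      ⟨a i :: (F.contract e).dom, consHom (𝟙 _) (F.contract e).layer,
        .leaf i (F.contract e).forest⟩
  | _, .node e' (v := v) f hf ch F =>
      if e' = e then
        ⟨(ch.contract e).dom ++ (F.contract e).dom,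
          spliceHom ((ch.contract e).layer ≫ f) (F.contract e).layer,
          (ch.contract e).forest.append (F.contract e).forest⟩
      else
        ⟨v :: (F.contract e).dom, consHom (𝟙 _) (F.contract e).layer,
          .node e' ((ch.contract e).layer ≫ f) (δ.deg_comp_pos_right _ hf)
            (ch.contract e).forest (F.contract e).forest⟩

/-- Isomorphisms of forests, up to a permutation of the trees and identifications of the output
colours. An isomorphism preserves the input labels and the edge names. It may permute the inputs of a
vertex, acting on the label by the symmetries, and relabel the colour of an internal edge along an
isomorphism of `V`, acting on the labels of both ends. The index is the induced isomorphism of the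
tensor products of the output colours. -/
inductive Forest.Iso : ∀ {l l' : List V}, Forest δ a l → Forest δ a l' →
    (tens 𝔉.ι.obj l ⟶ tens 𝔉.ι.obj l') → Prop
  | nil : Forest.Iso .nil .nil (𝟙 _)
  | leaf (i : Fin n) {m m' : List V} {F : Forest δ a m} {F' : Forest δ a m'}
      {s : tens 𝔉.ι.obj m ⟶ tens 𝔉.ι.obj m'} (h : Forest.Iso F F' s) :
      Forest.Iso (.leaf i F) (.leaf i F') (consHom (𝟙 _) s)
  | node (e : ℕ) {l l' : List V} {v v' : V} {f : tens 𝔉.ι.obj l ⟶ 𝔉.ι.obj v}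
      {f' : tens 𝔉.ι.obj l' ⟶ 𝔉.ι.obj v'} (hf : 0 < δ.deg f) (hf' : 0 < δ.deg f')
      {ch : Forest δ a l} {ch' : Forest δ a l'} {r : tens 𝔉.ι.obj l ⟶ tens 𝔉.ι.obj l'}
      (hch : Forest.Iso ch ch' r) (b : v ⟶ v') (hb : r ≫ f' = f ≫ 𝔉.ι.map b)
      {m m' : List V} {F : Forest δ a m} {F' : Forest δ a m'}
      {s : tens 𝔉.ι.obj m ⟶ tens 𝔉.ι.obj m'} (h : Forest.Iso F F' s) :
      Forest.Iso (.node e f hf ch F) (.node e f' hf' ch' F') (consHom (𝔉.ι.map b) s)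
  | swap {l m k : List V} (A : Forest δ a l) (B : Forest δ a m) (F : Forest δ a k) :
      Forest.Iso (A.append (B.append F)) (B.append (A.append F)) (blockSwap 𝔉.ι.obj l m k)
  | trans {l l' l'' : List V} {F : Forest δ a l} {F' : Forest δ a l'} {F'' : Forest δ a l''}
      {s : tens 𝔉.ι.obj l ⟶ tens 𝔉.ι.obj l'} {t : tens 𝔉.ι.obj l' ⟶ tens 𝔉.ι.obj l''}
      (h : Forest.Iso F F' s) (h' : Forest.Iso F' F'' t) : Forest.Iso F F'' (s ≫ t)




def assocHom {A : Type*} (X : A → C) (l m k : List A) :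
    tens X ((l ++ m) ++ k) ⟶ tens X (l ++ (m ++ k)) :=
  (tensAppend X (l ++ m) k).hom ≫ (tensAppend X l m).hom ▷ tens X k ≫ (α_ _ _ _).hom ≫
    tens X l ◁ (tensAppend X m k).inv ≫ (tensAppend X l (m ++ k)).inv

section coh
set_option linter.unusedSectionVars false
variable {A B D : Type*} {X : A → C} {Y : B → C} {Z : D → C}

theorem tensAppend_nil_hom (m : List A) :
    (tensAppend X [] m).hom = (λ_ (tens X m)).inv := rfl
theorem tensAppend_nil_inv (m : List A) :
    (tensAppend X [] m).inv = (λ_ (tens X m)).hom := rfl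
theorem tensAppend_cons_hom (x : A) (l m : List A) :
    (tensAppend X (x :: l) m).hom =
      X x ◁ (tensAppend X l m).hom ≫ (α_ (X x) (tens X l) (tens X m)).inv := rfl
theorem tensAppend_cons_inv (x : A) (l m : List A) :
    (tensAppend X (x :: l) m).inv =
      (α_ (X x) (tens X l) (tens X m)).hom ≫ X x ◁ (tensAppend X l m).inv := rfl

theorem assocHom_nil (m k : List A) :
    assocHom X [] m k = (𝟙 (tens X (m ++ k)) : tens X (m ++ k) ⟶ tens X (m ++ k)) := by
  simp only [assocHom, List.nil_append, tensAppend_nil_hom, tensAppend_nil_inv]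
  change (tensAppend X m k).hom ≫ (λ_ (tens X m)).inv ▷ tens X k ≫
        (α_ (𝟙_ C) (tens X m) (tens X k)).hom ≫ (𝟙_ C) ◁ (tensAppend X m k).inv ≫ (λ_ (tens X (m ++ k))).hom =
    𝟙 (tens X (m ++ k))
  simp

theorem consHom_comp {x : A} {y : B} {z : D} {l : List A} {m : List B} {k : List D}
    (b : X x ⟶ Y y) (s : tens X l ⟶ tens Y m) (c : Y y ⟶ Z z) (t : tens Y m ⟶ tens Z k) :
    consHom b s ≫ consHom c t = consHom (b ≫ c) (s ≫ t) :=
  tensorHom_comp_tensorHom _ _ _ _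

theorem consHom_id (x : A) (l : List A) :
    consHom (𝟙 (X x)) (𝟙 (tens X l)) = 𝟙 (tens X (x :: l)) :=
  id_tensorHom_id _ _

theorem assocHom_cons (x : A) (l m k : List A) :
    assocHom X (x :: l) m k = consHom (𝟙 (X x)) (assocHom X l m k) := by
  simp only [assocHom, List.cons_append, tensAppend_cons_hom, tensAppend_cons_inv, consHom, id_tensorHom, tens]
  simp

theorem appendHom_nil {m : List A} {m' : List B} (t : tens X m ⟶ tens Y m') :
    appendHom (l := []) (l' := []) (𝟙 (𝟙_ C) : tens X [] ⟶ tens Y []) t = t := by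
  simp only [appendHom, tensAppend_nil_hom, tensAppend_nil_inv, List.nil_append]
  change (λ_ (tens X m)).inv ≫ (𝟙 (𝟙_ C) ⊗ₘ t) ≫ (λ_ (tens Y m')).hom = _
  simp

theorem append_aux {P P' L L' M M' N N' : C} (μ : N ≅ L ⊗ M) (μ' : N' ≅ L' ⊗ M') (b : P ⟶ P')
    (s : L ⟶ L') (t : M ⟶ M') :
    (whiskerLeftIso P μ ≪≫ (α_ P L M).symm).hom ≫ ((b ⊗ₘ s) ⊗ₘ t) ≫
      (whiskerLeftIso P' μ' ≪≫ (α_ P' L' M').symm).inv = b ⊗ₘ (μ.hom ≫ (s ⊗ₘ t) ≫ μ'.inv) := by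
  have h : (α_ P L M).inv ≫ ((b ⊗ₘ s) ⊗ₘ t) = (b ⊗ₘ (s ⊗ₘ t)) ≫ (α_ P' L' M').inv := by
    simp
  simp only [Iso.trans_hom, whiskerLeftIso_hom, Iso.symm_hom, Iso.trans_inv, Iso.symm_inv,
    whiskerLeftIso_inv, Category.assoc]
  rw [reassoc_of% h, Iso.inv_hom_id_assoc]
  simp [← id_tensorHom]

theorem appendHom_cons {x : A} {y : B} {l m : List A} {l' m' : List B} (b : X x ⟶ Y y)
    (s : tens X l ⟶ tens Y l') (t : tens X m ⟶ tens Y m') :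
    appendHom (consHom b s) t = consHom b (appendHom s t) :=
  append_aux (tensAppend X l m) (tensAppend Y l' m') b s t

theorem appendHom_comp {l m : List A} {l' m' : List B} {l'' m'' : List D} (s : tens X l ⟶ tens Y l')
    (s' : tens Y l' ⟶ tens Z l'') (t : tens X m ⟶ tens Y m') (t' : tens Y m' ⟶ tens Z m'') :
    appendHom s t ≫ appendHom s' t' = appendHom (s ≫ s') (t ≫ t') := by
  simp [appendHom]

theorem appendHom_id (l m : List A) : appendHom (𝟙 (tens X l)) (𝟙 (tens X m)) = 𝟙 _ := by
  simp [appendHom]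

instance {l m : List A} {l' m' : List B} (s : tens X l ⟶ tens Y l') (t : tens X m ⟶ tens Y m')
    [IsIso s] [IsIso t] : IsIso (appendHom s t) := by
  unfold appendHom; infer_instance

theorem assocHom_naturality {l m k : List A} {l' m' k' : List B} (s : tens X l ⟶ tens Y l')
    (t : tens X m ⟶ tens Y m') (r : tens X k ⟶ tens Y k') :
    appendHom (appendHom s t) r ≫ assocHom Y l' m' k' =
      assocHom X l m k ≫ appendHom s (appendHom t r) := by
  have h : ((s ⊗ₘ t) ⊗ₘ r) ≫ (α_ _ _ _).hom = (α_ _ _ _).hom ≫ (s ⊗ₘ (t ⊗ₘ r)) := by simp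
  simp only [assocHom, appendHom, Category.assoc, Iso.inv_hom_id_assoc, ← id_tensorHom,
    Category.id_comp, Category.comp_id, ← tensorHom_id,
    tensorHom_comp_tensorHom_assoc, Iso.inv_hom_id]
  have h1 : ((tensAppend X l m).hom ≫ (s ⊗ₘ t) ⊗ₘ r) =
    ((tensAppend X l m).hom ⊗ₘ 𝟙 _) ≫ ((s ⊗ₘ t) ⊗ₘ r) := by
    rw [tensorHom_comp_tensorHom, Category.id_comp]
  rw [h1, Category.assoc, reassoc_of% h, tensorHom_comp_tensorHom_assoc, Category.comp_id]

theorem swap_aux {P Q R P' Q' R' : C} (s : P ⟶ P') (t : Q ⟶ Q') (r : R ⟶ R') :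
    (s ⊗ₘ (t ⊗ₘ r)) ≫ (α_ _ _ _).inv ≫ (β_ P' Q').hom ▷ R' ≫ (α_ _ _ _).hom =
      (α_ _ _ _).inv ≫ (β_ P Q).hom ▷ R ≫ (α_ _ _ _).hom ≫ (t ⊗ₘ (s ⊗ₘ r)) := by
  rw [associator_inv_naturality_assoc, ← associator_naturality, ← tensorHom_id,
    ← tensorHom_id, tensorHom_comp_tensorHom_assoc, tensorHom_comp_tensorHom_assoc,
    BraidedCategory.braiding_naturality, Category.comp_id, Category.id_comp]

theorem blockSwap_naturality {l m k : List A} {l' m' k' : List B} (s : tens X l ⟶ tens Y l')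
    (t : tens X m ⟶ tens Y m') (r : tens X k ⟶ tens Y k') :
    appendHom s (appendHom t r) ≫ blockSwap Y l' m' k' =
      blockSwap X l m k ≫ appendHom t (appendHom s r) := by
  have h := swap_aux s t r
  simp only [appendHom, blockSwap, Category.assoc, Iso.inv_hom_id_assoc, ← id_tensorHom,
    tensorHom_comp_tensorHom_assoc, Category.id_comp, Category.comp_id, Iso.inv_hom_id]
  have h2 : (s ⊗ₘ (tensAppend X m k).hom ≫ (t ⊗ₘ r)) =
      (𝟙 (tens X l) ⊗ₘ (tensAppend X m k).hom) ≫ (s ⊗ₘ (t ⊗ₘ r)) := by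
    rw [tensorHom_comp_tensorHom, Category.id_comp]
  rw [h2, Category.assoc, reassoc_of% h, tensorHom_comp_tensorHom_assoc, Category.comp_id]

variable (X)
theorem blockSwap_assoc (l m k p : List A) :
    appendHom (blockSwap X l m k) (𝟙 (tens X p)) ≫ assocHom X m (l ++ k) p ≫
        appendHom (𝟙 (tens X m)) (assocHom X l k p) =
      assocHom X l (m ++ k) p ≫ appendHom (𝟙 (tens X l)) (assocHom X m k p) ≫
      blockSwap X l m (k ++ p) := by
  simp only [appendHom, blockSwap, assocHom]
  simp only [tensorHom_id, id_tensorHom, comp_whiskerRight, Category.assoc,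
    Iso.inv_hom_id_assoc, MonoidalCategory.whiskerLeft_comp, inv_hom_whiskerRight_assoc,
    whiskerLeft_inv_hom_assoc]
  simp only [associator_inv_naturality_right_assoc, whisker_exchange_assoc,
    associator_naturality_right_assoc]
  simp

theorem blockSwap_symm (l m k : List A) : blockSwap X l m k ≫ blockSwap X m l k = 𝟙 _ := by
  simp [blockSwap, ← comp_whiskerRight_assoc]

instance (l m k : List A) : IsIso (assocHom X l m k) := by
  unfold assocHom; infer_instance
variable {X}

theorem appendHom_spliceHom {l m : List A} {l' m' : List D} {y : B} {k : List B} (r : tens X l ⟶ tens Z l')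
    (s : tens X m ⟶ tens Z m') (g : tens Z l' ⟶ Y y) (t : tens Z m' ⟶ tens Y k) :
    appendHom r s ≫ spliceHom g t = spliceHom (r ≫ g) (s ≫ t) := by
  have aux : ∀ {L M L' M' N N' P Q : C} (μ : N ≅ L ⊗ M) (μ' : N' ≅ L' ⊗ M') (r : L ⟶ L')
      (s : M ⟶ M') (g : L' ⟶ P) (t : M' ⟶ Q),
      (μ.hom ≫ (r ⊗ₘ s) ≫ μ'.inv) ≫ μ'.hom ≫ (g ⊗ₘ t) = μ.hom ≫ (r ≫ g ⊗ₘ s ≫ t) := by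
    intros; simp
  exact aux _ _ _ _ _ _

theorem spliceHom_consHom {l m : List A} {y : B} {k : List B} {z : D} {p : List D}
    (g : tens X l ⟶ Y y) (t : tens X m ⟶ tens Y k) (b : Y y ⟶ Z z) (s : tens Y k ⟶ tens Z p) :
    spliceHom g t ≫ consHom b s = spliceHom (g ≫ b) (t ≫ s) := by
  have aux : ∀ {L M N P Q P' Q' : C} (μ : N ≅ L ⊗ M) (g : L ⟶ P) (t : M ⟶ Q) (b : P ⟶ P')
      (s : Q ⟶ Q'), (μ.hom ≫ (g ⊗ₘ t)) ≫ (b ⊗ₘ s) = μ.hom ≫ (g ≫ b ⊗ₘ t ≫ s) := by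
    intros; simp
  exact aux _ _ _ _ _

theorem splice_aux {P L M K M' K' N Q S T R' : C} (g : L ⟶ P) (s : M ⟶ M') (t : K ⟶ K')
    (μ : N ≅ L ⊗ M) (μ' : Q ≅ N ⊗ K) (ν : S ≅ M ⊗ K) (ξ : T ≅ L ⊗ S) (ν' : R' ≅ M' ⊗ K') :
    (μ'.hom ≫ μ.hom ▷ K ≫ (α_ _ _ _).hom ≫ L ◁ ν.inv ≫ ξ.inv) ≫
        ξ.hom ≫ (g ⊗ₘ (ν.hom ≫ (s ⊗ₘ t) ≫ ν'.inv)) =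
      μ'.hom ≫ ((μ.hom ≫ (g ⊗ₘ s)) ⊗ₘ t) ≫ (whiskerLeftIso P ν' ≪≫ (α_ P M' K').symm).inv := by
  have h : ((g ⊗ₘ s) ⊗ₘ t) ≫ (α_ _ _ _).hom = (α_ _ _ _).hom ≫ (g ⊗ₘ (s ⊗ₘ t)) := by simp
  have h1 : ((μ.hom ≫ (g ⊗ₘ s)) ⊗ₘ t) = μ.hom ▷ _ ≫ ((g ⊗ₘ s) ⊗ₘ t) := by
    rw [← tensorHom_id, tensorHom_comp_tensorHom, Category.id_comp]
  simp only [Iso.trans_inv, Iso.symm_inv, whiskerLeftIso_inv, Category.assoc,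
    Iso.inv_hom_id_assoc]
  rw [h1, Category.assoc, reassoc_of% h, ← id_tensorHom, ← id_tensorHom,
    tensorHom_comp_tensorHom, tensorHom_comp_tensorHom,
    Category.comp_id, Category.id_comp, Iso.inv_hom_id_assoc]

theorem assocHom_spliceHom {l m k : List A} {y : B} {m' k' : List B} (g : tens X l ⟶ Y y)
    (s : tens X m ⟶ tens Y m') (t : tens X k ⟶ tens Y k') :
    assocHom X l m k ≫ spliceHom g (appendHom s t) = appendHom (spliceHom g s) t :=
  splice_aux g s t _ _ _ _ _

end coh

namespace Forest

theorem Iso.congr {l l' : List V} {F : Forest δ a l} {F' : Forest δ a l'}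
    {s t : tens 𝔉.ι.obj l ⟶ tens 𝔉.ι.obj l'} (h : Iso F F' s) (e : s = t) : Iso F F' t := e ▸ h

theorem Iso.refl {l : List V} (F : Forest δ a l) : Iso F F (𝟙 _) := by
  induction F with
  | nil => exact .nil
  | leaf i F ih => exact (Iso.leaf i ih).congr (consHom_id _ _)
  | node e f hf ch F ih1 ih2 =>
    refine (Iso.node e hf hf ih1 (𝟙 _) (by simp) ih2).congr ?_
    rw [CategoryTheory.Functor.map_id, consHom_id]

theorem Iso.symm {l l' : List V} {F : Forest δ a l} {F' : Forest δ a l'}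
    {s : tens 𝔉.ι.obj l ⟶ tens 𝔉.ι.obj l'} (h : Iso F F' s) :
    ∃ s', Iso F' F s' ∧ s ≫ s' = 𝟙 _ ∧ s' ≫ s = 𝟙 _ := by
  induction h with
  | nil => exact ⟨_, .nil, by simp, by simp⟩
  | leaf i h ih =>
    obtain ⟨s', h', h1, h2⟩ := ih
    refine ⟨_, .leaf i h', ?_, ?_⟩
    · rw [consHom_comp, h1, Category.comp_id, consHom_id]
    · rw [consHom_comp, h2, Category.comp_id, consHom_id]
  | node e hf hf' hch b hb h ih1 ih2 =>
    obtain ⟨s', h', h1, h2⟩ := ih2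
    obtain ⟨r', h'', h3, h4⟩ := ih1
    refine ⟨_, .node e hf' hf h'' (Groupoid.inv b) ?_ h', ?_, ?_⟩
    · rw [← cancel_mono (𝔉.ι.map b), Category.assoc, Category.assoc, ← Functor.map_comp,
        Groupoid.inv_comp, CategoryTheory.Functor.map_id, Category.comp_id, ← hb, reassoc_of% h4]
    · rw [consHom_comp, h1, ← Functor.map_comp, Groupoid.comp_inv, CategoryTheory.Functor.map_id, consHom_id]
    · rw [consHom_comp, h2, ← Functor.map_comp, Groupoid.inv_comp, CategoryTheory.Functor.map_id, consHom_id]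
  | swap A B F => exact ⟨_, .swap B A F, blockSwap_symm _ _ _ _, blockSwap_symm _ _ _ _⟩
  | trans h h' ih1 ih2 =>
    obtain ⟨s', h1, h2, h3⟩ := ih1
    obtain ⟨t', h4, h5, h6⟩ := ih2
    exact ⟨_, .trans h4 h1, by simp [reassoc_of% h5, h2], by simp [reassoc_of% h3, h6]⟩

theorem Iso.inv {l l' : List V} {F : Forest δ a l} {F' : Forest δ a l'}
    {s : tens 𝔉.ι.obj l ⟶ tens 𝔉.ι.obj l'} [IsIso s] (h : Iso F F' s) :
    Iso F' F (CategoryTheory.inv s) := by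
  obtain ⟨s', h1, h2, h3⟩ := h.symm
  exact h1.congr (IsIso.eq_inv_of_hom_inv_id h2)

theorem Iso.assoc {l m k : List V} (A : Forest δ a l) (B : Forest δ a m) (F : Forest δ a k) :
    Iso ((A.append B).append F) (A.append (B.append F)) (assocHom 𝔉.ι.obj l m k) := by
  induction A with
  | nil => exact (Iso.refl (B.append F)).congr (assocHom_nil m k).symm
  | leaf i A ih => exact (Iso.leaf i ih).congr (assocHom_cons _ _ _ _).symm
  | node e f hf ch A ih1 ih2 =>
    refine (Iso.node e hf hf (Iso.refl ch) (𝟙 _) (by simp) ih2).congr ?_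
    rw [CategoryTheory.Functor.map_id]
    exact (assocHom_cons _ _ _ _).symm

theorem Iso.append {l l' m m' : List V} {F : Forest δ a l} {F' : Forest δ a l'}
    {s : tens 𝔉.ι.obj l ⟶ tens 𝔉.ι.obj l'} (h : Iso F F' s)
    {G : Forest δ a m} {G' : Forest δ a m'}
    {t : tens 𝔉.ι.obj m ⟶ tens 𝔉.ι.obj m'} (h' : Iso G G' t) :
    Iso (F.append G) (F'.append G') (appendHom s t) := by
  have key2 : ∀ {l m m' : List V} (F : Forest δ a l) {G : Forest δ a m} {G' : Forest δ a m'}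
      {t : tens 𝔉.ι.obj m ⟶ tens 𝔉.ι.obj m'} (_ : Iso G G' t),
      Iso (F.append G) (F.append G') (appendHom (𝟙 _) t) := by
    intro l m m' F G G' t h'
    induction F with
    | nil => exact h'.congr (appendHom_nil _).symm
    | leaf i F ih =>
      exact (Iso.leaf i ih).congr (by rw [← consHom_id, appendHom_cons])
    | node e f hf ch F ih1 ih2 =>
      refine (Iso.node e hf hf (Iso.refl ch) (𝟙 _) (by simp) ih2).congr ?_
      rw [CategoryTheory.Functor.map_id, ← consHom_id, appendHom_cons]
  have key : ∀ {l l' m : List V} {F : Forest δ a l} {F' : Forest δ a l'}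
      {s : tens 𝔉.ι.obj l ⟶ tens 𝔉.ι.obj l'} (_ : Iso F F' s) (G : Forest δ a m),
      Iso (F.append G) (F'.append G) (appendHom s (𝟙 _)) := by
    intro l l' m F F' s h G
    induction h with
    | nil => exact (Iso.refl _).congr (appendHom_nil _).symm
    | leaf i h ih => exact (Iso.leaf i ih).congr (appendHom_cons _ _ _).symm
    | node e hf hf' hch b hb h ih1 ih2 =>
      exact (Iso.node e hf hf' hch b hb ih2).congr (appendHom_cons _ _ _).symm
    | @swap l m k A B F =>
      have h1 := (Iso.assoc A (B.append F) G).trans (key2 A (Iso.assoc B F G))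
      have h2 := (Iso.assoc B (A.append F) G).trans (key2 B (Iso.assoc A F G))
      refine ((h1.trans (.swap A B _)).trans h2.inv).congr ?_
      rw [IsIso.comp_inv_eq, Category.assoc, ← blockSwap_assoc]
    | trans h h' ih1 ih2 =>
      exact (ih1.trans ih2).congr (by rw [appendHom_comp, Category.id_comp])
  exact ((key h G).trans (key2 _ h')).congr (by rw [appendHom_comp, Category.comp_id, Category.id_comp])

end Forest




namespace Subst

abbrev append {l m : List V} (P : Subst δ a l) (Q : Subst δ a m) : Subst δ a (l ++ m) :=
  ⟨P.dom ++ Q.dom, appendHom P.layer Q.layer, P.forest.append Q.forest⟩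

abbrev postcomp {l m : List V} (P : Subst δ a l) (s : tens 𝔉.ι.obj l ⟶ tens 𝔉.ι.obj m) :
    Subst δ a m :=
  ⟨P.dom, P.layer ≫ s, P.forest⟩

abbrev contract (e : ℕ) {l : List V} (P : Subst δ a l) : Subst δ a l :=
  (P.forest.contract e).postcomp P.layer

def rename (ρ : ℕ → ℕ) {l : List V} (P : Subst δ a l) : Subst δ a l :=
  ⟨P.dom, P.layer, P.forest.rename ρ⟩

def Rel {l l' : List V} (P : Subst δ a l) (Q : Subst δ a l')
    (r : tens 𝔉.ι.obj l ⟶ tens 𝔉.ι.obj l') : Prop :=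
  ∃ q, Forest.Iso P.forest Q.forest q ∧ q ≫ Q.layer = P.layer ≫ r

theorem Rel.refl {l : List V} (P : Subst δ a l) : Rel P P (𝟙 _) :=
  ⟨_, Forest.Iso.refl _, by simp⟩

theorem Rel.trans {l l' l'' : List V} {P : Subst δ a l} {Q : Subst δ a l'} {R : Subst δ a l''}
    {r : tens 𝔉.ι.obj l ⟶ tens 𝔉.ι.obj l'} {s : tens 𝔉.ι.obj l' ⟶ tens 𝔉.ι.obj l''}
    (h : Rel P Q r) (h' : Rel Q R s) : Rel P R (r ≫ s) := by
  obtain ⟨q, h1, h2⟩ := h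
  obtain ⟨q', h3, h4⟩ := h'
  exact ⟨_, h1.trans h3, by rw [Category.assoc, h4, reassoc_of% h2]⟩

theorem Rel.congr {l l' : List V} {P : Subst δ a l} {Q : Subst δ a l'}
    {r s : tens 𝔉.ι.obj l ⟶ tens 𝔉.ι.obj l'} (h : Rel P Q r) (e : r = s) : Rel P Q s := e ▸ h

theorem Rel.symm {l : List V} {P : Subst δ a l} {Q : Subst δ a l} (h : Rel P Q (𝟙 _)) :
    Rel Q P (𝟙 _) := by
  obtain ⟨q, h1, h2⟩ := h
  obtain ⟨q', h3, h4, h5⟩ := h1.symm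
  refine ⟨q', h3, ?_⟩
  rw [Category.comp_id] at h2 ⊢
  rw [← h2, reassoc_of% h5]

theorem Rel.append {l l' m m' : List V} {P : Subst δ a l} {P' : Subst δ a l'}
    {Q : Subst δ a m} {Q' : Subst δ a m'}
    {r : tens 𝔉.ι.obj l ⟶ tens 𝔉.ι.obj l'} {s : tens 𝔉.ι.obj m ⟶ tens 𝔉.ι.obj m'}
    (h : Rel P P' r) (h' : Rel Q Q' s) : Rel (P.append Q) (P'.append Q') (appendHom r s) := by
  obtain ⟨q, h1, h2⟩ := h
  obtain ⟨q', h3, h4⟩ := h'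
  refine ⟨_, h1.append h3, ?_⟩
  simp only [Subst.append]
  rw [appendHom_comp, appendHom_comp, h2, h4]

theorem Rel.swap {l m k : List V} (P : Subst δ a l) (Q : Subst δ a m) (R : Subst δ a k) :
    Rel (P.append (Q.append R)) (Q.append (P.append R)) (blockSwap 𝔉.ι.obj l m k) :=
  ⟨_, .swap _ _ _, (blockSwap_naturality _ _ _).symm⟩

end Subst

namespace Forest
open Subst

theorem contract_node_pos {e e' : ℕ} (h : e' = e) {l : List V} {v : V}
    (f : tens 𝔉.ι.obj l ⟶ 𝔉.ι.obj v) (hf : 0 < δ.deg f) (ch : Forest δ a l) {m : List V}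
    (F : Forest δ a m) : (node e' f hf ch F).contract e =
      ⟨(ch.contract e).dom ++ (F.contract e).dom,
          spliceHom ((ch.contract e).layer ≫ f) (F.contract e).layer,
          (ch.contract e).forest.append (F.contract e).forest⟩ := by
  simp [contract, h]

theorem contract_node_neg {e e' : ℕ} (h : e' ≠ e) {l : List V} {v : V}
    (f : tens 𝔉.ι.obj l ⟶ 𝔉.ι.obj v) (hf : 0 < δ.deg f) (ch : Forest δ a l) {m : List V}
    (F : Forest δ a m) : (node e' f hf ch F).contract e =
      ⟨v :: (F.contract e).dom, consHom (𝟙 _) (F.contract e).layer,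
          .node e' ((ch.contract e).layer ≫ f) (δ.deg_comp_pos_right _ hf)
            (ch.contract e).forest (F.contract e).forest⟩ := by
  simp [contract, h]

theorem contract_append (e : ℕ) {l m : List V} (A : Forest δ a l) (B : Forest δ a m) :
    Rel ((A.append B).contract e) ((A.contract e).append (B.contract e)) (𝟙 _) := by
  induction A with
  | nil =>
    refine ⟨_, Iso.refl (B.contract e).forest, ?_⟩
    refine Eq.trans ?_ (Category.comp_id _).symm
    refine (Category.id_comp _).trans ?_
    exact appendHom_nil (B.contract e).layer
  | leaf i A ih =>
    obtain ⟨q, h1, h2⟩ := ih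
    change tens _ _ ⟶ tens _ ((A.contract e).dom ++ (B.contract e).dom) at q
    change Iso _ ((A.contract e).forest.append (B.contract e).forest) q at h1
    refine ⟨_, Iso.leaf i h1, ?_⟩
    simp only [Subst.append, contract, Forest.append] at h2 ⊢
    rw [Category.comp_id] at h2
    rw [appendHom_cons, consHom_comp, h2, Category.comp_id]
    exact (Category.comp_id _).symm
  | node e' f hf ch A ih1 ih2 =>
    obtain ⟨q, h1, h2⟩ := ih2
    change tens _ _ ⟶ tens _ ((A.contract e).dom ++ (B.contract e).dom) at q
    change Iso _ ((A.contract e).forest.append (B.contract e).forest) q at h1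
    rw [Category.comp_id] at h2
    by_cases he : e' = e
    · simp only [Forest.append, contract, if_pos he]
      refine ⟨_, ((Iso.refl (ch.contract e).forest).append h1).trans (Iso.assoc _ _ _).inv, ?_⟩
      simp only [Subst.append] at h2 ⊢
      rw [Category.assoc, ← assocHom_spliceHom, IsIso.inv_hom_id_assoc, appendHom_spliceHom, h2,
        Category.id_comp]
      exact (Category.comp_id _).symm
    · simp only [Forest.append, contract, if_neg he]
      refine ⟨_, .node e' _ _ (Iso.refl _) (𝟙 _) (by simp) h1, ?_⟩
      simp only [Subst.append] at h2 ⊢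
      rw [appendHom_cons, CategoryTheory.Functor.map_id, consHom_comp, h2, Category.comp_id]
      exact (Category.comp_id _).symm

theorem Iso.contract (e : ℕ) {l l' : List V} {F : Forest δ a l} {F' : Forest δ a l'}
    {s : tens 𝔉.ι.obj l ⟶ tens 𝔉.ι.obj l'} (h : Iso F F' s) :
    Rel (F.contract e) (F'.contract e) s := by
  induction h with
  | nil => exact Rel.refl _
  | leaf i h ih =>
    obtain ⟨q, h1, h2⟩ := ih
    refine ⟨_, Iso.leaf i h1, ?_⟩
    simp only [Forest.contract]
    rw [consHom_comp, consHom_comp, h2]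
  | node e' hf hf' hch b hb h ih1 ih2 =>
    obtain ⟨q, h1, h2⟩ := ih2
    obtain ⟨r, h3, h4⟩ := ih1
    by_cases he : e' = e
    · simp only [Forest.contract, if_pos he]
      refine ⟨_, h3.append h1, ?_⟩
      simp only
      rw [appendHom_spliceHom, spliceHom_consHom, h2, reassoc_of% h4, hb, Category.assoc]
    · simp only [Forest.contract, if_neg he]
      refine ⟨_, .node e' _ _ h3 b (by rw [reassoc_of% h4, hb, Category.assoc]) h1, ?_⟩
      simp only
      rw [consHom_comp, consHom_comp, h2, Category.comp_id, Category.id_comp]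
  | swap A B F =>
    have h1 := (contract_append e A (B.append F)).trans
      ((Rel.refl (A.contract e)).append (contract_append e B F))
    have h2 := ((Rel.refl (B.contract e)).append (contract_append e A F).symm).trans
      (contract_append e B (A.append F)).symm
    refine ((h1.trans (Rel.swap _ _ _)).trans h2).congr ?_
    simp only [appendHom_id, Category.comp_id, Category.id_comp]
  | trans h h' ih1 ih2 => exact ih1.trans ih2

theorem contract_contract (e e' : ℕ) {l : List V} (F : Forest δ a l) :
    Rel ((F.contract e).contract e') ((F.contract e').contract e) (𝟙 _) := by
  by_cases hee : e = e'
  · subst hee; exact Rel.refl _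
  induction F with
  | nil => exact Rel.refl _
  | leaf i F ih =>
    obtain ⟨q, h1, h2⟩ := ih
    refine ⟨_, Iso.leaf i h1, ?_⟩
    rw [Category.comp_id] at h2 ⊢
    simp only [Forest.contract] at h2 ⊢
    rw [consHom_comp, consHom_comp, consHom_comp, h2, Category.comp_id, Category.comp_id]
  | node e₁ f hf ch F ih1 ih2 =>
    have key : ∀ {e e' : ℕ}, e ≠ e' → e₁ = e →
        Rel ((ch.contract e).contract e') ((ch.contract e').contract e) (𝟙 _) →
        Rel ((F.contract e).contract e') ((F.contract e').contract e) (𝟙 _) →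
        Rel (((node e₁ f hf ch F).contract e).contract e')
          (((node e₁ f hf ch F).contract e').contract e) (𝟙 _) := by
      rintro e e' hee he ⟨r, h3, h4⟩ ⟨q, h1, h2⟩
      have he' : e₁ ≠ e' := fun h => hee (he.symm.trans h)
      rw [contract_node_pos he, contract_node_neg he']
      dsimp only [Subst.contract]
      rw [contract_node_pos he]
      obtain ⟨p, h5, h6⟩ := contract_append e' (ch.contract e).forest (F.contract e).forest
      refine ⟨_, h5.trans (h3.append h1), ?_⟩
      rw [Category.comp_id] at h2 h4 h6 ⊢
      dsimp only [Subst.postcomp, Subst.append] at h2 h4 h6 ⊢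
      rw [spliceHom_consHom, ← h6, Category.assoc p, Category.assoc p, appendHom_spliceHom,
        appendHom_spliceHom, Category.comp_id, h2, ← Category.assoc _ _ f, ← Category.assoc _ _ f,
        ← Category.assoc _ _ f, h4]
    by_cases he : e₁ = e
    · exact key hee he ih1 ih2
    by_cases he' : e₁ = e'
    · exact (key (Ne.symm hee) he' ih1.symm ih2.symm).symm
    obtain ⟨q, h1, h2⟩ := ih2
    obtain ⟨r, h3, h4⟩ := ih1
    rw [contract_node_neg he, contract_node_neg he']
    dsimp only [Subst.contract]
    rw [contract_node_neg he, contract_node_neg he']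
    rw [Category.comp_id] at h2 h4
    dsimp only [Subst.postcomp, Subst.append] at h2 h4
    refine ⟨_, .node e₁ _ _ h3 (𝟙 _) ?_ h1, ?_⟩
    · rw [CategoryTheory.Functor.map_id, Category.comp_id, ← Category.assoc _ _ f,
        ← Category.assoc, h4, Category.assoc]
    · dsimp only [Subst.postcomp]
      rw [consHom_comp, consHom_comp, consHom_comp, h2, CategoryTheory.Functor.map_id]
      simp only [Category.comp_id]

end Forest



namespace Forest
open Subst

theorem rename_append (ρ : ℕ → ℕ) {l m : List V} (A : Forest δ a l) (B : Forest δ a m) :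
    (A.append B).rename ρ = (A.rename ρ).append (B.rename ρ) := by
  induction A with
  | nil => rfl
  | leaf i A ih => simp only [Forest.append, rename]; rw [ih]
  | node e f hf ch A ih1 ih2 => simp only [Forest.append, rename]; rw [ih2]

theorem names_append {l m : List V} (A : Forest δ a l) (B : Forest δ a m) :
    (A.append B).names = A.names ++ B.names := by
  induction A with
  | nil => rfl
  | leaf i A ih => simp only [Forest.append, names]; rw [ih]
  | node e f hf ch A ih1 ih2 => simp only [Forest.append, names]; rw [ih2]; simp

theorem names_rename (ρ : ℕ → ℕ) {l : List V} (A : Forest δ a l) :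
    (A.rename ρ).names = A.names.map ρ := by
  induction A with
  | nil => rfl
  | leaf i A ih => simp only [rename, names]; rw [ih]
  | node e f hf ch A ih1 ih2 => simp only [rename, names]; rw [ih1, ih2]; simp

theorem rename_rename (ρ σ : ℕ → ℕ) {l : List V} (A : Forest δ a l) :
    (A.rename ρ).rename σ = A.rename (σ ∘ ρ) := by
  induction A with
  | nil => rfl
  | leaf i A ih => simp only [rename]; rw [ih]
  | node e f hf ch A ih1 ih2 => simp only [rename]; rw [ih1, ih2]; rfl

theorem rename_congr {ρ σ : ℕ → ℕ} {l : List V} (A : Forest δ a l)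
    (h : ∀ x ∈ A.names, ρ x = σ x) : A.rename ρ = A.rename σ := by
  induction A with
  | nil => rfl
  | leaf i A ih => simp only [rename]; rw [ih h]
  | node e f hf ch A ih1 ih2 =>
    simp only [names, List.mem_cons, List.mem_append] at h
    simp only [rename]
    rw [ih1 fun x hx => h x (.inr (.inl hx)), ih2 fun x hx => h x (.inr (.inr hx)), h e (.inl rfl)]

theorem rename_id {l : List V} (A : Forest δ a l) : A.rename id = A := by
  induction A with
  | nil => rfl
  | leaf i A ih => simp only [rename]; rw [ih]
  | node e f hf ch A ih1 ih2 => simp only [rename]; rw [ih1, ih2]; rfl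

theorem names_contract (e : ℕ) {l : List V} (A : Forest δ a l) :
    (A.contract e).forest.names = A.names.filter (· ≠ e) := by
  induction A with
  | nil => rfl
  | leaf i A ih => simp only [contract, names]; rw [ih]
  | node e' f hf ch A ih1 ih2 =>
    by_cases h : e' = e
    · rw [contract_node_pos h, names, names_append, ih1, ih2]; simp [h]
    · rw [contract_node_neg h, names, names, ih1, ih2]; simp [h]

theorem contract_rename {ρ : ℕ → ℕ} {x y : ℕ} {l : List V} (A : Forest δ a l)
    (h : ∀ z ∈ A.names, ρ z = y ↔ z = x) :
    (A.rename ρ).contract y = (A.contract x).rename ρ := by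
  induction A with
  | nil => rfl
  | leaf i A ih =>
    simp only [rename, contract]; rw [ih h]; rfl
  | node e f hf ch A ih1 ih2 =>
    simp only [names, List.mem_cons, List.mem_append] at h
    have h1 := ih1 fun x hx => h x (.inr (.inl hx))
    have h2 := ih2 fun x hx => h x (.inr (.inr hx))
    simp only [rename]
    by_cases he : e = x
    · rw [contract_node_pos he, contract_node_pos ((h e (.inl rfl)).2 he), h1, h2]
      simp only [Subst.rename, rename_append]
    · rw [contract_node_neg he, contract_node_neg fun h' => he ((h e (.inl rfl)).1 h'), h1, h2]
      rfl

theorem Iso.rename (ρ : ℕ → ℕ) {l l' : List V} {F : Forest δ a l} {F' : Forest δ a l'}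
    {s : tens 𝔉.ι.obj l ⟶ tens 𝔉.ι.obj l'} (h : Iso F F' s) :
    Iso (F.rename ρ) (F'.rename ρ) s := by
  induction h with
  | nil => exact .nil
  | leaf i h ih => exact .leaf i ih
  | node e hf hf' hch b hb h ih1 ih2 => exact .node (ρ e) hf hf' ih1 b hb ih2
  | swap A B F => simp only [rename_append]; exact .swap _ _ _
  | trans h h' ih1 ih2 => exact ih1.trans ih2

theorem Iso.names_perm {l l' : List V} {F : Forest δ a l} {F' : Forest δ a l'}
    {s : tens 𝔉.ι.obj l ⟶ tens 𝔉.ι.obj l'} (h : Iso F F' s) : F.names.Perm F'.names := by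
  induction h with
  | nil => exact .refl _
  | leaf i h ih => exact ih
  | node e hf hf' hch b hb h ih1 ih2 => exact (ih1.append ih2).cons _
  | swap A B F =>
    simp only [names_append, ← List.append_assoc]
    exact (List.perm_append_comm).append_right _
  | trans h h' ih1 ih2 => exact ih1.trans ih2

end Forest

section canonical
set_option linter.unusedSectionVars false
variable {A B : Type*} {X : A → C}

theorem Canonical.congr {L L' : List A} {s t : tens X L ⟶ tens X L'} (h : Canonical X L L' s)
    (e : s = t) : Canonical X L L' t := e ▸ h

theorem Canonical.refl : ∀ L : List A, Canonical X L L (𝟙 _)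
  | [] => .nil
  | x :: L => ((Canonical.refl L).cons x).congr (consHom_id _ _)

theorem Canonical.append_left : ∀ (K : List A) {L L' : List A} {s : tens X L ⟶ tens X L'}
    (_ : Canonical X L L' s), Canonical X (K ++ L) (K ++ L') (appendHom (𝟙 (tens X K)) s)
  | [], _, _, _, h => h.congr (appendHom_nil _).symm
  | x :: K, _, _, _, h => ((Canonical.append_left K h).cons x).congr
      (by rw [← appendHom_cons, consHom_id])


theorem swapHom_append (x y : A) (L K : List A) :
    appendHom (swapHom X x y L) (𝟙 (tens X K)) = swapHom X x y (L ++ K) := by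
  have aux : ∀ {P Q R S N : C} (μ : N ≅ R ⊗ S),
      (whiskerLeftIso P (whiskerLeftIso Q μ ≪≫ (α_ Q R S).symm) ≪≫ (α_ P (Q ⊗ R) S).symm).hom ≫
        (((α_ P Q R).inv ≫ (β_ P Q).hom ▷ R ≫ (α_ Q P R).hom) ⊗ₘ 𝟙 S) ≫
        (whiskerLeftIso Q (whiskerLeftIso P μ ≪≫ (α_ P R S).symm) ≪≫ (α_ Q (P ⊗ R) S).symm).inv =
      (α_ P Q N).inv ≫ (β_ P Q).hom ▷ N ≫ (α_ Q P N).hom := by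
    intro P Q R S N μ
    simp only [Iso.trans_hom, whiskerLeftIso_hom, Iso.symm_hom, Iso.trans_inv, Iso.symm_inv,
      whiskerLeftIso_inv, tensorHom_id]
    simp only [comp_whiskerRight, Category.assoc, MonoidalCategory.whiskerLeft_comp]
    have h : (β_ P Q).hom ▷ N = (P ⊗ Q) ◁ μ.hom ≫ (β_ P Q).hom ▷ (R ⊗ S) ≫ (Q ⊗ P) ◁ μ.inv := by
      rw [whisker_exchange_assoc, ← MonoidalCategory.whiskerLeft_comp, Iso.hom_inv_id,
        MonoidalCategory.whiskerLeft_id, Category.comp_id]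
    rw [h]
    simp
  exact aux (tensAppend X L K)

theorem Canonical.append_right {L L' : List A} {s : tens X L ⟶ tens X L'} (h : Canonical X L L' s)
    (K : List A) : Canonical X (L ++ K) (L' ++ K) (appendHom s (𝟙 (tens X K))) := by
  induction h with
  | nil => exact (Canonical.refl K).congr (appendHom_nil _).symm
  | cons x h ih => exact (ih.cons x).congr (appendHom_cons _ _ _).symm
  | swap x y L => exact (Canonical.swap x y (L ++ K)).congr (swapHom_append x y L K).symm
  | trans h h' ih ih' =>
    exact (ih.trans ih').congr (by rw [appendHom_comp, Category.comp_id])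

theorem Canonical.append {L L' M M' : List A} {s : tens X L ⟶ tens X L'}
    {t : tens X M ⟶ tens X M'} (h : Canonical X L L' s) (h' : Canonical X M M' t) :
    Canonical X (L ++ M) (L' ++ M') (appendHom s t) :=
  ((h.append_right M).trans (h'.append_left L')).congr
    (by rw [appendHom_comp, Category.comp_id, Category.id_comp])

theorem Canonical.assoc_inv : ∀ (L M K : List A),
    Canonical X (L ++ (M ++ K)) ((L ++ M) ++ K) (inv (assocHom X L M K))
  | [], M, K => (Canonical.refl (M ++ K)).congr (by
      symm; apply IsIso.inv_eq_of_hom_inv_id; rw [assocHom_nil]; exact Category.id_comp _)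
  | x :: L, M, K => ((Canonical.assoc_inv L M K).cons x).congr (by
      symm; apply IsIso.inv_eq_of_hom_inv_id
      rw [assocHom_cons, consHom_comp, IsIso.hom_inv_id, Category.comp_id, consHom_id]
      rfl)

theorem comp_append_leaf {Y : B → C} (x : A) {y : B} (g : X x ⟶ Y y) {L K N : List A} {l m : List B}
    (π : tens X N ⟶ tens X (L ++ K)) (s : tens X L ⟶ tens Y l) (t : tens X K ⟶ tens Y m)
    (r : tens X N ⟶ tens Y (l ++ m)) (h : π ≫ appendHom s t = r) :
    consHom (𝟙 (X x)) π ≫ appendHom (consHom g s) t = consHom g r := by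
  rw [appendHom_cons, consHom_comp, h, Category.id_comp]

theorem comp_append_node {Y : B → C} (M : List A) {y : B} (g : tens X M ⟶ Y y) {L K N : List A}
    {l m : List B} (π : tens X N ⟶ tens X (L ++ K)) (s : tens X L ⟶ tens Y l)
    (t : tens X K ⟶ tens Y m) (r : tens X N ⟶ tens Y (l ++ m)) (h : π ≫ appendHom s t = r) :
    (appendHom (𝟙 (tens X M)) π ≫ inv (assocHom X M L K)) ≫ appendHom (spliceHom g s) t =
      spliceHom g r := by
  rw [Category.assoc, ← assocHom_spliceHom, IsIso.inv_hom_id_assoc, appendHom_spliceHom, h,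
    Category.id_comp]

end canonical

namespace Forest
open Subst

theorem comp_append {l m : List V} (A : Forest δ a l) (B : Forest δ a m) :
    ∃ π, Canonical (fun i => 𝔉.ι.obj (a i)) (A.append B).leaves (A.leaves ++ B.leaves) π ∧
      π ≫ appendHom A.comp B.comp = (A.append B).comp := by
  induction A with
  | nil =>
    refine ⟨_, Canonical.refl B.leaves, ?_⟩
    refine (Category.id_comp _).trans ?_
    exact appendHom_nil B.comp
  | leaf i A ih =>
    obtain ⟨π, h1, h2⟩ := ih
    exact ⟨_, h1.cons i, comp_append_leaf (X := fun i => 𝔉.ι.obj (a i)) _ _ _ _ _ _ h2⟩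
  | node e f hf ch A ih1 ih2 =>
    obtain ⟨π, h1, h2⟩ := ih2
    exact ⟨_, (h1.append_left ch.leaves).trans (Canonical.assoc_inv _ _ _),
      comp_append_node (X := fun i => 𝔉.ι.obj (a i)) _ _ _ _ _ _ h2⟩

theorem comp_contract (e : ℕ) {l : List V} (A : Forest δ a l) :
    ∃ π, Canonical (fun i => 𝔉.ι.obj (a i)) (A.contract e).forest.leaves A.leaves π ∧
      π ≫ A.comp = (A.contract e).forest.comp ≫ (A.contract e).layer := by
  induction A with
  | nil => exact ⟨_, Canonical.refl [], rfl⟩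
  | leaf i A ih =>
    obtain ⟨π, h1, h2⟩ := ih
    refine ⟨_, h1.cons i, ?_⟩
    refine (consHom_comp (X := fun i => 𝔉.ι.obj (a i)) (Y := fun i => 𝔉.ι.obj (a i)) _ _ _ _).trans
      (Eq.trans ?_ (consHom_comp (X := fun i => 𝔉.ι.obj (a i)) (Y := 𝔉.ι.obj) (y := a i)
        (𝟙 _) _ (𝟙 _) _).symm)
    rw [h2]
  | node e' f hf ch A ih1 ih2 =>
    obtain ⟨π, h1, h2⟩ := ih2
    obtain ⟨ρ, h3, h4⟩ := ih1
    by_cases he : e' = e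
    · rw [contract_node_pos he]
      obtain ⟨τ, h5, h6⟩ := comp_append (ch.contract e).forest (A.contract e).forest
      refine ⟨_, h5.trans (h3.append h1), ?_⟩
      dsimp only
      rw [← h6, Category.assoc τ, appendHom_spliceHom]
      refine (Category.assoc τ (appendHom ρ π) (spliceHom (ch.comp ≫ f) A.comp)).trans ?_
      rw [appendHom_spliceHom, h2, reassoc_of% h4]
    · rw [contract_node_neg he]
      refine ⟨_, h3.append h1, ?_⟩
      refine (appendHom_spliceHom ρ π (ch.comp ≫ f) A.comp).trans ?_
      refine Eq.trans ?_ (spliceHom_consHom (X := fun i => 𝔉.ι.obj (a i)) (Y := 𝔉.ι.obj)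
        _ _ (𝟙 _) _).symm
      rw [h2, reassoc_of% h4, Category.comp_id]

theorem leaves_rename (ρ : ℕ → ℕ) {l : List V} (A : Forest δ a l) :
    (A.rename ρ).leaves = A.leaves := by
  induction A with
  | nil => rfl
  | leaf i A ih => simp only [rename, leaves]; rw [ih]
  | node e f hf ch A ih1 ih2 => simp only [rename, leaves]; rw [ih1, ih2]

theorem comp_rename (ρ : ℕ → ℕ) {l : List V} (A : Forest δ a l) :
    HEq (A.rename ρ).comp A.comp := by
  induction A with
  | nil => rfl
  | leaf i A ih =>
    have := leaves_rename ρ A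
    simp only [rename, comp, leaves]
    congr 1
  | node e f hf ch A ih1 ih2 =>
    have h1 := leaves_rename ρ A
    have h2 := leaves_rename ρ ch
    simp only [rename, comp, leaves]
    congr 1
    congr 1
    rw [h2]

end Forest

section Cubical
variable (δ : ProperDegree 𝔉)

/-- The number of arrows of nonzero degree in a path. -/
def posCount : ∀ {X Y : C}, Quiver.Path X Y → ℕ
  | _, _, .nil => 0
  | _, _, .cons p f => posCount p + if δ.deg f = 0 then 0 else 1

/-- A chain of composable morphisms of degree zero or one, of which exactly `n` have nonzero degree. -/
structure ChainWord (n : ℕ) (X Y : C) where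
  path : Quiver.Path X Y
  elementary : Elementary δ.deg path
  posCount_eq : posCount δ path = n

/-- Composing a morphism of degree zero with an adjacent morphism of the chain, and removing an
identity. -/
inductive PathStep : ∀ {X Y : C}, Quiver.Path X Y → Quiver.Path X Y → Prop
  | comp {X A B D Y : C} (p : Quiver.Path X A) (f : A ⟶ B) (g : B ⟶ D) (q : Quiver.Path D Y)
      (h : δ.deg f = 0 ∨ δ.deg g = 0) :
      PathStep (((p.cons f).cons g).comp q) ((p.cons (f ≫ g)).comp q)
  | id {X A Y : C} (p : Quiver.Path X A) (q : Quiver.Path A Y) :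
      PathStep ((p.cons (𝟙 A)).comp q) (p.comp q)

/-- The set `Cₙ⁺(X, Y)` of chains of morphisms of degree zero or one, of which `n` have nonzero
degree, modulo the equivalence relation generated by composing morphisms of degree zero. -/
def ChainPlus (n : ℕ) (X Y : C) : Type (max u v) :=
  Quot fun c c' : ChainWord δ n X Y => PathStep δ c.path c'.path

variable {δ}

theorem elementary_comp {X Y Z : C} {p : Quiver.Path X Y} {q : Quiver.Path Y Z}
    (hp : Elementary δ.deg p) (hq : Elementary δ.deg q) : Elementary δ.deg (p.comp q) := by
  induction q with
  | nil => exact hp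
  | cons q f ih =>
    rw [Elementary] at hq
    rw [Quiver.Path.comp_cons, Elementary]
    exact ⟨ih hq.1, hq.2⟩

theorem posCount_comp {X Y Z : C} (p : Quiver.Path X Y) (q : Quiver.Path Y Z) :
    posCount δ (p.comp q) = posCount δ p + posCount δ q := by
  induction q with
  | nil => simp [posCount]
  | cons q f ih => rw [Quiver.Path.comp_cons, posCount, posCount, ih, add_assoc]

/-- Concatenation of chains. -/
def ChainWord.concat {n m : ℕ} {X Y Z : C} (c : ChainWord δ n X Y) (c' : ChainWord δ m Y Z) :
    ChainWord δ (n + m) X Z :=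
  ⟨c.path.comp c'.path, elementary_comp c.elementary c'.elementary, by
    rw [posCount_comp, c.posCount_eq, c'.posCount_eq]⟩

theorem PathStep.comp_right {X Y Z : C} {p p' : Quiver.Path X Y} (h : PathStep δ p p')
    (q : Quiver.Path Y Z) : PathStep δ (p.comp q) (p'.comp q) := by
  cases h with
  | comp p f g r h => simpa only [Quiver.Path.comp_assoc] using PathStep.comp p f g (r.comp q) h
  | id p r => simpa only [Quiver.Path.comp_assoc] using PathStep.id p (r.comp q)

theorem PathStep.comp_left {X Y Z : C} {p p' : Quiver.Path Y Z} (h : PathStep δ p p')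
    (q : Quiver.Path X Y) : PathStep δ (q.comp p) (q.comp p') := by
  cases h with
  | comp p f g r h =>
    simpa only [← Quiver.Path.comp_assoc, Quiver.Path.comp_cons] using PathStep.comp (q.comp p) f g r h
  | id p r => simpa only [← Quiver.Path.comp_assoc, Quiver.Path.comp_cons] using PathStep.id (q.comp p) r

theorem PathStep.composePath_eq {X Y : C} {p p' : Quiver.Path X Y} (h : PathStep δ p p') :
    composePath p = composePath p' := by
  cases h with
  | comp p f g r h => simp
  | id p r => simp

/-- Concatenation of classes of chains; the first chain is applied first. -/
def ChainPlus.concat {n m : ℕ} {X Y Z : C} :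
    ChainPlus δ n X Y → ChainPlus δ m Y Z → ChainPlus δ (n + m) X Z :=
  Quot.map₂ ChainWord.concat (fun c _ _ h => PathStep.comp_left h c.path)
    (fun _ _ c h => PathStep.comp_right h c.path)

/-- The composite of a chain. -/
def ChainPlus.compose {n : ℕ} {X Y : C} : ChainPlus δ n X Y → (X ⟶ Y) :=
  Quot.lift (fun c => composePath c.path) fun _ _ h => h.composePath_eq

variable (δ) in
/-- The second part of the structure of a cubical Feynman category: a free action of the symmetric
group on `Cₙ⁺(X, Y)`, compatible with the concatenation of chains, whose orbits are mapped bijectively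
by composition to the morphisms of degree `n`. -/
structure CubicalStructure where
  act {n : ℕ} {X Y : C} (σ : Equiv.Perm (Fin n)) (c : ChainPlus δ n X Y) : ChainPlus δ n X Y
  one_act {n : ℕ} {X Y : C} (c : ChainPlus δ n X Y) : act 1 c = c
  mul_act {n : ℕ} {X Y : C} (σ τ : Equiv.Perm (Fin n)) (c : ChainPlus δ n X Y) :
    act (σ * τ) c = act σ (act τ c)
  free {n : ℕ} {X Y : C} (σ : Equiv.Perm (Fin n)) (c : ChainPlus δ n X Y) (h : act σ c = c) :
    σ = 1
  act_concat {n m : ℕ} {X Y Z : C} (σ : Equiv.Perm (Fin n)) (τ : Equiv.Perm (Fin m))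
    (c : ChainPlus δ n X Y) (c' : ChainPlus δ m Y Z) :
    (act σ c).concat (act τ c') =
      act (finSumFinEquiv.permCongr (Equiv.Perm.sumCongr σ τ)) (c.concat c')
  compose_eq_iff {n : ℕ} {X Y : C} (c c' : ChainPlus δ n X Y) :
    c.compose = c'.compose ↔ ∃ σ, act σ c = c'
  exists_compose {n : ℕ} {X Y : C} (f : X ⟶ Y) (hf : δ.deg f = n) :
    ∃ c : ChainPlus δ n X Y, c.compose = f
end Cubical

section Trees
variable {δ : ProperDegree 𝔉} {n : ℕ} {a : Fin n → V} {v₀ : V}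

set_option linter.unusedSectionVars false in
theorem comp_lift {P Q R S W : C} {q : P ⟶ Q} {b : Q ⟶ R} {c : P ⟶ S} {s : S ⟶ R}
    (h : q ≫ b = c ≫ s) (l : R ⟶ W) : q ≫ b ≫ l = c ≫ s ≫ l := by
  rw [← Category.assoc, h, Category.assoc]

/-- The order preserving renumbering of `ℕ ∖ {e}` by `ℕ`. -/
def shift (e x : ℕ) : ℕ := if e < x then x - 1 else x

variable (δ a v₀) in
/-- A tree with inputs labelled by elements of `Fin n` and output colour `v₀`, whose vertices are
labelled by basic morphisms of nonzero degree, with a total order of its internal edges: `lab` is the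
label of the root vertex, `br` is the forest of the branches at the root, and every vertex other than
the root carries the position, counted from zero, of the edge leaving it. -/
structure OrdTree where
  ins : List V
  lab : tens 𝔉.ι.obj ins ⟶ 𝔉.ι.obj v₀
  lab_pos : 0 < δ.deg lab
  br : Forest δ a ins
  names_perm : br.names.Perm (List.range br.names.length)

namespace OrdTree

/-- The number of internal edges. -/
def numEdges (T : OrdTree δ a v₀) : ℕ := T.br.names.length

/-- The width: the degree of the label of the root. -/
def width (T : OrdTree δ a v₀) : ℕ := δ.deg T.lab

/-- The trees are isomorphic, by an isomorphism that changes the edge order by `ρ` and fixes the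
inputs and the output. -/
def Isomorphic (ρ : ℕ → ℕ) (T T' : OrdTree δ a v₀) : Prop :=
  ∃ s, Forest.Iso (T.br.rename ρ) T'.br s ∧ s ≫ T'.lab = T.lab

/-- Reading the tree as a flow chart gives `φ`. Each input in `Fin n` has to occur exactly once. -/
def ComposesTo (φ : 𝔉.source a ⟶ 𝔉.ι.obj v₀) (T : OrdTree δ a v₀) : Prop :=
  ∃ π, Canonical (fun i => 𝔉.ι.obj (a i)) (List.finRange n) T.br.leaves π ∧
    π ≫ T.br.comp ≫ T.lab = φ

theorem filter_ne_eq {L : List ℕ} (h : L.Nodup) (e : ℕ) : L.filter (· ≠ e) = L.erase e := by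
  rw [h.erase_eq_filter]
  exact List.filter_congr fun x _ => by simp [bne, Bool.beq_eq_decide_eq]

theorem face_names_perm {L : List ℕ} (h : L.Perm (List.range L.length)) (e : ℕ) :
    ((L.filter (· ≠ e)).map (shift e)).Perm
      (List.range ((L.filter (· ≠ e)).map (shift e)).length) := by
  have hnd : L.Nodup := h.nodup_iff.2 List.nodup_range
  have hmem : ∀ x, x ∈ L ↔ x < L.length := fun x => by rw [h.mem_iff, List.mem_range]
  have hlen : ((L.filter (· ≠ e)).map (shift e)).length =
      if e < L.length then L.length - 1 else L.length := by
    rw [List.length_map]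
    split_ifs with he
    · rw [filter_ne_eq hnd e, List.length_erase_of_mem ((hmem e).2 he)]
    · rw [List.filter_eq_self.2]
      intro x hx
      have := (hmem x).1 hx
      simp; omega
  rw [List.perm_ext_iff_of_nodup _ List.nodup_range]
  · intro y
    rw [List.mem_range, hlen]
    simp only [List.mem_map, List.mem_filter, hmem, shift, decide_eq_true_eq, ne_eq]
    constructor
    · rintro ⟨x, ⟨hx, hxe⟩, rfl⟩
      split_ifs <;> omega
    · intro hy
      by_cases hye : y < e
      · refine ⟨y, ⟨?_, by omega⟩, by rw [if_neg (by omega)]⟩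
        split_ifs at hy <;> omega
      · split_ifs at hy with he
        · exact ⟨y + 1, ⟨by omega, by omega⟩, by rw [if_pos (by omega)]; rfl⟩
        · omega
  · refine List.Nodup.map_on ?_ (hnd.filter _)
    intro x hx y hy hxy
    simp only [List.mem_filter, decide_eq_true_eq, ne_eq] at hx hy
    simp only [shift] at hxy
    split_ifs at hxy <;> omega

theorem length_face_names {L : List ℕ} (h : L.Perm (List.range L.length)) {e : ℕ}
    (he : e < L.length) : ((L.filter (· ≠ e)).map (shift e)).length = L.length - 1 := by
  have hnd : L.Nodup := h.nodup_iff.2 List.nodup_range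
  rw [List.length_map, filter_ne_eq hnd e,
    List.length_erase_of_mem (h.mem_iff.2 (List.mem_range.2 he))]

theorem rename_shift_names (T : OrdTree δ a v₀) (e : ℕ) :
    ((T.br.contract e).forest.rename (shift e)).names =
      (T.br.names.filter (· ≠ e)).map (shift e) := by
  rw [Forest.names_rename, Forest.names_contract]

/-- The tree obtained by contracting the edge in position `e`, with the induced order of the
remaining edges. -/
def face (T : OrdTree δ a v₀) (e : ℕ) : OrdTree δ a v₀ where
  ins := (T.br.contract e).dom
  lab := (T.br.contract e).layer ≫ T.lab
  lab_pos := δ.deg_comp_pos_right _ T.lab_pos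
  br := (T.br.contract e).forest.rename (shift e)
  names_perm := by rw [rename_shift_names]; exact face_names_perm T.names_perm e

theorem numEdges_face (T : OrdTree δ a v₀) {e : ℕ} (he : e < T.numEdges) :
    (T.face e).numEdges = T.numEdges - 1 := by
  change ((T.br.contract e).forest.rename (shift e)).names.length = _
  rw [rename_shift_names]; exact length_face_names T.names_perm he

theorem width_le_width_face (T : OrdTree δ a v₀) (e : ℕ) : T.width ≤ (T.face e).width := by
  exact (Nat.le_add_left _ _).trans_eq (δ.deg_comp (T.br.contract e).layer T.lab).symm

theorem Isomorphic.numEdges_eq {ρ : ℕ → ℕ} {T T' : OrdTree δ a v₀} (h : Isomorphic ρ T T') :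
    T.numEdges = T'.numEdges := by
  obtain ⟨s, h, -⟩ := h
  have := h.names_perm.length_eq
  rwa [Forest.names_rename, List.length_map] at this

theorem mem_names {T : OrdTree δ a v₀} {x : ℕ} : x ∈ T.br.names ↔ x < T.numEdges := by
  rw [T.names_perm.mem_iff, List.mem_range]; rfl

theorem Isomorphic.face {ρ ρ' : ℕ → ℕ} {T T' : OrdTree δ a v₀} (h : Isomorphic ρ T T') {x y : ℕ}
    (h1 : ∀ z, ρ z = y ↔ z = x) (h2 : ∀ z, z ≠ x → ρ' (shift x z) = shift y (ρ z)) :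
    Isomorphic ρ' (T.face x) (T'.face y) := by
  obtain ⟨s, h, hs⟩ := h
  have h' := h.contract y
  rw [Forest.contract_rename _ fun z _ => h1 z] at h'
  obtain ⟨q, h3, h4⟩ := h'
  refine ⟨q, ?_, ?_⟩
  · have := h3.rename (shift y)
    dsimp only [Subst.rename] at this
    dsimp only [OrdTree.face]
    rw [Forest.rename_rename] at this ⊢
    rwa [Forest.rename_congr (ρ := ρ' ∘ shift x) (σ := shift y ∘ ρ)]
    intro z hz
    rw [Forest.names_contract, List.mem_filter] at hz
    exact h2 z (by simpa using hz.2)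
  · dsimp only [OrdTree.face, Subst.rename] at h4 ⊢
    rw [← hs]
    exact comp_lift h4 _

theorem face_face (T : OrdTree δ a v₀) {e e' : ℕ} (h : e ≤ e') :
    Isomorphic id ((T.face e).face e') ((T.face (e' + 1)).face e) := by
  have h1 : ((T.br.contract e).forest.rename (shift e)).contract e' =
      ((T.br.contract e).forest.contract (e' + 1)).rename (shift e) := by
    apply Forest.contract_rename
    intro z hz
    rw [Forest.names_contract, List.mem_filter] at hz
    have hz' : z ≠ e := by simpa using hz.2
    simp only [shift]; split_ifs <;> omega
  have h2 : ((T.br.contract (e' + 1)).forest.rename (shift (e' + 1))).contract e =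
      ((T.br.contract (e' + 1)).forest.contract e).rename (shift (e' + 1)) := by
    apply Forest.contract_rename
    intro z hz
    rw [Forest.names_contract, List.mem_filter] at hz
    have hz' : z ≠ e' + 1 := by simpa using hz.2
    simp only [shift]; split_ifs <;> omega
  obtain ⟨q, h3, h4⟩ := Forest.contract_contract e (e' + 1) T.br
  dsimp only [Subst.contract, Subst.postcomp] at h3 h4
  simp only [Isomorphic, OrdTree.face]
  rw [h1, h2, Forest.rename_id]
  refine ⟨q, ?_, ?_⟩
  · dsimp only [Subst.rename]
    have := h3.rename (shift e' ∘ shift e)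
    rw [Forest.rename_rename, Forest.rename_rename]
    rwa [Forest.rename_congr (ρ := shift e ∘ shift (e' + 1)) (σ := shift e' ∘ shift e)]
    intro z hz
    rw [Forest.names_contract, Forest.names_contract, List.mem_filter, List.mem_filter] at hz
    have hz1 : z ≠ e := by simpa using hz.2
    have hz2 : z ≠ e' + 1 := by simpa using hz.1.2
    simp only [shift, Function.comp]; split_ifs <;> omega
  · dsimp only [Subst.rename]
    rw [Category.comp_id] at h4
    rw [← Category.assoc, ← Category.assoc, ← Category.assoc] at *
    rw [h4]

theorem ComposesTo.of_face {φ : 𝔉.source a ⟶ 𝔉.ι.obj v₀} {T : OrdTree δ a v₀} {e : ℕ}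
    (h : ComposesTo φ (T.face e)) : ComposesTo φ T := by
  obtain ⟨π, h1, h2⟩ := h
  dsimp only [OrdTree.face] at π h1 h2
  have key : ∀ {L M : List (Fin n)} (_ : L = M)
      {p : tens (fun i => 𝔉.ι.obj (a i)) L ⟶ tens 𝔉.ι.obj (T.br.contract e).dom}
      {q : tens (fun i => 𝔉.ι.obj (a i)) M ⟶ tens 𝔉.ι.obj (T.br.contract e).dom} (_ : HEq p q)
      (π : tens (fun i => 𝔉.ι.obj (a i)) (List.finRange n) ⟶ tens (fun i => 𝔉.ι.obj (a i)) L)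
      (_ : Canonical (fun i => 𝔉.ι.obj (a i)) (List.finRange n) L π),
      ∃ π', Canonical (fun i => 𝔉.ι.obj (a i)) (List.finRange n) M π' ∧ π ≫ p = π' ≫ q := by
    rintro L _ rfl p q hpq π hπ
    exact ⟨π, hπ, by rw [eq_of_heq hpq]⟩
  obtain ⟨π', h3, h4⟩ := key (Forest.leaves_rename (shift e) (T.br.contract e).forest)
    (Forest.comp_rename _ _) π h1
  obtain ⟨τ, h5, h6⟩ := Forest.comp_contract e T.br
  refine ⟨_, h3.trans h5, ?_⟩
  rw [Category.assoc, reassoc_of% h6, ← reassoc_of% h4, h2]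

end OrdTree
end Trees

theorem sum_range_cancel {k : Type*} [AddCommGroup k] (M : ℕ) (F : ℕ → ℕ → k)
    (h : ∀ e e', e ≤ e' → e' < M → F e e' + F (e' + 1) e = 0) :
    ∑ e ∈ Finset.range (M + 1), ∑ e' ∈ Finset.range M, F e e' = 0 := by
  rw [← Finset.sum_product']
  refine Finset.sum_involution
    (fun p _ => if p.1 ≤ p.2 then (p.2 + 1, p.1) else (p.2, p.1 - 1)) ?_ ?_ ?_ ?_
  · rintro ⟨e, e'⟩ hp
    simp only [Finset.mem_product, Finset.mem_range] at hp ⊢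
    split_ifs with he
    · exact h e e' he hp.2
    · have := h e' (e - 1) (by omega) (by omega)
      rwa [Nat.sub_add_cancel (by omega), add_comm] at this
  · rintro ⟨e, e'⟩ hp -
    simp only [ne_eq]
    split_ifs with he <;> simp only [Prod.mk.injEq] <;> omega
  · rintro ⟨e, e'⟩ hp
    simp only [Finset.mem_product, Finset.mem_range] at hp ⊢
    split_ifs with he <;> simp only <;> omega
  · rintro ⟨e, e'⟩ hp
    simp only [Finset.mem_product, Finset.mem_range] at hp ⊢
    by_cases he : e ≤ e'
    · simp only [if_pos he]; rw [if_neg (by omega)]; simp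
    · simp only [if_neg he]; rw [if_pos (by omega)]
      simp only [Prod.mk.injEq, and_true]; omega

section Complexes
variable (k : Type w) [Field k]

/-- Chain complexes of vector spaces, graded by the integers, with an increasing filtration by
subcomplexes. -/
structure FilteredComplex where
  cx : ChainComplex (ModuleCat.{t} k) ℤ
  filt : ℕ → ∀ i : ℤ, Submodule k (cx.X i)
  filt_mono {s t : ℕ} (h : s ≤ t) (i : ℤ) : filt s i ≤ filt t i
  d_mem (t : ℕ) (i j : ℤ) (c : cx.X i) (hc : c ∈ filt t i) : cx.d i j c ∈ filt t j

variable {k}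

/-- The `n`-fold suspension: chains of degree `m - n` are placed in degree `m`, and the differential
is multiplied by `(-1) ^ n`. -/
def FilteredComplex.suspension (n : ℤ) (K : FilteredComplex.{w, t} k) :
    FilteredComplex.{w, t} k where
  cx :=
    { X := fun m => K.cx.X (m - n)
      d := fun i j => n.negOnePow • K.cx.d (i - n) (j - n)
      shape := fun i j h => by
        rw [K.cx.shape, smul_zero]
        intro h'; apply h; simp only [ComplexShape.down_Rel] at h' ⊢; omega
      d_comp_d' := fun i j l _ _ => by simp }
  filt := fun t i => K.filt t (i - n)
  filt_mono := fun h i => K.filt_mono h _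
  d_mem := fun t i j c hc => by
    have h := K.d_mem t (i - n) (j - n) c hc
    change (n.negOnePow • K.cx.d (i - n) (j - n)).hom c ∈ K.filt t (j - n)
    rcases Int.even_or_odd n with hn | hn
    · rw [Int.negOnePow_even n hn, one_smul]; exact h
    · rw [Int.negOnePow_odd n hn, Units.neg_smul, one_smul]; exact Submodule.neg_mem _ h

/-- A way to present a filtered complex by coefficient functions on a type `T` of cells: the chains
of degree `j` form a space of functions on `T`, and the filtration is by the support of a function
with respect to a weight. -/
structure CellData (T : Type t) (k : Type w) [Field k] where
  D : (T → k) →ₗ[k] (T → k)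
  chains : ℤ → Submodule k (T → k)
  D_mem (j : ℤ) (c : T → k) (hc : c ∈ chains (j + 1)) : D c ∈ chains j
  D_D (j : ℤ) (c : T → k) (hc : c ∈ chains j) : D (D c) = 0
  weight : T → ℕ
  weight_D (s : ℕ) (c : T → k) (hc : ∀ x, c x ≠ 0 → weight x ≤ s) :
    ∀ x, D c x ≠ 0 → weight x ≤ s

namespace CellData
variable {T : Type t} (S : CellData T k)

/-- The differential between chains of given degrees. -/
def d (i j : ℤ) : S.chains i →ₗ[k] S.chains j :=
  if h : j + 1 = i then S.D.restrict fun c hc => S.D_mem j c (h ▸ hc) else 0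

theorem d_apply {i j : ℤ} (h : j + 1 = i) (c : S.chains i) : (S.d i j c).1 = S.D c.1 := by
  rw [d, dif_pos h]; rfl

/-- The chains supported on cells of weight at most `s`. -/
def filt (s : ℕ) (i : ℤ) : Submodule k (S.chains i) where
  carrier := {c | ∀ x, c.1 x ≠ 0 → S.weight x ≤ s}
  zero_mem' := fun x h => absurd rfl h
  add_mem' := fun {c c'} hc hc' x h => by
    by_cases h' : c.1 x = 0
    · exact hc' x fun h'' => h (by simp [h', h''])
    · exact hc x h'
  smul_mem' := fun r c hc x h => hc x fun h' => h (by simp [h'])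

/-- The filtered complex presented by the data. -/
def toFiltered : FilteredComplex.{w, max t w} k where
  cx :=
    { X := fun i => ModuleCat.of k (S.chains i)
      d := fun i j => ModuleCat.ofHom (S.d i j)
      shape := fun i j h => by
        have : ¬ j + 1 = i := h
        rw [d, dif_neg this]; rfl
      d_comp_d' := fun i j l h h' => by
        have h : j + 1 = i := h
        have h' : l + 1 = j := h'
        refine ModuleCat.hom_ext (LinearMap.ext fun c => Subtype.ext ?_)
        change (S.d j l (S.d i j c)).1 = 0
        rw [d_apply S h', d_apply S h, S.D_D i c.1 c.2] }
  filt := S.filt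
  filt_mono := fun h i c hc x hx => (hc x hx).trans h
  d_mem := fun s i j c hc => by
    change S.d i j c ∈ S.filt s j
    by_cases h : j + 1 = i
    · intro x hx
      rw [d_apply S h] at hx
      exact S.weight_D s c.1 hc x hx
    · rw [d, dif_neg h]; exact Submodule.zero_mem _

/-- The coefficient function of a chain. -/
def coeff {i : ℤ} (c : S.toFiltered.cx.X i) : T → k := Subtype.val (p := (· ∈ S.chains i)) c

end CellData

/-- A totally ordered partition of `Fin n` into nonempty blocks `B₀ > B₁ > ⋯`, where `pos x` is the
index of the block of `x`. The greatest block has index zero, the least block has the last index. They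
index the cells of the permutohedron. -/
structure TOPartition.{x} (n : ℕ) : Type x where
  numBlocks : ℕ
  pos : Fin n → ℕ
  pos_lt (x : Fin n) : pos x < numBlocks
  exists_pos (j : ℕ) (hj : j < numBlocks) : ∃ x, pos x = j

namespace TOPartition
variable {n : ℕ}

theorem ext' {α β : TOPartition.{t} n} (h : α.numBlocks = β.numBlocks)
    (h' : ∀ x, α.pos x = β.pos x) : α = β := by
  obtain ⟨s, p, _, _⟩ := α
  obtain ⟨s', p', _, _⟩ := β
  obtain rfl : s = s' := h
  obtain rfl : p = p' := funext h'
  rfl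

theorem numBlocks_le (α : TOPartition.{t} n) : α.numBlocks ≤ n := by
  have h : Function.Surjective fun x : Fin n => (⟨α.pos x, α.pos_lt x⟩ : Fin α.numBlocks) :=
    fun j => (α.exists_pos j j.2).imp fun x hx => Fin.ext hx
  simpa using Fintype.card_le_of_surjective _ h

instance : Finite (TOPartition.{t} n) := by
  refine Finite.of_injective (β := Fin (n + 1) × (Fin n → Fin n)) (fun α =>
    (⟨α.numBlocks, Nat.lt_succ_of_le α.numBlocks_le⟩,
      fun x => ⟨α.pos x, (α.pos_lt x).trans_le α.numBlocks_le⟩)) fun α β h => ?_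
  simp only [Prod.mk.injEq, Fin.mk.injEq, funext_iff] at h
  exact ext' h.1 h.2

noncomputable instance : Fintype (TOPartition.{t} n) := Fintype.ofFinite _

/-- The union of the blocks with the indices `j` and `j + 1`. -/
def merge (α : TOPartition.{t} n) (j : ℕ) : TOPartition.{t} n :=
  if h : j + 1 < α.numBlocks then
    { numBlocks := α.numBlocks - 1
      pos := fun x => shift j (α.pos x)
      pos_lt := fun x => by have := α.pos_lt x; unfold shift; split_ifs <;> omega
      exists_pos := fun i hi => by
        by_cases hij : i ≤ j
        · obtain ⟨x, hx⟩ := α.exists_pos i (by omega)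
          exact ⟨x, by rw [hx, shift, if_neg (by omega)]⟩
        · obtain ⟨x, hx⟩ := α.exists_pos (i + 1) (by omega)
          exact ⟨x, by rw [hx, shift, if_pos (by omega)]; rfl⟩ }
  else α

theorem numBlocks_merge (α : TOPartition.{t} n) {j : ℕ} (h : j + 1 < α.numBlocks) :
    (α.merge j).numBlocks = α.numBlocks - 1 := by rw [merge, dif_pos h]

theorem pos_merge (α : TOPartition.{t} n) {j : ℕ} (h : j + 1 < α.numBlocks) (x : Fin n) :
    (α.merge j).pos x = shift j (α.pos x) := by rw [merge, dif_pos h]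

theorem merge_merge (α : TOPartition.{t} n) {i j : ℕ} (h : i ≤ j) (hj : j + 2 < α.numBlocks) :
    (α.merge i).merge j = (α.merge (j + 1)).merge i := by
  have h1 : i + 1 < α.numBlocks := by omega
  have h2 : j + 1 + 1 < α.numBlocks := by omega
  have h3 := α.numBlocks_merge h1
  have h4 := α.numBlocks_merge h2
  refine ext' ?_ fun x => ?_
  · rw [numBlocks_merge (α.merge i) (by omega), numBlocks_merge (α.merge (j + 1)) (by omega), h3,
      h4]
  · rw [pos_merge (α.merge i) (by omega), pos_merge (α.merge (j + 1)) (by omega), pos_merge _ h1,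
      pos_merge _ h2]
    simp only [shift]; split_ifs <;> omega

/-- The least block of the partition. -/
def leastBlock (α : TOPartition.{t} n) : Finset (Fin n) :=
  Finset.univ.filter fun x => α.pos x + 1 = α.numBlocks

theorem leastBlock_subset_merge (α : TOPartition.{t} n) {j : ℕ} (h : j + 1 < α.numBlocks) :
    α.leastBlock ⊆ (α.merge j).leastBlock := by
  intro x hx
  simp only [leastBlock, Finset.mem_filter, Finset.mem_univ, true_and] at hx ⊢
  rw [numBlocks_merge _ h, pos_merge _ h, shift]
  split_ifs <;> omega

/-- All blocks other than the least one have exactly one element. -/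
def IsSimplicial (α : TOPartition.{t} n) : Prop :=
  ∀ x y, α.pos x = α.pos y → α.pos x + 1 < α.numBlocks → x = y

/-- The number of pairs `x < y` such that the block of `y` comes before the block of `x`. -/
def inversions (α : TOPartition.{t} n) : ℕ :=
  (Finset.univ.filter fun p : Fin n × Fin n => p.1 < p.2 ∧ α.pos p.2 < α.pos p.1).card

variable (k n) in
/-- The differential of the permutohedron in terms of coefficient functions: the boundary of a totally
ordered partition is the sum over all ways to subdivide one block `B` into `B' > B''`, with the sign
`(-1) ^ j`, where `j` is the index of `B`. The coefficient of `α` in the boundary of `c` thus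
involves the coefficients of the partitions obtained from `α` by uniting adjacent blocks. -/
def boundary : (TOPartition.{t} n → k) →ₗ[k] (TOPartition.{t} n → k) where
  toFun c α := ∑ j ∈ Finset.range (α.numBlocks - 1), (-1) ^ j * c (α.merge j)
  map_add' c c' := by
    funext α; simp only [Pi.add_apply, mul_add, Finset.sum_add_distrib]
  map_smul' r c := by
    funext α
    simp only [Pi.smul_apply, smul_eq_mul, RingHom.id_apply, Finset.mul_sum]
    exact Finset.sum_congr rfl fun _ _ => by ring

theorem exists_of_boundary {c : TOPartition.{t} n → k} {α : TOPartition.{t} n}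
    (h : boundary k n c α ≠ 0) : ∃ i, i + 1 < α.numBlocks ∧ c (α.merge i) ≠ 0 := by
  obtain ⟨i, hi, h'⟩ := Finset.exists_ne_zero_of_sum_ne_zero
    (f := fun j => (-1) ^ j * c (α.merge j)) (s := Finset.range (α.numBlocks - 1)) h
  rw [Finset.mem_range] at hi
  exact ⟨i, by omega, right_ne_zero_of_mul h'⟩

variable (k n) in
/-- The cellular chains of the permutohedron. The degree of a partition is `n` minus its number of
blocks, its width is the number of elements of its least block. -/
def cells : CellData (TOPartition.{t} n) k where
  D := boundary k n
  chains j :=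
    { carrier := {c | ∀ α, c α ≠ 0 → (n : ℤ) - α.numBlocks = j}
      zero_mem' := fun α h => absurd rfl h
      add_mem' := fun {c c'} hc hc' α h => by
        by_cases h' : c α = 0
        · exact hc' α fun h'' => h (by simp [h', h''])
        · exact hc α h'
      smul_mem' := fun r c hc α h => hc α fun h' => h (by simp [h']) }
  D_mem j c hc α h := by
    obtain ⟨i, hi, h'⟩ := exists_of_boundary h
    have := hc _ h'
    rw [numBlocks_merge _ hi] at this
    omega
  D_D j c _ := by
    funext α
    change ∑ i ∈ Finset.range (α.numBlocks - 1), (-1) ^ i *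
      ∑ j ∈ Finset.range ((α.merge i).numBlocks - 1), (-1) ^ j * c ((α.merge i).merge j) = 0
    rcases h : α.numBlocks - 1 with _ | M
    · simp
    · rw [← sum_range_cancel M (fun i j => (-1) ^ i * ((-1) ^ j * c ((α.merge i).merge j)))]
      · refine Finset.sum_congr rfl fun i hi => ?_
        rw [Finset.mem_range] at hi
        rw [numBlocks_merge _ (by omega), Finset.mul_sum, h]; rfl
      · intro i j hij hj
        rw [merge_merge α hij (by omega)]; ring
  weight α := α.leastBlock.card
  weight_D s c hc α h := by
    obtain ⟨i, hi, h'⟩ := exists_of_boundary h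
    exact (Finset.card_le_card (α.leastBlock_subset_merge hi)).trans (hc _ h')
end TOPartition

/-- The nonempty faces of the simplex with vertex set `Fin n`. -/
structure Face.{x} (n : ℕ) : Type x where
  verts : Finset (Fin n)
  nonempty : verts.Nonempty

namespace Face
variable {n : ℕ}

/-- The face spanned by `Y` and `x`. -/
def adjoin (Y : Face.{t} n) (x : Fin n) : Face.{t} n := ⟨insert x Y.verts, Finset.insert_nonempty _ _⟩

variable (k n) in
/-- The simplicial differential in terms of coefficient functions: the boundary of
`x₀ < ⋯ < x_p` is the alternating sum of the faces omitting `x_i`. -/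
def boundary : (Face.{t} n → k) →ₗ[k] (Face.{t} n → k) where
  toFun c Y := ∑ x ∈ Y.vertsᶜ, (-1) ^ (Y.verts.filter (· < x)).card * c (Y.adjoin x)
  map_add' c c' := by
    funext α; simp only [Pi.add_apply, mul_add, Finset.sum_add_distrib]
  map_smul' r c := by
    funext α
    simp only [Pi.smul_apply, smul_eq_mul, RingHom.id_apply, Finset.mul_sum]
    exact Finset.sum_congr rfl fun _ _ => by ring

theorem exists_of_boundary {c : Face.{t} n → k} {Y : Face.{t} n} (h : boundary k n c Y ≠ 0) :
    ∃ x, x ∉ Y.verts ∧ c (Y.adjoin x) ≠ 0 := by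
  obtain ⟨x, hx, h'⟩ := Finset.exists_ne_zero_of_sum_ne_zero
    (f := fun x => (-1) ^ (Y.verts.filter (· < x)).card * c (Y.adjoin x)) (s := Y.vertsᶜ) h
  exact ⟨x, Finset.mem_compl.1 hx, right_ne_zero_of_mul h'⟩

theorem sign_swap {Y : Finset (Fin n)} {x x' : Fin n} (hx : x ∉ Y) (h : x < x') :
    ((-1 : k) ^ (Y.filter (· < x)).card * (-1) ^ ((insert x Y).filter (· < x')).card) +
      (-1) ^ (Y.filter (· < x')).card * (-1) ^ ((insert x' Y).filter (· < x)).card = 0 := by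
  rw [Finset.filter_insert, if_pos h, Finset.card_insert_of_notMem (by simp [hx]),
    Finset.filter_insert, if_neg h.not_gt]
  ring

variable (k n) in
/-- The simplicial chains of the simplex, filtered by the number of vertices of a face. -/
def cells : CellData (Face.{t} n) k where
  D := boundary k n
  chains j :=
    { carrier := {c | ∀ X, c X ≠ 0 → (X.verts.card : ℤ) = j + 1}
      zero_mem' := fun α h => absurd rfl h
      add_mem' := fun {c c'} hc hc' α h => by
        by_cases h' : c α = 0
        · exact hc' α fun h'' => h (by simp [h', h''])
        · exact hc α h'
      smul_mem' := fun r c hc α h => hc α fun h' => h (by simp [h']) }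
  D_mem j c hc Y h := by
    obtain ⟨x, hx, h'⟩ := exists_of_boundary h
    have := hc _ h'
    rw [adjoin, Finset.card_insert_of_notMem hx] at this
    push_cast at this
    omega
  D_D j c _ := by
    funext Y
    change ∑ x ∈ Y.vertsᶜ, (-1) ^ (Y.verts.filter (· < x)).card *
      ∑ x' ∈ (insert x Y.verts)ᶜ, (-1) ^ ((insert x Y.verts).filter (· < x')).card *
        c ((Y.adjoin x).adjoin x') = 0
    simp only [Finset.mul_sum, ← mul_assoc]
    rw [Finset.sum_sigma']
    refine Finset.sum_involution (fun p _ => ⟨p.2, p.1⟩) ?_ ?_ ?_ ?_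
    · rintro ⟨x, x'⟩ h
      simp only [Finset.mem_sigma, Finset.mem_compl, Finset.mem_insert, not_or] at h
      have hc : (Y.adjoin x).adjoin x' = (Y.adjoin x').adjoin x := by
        simp only [adjoin, Finset.insert_comm]
      dsimp only
      rw [hc, ← add_mul]
      rcases lt_or_gt_of_ne h.2.1 with hlt | hlt
      · rw [add_comm, sign_swap h.2.2 hlt, zero_mul]
      · rw [sign_swap h.1 hlt, zero_mul]
    · rintro ⟨x, x'⟩ h -
      simp only [Finset.mem_sigma, Finset.mem_compl, Finset.mem_insert, not_or] at h
      simp only [ne_eq, Sigma.mk.injEq, not_and]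
      exact fun h' => absurd h' h.2.1
    · rintro ⟨x, x'⟩ h
      simp only [Finset.mem_sigma, Finset.mem_compl, Finset.mem_insert, not_or] at h ⊢
      exact ⟨h.2.2, fun h' => h.2.1 h'.symm, h.1⟩
    · rintro ⟨x, x'⟩ h; rfl
  weight X := X.verts.card
  weight_D s c hc Y h := by
    obtain ⟨x, hx, h'⟩ := exists_of_boundary h
    exact (Finset.card_le_card (Finset.subset_insert x Y.verts)).trans (hc _ h')
end Face

open Classical in
/-- The map from the chains of the permutohedron to the chains of the simplex: a partition all of
whose blocks but the least one have one element is sent, up to the sign that makes this a chain map, to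
its least block; the other partitions are sent to zero. -/
noncomputable def permToSimplex {n : ℕ} (c : TOPartition.{t} n → k) (X : Face.{t} n) : k :=
  ∑ α : TOPartition.{t} n, if α.IsSimplicial ∧ α.leastBlock = X.verts then
    (-1) ^ (α.inversions + (α.numBlocks - 1).choose 2) * c α else 0

namespace OrdTree
variable {δ : ProperDegree 𝔉} {n : ℕ} {a : Fin n → V} {v₀ : V}

/-- The coefficient functions of the elements of degree `j` in the fiber over `φ`: functions on the
trees with ordered edges that are invariant under isomorphisms, change the sign under an odd
permutation of the edges, and are supported on trees that compose to `φ`. The degree of a tree is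
`-1` minus the number of its edges. -/
structure IsChain (φ : 𝔉.source a ⟶ 𝔉.ι.obj v₀) (j : ℤ) (c : OrdTree δ a v₀ → k) : Prop where
  iso {T T' : OrdTree δ a v₀} (h : Isomorphic id T T') : c T' = c T
  swap {T T' : OrdTree δ a v₀} (i : ℕ) (hi : i + 1 < T.numEdges)
    (h : Isomorphic (Equiv.swap i (i + 1)) T T') : c T' = -c T
  composesTo {T : OrdTree δ a v₀} (h : c T ≠ 0) : ComposesTo φ T
  degree {T : OrdTree δ a v₀} (h : c T ≠ 0) : -((T.numEdges : ℤ) + 1) = j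

variable (k δ a v₀) in
/-- The differential of the fiber in terms of coefficient functions: the differential of a tree is
the sum of its edge expansions, the new edge being put last. The coefficient of `T` in the
differential of `c` thus involves the trees obtained by contracting an edge `e` of `T`, with the sign
of the permutation of the edges of `T` that moves `e` to the last place. -/
def boundary : (OrdTree δ a v₀ → k) →ₗ[k] (OrdTree δ a v₀ → k) where
  toFun c T := ∑ e ∈ Finset.range T.numEdges, (-1) ^ (T.numEdges - 1 - e) * c (T.face e)
  map_add' c c' := by
    funext α; simp only [Pi.add_apply, mul_add, Finset.sum_add_distrib]
  map_smul' r c := by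
    funext α
    simp only [Pi.smul_apply, smul_eq_mul, RingHom.id_apply, Finset.mul_sum]
    exact Finset.sum_congr rfl fun _ _ => by ring

theorem exists_of_boundary {c : OrdTree δ a v₀ → k} {T : OrdTree δ a v₀}
    (h : boundary k δ a v₀ c T ≠ 0) : ∃ e, e < T.numEdges ∧ c (T.face e) ≠ 0 := by
  obtain ⟨e, he, h'⟩ := Finset.exists_ne_zero_of_sum_ne_zero
    (f := fun e => (-1) ^ (T.numEdges - 1 - e) * c (T.face e)) (s := Finset.range T.numEdges) h
  exact ⟨e, Finset.mem_range.1 he, right_ne_zero_of_mul h'⟩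

theorem swap_eq (i z : ℕ) : Equiv.swap i (i + 1) z =
    if z = i then i + 1 else if z = i + 1 then i else z := Equiv.swap_apply_def _ _ _

theorem IsChain.boundary {φ : 𝔉.source a ⟶ 𝔉.ι.obj v₀} {j : ℤ} {c : OrdTree δ a v₀ → k}
    (hc : IsChain φ (j + 1) c) : IsChain φ j (boundary k δ a v₀ c) where
  iso {T T'} h := by
    change ∑ e ∈ Finset.range T'.numEdges, (-1) ^ (T'.numEdges - 1 - e) * c (T'.face e) =
      ∑ e ∈ Finset.range T.numEdges, (-1) ^ (T.numEdges - 1 - e) * c (T.face e)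
    rw [h.numEdges_eq]
    refine Finset.sum_congr rfl fun e _ => ?_
    rw [hc.iso (h.face (x := e) (y := e) (fun _ => Iff.rfl) fun _ _ => rfl)]
  swap {T T'} i hi h := by
    change ∑ e ∈ Finset.range T'.numEdges, (-1) ^ (T'.numEdges - 1 - e) * c (T'.face e) =
      -∑ e ∈ Finset.range T.numEdges, (-1) ^ (T.numEdges - 1 - e) * c (T.face e)
    rw [← h.numEdges_eq, ← Finset.sum_neg_distrib]
    symm
    refine Finset.sum_nbij' (Equiv.swap i (i + 1)) (Equiv.swap i (i + 1)) ?_ ?_ ?_ ?_ ?_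
    · intro e he
      rw [Finset.mem_range] at he ⊢
      rw [swap_eq]; split_ifs <;> omega
    · intro e he
      rw [Finset.mem_range] at he ⊢
      rw [swap_eq]; split_ifs <;> omega
    · intro e _; simp
    · intro e _; simp
    · intro e he
      rw [Finset.mem_range] at he
      have hface : ∀ (ρ : ℕ → ℕ), (∀ z, z ≠ e → ρ (shift e z) =
          shift (Equiv.swap i (i + 1) e) (Equiv.swap i (i + 1) z)) →
          Isomorphic ρ (T.face e) (T'.face (Equiv.swap i (i + 1) e)) :=
        fun ρ hρ => h.face (fun z => (Equiv.swap i (i + 1)).injective.eq_iff) hρ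
      have hn := T.numEdges_face he
      rcases lt_trichotomy e i with h1 | rfl | h1
      · have he' : Equiv.swap i (i + 1) e = e := by
          rw [swap_eq, if_neg (by omega), if_neg (by omega)]
        have := hc.swap (i - 1) (by omega) (hface (Equiv.swap (i - 1) (i - 1 + 1)) fun z hz => by
          rw [he', swap_eq, swap_eq]; simp only [shift]; split_ifs <;> omega)
        rw [this, he']; ring
      · have he' : Equiv.swap e (e + 1) e = e + 1 := Equiv.swap_apply_left _ _
        have := hc.iso (hface id fun z hz => by
          rw [he', swap_eq]; simp only [shift, id]; split_ifs <;> omega)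
        rw [this, he', show T.numEdges - 1 - e = T.numEdges - 1 - (e + 1) + 1 by omega, pow_succ]
        ring
      · rcases Nat.lt_or_eq_of_le (Nat.succ_le_of_lt h1) with h2 | h2
        · have he' : Equiv.swap i (i + 1) e = e := by
            rw [swap_eq, if_neg (by omega), if_neg (by omega)]
          have := hc.swap i (by omega) (hface (Equiv.swap i (i + 1)) fun z hz => by
            rw [he', swap_eq, swap_eq]; simp only [shift]; split_ifs <;> omega)
          rw [this, he']; ring
        · obtain rfl : e = i + 1 := h2.symm
          have he' : Equiv.swap i (i + 1) (i + 1) = i := Equiv.swap_apply_right _ _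
          have := hc.iso (hface id fun z hz => by
            rw [he', swap_eq]; simp only [shift, id]; split_ifs <;> omega)
          rw [this, he', show T.numEdges - 1 - i = T.numEdges - 1 - (i + 1) + 1 by omega, pow_succ]
          ring
  composesTo {T} h := by
    obtain ⟨e, _, h'⟩ := exists_of_boundary h
    exact (hc.composesTo h').of_face
  degree {T} h := by
    obtain ⟨e, he, h'⟩ := exists_of_boundary h
    have := hc.degree h'
    rw [T.numEdges_face he] at this
    omega

theorem IsChain.boundary_boundary {φ : 𝔉.source a ⟶ 𝔉.ι.obj v₀} {j : ℤ}
    {c : OrdTree δ a v₀ → k} (hc : IsChain φ j c) :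
    OrdTree.boundary k δ a v₀ (OrdTree.boundary k δ a v₀ c) = 0 := by
  funext T
  change ∑ e ∈ Finset.range T.numEdges, (-1) ^ (T.numEdges - 1 - e) *
    ∑ e' ∈ Finset.range (T.face e).numEdges, (-1) ^ ((T.face e).numEdges - 1 - e') *
      c ((T.face e).face e') = 0
  rcases h : T.numEdges with _ | M
  · simp
  · rw [← sum_range_cancel M (fun e e' => (-1) ^ (M - e) * ((-1) ^ (M - 1 - e') *
      c ((T.face e).face e')))]
    · refine Finset.sum_congr rfl fun e he => ?_
      rw [Finset.mem_range] at he
      rw [T.numEdges_face (by omega), Finset.mul_sum, h]; rfl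
    · intro e e' hee he'
      rw [hc.iso (T.face_face hee), show M - (e' + 1) = M - 1 - e' by omega,
        show M - e = M - 1 - e + 1 by omega, pow_succ]
      ring

variable (k) in
/-- The filtered complex of trees that compose to `φ`, filtered by width. -/
def cells (φ : 𝔉.source a ⟶ 𝔉.ι.obj v₀) : CellData (OrdTree δ a v₀) k where
  D := boundary k δ a v₀
  chains j :=
    { carrier := {c | IsChain φ j c}
      zero_mem' := ⟨fun _ => rfl, fun _ _ _ => by simp, fun h => absurd rfl h, fun h => absurd rfl h⟩
      add_mem' := fun {c c'} hc hc' =>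
        ⟨fun h => by simp only [Pi.add_apply, hc.iso h, hc'.iso h],
          fun i hi h => by simp only [Pi.add_apply, hc.swap i hi h, hc'.swap i hi h]; ring,
          fun {T} h => by
            by_cases h' : c T = 0
            · exact hc'.composesTo fun h'' => h (by simp [h', h''])
            · exact hc.composesTo h',
          fun {T} h => by
            by_cases h' : c T = 0
            · exact hc'.degree fun h'' => h (by simp [h', h''])
            · exact hc.degree h'⟩
      smul_mem' := fun r c hc =>
        ⟨fun h => by simp only [Pi.smul_apply, hc.iso h],
          fun i hi h => by simp only [Pi.smul_apply, hc.swap i hi h, smul_neg],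
          fun {T} h => hc.composesTo fun h' => h (by simp [h']),
          fun {T} h => hc.degree fun h' => h (by simp [h'])⟩ }
  D_mem _ _ hc := hc.boundary
  D_D _ _ hc := hc.boundary_boundary
  weight := width
  weight_D s c hc T h := by
    obtain ⟨e, _, h'⟩ := exists_of_boundary h
    exact (T.width_le_width_face e).trans (hc _ h')
end OrdTree

section Main
variable (k)

/-- The cellular chain complex of the permutohedron, filtered by width. -/
abbrev permutohedron (n : ℕ) : FilteredComplex.{w, max t w} k :=
  (TOPartition.cells.{w, t} k n).toFiltered

/-- The chain complex of the simplex with `n` vertices. -/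
abbrev simplex (n : ℕ) : FilteredComplex.{w, max t w} k := (Face.cells.{w, t} k n).toFiltered

/-- The complex of the trees that compose to `φ`, filtered by width. -/
abbrev fiber (δ : ProperDegree 𝔉) {n : ℕ} {a : Fin n → V} {v₀ : V}
    (φ : 𝔉.source a ⟶ 𝔉.ι.obj v₀) : FilteredComplex k :=
  (OrdTree.cells k (δ := δ) φ).toFiltered

end Main
end Complexes

end Feyn

namespace Feyn

set_option linter.unusedSectionVars false

/-- A building set on `Fin n`: a family of nonempty subsets that contains the singletons and is closed
under unions of intersecting members. -/
structure BuildingSet (n : ℕ) where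
  mem : Finset (Fin n) → Prop
  nonempty {S : Finset (Fin n)} : mem S → S.Nonempty
  singleton (x : Fin n) : mem {x}
  union {S T : Finset (Fin n)} : mem S → mem T → (∃ x, x ∈ S ∧ x ∈ T) → mem (S ∪ T)

namespace BuildingSet
open Finset
open scoped Classical in
section
variable {n : ℕ} (B : BuildingSet n)

/-- A nested family: no union of members that belongs to the building set is new. -/
def Nested (N : Finset (Finset (Fin n))) : Prop :=
  (∀ S ∈ N, B.mem S) ∧ ∀ J ⊆ N, B.mem (J.sup id) → J.sup id ∈ J

variable {B} in
theorem Nested.mono {N N' : Finset (Finset (Fin n))} (h : B.Nested N) (h' : N' ⊆ N) :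
    B.Nested N' :=
  ⟨fun S hS => h.1 S (h' hS), fun J hJ => h.2 J (hJ.trans h')⟩

variable {B} in
theorem Nested.subset_or {N : Finset (Finset (Fin n))} (h : B.Nested N) {S T : Finset (Fin n)}
    (hS : S ∈ N) (hT : T ∈ N) {x : Fin n} (hx : x ∈ S) (hx' : x ∈ T) : S ⊆ T ∨ T ⊆ S := by
  have := h.2 {S, T} (by simp [insert_subset_iff, hS, hT]) (by
    simpa using B.union (h.1 S hS) (h.1 T hT) ⟨x, hx, hx'⟩)
  simp only [sup_insert, id, sup_singleton, mem_insert, mem_singleton, sup_eq_union,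
    union_eq_left, union_eq_right] at this
  exact this.symm

theorem mem_sup {x : Fin n} {J : Finset (Finset (Fin n))} (hJ : J.Nonempty)
    (h : ∀ S ∈ J, B.mem S ∧ x ∈ S) : B.mem (J.sup id) ∧ x ∈ J.sup id := by
  induction hJ using Finset.Nonempty.cons_induction with
  | singleton S => simpa using h S (by simp)
  | cons S J hS hJ ih =>
    have h1 := h S (by simp)
    have h2 := ih fun T hT => h T (by simp [hT])
    rw [Finset.sup_cons]
    exact ⟨B.union h1.1 h2.1 ⟨x, h1.2, h2.2⟩, mem_union_left _ h1.2⟩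

/-- The component of `x` in `U`. -/
noncomputable def component (x : Fin n) (U : Finset (Fin n)) : Finset (Fin n) :=
  (univ.filter fun S => B.mem S ∧ x ∈ S ∧ S ⊆ U).sup id

variable {B} in
theorem subset_component {x : Fin n} {S U : Finset (Fin n)} (hS : B.mem S) (hx : x ∈ S)
    (h : S ⊆ U) : S ⊆ B.component x U :=
  le_sup (f := id) (by simp [hS, hx, h])

theorem component_subset (x : Fin n) (U : Finset (Fin n)) : B.component x U ⊆ U :=
  Finset.sup_le fun S hS => by simp at hS; exact hS.2.2

theorem mem_component {x : Fin n} {U : Finset (Fin n)} (hx : x ∈ U) :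
    B.mem (B.component x U) ∧ x ∈ B.component x U :=
  B.mem_sup ⟨{x}, by simp [B.singleton, hx]⟩ fun S hS => by
    simp at hS; exact ⟨hS.1, hS.2.1⟩

/-- The members of a family that do not contain `x`. -/
def avoid (x : Fin n) (N : Finset (Finset (Fin n))) : Finset (Finset (Fin n)) :=
  N.filter fun S => x ∉ S

/-- The component of `x` in the union of `x` and the members of the family not containing `x`. -/
noncomputable def apex (x : Fin n) (N : Finset (Finset (Fin n))) : Finset (Fin n) :=
  B.component x (insert x ((avoid x N).sup id))

theorem mem_apex (x : Fin n) (N : Finset (Finset (Fin n))) :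
    B.mem (B.apex x N) ∧ x ∈ B.apex x N := B.mem_component (by simp)

theorem apex_subset (x : Fin n) (N : Finset (Finset (Fin n))) :
    B.apex x N ⊆ insert x ((avoid x N).sup id) := B.component_subset _ _

variable {B} in
theorem Nested.apex_subset {N : Finset (Finset (Fin n))} (h : B.Nested N) {x : Fin n}
    {M : Finset (Fin n)} (hM : M ∈ N) (hx : x ∈ M) : B.apex x N ⊆ M := by
  obtain ⟨h1, h2⟩ := B.mem_apex x N
  set z := B.apex x N with hz
  let J := insert M ((avoid x N).filter fun Y => ∃ y, y ∈ Y ∧ y ∈ z)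
  have hJs : J.sup id = M ∪ z := by
    apply subset_antisymm
    · refine Finset.sup_le fun Y hY => ?_
      rcases mem_insert.1 hY with rfl | hY
      · exact subset_union_left
      · obtain ⟨hYN, y, hy, hyz⟩ := mem_filter.1 hY
        refine (subset_union_left (s₁ := Y) (s₂ := z)).trans
          ((subset_component (B.union (h.1 Y (mem_filter.1 hYN).1) h1 ⟨y, hy, hyz⟩)
            (mem_union_right _ h2) (union_subset ?_ (B.apex_subset x N))).trans subset_union_right)
        exact (le_sup (f := id) hYN).trans (subset_insert _ _)
    · refine union_subset (le_sup (f := id) (mem_insert_self _ _)) fun y hy => ?_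
      rcases mem_insert.1 (B.apex_subset x N hy) with rfl | hy'
      · exact (le_sup (f := id) (mem_insert_self _ _) : M ≤ J.sup id) hx
      · obtain ⟨Y, hY, hyY⟩ := Finset.mem_sup.1 hy'
        exact (le_sup (f := id) (mem_insert_of_mem (mem_filter.2 ⟨hY, y, hyY, hy⟩)) :
          Y ≤ J.sup id) hyY
  have hJN : J ⊆ N := insert_subset hM fun Y hY => (mem_filter.1 (mem_filter.1 hY).1).1
  have := h.2 J hJN (by rw [hJs]; exact B.union (h.1 M hM) h1 ⟨x, hx, h2⟩)
  rw [hJs] at this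
  rcases mem_insert.1 this with h' | h'
  · exact union_eq_left.1 h'
  · have := (mem_filter.1 (mem_filter.1 h').1).2
    exact absurd (mem_union_left z hx) this

variable {B} in
theorem Nested.insert_apex {N : Finset (Finset (Fin n))} (h : B.Nested N) (x : Fin n) :
    B.Nested (insert (B.apex x N) N) := by
  obtain ⟨h1, h2⟩ := B.mem_apex x N
  refine ⟨fun S hS => ?_, fun J hJ hB => ?_⟩
  · rcases mem_insert.1 hS with rfl | hS
    · exact h1
    · exact h.1 S hS
  by_cases hz : B.apex x N ∈ J
  swap
  · exact h.2 J (fun S hS => (mem_insert.1 (hJ hS)).resolve_left fun h' => hz (h' ▸ hS)) hB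
  have hle : B.apex x N ⊆ J.sup id := le_sup (f := id) hz
  by_cases hM : ∃ M ∈ J, M ∈ N ∧ x ∈ M ∧ M ≠ B.apex x N
  · obtain ⟨M, hMJ, hMN, hxM, hne⟩ := hM
    have hs : (J.erase (B.apex x N)).sup id = J.sup id := by
      apply le_antisymm (sup_mono (erase_subset _ _))
      refine Finset.sup_le fun S hS => ?_
      by_cases hS' : S = B.apex x N
      · rw [hS']
        exact (h.apex_subset hMN hxM).trans (le_sup (f := id) (mem_erase.2 ⟨hne, hMJ⟩))
      · exact le_sup (f := id) (mem_erase.2 ⟨hS', hS⟩)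
    rw [← hs] at hB ⊢
    refine mem_of_mem_erase (h.2 _ (fun S hS => ?_) hB)
    exact (mem_insert.1 (hJ (mem_of_mem_erase hS))).resolve_left (ne_of_mem_erase hS)
  · push Not at hM
    have : J.sup id ⊆ B.apex x N := by
      refine subset_component hB (hle h2) (Finset.sup_le fun S hS => ?_)
      by_cases hS' : S = B.apex x N
      · rw [hS']; exact B.apex_subset x N
      · have hSN := (mem_insert.1 (hJ hS)).resolve_left hS'
        have hxS : x ∉ S := fun hx => hS' (hM S hS hSN hx)
        exact (le_sup (f := id) (mem_filter.2 ⟨hSN, hxS⟩)).trans (subset_insert _ _)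
    rw [subset_antisymm this hle]; exact hz

end
end BuildingSet

section Cochains
open Finset
variable {β : Type*} [DecidableEq β] (κ : β → ℕ) {k : Type*} [CommRing k]

/-- The sign of the position of `M` in the set `N` ordered by `κ`. -/
def posSign (k : Type*) [CommRing k] (M : β) (N : Finset β) : k :=
  (-1) ^ (N.filter fun M' => κ M' < κ M).card

/-- The simplicial coboundary. -/
def coboundary (c : Finset β → k) (N : Finset β) : k :=
  ∑ M ∈ N, posSign κ k M N * c (N.erase M)

theorem posSign_mul_self (M : β) (N : Finset β) : posSign κ k M N * posSign κ k M N = 1 := by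
  rw [posSign, ← mul_pow]; simp

theorem posSign_erase_self (M : β) (N : Finset β) :
    posSign κ k M (N.erase M) = posSign κ k M N := by
  rw [posSign, posSign, Finset.filter_erase, Finset.erase_eq_of_notMem (by simp)]

theorem posSign_insert_self (M : β) (N : Finset β) :
    posSign κ k M (insert M N) = posSign κ k M N := by
  rw [posSign, posSign, Finset.filter_insert, if_neg (lt_irrefl _)]

variable {κ}

theorem posSign_swap_of_lt {M M' : β} {N : Finset β} (hM : M ∈ N) (h : κ M < κ M') :
    posSign κ k M N * posSign κ k M' (N.erase M) +
      posSign κ k M' N * posSign κ k M (N.erase M') = 0 := by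
  have h1 : posSign κ k M (N.erase M') = posSign κ k M N := by
    rw [posSign, posSign, Finset.filter_erase, Finset.erase_eq_of_notMem (by simp [h.le])]
  have h2 : posSign κ k M' N = - posSign κ k M' (N.erase M) := by
    rw [posSign, posSign, Finset.filter_erase, ← Finset.card_erase_add_one (a := M)
      (s := N.filter fun x => κ x < κ M') (by simp [hM, h]), pow_succ]
    ring
  rw [h1, h2]; ring

theorem posSign_swap (hκ : Function.Injective κ) {M M' : β} {N : Finset β} (hM : M ∈ N)
    (hM' : M' ∈ N) (h : M ≠ M') :
    posSign κ k M N * posSign κ k M' (N.erase M) +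
      posSign κ k M' N * posSign κ k M (N.erase M') = 0 := by
  rcases lt_or_gt_of_ne (hκ.ne h) with h | h
  · exact posSign_swap_of_lt hM h
  · rw [add_comm]; exact posSign_swap_of_lt hM' h

theorem posSign_swap_insert (hκ : Function.Injective κ) {M Z : β} {N : Finset β} (hM : M ∈ N)
    (hZ : Z ∉ N) :
    posSign κ k Z N * posSign κ k M (insert Z N) +
      posSign κ k M N * posSign κ k Z (N.erase M) = 0 := by
  have hne : Z ≠ M := fun h => hZ (h ▸ hM)
  have := posSign_swap (k := k) hκ (mem_insert_self Z N) (mem_insert_of_mem hM) hne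
  rw [erase_insert hZ, posSign_insert_self, erase_insert_of_ne hne, posSign_insert_self] at this
  rw [add_comm, mul_comm (posSign κ k M N), mul_comm (posSign κ k Z N)]
  rw [add_comm, mul_comm (posSign κ k M (insert Z N))] at this
  have h1 := posSign_mul_self κ (k := k) Z N
  have h2 := posSign_mul_self κ (k := k) Z (N.erase M)
  linear_combination (posSign κ k Z N * posSign κ k Z (N.erase M)) * this - (posSign κ k M N *
    posSign κ k Z (N.erase M)) * h1 - posSign κ k M (insert Z N) * posSign κ k Z N * h2

theorem coboundary_coboundary (hκ : Function.Injective κ) (c : Finset β → k) (N : Finset β) :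
    coboundary κ (coboundary κ c) N = 0 := by
  simp only [coboundary, mul_sum, ← mul_assoc]
  rw [Finset.sum_sigma']
  refine Finset.sum_involution (fun p _ => ⟨p.2, p.1⟩) ?_ ?_ ?_ ?_
  · rintro ⟨M, M'⟩ h
    simp only [mem_sigma, mem_erase] at h
    dsimp only
    rw [erase_right_comm, ← add_mul, posSign_swap hκ h.1 h.2.2 h.2.1.symm, zero_mul]
  · rintro ⟨M, M'⟩ h -
    simp only [mem_sigma, mem_erase] at h
    simp only [ne_eq, Sigma.mk.injEq, not_and]
    exact fun h' => absurd h' h.2.1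
  · rintro ⟨M, M'⟩ h
    simp only [mem_sigma, mem_erase] at h ⊢
    exact ⟨h.2.2, h.2.1.symm, h.1⟩
  · rintro ⟨M, M'⟩ h; rfl

theorem coboundary_congr {c c' : Finset β → k} {N : Finset β}
    (h : ∀ M ∈ N, c (N.erase M) = c' (N.erase M)) : coboundary κ c N = coboundary κ c' N :=
  Finset.sum_congr rfl fun M hM => by rw [h M hM]

theorem coboundary_add (c c' : Finset β → k) (N : Finset β) :
    coboundary κ (fun N => c N + c' N) N = coboundary κ c N + coboundary κ c' N := by
  simp only [coboundary, mul_add, sum_add_distrib]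

theorem coboundary_smul (r : k) (c : Finset β → k) (N : Finset β) :
    coboundary κ (fun N => r * c N) N = r * coboundary κ c N := by
  simp only [coboundary, mul_sum]; exact Finset.sum_congr rfl fun _ _ => by ring

theorem coboundary_sub (c c' : Finset β → k) (N : Finset β) :
    coboundary κ (fun N => c N - c' N) N = coboundary κ c N - coboundary κ c' N := by
  simp only [coboundary, mul_sub, sum_sub_distrib]

end Cochains

namespace BuildingSet
open Finset
open scoped Classical in
section
variable {n : ℕ} (B : BuildingSet n) {k : Type*} [CommRing k] (κ : Finset (Fin n) → ℕ)

/-- The nested families with union `S`. -/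
def Cover (S : Finset (Fin n)) (N : Finset (Finset (Fin n))) : Prop := B.Nested N ∧ N.sup id = S

/-- The families with union `S` whose members not containing `x` have union `S \ {x}`. -/
def Critical (x : Fin n) (S : Finset (Fin n)) (N : Finset (Finset (Fin n))) : Prop :=
  B.Cover S N ∧ (avoid x N).sup id = S.erase x

/-- The contracting homotopy that inserts the apex. -/
noncomputable def homotopy (x : Fin n) (S : Finset (Fin n)) (c : Finset (Finset (Fin n)) → k)
    (N : Finset (Finset (Fin n))) : k :=
  if B.Cover S N ∧ ¬ B.Critical x S N ∧ B.apex x N ∉ N then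
    posSign κ k (B.apex x N) N * c (insert (B.apex x N) N) else 0

variable {B}

theorem avoid_erase_of_mem {x : Fin n} {N : Finset (Finset (Fin n))} {M : Finset (Fin n)}
    (h : x ∈ M) : avoid x (N.erase M) = avoid x N := by
  ext S; simp only [avoid, mem_filter, mem_erase]
  exact ⟨fun h' => ⟨h'.1.2, h'.2⟩, fun h' => ⟨⟨fun e => h'.2 (e ▸ h), h'.1⟩, h'.2⟩⟩

theorem avoid_insert_of_mem {x : Fin n} {N : Finset (Finset (Fin n))} {M : Finset (Fin n)}
    (h : x ∈ M) : avoid x (insert M N) = avoid x N := by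
  rw [avoid, avoid, filter_insert, if_neg (by simpa using h)]

theorem avoid_erase {x : Fin n} {N : Finset (Finset (Fin n))} {M : Finset (Fin n)} :
    avoid x (N.erase M) = (avoid x N).erase M := by
  rw [avoid, filter_erase]; rfl

theorem apex_insert {x : Fin n} {N : Finset (Finset (Fin n))} {M : Finset (Fin n)} (h : x ∈ M) :
    B.apex x (insert M N) = B.apex x N := by rw [apex, apex, avoid_insert_of_mem h]

theorem apex_erase {x : Fin n} {N : Finset (Finset (Fin n))} {M : Finset (Fin n)} (h : x ∈ M) :
    B.apex x (N.erase M) = B.apex x N := by rw [apex, apex, avoid_erase_of_mem h]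

theorem sup_avoid_subset {x : Fin n} {S : Finset (Fin n)} {N : Finset (Finset (Fin n))}
    (h : N.sup id ⊆ S) : (avoid x N).sup id ⊆ S.erase x := by
  refine Finset.sup_le fun M hM => ?_
  rw [avoid, mem_filter] at hM
  exact fun y hy => mem_erase.2 ⟨fun e => hM.2 (e ▸ hy),
    h ((le_sup (f := id) hM.1 : M ≤ N.sup id) hy)⟩

theorem Cover.insert_apex {x : Fin n} {S : Finset (Fin n)} (hx : x ∈ S)
    {N : Finset (Finset (Fin n))} (h : B.Cover S N) : B.Cover S (insert (B.apex x N) N) := by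
  refine ⟨h.1.insert_apex x, ?_⟩
  rw [sup_insert, h.2, id, sup_eq_union, union_eq_right]
  exact (B.apex_subset x N).trans (insert_subset hx
    ((sup_avoid_subset h.2.le).trans (erase_subset _ _)))

/-- If `N` covers and is not critical, then removing a member not equal to the unique member
containing `x` covers. -/
theorem Cover.erase_apex {x : Fin n} {S : Finset (Fin n)}
    {N : Finset (Finset (Fin n))} (h : B.Cover S N) (hc : ¬ B.Critical x S N)
    : B.Cover S (N.erase (B.apex x N)) := by
  refine ⟨h.1.mono (erase_subset _ _), ?_⟩
  by_cases hM : ∃ M ∈ N, x ∈ M ∧ M ≠ B.apex x N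
  · obtain ⟨M, hMN, hxM, hne⟩ := hM
    rw [← h.2]
    apply le_antisymm (sup_mono (erase_subset _ _))
    refine Finset.sup_le fun T hT => ?_
    by_cases hT' : T = B.apex x N
    · rw [hT']
      exact (h.1.apex_subset hMN hxM).trans (le_sup (f := id) (mem_erase.2 ⟨hne, hMN⟩))
    · exact le_sup (f := id) (mem_erase.2 ⟨hT', hT⟩)
  · push Not at hM
    exfalso
    refine hc ⟨h, subset_antisymm (sup_avoid_subset h.2.le) fun y hy => ?_⟩
    rw [mem_erase] at hy
    have hy' := hy.2
    rw [← h.2] at hy'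
    obtain ⟨T, hT, hyT⟩ := Finset.mem_sup.1 hy'
    by_cases hxT : x ∈ T
    · rw [id, hM T hT hxT] at hyT
      exact (mem_insert.1 (B.apex_subset x N hyT)).resolve_left hy.1
    · exact (le_sup (f := id) (mem_filter.2 ⟨hT, hxT⟩) : T ≤ (avoid x N).sup id) hyT

theorem Critical.of_erase {x : Fin n} {S : Finset (Fin n)}
    {N : Finset (Finset (Fin n))} (h : B.Cover S N) {M : Finset (Fin n)}
    (hc : B.Critical x S (N.erase M)) : B.Critical x S N := by
  refine ⟨h, subset_antisymm (sup_avoid_subset h.2.le) ?_⟩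
  rw [← hc.2, avoid_erase]; exact sup_mono (erase_subset _ _)

theorem card_avoid_erase {x : Fin n}
    {N : Finset (Finset (Fin n))} {M : Finset (Fin n)} (hM : M ∈ N) (hx : x ∉ M) :
    (avoid x (N.erase M)).card + 1 = (avoid x N).card := by
  rw [avoid_erase]
  exact card_erase_add_one (by simp [avoid, hM, hx])

variable {κ}

/-- The homotopy formula, up to terms in which the number of members avoiding `x` is smaller. -/
theorem homotopy_formula (hκ : Function.Injective κ) {x : Fin n} {S : Finset (Fin n)} (hx : x ∈ S)
    {c : Finset (Finset (Fin n)) → k} (hc : ∀ N, c N ≠ 0 → B.Cover S N)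
    (hD : ∀ N, B.Cover S N → coboundary κ c N = 0) {N : Finset (Finset (Fin n))}
    (hN : B.Cover S N) (hcr : ¬ B.Critical x S N)
    (hlow : ∀ N', B.Cover S N' → ¬ B.Critical x S N' → (avoid x N').card < (avoid x N).card →
      c N' = 0) :
    coboundary κ (B.homotopy κ x S c) N = c N := by
  set z := B.apex x N with hz
  have hxz : x ∈ z := (B.mem_apex x N).2
  have hlow' : ∀ M ∈ N, x ∉ M → B.homotopy κ x S c (N.erase M) = 0 := by
    intro M hM hxM
    rw [homotopy]
    split_ifs with h
    · rw [hlow _ (h.1.insert_apex hx), mul_zero]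
      · intro h'
        apply h.2.1
        rw [Critical, avoid_insert_of_mem (B.mem_apex x _).2] at h'
        exact ⟨h.1, h'.2⟩
      · rw [avoid_insert_of_mem (B.mem_apex x _).2]
        have := card_avoid_erase hM hxM
        omega
    · rfl
  by_cases hzN : z ∈ N
  · rw [coboundary, sum_eq_single z]
    · have h1 : B.apex x (N.erase z) = z := apex_erase hxz
      have h2 := hN.erase_apex hcr
      rw [homotopy, h1, if_pos ⟨h2, fun h => hcr (h.of_erase hN), by simp⟩, insert_erase hzN,
        posSign_erase_self, ← mul_assoc, posSign_mul_self, one_mul]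
    · intro M hM hMz
      by_cases hxM : x ∈ M
      · rw [homotopy, if_neg, mul_zero]
        rintro ⟨-, -, h⟩
        rw [apex_erase hxM] at h
        exact h (mem_erase.2 ⟨hMz.symm, hzN⟩)
      · rw [hlow' M hM hxM, mul_zero]
    · exact fun h => absurd hzN h
  · have h1 := hD _ (hN.insert_apex hx)
    rw [← hz, coboundary, sum_insert hzN, posSign_insert_self, erase_insert hzN] at h1
    have h2 : coboundary κ (B.homotopy κ x S c) N = - (posSign κ k z N *
        ∑ M ∈ N, posSign κ k M (insert z N) * c ((insert z N).erase M)) := by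
      rw [coboundary, mul_sum, ← sum_neg_distrib]
      refine Finset.sum_congr rfl fun M hM => ?_
      have hne : z ≠ M := fun h => hzN (h ▸ hM)
      rw [erase_insert_of_ne hne]
      by_cases hxM : x ∈ M
      · have hsg := posSign_swap_insert (k := k) hκ hM hzN
        rw [homotopy, apex_erase hxM, ← hz]
        split_ifs with h
        · linear_combination c (insert z (N.erase M)) * hsg
        · have : c (insert z (N.erase M)) = 0 := by
            by_contra h'
            have h'' := hc _ h'
            refine h ⟨⟨hN.1.mono (erase_subset _ _), ?_⟩, fun h => hcr (h.of_erase hN), fun h =>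
              hzN (mem_of_mem_erase h)⟩
            have hne : B.apex x (insert z (N.erase M)) = z := by
              rw [apex_insert hxz, apex_erase hxM]
            have := h''.erase_apex (fun h3 => by
              apply hcr
              refine ⟨hN, ?_⟩
              rw [← h3.2, avoid_insert_of_mem hxz, avoid_erase_of_mem hxM])
            rw [hne, erase_insert (fun h => hzN (mem_of_mem_erase h))] at this
            exact this.2
          rw [this]; ring
      · rw [hlow' M hM hxM]
        have : c (insert z (N.erase M)) = 0 := by
          by_contra h'
          refine h' (hlow _ (hc _ h') ?_ ?_)
          · rintro ⟨-, h3⟩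
            rw [avoid_insert_of_mem hxz] at h3
            refine hcr ⟨hN, subset_antisymm (sup_avoid_subset hN.2.le) ?_⟩
            rw [← h3, avoid_erase]; exact sup_mono (erase_subset _ _)
          · rw [avoid_insert_of_mem hxz]
            have := card_avoid_erase hM hxM
            omega
        rw [this]; ring
    rw [h2]
    have h3 := posSign_mul_self κ (k := k) z N
    linear_combination (-posSign κ k z N) * h1 + c N * h3

theorem homotopy_cover {x : Fin n} {S : Finset (Fin n)} {c : Finset (Finset (Fin n)) → k}
    {N : Finset (Finset (Fin n))} (h : B.homotopy κ x S c N ≠ 0) : B.Cover S N := by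
  rw [homotopy] at h
  by_contra h'
  exact h (if_neg fun h'' => h' h''.1)

theorem coboundary_restrict (hκ : Function.Injective κ) {S : Finset (Fin n)}
    {b : Finset (Finset (Fin n)) → k} (hb : ∀ N, b N ≠ 0 → B.Cover S N)
    {N : Finset (Finset (Fin n))} (hN : B.Cover S N) :
    coboundary κ (fun N => if B.Cover S N then coboundary κ b N else 0) N = 0 := by
  refine Eq.trans ?_ (coboundary_coboundary hκ b N)
  refine coboundary_congr fun M hM => ?_
  split_ifs with h
  · rfl
  · rw [coboundary]
    refine Eq.symm (Finset.sum_eq_zero fun M' hM' => ?_)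
    by_contra h'
    have h'' := hb _ (right_ne_zero_of_mul h')
    refine h ⟨hN.1.mono (erase_subset _ _), subset_antisymm ?_ ?_⟩
    · rw [← hN.2]; exact sup_mono (erase_subset _ _)
    · rw [← h''.2]; exact sup_mono (erase_subset _ _)

/-- Every cocycle is cohomologous to one supported on critical families. -/
theorem exists_critical (hκ : Function.Injective κ) {x : Fin n} {S : Finset (Fin n)} (hx : x ∈ S)
    {c : Finset (Finset (Fin n)) → k} (hc : ∀ N, c N ≠ 0 → B.Cover S N)
    (hD : ∀ N, B.Cover S N → coboundary κ c N = 0) :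
    ∃ c' b : Finset (Finset (Fin n)) → k, (∀ N, c' N ≠ 0 → B.Critical x S N) ∧
      (∀ N, b N ≠ 0 → B.Cover S N) ∧ (∀ N, B.Cover S N → coboundary κ c' N = 0) ∧
      ∀ N, B.Cover S N → c N = c' N + coboundary κ b N := by
  have key : ∀ m : ℕ, ∃ c' b : Finset (Finset (Fin n)) → k, (∀ N, c' N ≠ 0 → B.Cover S N) ∧
      (∀ N, c' N ≠ 0 → ¬ B.Critical x S N → m ≤ (avoid x N).card) ∧
      (∀ N, b N ≠ 0 → B.Cover S N) ∧ (∀ N, B.Cover S N → coboundary κ c' N = 0) ∧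
      ∀ N, B.Cover S N → c N = c' N + coboundary κ b N := by
    intro m
    induction m with
    | zero => exact ⟨c, fun _ => 0, hc, fun _ _ _ => Nat.zero_le _, fun _ h => absurd rfl h, hD,
        fun N _ => by simp [coboundary]⟩
    | succ m ih =>
      obtain ⟨c₁, b, h1, h2, h3, h4, h5⟩ := ih
      refine ⟨fun N => c₁ N - if B.Cover S N then coboundary κ (B.homotopy κ x S c₁) N else 0,
        fun N => b N + B.homotopy κ x S c₁ N, ?_, ?_, ?_, ?_, ?_⟩
      · intro N h
        by_contra h'
        refine h ?_
        dsimp only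
        rw [if_neg h', sub_zero]
        by_contra h''
        exact h' (h1 N h'')
      · intro N h hcr
        by_contra hlt
        have hN : B.Cover S N := by
          by_contra h'
          refine h ?_
          dsimp only
          rw [if_neg h', sub_zero]
          by_contra h''
          exact h' (h1 N h'')
        refine h ?_
        dsimp only
        rw [if_pos hN, homotopy_formula hκ hx h1 h4 hN hcr, sub_self]
        intro N' hN' hcr' hlt'
        by_contra h'
        have := h2 N' h' hcr'
        omega
      · intro N h
        by_contra h'
        refine h ?_
        dsimp only
        have e1 : b N = 0 := by by_contra e; exact h' (h3 N e)
        have e2 : B.homotopy κ x S c₁ N = 0 := by by_contra e; exact h' (homotopy_cover e)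
        rw [e1, e2, add_zero]
      · intro N hN
        rw [coboundary_sub, h4 N hN, coboundary_restrict hκ (fun N h => homotopy_cover h) hN,
          sub_zero]
      · intro N hN
        dsimp only
        rw [coboundary_add, h5 N hN, if_pos hN]; ring
  obtain ⟨c', b, h1, h2, h3, h4, h5⟩ := key (Fintype.card (Finset (Fin n)) + 1)
  refine ⟨c', b, fun N h => ?_, h3, h4, h5⟩
  by_contra hcr
  have := h2 N h hcr
  have := card_le_univ (avoid x N)
  omega

theorem critical_iff {x : Fin n} {S : Finset (Fin n)} (hx : x ∈ S)
    {N : Finset (Finset (Fin n))} :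
    B.Critical x S N ↔ B.component x S ∈ N ∧ B.Cover (S.erase x) (N.erase (B.component x S)) := by
  obtain ⟨hZ, hxZ⟩ := B.mem_component hx
  constructor
  · rintro ⟨hN, hs⟩
    have hz : B.apex x N = B.component x S := by rw [apex, hs, insert_erase hx]
    have hall : ∀ M ∈ N, x ∈ M → M = B.component x S := fun M hM hxM =>
      subset_antisymm (subset_component (hN.1.1 M hM) hxM (by
        rw [← hN.2]; exact le_sup (f := id) hM)) (hz ▸ hN.1.apex_subset hM hxM)
    have hmem : B.component x S ∈ N := by
      have : x ∈ N.sup id := by rw [hN.2]; exact hx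
      obtain ⟨M, hM, hxM⟩ := Finset.mem_sup.1 this
      rw [← hall M hM hxM]; exact hM
    refine ⟨hmem, hN.1.mono (erase_subset _ _), ?_⟩
    rw [← hs]
    congr 1
    ext M
    simp only [avoid, mem_erase, mem_filter]
    exact ⟨fun h => ⟨h.2, fun h' => h.1 (hall M h.2 h')⟩, fun h => ⟨fun e => h.2 (e ▸ hxZ), h.1⟩⟩
  · rintro ⟨hmem, hN⟩
    have hav : avoid x N = N.erase (B.component x S) := by
      ext M
      simp only [avoid, mem_erase, mem_filter]
      refine ⟨fun h => ⟨fun e => h.2 (e ▸ hxZ), h.1⟩, fun h => ⟨h.2, fun h' => ?_⟩⟩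
      have : x ∈ S.erase x := by
        rw [← hN.2]
        exact (le_sup (f := id) (mem_erase.2 h) : M ≤ _) h'
      simp at this
    have hsup : (avoid x N).sup id = S.erase x := by rw [hav, hN.2]
    have hz : B.apex x (N.erase (B.component x S)) = B.component x S := by
      rw [apex_erase hxZ, apex, hsup, insert_erase hx]
    refine ⟨⟨?_, ?_⟩, hsup⟩
    · have := hN.1.insert_apex x
      rwa [hz, insert_erase hmem] at this
    · rw [← insert_erase hmem, sup_insert, hN.2, id, sup_eq_union]
      apply subset_antisymm
      · exact union_subset (B.component_subset _ _) (erase_subset _ _)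
      · intro y hy
        by_cases h : y = x
        · exact mem_union_left _ (h ▸ hxZ)
        · exact mem_union_right _ (mem_erase.2 ⟨h, hy⟩)

/-- The extension of a cochain by one member. -/
noncomputable def extend (κ : Finset (Fin n) → ℕ) (Z : Finset (Fin n))
    (e : Finset (Finset (Fin n)) → k) (N : Finset (Finset (Fin n))) : k :=
  if Z ∈ N then posSign κ k Z N * e (N.erase Z) else 0

theorem coboundary_extend (hκ : Function.Injective κ) {Z : Finset (Fin n)}
    (e : Finset (Finset (Fin n)) → k) {N : Finset (Finset (Fin n))} (hZ : Z ∈ N) :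
    coboundary κ (extend κ Z e) N = - (posSign κ k Z N * coboundary κ e (N.erase Z)) := by
  rw [coboundary, ← add_sum_erase _ _ hZ, extend, if_neg (by simp), mul_zero, zero_add,
    coboundary, mul_sum, ← sum_neg_distrib]
  refine Finset.sum_congr rfl fun M hM => ?_
  rw [mem_erase] at hM
  rw [extend, if_pos (mem_erase.2 ⟨hM.1.symm, hZ⟩), erase_right_comm]
  linear_combination e ((N.erase Z).erase M) * posSign_swap (k := k) hκ hZ hM.2 hM.1.symm

variable (B k) in
/-- The cohomology of the complex of nested families with union `S` is at most one-dimensional and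
concentrated in the top degree. -/
theorem exists_cocycle (hκ : Function.Injective κ) (S : Finset (Fin n)) :
    ∃ c₀ : Finset (Finset (Fin n)) → k, (∀ N, c₀ N ≠ 0 → B.Cover S N ∧ N.card = S.card) ∧
      ∀ c : Finset (Finset (Fin n)) → k, (∀ N, c N ≠ 0 → B.Cover S N) →
        (∀ N, B.Cover S N → coboundary κ c N = 0) →
        ∃ (r : k) (b : Finset (Finset (Fin n)) → k), (∀ N, b N ≠ 0 → B.Cover S N) ∧
          ∀ N, B.Cover S N → c N = r * c₀ N + coboundary κ b N := by
  induction S using Finset.strongInduction with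
  | H S ih =>
  rcases S.eq_empty_or_nonempty with rfl | ⟨x, hx⟩
  · have hcov : ∀ N, B.Cover ∅ N ↔ N = ∅ := by
      intro N
      refine ⟨fun h => eq_empty_of_forall_notMem fun M hM => ?_, ?_⟩
      · obtain ⟨y, hy⟩ := B.nonempty (h.1.1 M hM)
        have : y ∈ N.sup id := (le_sup (f := id) hM : M ≤ _) hy
        rw [h.2] at this
        simp at this
      · rintro rfl
        refine ⟨⟨by simp, fun J hJ hB => ?_⟩, rfl⟩
        rw [subset_empty.1 hJ] at hB
        simpa using B.nonempty hB
    refine ⟨fun N => if N = ∅ then 1 else 0, fun N h => ?_, fun c hc hD =>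
      ⟨c ∅, fun _ => 0, fun N h => absurd rfl h, fun N hN => ?_⟩⟩
    · have : N = ∅ := by by_contra h'; exact h (if_neg h')
      exact ⟨(hcov N).2 this, by rw [this]; rfl⟩
    · rw [(hcov N).1 hN]; simp [coboundary]
  · obtain ⟨e₀, he₀, h⟩ := ih (S.erase x) (erase_ssubset hx)
    set Z := B.component x S with hZ
    have hext : ∀ e : Finset (Finset (Fin n)) → k, (∀ N, e N ≠ 0 → B.Cover (S.erase x) N) →
        ∀ N, extend κ Z e N ≠ 0 → B.Critical x S N := by
      intro e he N hN
      rw [critical_iff hx]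
      by_cases hZN : Z ∈ N
      · rw [extend, if_pos hZN] at hN
        exact ⟨hZN, he _ (right_ne_zero_of_mul hN)⟩
      · exact absurd (if_neg hZN) hN
    refine ⟨extend κ Z e₀, fun N hN => ?_, fun c hc hD => ?_⟩
    · have h1 := hext e₀ (fun N h => (he₀ N h).1) N hN
      refine ⟨h1.1, ?_⟩
      have hZN := ((critical_iff hx).1 h1).1
      rw [extend, if_pos hZN] at hN
      have := (he₀ _ (right_ne_zero_of_mul hN)).2
      rw [card_erase_of_mem hZN, card_erase_of_mem hx] at this
      have := card_pos.2 ⟨_, hZN⟩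
      have := card_pos.2 ⟨_, hx⟩
      omega
    · obtain ⟨c', b, h1, h2, h3, h4⟩ := exists_critical hκ hx hc hD
      have hZx : ∀ N, B.Cover (S.erase x) N → Z ∉ N := fun N hN hZN => by
        have : x ∈ S.erase x := by
          rw [← hN.2]
          exact (le_sup (f := id) hZN : Z ≤ _) (B.mem_component hx).2
        simp at this
      let e : Finset (Finset (Fin n)) → k := fun N =>
        if B.Cover (S.erase x) N then posSign κ k Z N * c' (insert Z N) else 0
      have hcrit : ∀ N, B.Cover (S.erase x) N → B.Critical x S (insert Z N) := fun N hN => by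
        rw [critical_iff hx, ← hZ, erase_insert (hZx N hN)]
        exact ⟨mem_insert_self _ _, hN⟩
      have hec : ∀ N, c' N = extend κ Z e N := by
        intro N
        by_cases hN : B.Critical x S N
        · obtain ⟨h5, h6⟩ := (critical_iff hx).1 hN
          rw [extend, if_pos h5]
          simp only [e]
          rw [if_pos h6, insert_erase h5, posSign_erase_self, ← mul_assoc, posSign_mul_self,
            one_mul]
        · have e1 : c' N = 0 := by by_contra e; exact hN (h1 N e)
          rw [e1]
          by_contra e2
          refine hN (hext e (fun N h => ?_) N (Ne.symm e2))
          by_contra h'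
          exact h (if_neg h')
      obtain ⟨r, b', h5, h6⟩ := h e (fun N h => by by_contra h'; exact h (if_neg h')) (fun N hN => by
        have h7 := h3 _ (hcrit N hN).1
        rw [coboundary_congr (c' := extend κ Z e) (fun M _ => hec _),
          coboundary_extend hκ e (mem_insert_self _ _), erase_insert (hZx N hN), neg_eq_zero] at h7
        have h8 := congrArg (posSign κ k Z (insert Z N) * ·) h7
        simpa only [← mul_assoc, posSign_mul_self, one_mul, mul_zero] using h8)
      refine ⟨r, fun N => b N + extend κ Z (fun N => -1 * b' N) N, fun N hN => ?_, fun N hN => ?_⟩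
      · by_contra h'
        refine hN ?_
        have e1 : b N = 0 := by by_contra e; exact h' (h2 N e)
        have e2 : extend κ Z (fun N => -1 * b' N) N = 0 := by
          by_contra e
          refine h' (hext _ (fun N h => h5 N fun h' => h ?_) N e).1
          rw [h', mul_zero]
        dsimp only
        rw [e1, e2, add_zero]
      · rw [coboundary_add, h4 N hN, hec N]
        by_cases hcr : B.Critical x S N
        · obtain ⟨h7, h8⟩ := (critical_iff hx).1 hcr
          rw [coboundary_extend hκ _ h7, coboundary_smul, extend, extend, if_pos h7, if_pos h7,
            h6 _ h8]
          ring
        · have hz : ∀ e : Finset (Finset (Fin n)) → k,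
              (∀ N, e N ≠ 0 → B.Cover (S.erase x) N) → extend κ Z e N = 0 := by
            intro e he
            by_contra h'
            exact hcr (hext e he N h')
          rw [← hec, show c' N = 0 by by_contra e; exact hcr (h1 N e),
            hz e₀ fun N h => (he₀ N h).1]
          have : coboundary κ (extend κ Z fun N => -1 * b' N) N = 0 := by
            refine Finset.sum_eq_zero fun M hM => ?_
            by_contra h'
            refine hcr (Critical.of_erase hN (hext _ (fun N h => h5 N fun h' => h ?_) _
              (right_ne_zero_of_mul h')))
            rw [h', mul_zero]
          rw [this]; ring

end
end BuildingSet

section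
variable {V : Type u₁} [Groupoid.{v₁} V] {C : Type u} [Category.{v} C]
    [MonoidalCategory C] [SymmetricCategory C] {𝔉 : FeynmanCategory V C} (δ : ProperDegree 𝔉)

section Refines
omit [MonoidalCategory C] [SymmetricCategory C]

/-- The factorization `(f, g)` of a morphism divides the factorization `(f', g')` from the left. -/
def Refines {X Y Z Z' : C} (f : X ⟶ Z) (g : Z ⟶ Y) (f' : X ⟶ Z') (g' : Z' ⟶ Y) : Prop :=
  ∃ h : Z ⟶ Z', f ≫ h = f' ∧ h ≫ g' = g

/-- Isomorphic factorizations. -/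
def IsoFactors {X Y Z Z' : C} (f : X ⟶ Z) (g : Z ⟶ Y) (f' : X ⟶ Z') (g' : Z' ⟶ Y) : Prop :=
  ∃ h : Z ≅ Z', f ≫ h.hom = f' ∧ h.hom ≫ g' = g

variable {X Y Z Z' Z'' : C} {f : X ⟶ Z} {g : Z ⟶ Y} {f' : X ⟶ Z'} {g' : Z' ⟶ Y}
  {f'' : X ⟶ Z''} {g'' : Z'' ⟶ Y}

theorem IsoFactors.refl (f : X ⟶ Z) (g : Z ⟶ Y) : IsoFactors f g f g := ⟨Iso.refl _, by simp⟩

theorem IsoFactors.symm (h : IsoFactors f g f' g') : IsoFactors f' g' f g := by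
  obtain ⟨z, rfl, rfl⟩ := h; exact ⟨z.symm, by simp⟩

theorem IsoFactors.trans (h : IsoFactors f g f' g') (h' : IsoFactors f' g' f'' g'') :
    IsoFactors f g f'' g'' := by
  obtain ⟨z, rfl, rfl⟩ := h; obtain ⟨z', rfl, rfl⟩ := h'; exact ⟨z ≪≫ z', by simp⟩

theorem IsoFactors.refines (h : IsoFactors f g f' g') : Refines f g f' g' := by
  obtain ⟨z, h⟩ := h; exact ⟨z.hom, h⟩

theorem Refines.trans (h : Refines f g f' g') (h' : Refines f' g' f'' g'') :
    Refines f g f'' g'' := by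
  obtain ⟨z, rfl, rfl⟩ := h; obtain ⟨z', rfl, rfl⟩ := h'; exact ⟨z ≫ z', by simp⟩

theorem IsoFactors.comp_right {W : C} (h : IsoFactors f g f' g') (k : Y ⟶ W) :
    IsoFactors f (g ≫ k) f' (g' ≫ k) := by
  obtain ⟨z, rfl, rfl⟩ := h; exact ⟨z, by simp⟩

theorem Refines.comp_right {W : C} (h : Refines f g f' g') (k : Y ⟶ W) :
    Refines f (g ≫ k) f' (g' ≫ k) := by
  obtain ⟨z, rfl, rfl⟩ := h; exact ⟨z, by simp⟩

end Refines

section Paths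

/-- A factorization of a morphism `X ⟶ Y`. -/
structure Factor (X Y : C) where
  mid : C
  left : X ⟶ mid
  right : mid ⟶ Y

/-- The factorization obtained by cutting a path after the longest initial segment with at most `p`
arrows of nonzero degree. -/
def pathCut (p : ℕ) : ∀ {X Y : C}, Quiver.Path X Y → Factor X Y
  | X, _, .nil => ⟨X, 𝟙 _, 𝟙 _⟩
  | _, Y, .cons P f => if posCount δ (P.cons f) ≤ p then ⟨Y, composePath (P.cons f), 𝟙 _⟩ else
      ⟨(pathCut p P).mid, (pathCut p P).left, (pathCut p P).right ≫ f⟩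

/-- Isomorphism of factorizations. -/
def Factor.Equiv {X Y : C} (A B : Factor X Y) : Prop := IsoFactors A.left A.right B.left B.right

variable {δ}

theorem pathCut_nil (p : ℕ) (X : C) :
    pathCut δ p (Quiver.Path.nil : Quiver.Path X X) = ⟨X, 𝟙 _, 𝟙 _⟩ := by
  simp only [pathCut]

theorem pathCut_cons_of_le {p : ℕ} {X Y Z : C} {P : Quiver.Path X Y} {f : Y ⟶ Z}
    (h : posCount δ (P.cons f) ≤ p) : pathCut δ p (P.cons f) = ⟨Z, composePath (P.cons f),
        𝟙 _⟩ := by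
  rw [pathCut, if_pos h]

theorem pathCut_cons_of_not_le {p : ℕ} {X Y Z : C} {P : Quiver.Path X Y} {f : Y ⟶ Z}
    (h : ¬ posCount δ (P.cons f) ≤ p) : pathCut δ p (P.cons f) =
      ⟨(pathCut δ p P).mid, (pathCut δ p P).left, (pathCut δ p P).right ≫ f⟩ := by
  rw [pathCut, if_neg h]

theorem pathCut_comp_eq (p : ℕ) {X Y : C} (P : Quiver.Path X Y) :
    (pathCut δ p P).left ≫ (pathCut δ p P).right = composePath P := by
  induction P with
  | nil => rw [pathCut_nil]; simp
  | cons P f ih =>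
    by_cases h : posCount δ (P.cons f) ≤ p
    · rw [pathCut_cons_of_le h]; simp
    · rw [pathCut_cons_of_not_le h, composePath_cons, ← ih, Category.assoc]

theorem pathCut_of_le {p : ℕ} {X Y : C} (P : Quiver.Path X Y) (h : posCount δ P ≤ p) :
    pathCut δ p P = ⟨Y, composePath P, 𝟙 _⟩ := by
  cases P with
  | nil => exact pathCut_nil p _
  | cons P f => exact pathCut_cons_of_le h

theorem pathCut_comp_congr {p : ℕ} {X Y Z : C} {P P' : Quiver.Path X Y}
    (h : (pathCut δ p P).Equiv (pathCut δ p P')) (hc : composePath P = composePath P')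
    (hn : posCount δ P = posCount δ P') (q : Quiver.Path Y Z) :
    (pathCut δ p (P.comp q)).Equiv (pathCut δ p (P'.comp q)) := by
  induction q with
  | nil => exact h
  | cons q f ih =>
    rw [Quiver.Path.comp_cons, Quiver.Path.comp_cons]
    have : posCount δ ((P.comp q).cons f) = posCount δ ((P'.comp q).cons f) := by
      simp only [posCount, posCount_comp, hn]
    by_cases h1 : posCount δ ((P.comp q).cons f) ≤ p
    · rw [pathCut_cons_of_le h1, pathCut_cons_of_le (this ▸ h1)]
      simp only [composePath_cons, composePath_comp, hc]; exact IsoFactors.refl _ _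
    · rw [pathCut_cons_of_not_le h1, pathCut_cons_of_not_le (this ▸ h1)]
      exact IsoFactors.comp_right ih f

theorem PathStep.posCount_eq {X Y : C} {P P' : Quiver.Path X Y} (h : PathStep δ P P') :
    posCount δ P = posCount δ P' := by
  cases h with
  | comp p f g q h =>
    simp only [posCount_comp, posCount, δ.deg_comp]
    rcases h with h | h <;> simp [h]
  | id p q =>
    simp only [posCount_comp, posCount, (δ.deg_eq_zero_iff (𝟙 _)).2 inferInstance, if_pos]
    simp

theorem PathStep.pathCut {X Y : C} {P P' : Quiver.Path X Y} (h : PathStep δ P P') (p : ℕ) :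
    (pathCut δ p P).Equiv (pathCut δ p P') := by
  cases h with
  | comp P f g q h =>
    have hn := (PathStep.comp P f g .nil h).posCount_eq
    simp only [Quiver.Path.comp_nil] at hn
    refine pathCut_comp_congr ?_ (by simp) hn q
    by_cases h1 : posCount δ (P.cons (f ≫ g)) ≤ p
    · rw [pathCut_cons_of_le h1, pathCut_cons_of_le (hn ▸ h1)]
      simp only [composePath_cons, Category.assoc]; exact IsoFactors.refl _ _
    · rw [pathCut_cons_of_not_le h1, pathCut_cons_of_not_le (hn ▸ h1)]
      by_cases h2 : posCount δ (P.cons f) ≤ p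
      · have hf : δ.deg f = 0 := by
          refine h.resolve_right fun hg => h1 ?_
          rw [← hn, posCount, if_pos hg, add_zero]; exact h2
        have : IsIso f := (δ.deg_eq_zero_iff f).1 hf
        have h3 := h2
        rw [posCount, if_pos hf, add_zero] at h3
        rw [pathCut_of_le P h3, pathCut_cons_of_le h2]
        exact ⟨(asIso f).symm, by simp⟩
      · rw [pathCut_cons_of_not_le h2]
        dsimp only [Factor.Equiv]; rw [Category.assoc]; exact IsoFactors.refl _ _
  | id P q =>
    have hn := (PathStep.id (δ := δ) P .nil).posCount_eq
    simp only [Quiver.Path.comp_nil] at hn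
    refine pathCut_comp_congr ?_ (by simp) hn q
    by_cases h1 : posCount δ P ≤ p
    · rw [pathCut_of_le P h1, pathCut_cons_of_le (hn ▸ h1)]
      simp only [composePath_cons, Category.comp_id]
      exact IsoFactors.refl _ _
    · rw [pathCut_cons_of_not_le (hn ▸ h1)]
      dsimp only [Factor.Equiv]; rw [Category.comp_id]; exact IsoFactors.refl _ _

theorem elementary_nil (X : C) : Elementary δ.deg (Quiver.Path.nil : Quiver.Path X X) := by
  rw [Elementary]; trivial

theorem Elementary.cons {X Y Z : C} {P : Quiver.Path X Y} (h : Elementary δ.deg P) {f : Y ⟶ Z}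
    (hf : δ.deg f ≤ 1) : Elementary δ.deg (P.cons f) := by
  rw [Elementary]; exact ⟨h, hf⟩

theorem deg_composePath {X Y : C} {P : Quiver.Path X Y} (h : Elementary δ.deg P) :
    δ.deg (composePath P) = posCount δ P := by
  induction P with
  | nil => simp only [composePath_nil, posCount]; exact (δ.deg_eq_zero_iff _).2 inferInstance
  | cons P f ih =>
    rw [Elementary] at h
    rw [composePath_cons, δ.deg_comp, ih h.1, posCount]
    have := h.2
    split_ifs <;> omega

theorem isIso_composePath {X Y : C} {P : Quiver.Path X Y} (h : posCount δ P = 0) :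
    IsIso (composePath P) := by
  induction P with
  | nil => rw [composePath_nil]; infer_instance
  | cons P f ih =>
    rw [posCount] at h
    have h1 := ih (by omega)
    have h2 : δ.deg f = 0 := by by_contra h'; rw [if_neg h'] at h; omega
    have : IsIso f := (δ.deg_eq_zero_iff f).1 h2
    rw [composePath_cons]; infer_instance

theorem pathCut_comp {p : ℕ} {X Y Z : C} {P : Quiver.Path X Y} (h : p ≤ posCount δ P)
    (q : Quiver.Path Y Z) : IsoFactors (pathCut δ p (P.comp q)).left (pathCut δ p (P.comp q)).right
      (pathCut δ p P).left ((pathCut δ p P).right ≫ composePath q) := by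
  induction q with
  | nil => simp only [Quiver.Path.comp_nil, composePath_nil, Category.comp_id]; exact .refl _ _
  | cons q f ih =>
    rw [Quiver.Path.comp_cons]
    by_cases h1 : posCount δ ((P.comp q).cons f) ≤ p
    · rw [pathCut_cons_of_le h1]
      have h2 := posCount_comp (δ := δ) P (q.cons f)
      rw [Quiver.Path.comp_cons] at h2
      have : IsIso (composePath (q.cons f)) := isIso_composePath (δ := δ) (by omega)
      rw [pathCut_of_le P (by omega), ← Quiver.Path.comp_cons, composePath_comp]
      exact ⟨(asIso (composePath (q.cons f))).symm, by simp⟩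
    · rw [pathCut_cons_of_not_le h1]
      have := ih.comp_right f
      rwa [Category.assoc, ← composePath_cons] at this

theorem pathCut_refines {p p' : ℕ} (h : p ≤ p') {X Y : C} (P : Quiver.Path X Y) :
    Refines (pathCut δ p P).left (pathCut δ p P).right
      (pathCut δ p' P).left (pathCut δ p' P).right := by
  induction P with
  | nil => rw [pathCut_nil, pathCut_nil]; exact ⟨𝟙 _, by simp, by simp⟩
  | cons P f ih =>
    by_cases h1 : posCount δ (P.cons f) ≤ p
    · rw [pathCut_cons_of_le h1, pathCut_cons_of_le (h1.trans h)]
      exact (IsoFactors.refl _ _).refines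
    rw [pathCut_cons_of_not_le h1]
    by_cases h2 : posCount δ (P.cons f) ≤ p'
    · rw [pathCut_cons_of_le h2]
      refine ⟨(pathCut δ p P).right ≫ f, ?_, by simp⟩
      dsimp only
      rw [composePath_cons, ← pathCut_comp_eq (δ := δ) p P, Category.assoc]
    · rw [pathCut_cons_of_not_le h2]
      exact ih.comp_right f

theorem exists_split (p q : ℕ) {X Y : C} (P : Quiver.Path X Y) (hP : Elementary δ.deg P)
    (h : posCount δ P = p + q) : ∃ (Z : C) (P₁ : Quiver.Path X Z) (P₂ : Quiver.Path Z Y),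
      P = P₁.comp P₂ ∧ Elementary δ.deg P₁ ∧ Elementary δ.deg P₂ ∧ posCount δ P₁ = p ∧
        posCount δ P₂ = q := by
  induction P generalizing q with
  | nil =>
    simp only [posCount] at h
    exact ⟨X, .nil, .nil, rfl, elementary_nil _, elementary_nil _, by simp only [posCount]; omega,
      by simp only [posCount]; omega⟩
  | cons P f ih =>
    rcases q with _ | q
    · exact ⟨_, P.cons f, .nil, rfl, hP, elementary_nil _, h, by rw [posCount]⟩
    rw [Elementary] at hP
    rw [posCount] at h
    by_cases hf : δ.deg f = 0
    · rw [if_pos hf] at h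
      obtain ⟨Z, P₁, P₂, rfl, h1, h2, h3, h4⟩ := ih (q + 1) hP.1 h
      exact ⟨Z, P₁, P₂.cons f, rfl, h1, h2.cons hP.2, h3, by rw [posCount, if_pos hf, h4]⟩
    · rw [if_neg hf] at h
      obtain ⟨Z, P₁, P₂, rfl, h1, h2, h3, h4⟩ := ih q hP.1 (by omega)
      exact ⟨Z, P₁, P₂.cons f, rfl, h1, h2.cons hP.2, h3, by rw [posCount, if_neg hf, h4]⟩

end Paths

section ChainPlus
variable {δ}

/-- The factorization `(f, g)` arises by cutting the class of chains `c` after `p` arrows of nonzero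
degree. -/
def ChainPlus.IsCut {n : ℕ} {X Y Z : C} (p : ℕ) (c : ChainPlus δ n X Y) (f : X ⟶ Z) (g : Z ⟶ Y) :
    Prop :=
  ∃ P : ChainWord δ n X Y, Quot.mk _ P = c ∧
    IsoFactors (pathCut δ p P.path).left (pathCut δ p P.path).right f g

theorem pathCut_equiv_of_mk_eq {n : ℕ} {X Y : C} (p : ℕ) {P P' : ChainWord δ n X Y}
    (h : (Quot.mk _ P : ChainPlus δ n X Y) = Quot.mk _ P') :
    (pathCut δ p P.path).Equiv (pathCut δ p P'.path) := by
  have := Quot.eqvGen_exact h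
  clear h
  induction this with
  | rel P P' h => exact PathStep.pathCut h p
  | refl P => exact IsoFactors.refl _ _
  | symm P P' h ih => exact IsoFactors.symm ih
  | trans P P' P'' h h' ih ih' =>
    exact IsoFactors.trans ih ih'

namespace ChainPlus
variable {n p q : ℕ} {X Y Z Z' : C}

theorem IsCut.isoFactors {c : ChainPlus δ n X Y} {f : X ⟶ Z} {g : Z ⟶ Y} {f' : X ⟶ Z'} {g' : Z' ⟶ Y}
    (h : c.IsCut p f g) (h' : c.IsCut p f' g') : IsoFactors f g f' g' := by
  obtain ⟨P, h1, h2⟩ := h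
  obtain ⟨P', h1', h2'⟩ := h'
  exact h2.symm.trans ((pathCut_equiv_of_mk_eq p (h1.trans h1'.symm)).trans h2')

theorem isCut_concat (c : ChainPlus δ p X Z) (c' : ChainPlus δ q Z Y) :
    (c.concat c').IsCut p c.compose c'.compose := by
  induction c using Quot.inductionOn with | h P => ?_
  induction c' using Quot.inductionOn with | h Q => ?_
  refine ⟨P.concat Q, rfl, (pathCut_comp P.posCount_eq.ge Q.path).trans ?_⟩
  rw [pathCut_of_le P.path P.posCount_eq.le, Category.id_comp]
  exact IsoFactors.refl _ _

theorem isCut_concat_left {r : ℕ} (hr : r ≤ p) (c : ChainPlus δ p X Z) (c' : ChainPlus δ q Z Y)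
    {f : X ⟶ Z'} {g : Z' ⟶ Z} (h : c.IsCut r f g) :
    (c.concat c').IsCut r f (g ≫ c'.compose) := by
  obtain ⟨P, rfl, h⟩ := h
  induction c' using Quot.inductionOn with | h Q => ?_
  exact ⟨P.concat Q, rfl, (pathCut_comp (hr.trans P.posCount_eq.ge) Q.path).trans (h.comp_right _)⟩

theorem exists_isCut (c : ChainPlus δ n X Y) (p : ℕ) :
    ∃ (Z : C) (f : X ⟶ Z) (g : Z ⟶ Y), c.IsCut p f g ∧ f ≫ g = c.compose := by
  induction c using Quot.inductionOn with | h P => ?_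
  exact ⟨_, _, _, ⟨P, rfl, IsoFactors.refl _ _⟩, pathCut_comp_eq p P.path⟩

theorem IsCut.refines {c : ChainPlus δ n X Y} {f : X ⟶ Z} {g : Z ⟶ Y} {f' : X ⟶ Z'} {g' : Z' ⟶ Y}
    {p' : ℕ} (h : c.IsCut p f g) (h' : c.IsCut p' f' g') (hp : p ≤ p') : Refines f g f' g' := by
  obtain ⟨P, rfl, h2⟩ := h
  obtain ⟨P', h1', h2'⟩ := h'
  exact h2.symm.refines.trans ((pathCut_refines hp P.path).trans
    ((pathCut_equiv_of_mk_eq p' h1'.symm).trans h2').refines)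

theorem exists_concat (c : ChainPlus δ (p + q) X Y) : ∃ (Z : C) (c₁ : ChainPlus δ p X Z)
    (c₂ : ChainPlus δ q Z Y), c₁.concat c₂ = c := by
  induction c using Quot.inductionOn with | h P => ?_
  obtain ⟨Z, P₁, P₂, h, h1, h2, h3, h4⟩ := exists_split p q P.path P.elementary P.posCount_eq
  refine ⟨Z, Quot.mk _ ⟨P₁, h1, h3⟩, Quot.mk _ ⟨P₂, h2, h4⟩, ?_⟩
  obtain ⟨P, h5, h6⟩ := P
  dsimp only at h; subst h; rfl

theorem IsCut.exists_concat {c : ChainPlus δ (p + q) X Y} {f : X ⟶ Z} {g : Z ⟶ Y}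
    (h : c.IsCut p f g) : ∃ (c₁ : ChainPlus δ p X Z) (c₂ : ChainPlus δ q Z Y),
      c₁.concat c₂ = c ∧ c₁.compose = f ∧ c₂.compose = g := by
  obtain ⟨W, c₁, c₂, rfl⟩ := c.exists_concat
  obtain ⟨z, hf, hg⟩ := (isCut_concat c₁ c₂).isoFactors h
  induction c₁ using Quot.inductionOn with | h P => ?_
  induction c₂ using Quot.inductionOn with | h Q => ?_
  have hz : δ.deg z.hom = 0 := (δ.deg_eq_zero_iff _).2 inferInstance
  have hz' : δ.deg z.inv = 0 := (δ.deg_eq_zero_iff _).2 inferInstance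
  have h1 : δ.deg (𝟙 W) = 0 := (δ.deg_eq_zero_iff _).2 inferInstance
  let P' : ChainWord δ p X Z := ⟨P.path.cons z.hom, (P.elementary.cons (by omega)), by
    rw [posCount, if_pos hz, P.posCount_eq, add_zero]⟩
  have hE : Elementary δ.deg (Quiver.Path.nil.cons z.inv) := (elementary_nil _).cons (by omega)
  have hp : posCount δ (Quiver.Path.nil.cons z.inv) = 0 := by
    rw [posCount, if_pos hz', posCount]
  let Q' : ChainWord δ q Z Y := ⟨(Quiver.Path.nil.cons z.inv).comp Q.path,
    elementary_comp hE Q.elementary, by rw [posCount_comp, hp, Q.posCount_eq, zero_add]⟩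
  let R : ChainWord δ (p + q) X Y := ⟨(P.path.cons (𝟙 W)).comp Q.path,
    elementary_comp (P.elementary.cons (by omega)) Q.elementary, by
      rw [posCount_comp, posCount, if_pos h1, P.posCount_eq, Q.posCount_eq, add_zero]⟩
  refine ⟨Quot.mk _ P', Quot.mk _ Q', ?_, ?_, ?_⟩
  · have e1 : PathStep δ (P'.concat Q').path R.path := by
      have := PathStep.comp (δ := δ) P.path z.hom z.inv Q.path (.inl hz)
      rw [z.hom_inv_id] at this
      change PathStep δ ((P.path.cons z.hom).comp ((Quiver.Path.nil.cons z.inv).comp Q.path)) _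
      rwa [← Quiver.Path.comp_assoc]
    have e2 : PathStep δ R.path (P.concat Q).path := PathStep.id P.path Q.path
    exact (Quot.sound (a := P'.concat Q') (b := R) e1).trans (Quot.sound (b := P.concat Q) e2)
  · change composePath (P.path.cons z.hom) = f
    rw [composePath_cons]; exact hf
  · change composePath ((Quiver.Path.nil.cons z.inv).comp Q.path) = g
    rw [composePath_comp, composePath_cons, composePath_nil, Category.id_comp, Iso.inv_comp_eq]
    exact hg.symm

end ChainPlus

/-- The permutation of `Fin (p + q)` given by permutations of the two parts. -/
abbrev blockPerm {p q : ℕ} (σ : Equiv.Perm (Fin p)) (τ : Equiv.Perm (Fin q)) :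
    Equiv.Perm (Fin (p + q)) := finSumFinEquiv.permCongr (Equiv.Perm.sumCongr σ τ)

theorem blockPerm_lt {p q : ℕ} (σ : Equiv.Perm (Fin p)) (τ : Equiv.Perm (Fin q))
    (x : Fin (p + q)) : (blockPerm σ τ x : ℕ) < p ↔ (x : ℕ) < p := by
  refine Fin.addCases (fun i => ?_) (fun i => ?_) x
  · simp [blockPerm, Equiv.permCongr_apply]
  · simp [blockPerm, Equiv.permCongr_apply]

theorem exists_blockPerm {p q : ℕ} (ρ : Equiv.Perm (Fin (p + q)))
    (h : ∀ x, (ρ x : ℕ) < p ↔ (x : ℕ) < p) : ∃ σ τ, blockPerm σ τ = ρ := by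
  have : finSumFinEquiv.symm.permCongr ρ ∈ (Equiv.Perm.sumCongrHom (Fin p) (Fin q)).range := by
    apply Equiv.Perm.mem_sumCongrHom_range_of_perm_mapsTo_inl
    rintro _ ⟨i, rfl⟩
    have h1 := (h (Fin.castAdd q i)).2 (by simp)
    refine ⟨⟨_, h1⟩, ?_⟩
    rw [Equiv.permCongr_apply, Equiv.symm_symm, finSumFinEquiv_apply_left, eq_comm,
      Equiv.symm_apply_eq, finSumFinEquiv_apply_left]
    rfl
  obtain ⟨⟨σ, τ⟩, h'⟩ := this
  refine ⟨σ, τ, ?_⟩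
  rw [blockPerm]
  change Equiv.Perm.sumCongr σ τ = _ at h'
  rw [h']
  ext x; simp [Equiv.permCongr_apply]

theorem exists_perm_lt {n p p' : ℕ} {S S' : Finset (Fin n)} (h : S ⊆ S') (hS : S.card = p)
    (hS' : S'.card = p') :
    ∃ σ : Equiv.Perm (Fin n), (∀ x, (σ x : ℕ) < p ↔ x ∈ S) ∧ ∀ x, (σ x : ℕ) < p' ↔ x ∈ S' := by
  classical
  have hp : p ≤ p' := hS ▸ hS' ▸ Finset.card_le_card h
  have hn : p' ≤ n := by simpa [hS'] using Finset.card_le_univ S'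
  let c₁ : Fin n → Bool × Bool := fun x => (decide (x ∈ S), decide (x ∈ S'))
  let c₂ : Fin n → Bool × Bool := fun x => (decide ((x : ℕ) < p), decide ((x : ℕ) < p'))
  have hT : ∀ m ≤ n, (Finset.univ.filter fun x : Fin n => (x : ℕ) < m).card = m := fun m hm => by
    rw [Fin.card_filter_val_lt, min_eq_right hm]
  set T := Finset.univ.filter fun x : Fin n => (x : ℕ) < p with hTdef
  set T' := Finset.univ.filter fun x : Fin n => (x : ℕ) < p' with hTdef'
  have hTT : T ⊆ T' := fun x hx => by
    rw [hTdef, Finset.mem_filter] at hx; rw [hTdef', Finset.mem_filter]; exact ⟨hx.1, by omega⟩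
  have hc : ∀ b, Nonempty ({x // c₁ x = b} ≃ {x // c₂ x = b}) := by
    have aux : ∀ b (A A' : Finset (Fin n)), (∀ x, c₁ x = b ↔ x ∈ A) → (∀ x, c₂ x = b ↔ x ∈ A') →
        A.card = A'.card → Nonempty ({x // c₁ x = b} ≃ {x // c₂ x = b}) := by
      intro b A A' h1 h2 h3
      exact ⟨(Equiv.subtypeEquivRight h1).trans ((Finset.equivOfCardEq h3).trans
        (Equiv.subtypeEquivRight h2).symm)⟩
    rintro ⟨_ | _, _ | _⟩
    · refine aux _ (S'ᶜ) (T'ᶜ) (fun x => ?_) (fun x => ?_) ?_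
      · simp only [c₁, Prod.mk.injEq, decide_eq_false_iff_not, Finset.mem_compl]
        exact ⟨fun h => h.2, fun h' => ⟨fun h'' => h' (h h''), h'⟩⟩
      · simp only [c₂, Prod.mk.injEq, decide_eq_false_iff_not, Finset.mem_compl, hTdef',
          Finset.mem_filter, Finset.mem_univ, true_and]
        omega
      · rw [Finset.card_compl, Finset.card_compl, hS', hT p' hn]
    · refine aux _ (S' \ S) (T' \ T) (fun x => ?_) (fun x => ?_) ?_
      · simp only [c₁, Prod.mk.injEq, decide_eq_false_iff_not, decide_eq_true_eq, Finset.mem_sdiff]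
        tauto
      · simp only [c₂, Prod.mk.injEq, decide_eq_false_iff_not, decide_eq_true_eq, Finset.mem_sdiff,
          hTdef', hTdef, Finset.mem_filter, Finset.mem_univ, true_and]
        tauto
      · rw [Finset.card_sdiff_of_subset h, Finset.card_sdiff_of_subset hTT, hS', hS, hT p' hn,
          hT p (hp.trans hn)]
    · refine aux _ ∅ ∅ (fun x => ?_) (fun x => ?_) rfl
      · simp only [c₁, Prod.mk.injEq, decide_eq_false_iff_not, decide_eq_true_eq,
          Finset.notMem_empty, iff_false, not_and, not_not]
        exact fun h' => h h'
      · simp only [c₂, Prod.mk.injEq, decide_eq_false_iff_not, decide_eq_true_eq,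
          Finset.notMem_empty, iff_false, not_and, not_not]
        omega
    · refine aux _ S T (fun x => ?_) (fun x => ?_) ?_
      · simp only [c₁, Prod.mk.injEq, decide_eq_true_eq]
        exact ⟨fun h => h.1, fun h' => ⟨h', h h'⟩⟩
      · simp only [c₂, Prod.mk.injEq, decide_eq_true_eq, hTdef,
          Finset.mem_filter, Finset.mem_univ, true_and]
        omega
      · rw [hS, hT p (hp.trans hn)]
  let σ : Equiv.Perm (Fin n) := Equiv.ofFiberEquiv fun b => (hc b).some
  have hσ : ∀ x, c₂ (σ x) = c₁ x := fun x => Equiv.ofFiberEquiv_map _ x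
  refine ⟨σ, fun x => ?_, fun x => ?_⟩
  · have := congrArg Prod.fst (hσ x); simpa [c₁, c₂] using this
  · have := congrArg Prod.snd (hσ x); simpa [c₁, c₂] using this

end ChainPlus

section Chart
variable {δ}

/-- A presentation of the poset of factorizations of a morphism as a poset of finite sets. -/
structure Chart (δ : ProperDegree 𝔉) {X Y : C} (ψ : X ⟶ Y) (n : ℕ) where
  toFun {Z : C} (f : X ⟶ Z) (g : Z ⟶ Y) : Finset (Fin n)
  card_eq {Z : C} {f : X ⟶ Z} {g : Z ⟶ Y} (h : f ≫ g = ψ) : (toFun f g).card = δ.deg f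
  subset_iff {Z Z' : C} {f : X ⟶ Z} {g : Z ⟶ Y} {f' : X ⟶ Z'} {g' : Z' ⟶ Y} (h : f ≫ g = ψ)
    (h' : f' ≫ g' = ψ) : toFun f g ⊆ toFun f' g' ↔ Refines f g f' g'
  exists_eq {S : Finset (Fin n)} (h : S ⊆ toFun ψ (𝟙 Y)) :
    ∃ (Z : C) (f : X ⟶ Z) (g : Z ⟶ Y), f ≫ g = ψ ∧ toFun f g = S

theorem ChainPlus.deg_compose {n : ℕ} {X Y : C} (c : ChainPlus δ n X Y) : δ.deg c.compose = n := by
  induction c using Quot.inductionOn with | h P => ?_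
  exact (deg_composePath P.elementary).trans P.posCount_eq

theorem ChainPlus.compose_concat {p q : ℕ} {X Y Z : C} (c : ChainPlus δ p X Z)
    (c' : ChainPlus δ q Z Y) : (c.concat c').compose = c.compose ≫ c'.compose := by
  induction c using Quot.inductionOn with | h P => ?_
  induction c' using Quot.inductionOn with | h Q => ?_
  exact composePath_comp P.path Q.path

theorem ChainPlus.IsCut.deg_left {p n : ℕ} {X Y Z : C} {c : ChainPlus δ n X Y} {f : X ⟶ Z}
    {g : Z ⟶ Y} (h : c.IsCut p f g) (hp : p ≤ n) : δ.deg f = p := by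
  obtain ⟨q, rfl⟩ := Nat.exists_eq_add_of_le hp
  obtain ⟨c₁, c₂, -, h1, -⟩ := h.exists_concat
  rw [← h1, c₁.deg_compose]

theorem isIso_of_deg_eq {X Y Z : C} {f : X ⟶ Y} {h : Y ⟶ Z} (e : δ.deg (f ≫ h) = δ.deg f) :
    IsIso h := by
  rw [δ.deg_comp] at e
  exact (δ.deg_eq_zero_iff h).1 (by omega)

theorem Refines.isoFactors {X Y Z Z' : C} {f : X ⟶ Z} {g : Z ⟶ Y} {f' : X ⟶ Z'} {g' : Z' ⟶ Y}
    (h : Refines f g f' g') (e : δ.deg f' = δ.deg f) : IsoFactors f g f' g' := by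
  obtain ⟨z, rfl, rfl⟩ := h
  have := isIso_of_deg_eq (δ := δ) e
  exact ⟨asIso z, rfl, rfl⟩

theorem IsoFactors.deg_eq {X Y Z Z' : C} {f : X ⟶ Z} {g : Z ⟶ Y} {f' : X ⟶ Z'} {g' : Z' ⟶ Y}
    (h : IsoFactors f g f' g') : δ.deg f' = δ.deg f := by
  obtain ⟨z, rfl, rfl⟩ := h
  rw [δ.deg_comp, (δ.deg_eq_zero_iff z.hom).2 inferInstance, add_zero]

theorem Chart.eq_iff {X Y : C} {ψ : X ⟶ Y} {n : ℕ} (χ : Chart δ ψ n) {Z Z' : C} {f : X ⟶ Z}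
    {g : Z ⟶ Y} {f' : X ⟶ Z'} {g' : Z' ⟶ Y} (h : f ≫ g = ψ) (h' : f' ≫ g' = ψ) :
    χ.toFun f g = χ.toFun f' g' ↔ IsoFactors f g f' g' := by
  constructor
  · intro e
    refine ((χ.subset_iff h h').1 e.subset).isoFactors (δ := δ) ?_
    rw [← χ.card_eq h, ← χ.card_eq h', e]
  · intro e
    exact ((χ.subset_iff h h').2 e.refines).antisymm ((χ.subset_iff h' h).2 e.symm.refines)

theorem Chart.subset_ground {X Y : C} {ψ : X ⟶ Y} {n : ℕ} (χ : Chart δ ψ n) {Z : C} {f : X ⟶ Z}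
    {g : Z ⟶ Y} (h : f ≫ g = ψ) : χ.toFun f g ⊆ χ.toFun ψ (𝟙 Y) :=
  (χ.subset_iff h (Category.comp_id _)).2 ⟨g, h, Category.comp_id g⟩

theorem Chart.ground_eq_univ {X Y : C} {ψ : X ⟶ Y} {n : ℕ} (χ : Chart δ ψ n) (h : δ.deg ψ = n) :
    χ.toFun ψ (𝟙 Y) = Finset.univ := by
  apply Finset.eq_univ_of_card
  rw [χ.card_eq (Category.comp_id _), h, Fintype.card_fin]

namespace CubicalStructure
variable (𝔠 : CubicalStructure δ) {n : ℕ} {X Y Z Z' : C}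
include 𝔠

theorem act_injective {σ σ' : Equiv.Perm (Fin n)} {c : ChainPlus δ n X Y}
    (h : 𝔠.act σ c = 𝔠.act σ' c) : σ = σ' := by
  have := 𝔠.free (σ'⁻¹ * σ) c (by rw [𝔠.mul_act, h, ← 𝔠.mul_act, inv_mul_cancel, 𝔠.one_act])
  exact (inv_mul_eq_one.1 this).symm

theorem compose_act (σ : Equiv.Perm (Fin n)) (c : ChainPlus δ n X Y) :
    (𝔠.act σ c).compose = c.compose :=
  ((𝔠.compose_eq_iff c _).2 ⟨σ, rfl⟩).symm

theorem exists_act_isCut {c : ChainPlus δ n X Y} {f : X ⟶ Z} {g : Z ⟶ Y} (h : f ≫ g = c.compose) :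
    ∃ σ, (𝔠.act σ c).IsCut (δ.deg f) f g := by
  have hn : n = δ.deg f + δ.deg g := by rw [← c.deg_compose, ← h, δ.deg_comp]
  subst hn
  obtain ⟨c₁, h₁⟩ := 𝔠.exists_compose f rfl
  obtain ⟨c₂, h₂⟩ := 𝔠.exists_compose g rfl
  have h3 : (c₁.concat c₂).compose = f ≫ g := by rw [c₁.compose_concat, h₁, h₂]
  obtain ⟨σ, hσ⟩ := (𝔠.compose_eq_iff c (c₁.concat c₂)).1 (by rw [h3, h])
  refine ⟨σ, ?_⟩
  rw [hσ]
  have := ChainPlus.isCut_concat c₁ c₂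
  rwa [h₁, h₂] at this

theorem lt_iff_of_isCut {p : ℕ} {c : ChainPlus δ n X Y} {f : X ⟶ Z} {g : Z ⟶ Y} (hp : p ≤ n)
    {σ σ' : Equiv.Perm (Fin n)} (h : (𝔠.act σ c).IsCut p f g) (h' : (𝔠.act σ' c).IsCut p f g)
    (x : Fin n) : (σ x : ℕ) < p ↔ (σ' x : ℕ) < p := by
  obtain ⟨q, rfl⟩ := Nat.exists_eq_add_of_le hp
  obtain ⟨c₁, c₂, e, h1, h2⟩ := h.exists_concat
  obtain ⟨c₁', c₂', e', h1', h2'⟩ := h'.exists_concat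
  obtain ⟨α, rfl⟩ := (𝔠.compose_eq_iff c₁ c₁').1 (h1.trans h1'.symm)
  obtain ⟨β, rfl⟩ := (𝔠.compose_eq_iff c₂ c₂').1 (h2.trans h2'.symm)
  rw [𝔠.act_concat, e, ← 𝔠.mul_act] at e'
  rw [← 𝔠.act_injective e']
  exact (blockPerm_lt α β (σ x)).symm

theorem isCut_of_lt_iff {p : ℕ} {c : ChainPlus δ n X Y} {f : X ⟶ Z} {g : Z ⟶ Y} (hp : p ≤ n)
    {σ σ' : Equiv.Perm (Fin n)} (h : (𝔠.act σ c).IsCut p f g)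
    (hσ : ∀ x, (σ' x : ℕ) < p ↔ (σ x : ℕ) < p) : (𝔠.act σ' c).IsCut p f g := by
  obtain ⟨q, rfl⟩ := Nat.exists_eq_add_of_le hp
  obtain ⟨c₁, c₂, e, rfl, rfl⟩ := h.exists_concat
  obtain ⟨α, β, hαβ⟩ := exists_blockPerm (σ' * σ⁻¹) fun x => by
    simpa using hσ (σ⁻¹ x)
  have h1 : 𝔠.act σ' c = (𝔠.act α c₁).concat (𝔠.act β c₂) := by
    have h2 : σ' = blockPerm α β * σ := by rw [hαβ]; simp
    rw [h2, 𝔠.mul_act, ← e, 𝔠.act_concat]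
  rw [h1, ← 𝔠.compose_act α c₁, ← 𝔠.compose_act β c₂]
  exact ChainPlus.isCut_concat _ _

open Classical in
/-- The set of the arrows of a chain that lie above a factorization of its composite. -/
noncomputable def cutSet (c : ChainPlus δ n X Y) (f : X ⟶ Z) (g : Z ⟶ Y) : Finset (Fin n) :=
  if h : ∃ σ, (𝔠.act σ c).IsCut (δ.deg f) f g then
    Finset.univ.filter fun x => (h.choose x : ℕ) < δ.deg f
  else ∅

theorem mem_cutSet {c : ChainPlus δ n X Y} {f : X ⟶ Z} {g : Z ⟶ Y} (h : f ≫ g = c.compose)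
    {σ : Equiv.Perm (Fin n)} (hσ : (𝔠.act σ c).IsCut (δ.deg f) f g) (x : Fin n) :
    x ∈ 𝔠.cutSet c f g ↔ (σ x : ℕ) < δ.deg f := by
  have hn : δ.deg f ≤ n := by rw [← c.deg_compose, ← h, δ.deg_comp]; omega
  have h' : ∃ σ, (𝔠.act σ c).IsCut (δ.deg f) f g := ⟨σ, hσ⟩
  rw [cutSet, dif_pos h', Finset.mem_filter]
  simp only [Finset.mem_univ, true_and]
  exact 𝔠.lt_iff_of_isCut hn h'.choose_spec hσ x

theorem card_cutSet {c : ChainPlus δ n X Y} {f : X ⟶ Z} {g : Z ⟶ Y} (h : f ≫ g = c.compose) :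
    (𝔠.cutSet c f g).card = δ.deg f := by
  have hn : δ.deg f ≤ n := by rw [← c.deg_compose, ← h, δ.deg_comp]; omega
  obtain ⟨σ, hσ⟩ := 𝔠.exists_act_isCut h
  have : 𝔠.cutSet c f g =
      (Finset.univ.filter fun x : Fin n => (x : ℕ) < δ.deg f).map σ.symm.toEmbedding := by
    ext x
    rw [𝔠.mem_cutSet h hσ, Finset.mem_map_equiv]
    simp
  rw [this, Finset.card_map, Fin.card_filter_val_lt, min_eq_right hn]

theorem cutSet_subset_iff {c : ChainPlus δ n X Y} {f : X ⟶ Z} {g : Z ⟶ Y} {f' : X ⟶ Z'}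
    {g' : Z' ⟶ Y} (h : f ≫ g = c.compose) (h' : f' ≫ g' = c.compose) :
    𝔠.cutSet c f g ⊆ 𝔠.cutSet c f' g' ↔ Refines f g f' g' := by
  have hn : δ.deg f ≤ n := by rw [← c.deg_compose, ← h, δ.deg_comp]; omega
  have hn' : δ.deg f' ≤ n := by rw [← c.deg_compose, ← h', δ.deg_comp]; omega
  constructor
  · intro hs
    obtain ⟨ρ, h1, h2⟩ := exists_perm_lt hs (𝔠.card_cutSet h) (𝔠.card_cutSet h')
    obtain ⟨σ, hσ⟩ := 𝔠.exists_act_isCut h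
    obtain ⟨σ', hσ'⟩ := 𝔠.exists_act_isCut h'
    have e1 := 𝔠.isCut_of_lt_iff hn hσ fun x => (h1 x).trans (𝔠.mem_cutSet h hσ x)
    have e2 := 𝔠.isCut_of_lt_iff hn' hσ' fun x => (h2 x).trans (𝔠.mem_cutSet h' hσ' x)
    refine e1.refines e2 ?_
    rw [← 𝔠.card_cutSet h, ← 𝔠.card_cutSet h']; exact Finset.card_le_card hs
  · rintro ⟨z, rfl, rfl⟩
    obtain ⟨σ, hσ⟩ := 𝔠.exists_act_isCut h'
    obtain ⟨q, hq⟩ := Nat.exists_eq_add_of_le hn'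
    subst hq
    obtain ⟨c₁, c₂, e, h1, h2⟩ := hσ.exists_concat
    obtain ⟨τ, hτ⟩ := 𝔠.exists_act_isCut h1.symm
    have hd : δ.deg f ≤ δ.deg (f ≫ z) := by rw [δ.deg_comp]; omega
    have h3 := ChainPlus.isCut_concat_left hd (𝔠.act τ c₁) (𝔠.act 1 c₂) hτ
    rw [𝔠.compose_act, h2, 𝔠.act_concat, e, ← 𝔠.mul_act] at h3
    intro x hx
    rw [𝔠.mem_cutSet h h3] at hx
    rw [𝔠.mem_cutSet h' hσ, ← blockPerm_lt τ 1]
    exact lt_of_lt_of_le hx hd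

theorem exists_cutSet_eq (c : ChainPlus δ n X Y) (S : Finset (Fin n)) :
    ∃ (Z : C) (f : X ⟶ Z) (g : Z ⟶ Y), f ≫ g = c.compose ∧ 𝔠.cutSet c f g = S := by
  have hn : S.card ≤ n := by simpa using Finset.card_le_univ S
  obtain ⟨σ, hσ, -⟩ := exists_perm_lt (subset_refl S) rfl rfl
  obtain ⟨Z, f, g, h, e⟩ := (𝔠.act σ c).exists_isCut S.card
  rw [𝔠.compose_act] at e
  have hd : δ.deg f = S.card := h.deg_left hn
  refine ⟨Z, f, g, e, ?_⟩
  ext x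
  rw [← hd] at h
  rw [𝔠.mem_cutSet e h, hd, hσ]

theorem exists_chart (φ : X ⟶ Y) (hφ : δ.deg φ = n) : Nonempty (Chart δ φ n) := by
  obtain ⟨c, rfl⟩ := 𝔠.exists_compose φ hφ
  exact ⟨⟨𝔠.cutSet c, fun h => 𝔠.card_cutSet h, fun h h' => 𝔠.cutSet_subset_iff h h',
    fun {S} _ => 𝔠.exists_cutSet_eq c S⟩⟩

theorem refines_of_comp {W : C} {u : X ⟶ Z} {w : Z ⟶ Y} {u' : X ⟶ Z'} {w' : Z' ⟶ Y}
    (h : u ≫ w = u' ≫ w') {f : Y ⟶ W} (hr : Refines u (w ≫ f) u' (w' ≫ f)) :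
    Refines u w u' w' := by
  obtain ⟨c, hc⟩ := 𝔠.exists_compose (u ≫ w) rfl
  obtain ⟨q, hq⟩ : ∃ q, δ.deg f = q := ⟨_, rfl⟩
  obtain ⟨c', rfl⟩ := 𝔠.exists_compose f hq
  have h' : u' ≫ w' = c.compose := by rw [hc, h]
  replace h := hc.symm
  have hd : δ.deg u ≤ δ.deg (u ≫ w) := by rw [δ.deg_comp]; omega
  have hd' : δ.deg u' ≤ δ.deg (u ≫ w) := by rw [← hc, ← h', δ.deg_comp]; omega
  obtain ⟨σ, hσ⟩ := 𝔠.exists_act_isCut h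
  obtain ⟨σ', hσ'⟩ := 𝔠.exists_act_isCut h'
  have hcc := c.compose_concat c'
  have e : u ≫ w ≫ c'.compose = (c.concat c').compose := by rw [hcc, ← h, Category.assoc]
  have e' : u' ≫ w' ≫ c'.compose = (c.concat c').compose := by rw [hcc, ← h', Category.assoc]
  have h1 := ChainPlus.isCut_concat_left hd _ (𝔠.act 1 c') hσ
  have h1' := ChainPlus.isCut_concat_left hd' _ (𝔠.act 1 c') hσ'
  rw [𝔠.compose_act, 𝔠.act_concat] at h1 h1'
  rw [← 𝔠.cutSet_subset_iff h h']
  intro x hx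
  rw [𝔠.mem_cutSet h hσ] at hx
  rw [𝔠.mem_cutSet h' hσ']
  have hs := (𝔠.cutSet_subset_iff e e').2 hr
  specialize @hs (Fin.castAdd q x)
  rw [𝔠.mem_cutSet e h1, 𝔠.mem_cutSet e' h1'] at hs
  simp [Equiv.permCongr_apply] at hs
  exact hs hx

theorem isoFactors_of_comp {W : C} {u : X ⟶ Z} {w : Z ⟶ Y} {u' : X ⟶ Z'} {w' : Z' ⟶ Y}
    (h : u ≫ w = u' ≫ w') {f : Y ⟶ W} (hr : IsoFactors u (w ≫ f) u' (w' ≫ f)) :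
    IsoFactors u w u' w' :=
  (𝔠.refines_of_comp h hr.refines).isoFactors (δ := δ) hr.deg_eq

end CubicalStructure

/-- The factorizations of the first part of a morphism. -/
def Chart.restrict (𝔠 : CubicalStructure δ) {n : ℕ} {X Y Z : C} {φ : X ⟶ Y} (χ : Chart δ φ n)
    {u : X ⟶ Z} {w : Z ⟶ Y} (h : u ≫ w = φ) : Chart δ u n where
  toFun f g := χ.toFun f (g ≫ w)
  card_eq e := χ.card_eq (by rw [← Category.assoc, e, h])
  subset_iff e e' := by
    rw [χ.subset_iff (by rw [← Category.assoc, e, h]) (by rw [← Category.assoc, e', h])]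
    exact ⟨𝔠.refines_of_comp (e.trans e'.symm), fun h => h.comp_right w⟩
  exists_eq {S} hS := by
    rw [Category.id_comp] at hS
    obtain ⟨W, f, g, e, rfl⟩ := χ.exists_eq (hS.trans (χ.subset_ground h))
    obtain ⟨z, rfl, rfl⟩ := (χ.subset_iff e h).1 hS
    exact ⟨W, f, z, rfl, rfl⟩

end Chart
end

section Words
variable {C : Type u} [Category.{v} C] [MonoidalCategory C] [SymmetricCategory C]
  {A B : Type*} {X : A → C} {Y : B → C}

theorem swapHom_naturality {x x' : A} {y y' : B} {l : List A} {m : List B} (b : X x ⟶ Y y)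
    (b' : X x' ⟶ Y y') (s : tens X l ⟶ tens Y m) :
    consHom b (consHom b' s) ≫ swapHom Y y y' m = swapHom X x x' l ≫ consHom b' (consHom b s) := by
  refine (swap_aux b b' s).trans ?_
  have : ∀ {P Q R S T : C} (f : P ⟶ Q) (g : Q ⟶ R) (h : R ⟶ S) (k : S ⟶ T),
      f ≫ g ≫ h ≫ k = (f ≫ g ≫ h) ≫ k := by simp
  exact this _ _ _ _

theorem swap_swap_aux (P Q R : C) : ((α_ P Q R).inv ≫ (β_ P Q).hom ▷ R ≫ (α_ Q P R).hom) ≫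
    (α_ Q P R).inv ≫ (β_ Q P).hom ▷ R ≫ (α_ P Q R).hom = 𝟙 (P ⊗ (Q ⊗ R)) := by
  simp only [Category.assoc, Iso.hom_inv_id_assoc]
  rw [← comp_whiskerRight_assoc, SymmetricCategory.symmetry, id_whiskerRight, Category.id_comp,
    Iso.inv_hom_id]

theorem swapHom_swapHom (x y : A) (l : List A) : swapHom X x y l ≫ swapHom X y x l = 𝟙 _ :=
  swap_swap_aux _ _ _

instance (x y : A) (l : List A) : IsIso (swapHom X x y l) :=
  ⟨swapHom X y x l, swapHom_swapHom _ _ _, swapHom_swapHom _ _ _⟩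

theorem consHom_id_comp {x : A} {l m k : List A} (s : tens X l ⟶ tens X m)
    (t : tens X m ⟶ tens X k) :
    consHom (𝟙 (X x)) s ≫ consHom (𝟙 (X x)) t = consHom (𝟙 (X x)) (s ≫ t) := by
  rw [consHom_comp, Category.comp_id]

omit [SymmetricCategory C] in
theorem isIso_consHom {x : A} {y : B} {l : List A} {m : List B} (b : X x ⟶ Y y)
    (s : tens X l ⟶ tens Y m) [IsIso b] [IsIso s] : IsIso (consHom b s) :=
  inferInstanceAs (IsIso (b ⊗ₘ s))

instance {x : A} {y : B} {l : List A} {m : List B} (b : X x ⟶ Y y) (s : tens X l ⟶ tens Y m)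
    [IsIso b] [IsIso s] : IsIso (consHom b s) := isIso_consHom b s

theorem yang_baxter_aux (P Q R S : C) :
    ((α_ P Q (R ⊗ S)).inv ≫ (β_ P Q).hom ▷ (R ⊗ S) ≫ (α_ Q P (R ⊗ S)).hom) ≫
      (𝟙 Q ⊗ₘ ((α_ P R S).inv ≫ (β_ P R).hom ▷ S ≫ (α_ R P S).hom)) ≫
        ((α_ Q R (P ⊗ S)).inv ≫ (β_ Q R).hom ▷ (P ⊗ S) ≫ (α_ R Q (P ⊗ S)).hom) =
    (𝟙 P ⊗ₘ ((α_ Q R S).inv ≫ (β_ Q R).hom ▷ S ≫ (α_ R Q S).hom)) ≫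
      ((α_ P R (Q ⊗ S)).inv ≫ (β_ P R).hom ▷ (Q ⊗ S) ≫ (α_ R P (Q ⊗ S)).hom) ≫
        (𝟙 R ⊗ₘ ((α_ P Q S).inv ≫ (β_ P Q).hom ▷ S ≫ (α_ Q P S).hom)) := by
  have h := congrArg (· ▷ S) (BraidedCategory.yang_baxter' P Q R)
  simp only [id_tensorHom]
  trans 𝟙 _ ⊗≫ ((β_ P Q).hom ▷ R ⊗≫ Q ◁ (β_ P R).hom ⊗≫ (β_ Q R).hom ▷ P) ▷ S ⊗≫ 𝟙 _
  · monoidal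
  · rw [h]; monoidal

theorem swapHom_yang_baxter (x y z : A) (l : List A) :
    swapHom X x y (z :: l) ≫ consHom (𝟙 (X y)) (swapHom X x z l) ≫ swapHom X y z (x :: l) =
      consHom (𝟙 (X x)) (swapHom X y z l) ≫ swapHom X x z (y :: l) ≫
        consHom (𝟙 (X z)) (swapHom X x y l) :=
  yang_baxter_aux _ _ _ _

theorem Ins.map_here (x : A) (l : List A) : (Ins.here (x := x) l).map X = 𝟙 _ := rfl

theorem Ins.map_there {x : A} (y : A) {l m : List A} (i : Ins x l m) :
    (Ins.there y i).map X = swapHom X x y l ≫ consHom (𝟙 (X y)) (i.map X) := rfl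

instance {x : A} {l m : List A} (i : Ins x l m) : IsIso (i.map X) := by
  induction i with
  | here l => rw [Ins.map_here]; infer_instance
  | there y i ih => rw [Ins.map_there]; infer_instance

/-- A reordering of a list, given by the place of the first letter and a reordering of the others. -/
inductive Reorder {A : Type*} : List A → List A → Type _
  | nil : Reorder [] []
  | cons (x : A) {l m m' : List A} (h : Reorder l m) (i : Ins x m m') : Reorder (x :: l) m'

namespace Reorder

/-- The symmetry of tensor products given by a reordering. -/
def map (X : A → C) : ∀ {l m : List A}, Reorder l m → (tens X l ⟶ tens X m)
  | _, _, .nil => 𝟙 _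
  | _, _, .cons x h i => consHom (𝟙 (X x)) (h.map X) ≫ i.map X

/-- The identity. -/
def refl : ∀ l : List A, Reorder l l
  | [] => .nil
  | x :: l => .cons x (refl l) (.here l)

theorem map_cons (x : A) {l m m' : List A} (h : Reorder l m) (i : Ins x m m') :
    (cons x h i).map X = consHom (𝟙 (X x)) (h.map X) ≫ i.map X := rfl

theorem map_refl : ∀ l : List A, (refl l).map X = 𝟙 (tens X l)
  | [] => rfl
  | x :: l => by
    rw [refl, map_cons, map_refl l, consHom_id, Ins.map_here, Category.id_comp]

end Reorder

theorem Ins.exchange {x y : A} {l m m' : List A} (j : Ins x l m) (k : Ins y m m') :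
    ∃ (n : List A) (k' : Ins y l n) (j' : Ins x n m'),
      swapHom X x y l ≫ consHom (𝟙 (X y)) (j.map X) ≫ k.map X =
        consHom (𝟙 (X x)) (k'.map X) ≫ j'.map X := by
  induction k generalizing l with
  | here m =>
    exact ⟨_, .here _, .there y j, by
      rw [Ins.map_here, Ins.map_here, Ins.map_there, consHom_id, Category.id_comp]
      rw [Category.comp_id]⟩
  | there z k ih =>
    cases j with
    | here m =>
      refine ⟨_, k, .here _, ?_⟩
      rw [Ins.map_here, Ins.map_here, Ins.map_there, consHom_id, Category.id_comp,
        ← Category.assoc, swapHom_swapHom, Category.id_comp, Category.comp_id]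
    | there z j =>
      obtain ⟨n, k', j', e⟩ := ih j
      refine ⟨_, .there z k', .there z j', ?_⟩
      simp only [Ins.map_there]
      rw [← Category.comp_id (𝟙 (X y)), ← consHom_comp, Category.assoc,
        ← Category.assoc (consHom (𝟙 (X y)) (consHom (𝟙 (X z)) (j.map X))), swapHom_naturality]
      simp only [Category.assoc]
      rw [consHom_comp, Category.comp_id, ← Category.assoc, ← Category.assoc,
        Category.assoc (swapHom X x y _), swapHom_yang_baxter]
      simp only [Category.assoc]
      rw [consHom_comp, Category.comp_id, e, ← Category.comp_id (𝟙 (X z)), ← consHom_comp,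
        ← Category.assoc (swapHom X x z _), ← swapHom_naturality]
      simp only [Category.assoc]
      rw [← Category.assoc, consHom_comp, Category.comp_id]
      simp only [Category.comp_id]

theorem Ins.comp_reorder {x : A} {l m m' : List A} (i : Ins x l m) (d : Reorder m m') :
    ∃ (n : List A) (e : Reorder l n) (j : Ins x n m'),
      i.map X ≫ d.map X = consHom (𝟙 (X x)) (e.map X) ≫ j.map X := by
  induction i generalizing m' with
  | here l =>
    cases d with
    | cons x h j => exact ⟨_, h, j, by rw [Ins.map_here, Category.id_comp, Reorder.map_cons]⟩
  | there y i ih =>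
    cases d with
    | cons y h k =>
      obtain ⟨n, e, j, he⟩ := ih h
      obtain ⟨n', k', j', he'⟩ := Ins.exchange (X := X) j k
      refine ⟨_, .cons y e k', j', ?_⟩
      rw [Ins.map_there, Reorder.map_cons, Reorder.map_cons, Category.assoc,
        ← Category.assoc (consHom _ _) (consHom _ _), consHom_id_comp, he,
        ← consHom_id_comp, ← consHom_id_comp, Category.assoc, Category.assoc, ← he']
      simp only [← Category.assoc]
      rw [swapHom_naturality]

theorem Reorder.exists_trans {l m k : List A} (d : Reorder l m) (e : Reorder m k) :
    ∃ f : Reorder l k, f.map X = d.map X ≫ e.map X := by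
  induction d generalizing k with
  | nil => exact ⟨e, by simp [Reorder.map]⟩
  | cons x h i ih =>
    obtain ⟨n, e', j, he⟩ := i.comp_reorder (X := X) e
    obtain ⟨f, hf⟩ := ih e'
    exact ⟨.cons x f j, by
      rw [map_cons, map_cons, Category.assoc, he, hf, ← Category.assoc, consHom_comp,
        Category.comp_id]⟩

theorem Canonical.exists_reorder {l m : List A} {s : tens X l ⟶ tens X m} (h : Canonical X l m s) :
    ∃ d : Reorder l m, d.map X = s := by
  induction h with
  | nil => exact ⟨.nil, rfl⟩
  | cons x h ih =>
    obtain ⟨d, rfl⟩ := ih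
    exact ⟨.cons x d (.here _), by rw [Reorder.map_cons, Ins.map_here, Category.comp_id]⟩
  | swap x y l =>
    refine ⟨.cons x (.cons y (.refl l) (.here _)) (.there y (.here _)), ?_⟩
    rw [Reorder.map_cons, Reorder.map_cons, Reorder.map_refl, Ins.map_there, Ins.map_here,
      Ins.map_here, consHom_id]
    simp only [Category.id_comp, Category.comp_id, consHom_id]
  | trans h h' ih ih' =>
    obtain ⟨d, rfl⟩ := ih
    obtain ⟨e, rfl⟩ := ih'
    exact d.exists_trans e

theorem Ins.canonical {x : A} {l m : List A} (i : Ins x l m) : Canonical X (x :: l) m (i.map X) := by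
  induction i with
  | here l => exact Canonical.refl _
  | there y i ih => exact (Canonical.swap _ _ _).trans (ih.cons y)

theorem Reorder.canonical {l m : List A} (d : Reorder l m) : Canonical X l m (d.map X) := by
  induction d with
  | nil => exact .nil
  | cons x h i ih => exact (ih.cons x).trans i.canonical

theorem Canonical.isIso {l m : List A} {s : tens X l ⟶ tens X m} (h : Canonical X l m s) :
    IsIso s := by
  induction h with
  | nil => infer_instance
  | cons x h ih => infer_instance
  | swap x y l => infer_instance
  | trans h h' ih ih' => infer_instance

theorem Canonical.symm {l m : List A} {s : tens X l ⟶ tens X m} (h : Canonical X l m s) :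
    ∃ s', Canonical X m l s' ∧ s ≫ s' = 𝟙 _ ∧ s' ≫ s = 𝟙 _ := by
  induction h with
  | nil => exact ⟨_, .nil, by simp, by simp⟩
  | cons x h ih =>
    obtain ⟨s', h, h1, h2⟩ := ih
    exact ⟨_, h.cons x, by rw [consHom_comp, h1, Category.comp_id, consHom_id],
      by rw [consHom_comp, h2, Category.comp_id, consHom_id]⟩
  | swap x y l => exact ⟨_, .swap y x l, swapHom_swapHom _ _ _, swapHom_swapHom _ _ _⟩
  | @trans _ _ _ s t h h' ih ih' =>
    obtain ⟨s', k, h1, h2⟩ := ih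
    obtain ⟨t', k', h1', h2'⟩ := ih'
    exact ⟨_, k'.trans k, by rw [Category.assoc, ← Category.assoc t, h1', Category.id_comp, h1],
      by rw [Category.assoc, ← Category.assoc s', h2, Category.id_comp, h2']⟩

theorem Ins.perm {x : A} {l m : List A} (i : Ins x l m) : (x :: l).Perm m := by
  induction i with
  | here l => exact .refl _
  | there y i ih => exact (List.Perm.swap _ _ _).trans (ih.cons y)

theorem Reorder.perm {l m : List A} (d : Reorder l m) : l.Perm m := by
  induction d with
  | nil => exact .nil
  | cons x h i ih => exact (ih.cons x).trans i.perm

theorem Canonical.perm {l m : List A} {s : tens X l ⟶ tens X m} (h : Canonical X l m s) :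
    l.Perm m := by
  obtain ⟨d, -⟩ := h.exists_reorder; exact d.perm

theorem Ins.eq_of_nodup {x : A} {l l' m : List A} (hm : m.Nodup) (i : Ins x l m) (i' : Ins x l' m) :
    l = l' ∧ HEq i i' := by
  induction i generalizing l' with
  | here l =>
    cases i' with
    | here => exact ⟨rfl, HEq.rfl⟩
    | there y i' =>
      have := i'.perm.mem_iff.1 List.mem_cons_self
      exact absurd this (List.nodup_cons.1 hm).1
  | there y i ih =>
    cases i' with
    | here l =>
      have := i.perm.mem_iff.1 List.mem_cons_self
      exact absurd this (List.nodup_cons.1 hm).1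
    | there y i' =>
      obtain ⟨rfl, h⟩ := ih (List.nodup_cons.1 hm).2 i'
      rw [eq_of_heq h]; exact ⟨rfl, HEq.rfl⟩

theorem Reorder.eq_of_nodup {l m : List A} (hm : m.Nodup) (d d' : Reorder l m) : d = d' := by
  induction d with
  | nil => cases d'; rfl
  | cons x h i ih =>
    cases d' with
    | cons x h' i' =>
      obtain ⟨rfl, e⟩ := i.eq_of_nodup hm i'
      rw [eq_of_heq e, ih (List.nodup_cons.1 (i.perm.nodup_iff.2 hm)).2 h']

theorem Canonical.eq_of_nodup {l m : List A} {s s' : tens X l ⟶ tens X m} (h : Canonical X l m s)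
    (h' : Canonical X l m s') (hl : l.Nodup) : s = s' := by
  obtain ⟨d, rfl⟩ := h.exists_reorder
  obtain ⟨d', rfl⟩ := h'.exists_reorder
  rw [d.eq_of_nodup (d.perm.nodup_iff.1 hl) d']

/-- The tensor product of a family of morphisms. -/
def tensMap {X Y : A → C} (g : ∀ x, X x ⟶ Y x) : ∀ l : List A, tens X l ⟶ tens Y l
  | [] => 𝟙 _
  | x :: l => consHom (g x) (tensMap g l)

theorem Ins.map_naturality {X Y : A → C} (g : ∀ x, X x ⟶ Y x) {x : A} {l m : List A}
    (i : Ins x l m) : i.map X ≫ tensMap g m = tensMap g (x :: l) ≫ i.map Y := by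
  induction i with
  | here l => rw [map_here, map_here, Category.id_comp, Category.comp_id]
  | there y i ih =>
    rw [map_there, map_there]
    simp only [tensMap] at ih ⊢
    rw [Category.assoc, consHom_comp, Category.id_comp, ih, ← Category.assoc, swapHom_naturality,
      Category.assoc, consHom_comp, Category.comp_id]

theorem Reorder.map_naturality {X Y : A → C} (g : ∀ x, X x ⟶ Y x) {l m : List A}
    (d : Reorder l m) : d.map X ≫ tensMap g m = tensMap g l ≫ d.map Y := by
  induction d with
  | nil => simp only [tensMap, map]; rfl
  | cons x h i ih =>
    rw [map_cons, map_cons, Category.assoc, i.map_naturality]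
    simp only [tensMap]
    rw [← Category.assoc, ← Category.assoc, consHom_comp, consHom_comp, ih, Category.id_comp,
      Category.comp_id]

theorem tensMap_append {X Y : A → C} (g : ∀ x, X x ⟶ Y x) (l m : List A) :
    tensMap g (l ++ m) = appendHom (tensMap g l) (tensMap g m) := by
  induction l with
  | nil => exact (appendHom_nil _).symm
  | cons x l ih => rw [tensMap, appendHom_cons, ← ih]; rfl

omit [SymmetricCategory C] in
theorem tensArrow_eq {V : Type*} [Category V] (ι : V ⥤ C) (L : List (Comma (𝟭 C) ι)) :
    tensArrow ι L = tensMap (X := (Comma.fst (𝟭 C) ι).obj) (Y := (Comma.snd (𝟭 C) ι ⋙ ι).obj)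
      (fun φ => φ.hom) L := by
  induction L with
  | nil => rfl
  | cons φ L ih => rw [tensArrow, ih]; rfl

end Words

section WordIso
variable {V : Type u₁} [Groupoid.{v₁} V] {A B : Type*}

/-- A bijection between two words of letters coloured by objects of `V` together with isomorphisms
between the colours of corresponding letters. -/
inductive WordIso (x : A → V) (y : B → V) : List A → List B → Type _
  | nil : WordIso x y [] []
  | cons {a : A} {b : B} {l : List A} {m m' : List B} (f : x a ≅ y b) (h : WordIso x y l m)
      (i : Ins b m m') : WordIso x y (a :: l) m'

variable {x : A → V} {y : B → V}

/-- Insertion after mapping the letters. -/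
def Ins.mapList (y : B → V) {b : B} : ∀ {m m' : List B}, Ins b m m' → Ins (y b) (m.map y) (m'.map y)
  | _, _, .here l => .here (l.map y)
  | _, _, .there c i => .there (y c) (i.mapList y)

omit [Groupoid.{v₁} V] in
theorem Ins.exists_mapList {v : V} {k k' : List V} (i : Ins v k k') {m' : List B}
    (h : k' = m'.map y) : ∃ (b : B) (m : List B) (j : Ins b m m') (e : v = y b) (e' : k = m.map y),
      i = (e ▸ e' ▸ h ▸ j.mapList y : Ins v k k') := by
  induction i generalizing m' with
  | here k =>
    cases m' with
    | nil => cases h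
    | cons b m =>
      rw [List.map_cons, List.cons.injEq] at h
      obtain ⟨rfl, rfl⟩ := h
      exact ⟨b, m, .here _, rfl, rfl, rfl⟩
  | there c i ih =>
    cases m' with
    | nil => cases h
    | cons b m =>
      rw [List.map_cons, List.cons.injEq] at h
      obtain ⟨rfl, rfl⟩ := h
      obtain ⟨b', m₀, j, rfl, rfl, rfl⟩ := ih rfl
      exact ⟨b', _, .there b j, rfl, rfl, rfl⟩

/-- The number of letters before the inserted one. -/
def Ins.pos {W : Type*} {b : W} : ∀ {m m' : List W}, Ins b m m' → ℕ
  | _, _, .here _ => 0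
  | _, _, .there _ i => i.pos + 1

omit [Groupoid.{v₁} V] in
theorem Ins.pos_mapList {b : B} {m m' : List B} (i : Ins b m m') : (i.mapList y).pos = i.pos := by
  induction i with
  | here l => rfl
  | there c i ih => exact congrArg (· + 1) ih

theorem Ins.eq_of_pos_eq {W : Type*} {b b' : W} {m₁ m₂ m' : List W} {i : Ins b m₁ m'}
    {j : Ins b' m₂ m'} (h : i.pos = j.pos) : b = b' ∧ m₁ = m₂ ∧ HEq i j := by
  induction i generalizing m₂ with
  | here l =>
    cases j with
    | here => exact ⟨rfl, rfl, HEq.rfl⟩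
    | there c j => cases h
  | there c i ih =>
    cases j with
    | here => cases h
    | there c j =>
      obtain ⟨rfl, rfl, h⟩ := ih (Nat.succ.inj h)
      rw [eq_of_heq h]; exact ⟨rfl, rfl, HEq.rfl⟩

theorem Ins.pos_congr {W : Type*} {b b' : W} {m₁ m₂ m' : List W} {i : Ins b m₁ m'}
    {j : Ins b' m₂ m'} (hb : b = b') (hm : m₁ = m₂) (h : HEq i j) : i.pos = j.pos := by
  subst hb; subst hm; rw [eq_of_heq h]

/-- The coherence isomorphism for the change of letters. -/
def tensList {C : Type u} [Category.{v} C] [MonoidalCategory C] (ι : V ⥤ C) (x : A → V) :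
    ∀ l : List A, tens (fun a => ι.obj (x a)) l ≅ tens ι.obj (l.map x)
  | [] => Iso.refl _
  | a :: l => Iso.refl (ι.obj (x a)) ⊗ᵢ tensList ι x l

namespace WordIso

def toSymHom : ∀ {l : List A} {m : List B}, WordIso x y l m → SymHom V (l.map x) (m.map y)
  | _, _, .nil => .nil
  | _, _, .cons f h i => .cons f h.toSymHom (i.mapList y)

theorem toSymHom_injective {l : List A} {m : List B} {s t : WordIso x y l m}
    (h : s.toSymHom = t.toSymHom) : s = t := by
  induction s with
  | nil => cases t; rfl
  | cons f r i ih =>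
    cases t with
    | cons f' r' i' =>
      simp only [toSymHom] at h
      injection h with h1 h2 h3 h4 h5 h6 h7 h8
      have hp := Ins.pos_congr h2 h4 h8
      rw [Ins.pos_mapList, Ins.pos_mapList] at hp
      obtain ⟨rfl, rfl, h9⟩ := Ins.eq_of_pos_eq hp
      rw [eq_of_heq h6, ih (eq_of_heq h7), eq_of_heq h9]

theorem exists_toSymHom {l : List A} {m : List B} {k : List V} (hk : k = m.map y)
    (s : SymHom V (l.map x) k) : ∃ t : WordIso x y l m, t.toSymHom = hk ▸ s := by
  induction l generalizing m k with
  | nil =>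
    cases s
    cases m with
    | nil => exact ⟨.nil, rfl⟩
    | cons b m => cases hk
  | cons a l ih =>
    cases s with
    | cons f h i =>
      obtain ⟨b, m₀, j, rfl, rfl, rfl⟩ := i.exists_mapList hk
      subst hk
      obtain ⟨t, rfl⟩ := ih rfl h
      exact ⟨.cons f t j, rfl⟩

variable {C : Type u} [Category.{v} C] [MonoidalCategory C] [SymmetricCategory C]

/-- The induced isomorphism of tensor products. -/
def map (ι : V ⥤ C) : ∀ {l : List A} {m : List B}, WordIso x y l m →
    (tens (fun a => ι.obj (x a)) l ⟶ tens (fun b => ι.obj (y b)) m)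
  | _, _, .nil => 𝟙 _
  | _, _, .cons f h i => consHom (X := fun a => ι.obj (x a)) (Y := fun b => ι.obj (y b))
      (ι.map f.hom) (h.map ι) ≫ i.map (fun b => ι.obj (y b))

theorem map_cons (ι : V ⥤ C) {a : A} {b : B} {l : List A} {m m' : List B} (f : x a ≅ y b)
    (h : WordIso x y l m) (i : Ins b m m') : (cons f h i).map ι =
      consHom (X := fun a => ι.obj (x a)) (Y := fun b => ι.obj (y b))
        (ι.map f.hom) (h.map ι) ≫ i.map (fun b => ι.obj (y b)) := rfl

instance isIso_map (ι : V ⥤ C) {l : List A} {m : List B} (s : WordIso x y l m) : IsIso (s.map ι) := by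
  induction s with
  | nil => exact inferInstanceAs (IsIso (𝟙 (𝟙_ C)))
  | cons f h i ih => rw [map_cons]; infer_instance

end WordIso

variable {C : Type u} [Category.{v} C] [MonoidalCategory C] [SymmetricCategory C]

omit [SymmetricCategory C] in
theorem tensList_cons_hom (ι : V ⥤ C) (a : A) (l : List A) : (tensList ι x (a :: l)).hom =
    consHom (X := fun a => ι.obj (x a)) (Y := ι.obj) (x := a) (y :=
        x a) (𝟙 (ι.obj (x a))) (tensList ι x l).hom := rfl

theorem swapHom_tensList (ι : V ⥤ C) (a b : A) (l : List A) :
    swapHom (fun a => ι.obj (x a)) a b l ≫ (tensList ι x (b :: a :: l)).hom =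
      (tensList ι x (a :: b :: l)).hom ≫ swapHom ι.obj (x a) (x b) (l.map x) :=
  (swapHom_naturality (X := fun a => ι.obj (x a)) (Y := ι.obj) (x := a) (x' := b) (y := x a)
    (y' := x b) (𝟙 (ι.obj (x a))) (𝟙 (ι.obj (x b))) (tensList ι x l).hom).symm

theorem Ins.map_tensList (ι : V ⥤ C) {a : A} {l m : List A} (i : Ins a l m) :
    i.map (fun a => ι.obj (x a)) ≫ (tensList ι x m).hom =
      (tensList ι x (a :: l)).hom ≫ (i.mapList x).map ι.obj := by
  induction i with
  | here l =>
    rw [Ins.map_here, Category.id_comp]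
    exact (Category.comp_id _).symm
  | @there b l m i ih =>
    have e1 : (Ins.there b i).mapList x = .there (x b) (i.mapList x) := rfl
    rw [e1, Ins.map_there, Ins.map_there, tensList_cons_hom, Category.assoc, consHom_comp,
      Category.id_comp, ih, ← Category.assoc]
    erw [← swapHom_tensList]
    rw [Category.assoc]
    congr 1
    rw [tensList_cons_hom, tensList_cons_hom, consHom_comp, Category.id_comp]
    rfl

theorem WordIso.map_tensList (ι : V ⥤ C) {l : List A} {m : List B} (s : WordIso x y l m) :
    s.map ι ≫ (tensList ι y m).hom = (tensList ι x l).hom ≫ s.toSymHom.map ι := by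
  induction s with
  | nil => rfl
  | cons f h i ih =>
    have e1 : (WordIso.cons f h i).toSymHom.map ι =
      consHom (ι.map f.hom) (h.toSymHom.map ι) ≫ (i.mapList y).map ι.obj := rfl
    rw [e1, map_cons, Category.assoc, i.map_tensList, ← Category.assoc, ← Category.assoc]
    congr 1
    rw [tensList_cons_hom, tensList_cons_hom, consHom_comp, consHom_comp, ih, Category.id_comp,
      Category.comp_id]

namespace FeynmanCategory
variable (𝔉 : FeynmanCategory V C)

theorem sym_map_injective {l : List A} {m : List B} {s t : WordIso x y l m}
    (h : s.map 𝔉.ι = t.map 𝔉.ι) : s = t := by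
  apply WordIso.toSymHom_injective
  have h1 := s.map_tensList 𝔉.ι
  rw [h, t.map_tensList, cancel_epi] at h1
  let f := (tensList 𝔉.ι x l).symm ≪≫ asIso (s.map 𝔉.ι) ≪≫ tensList 𝔉.ι y m
  have hs : s.toSymHom.map 𝔉.ι = f.hom := (Iso.eq_inv_comp _).2 (s.map_tensList 𝔉.ι).symm
  exact (𝔉.existsUnique_iso f).unique hs (h1.trans hs)

theorem exists_sym {l : List A} {m : List B}
    (r : tens (fun a => 𝔉.ι.obj (x a)) l ⟶ tens (fun b => 𝔉.ι.obj (y b)) m) [IsIso r] :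
    ∃ s : WordIso x y l m, s.map 𝔉.ι = r := by
  obtain ⟨s, hs, -⟩ := 𝔉.existsUnique_iso
    ((tensList 𝔉.ι x l).symm ≪≫ asIso r ≪≫ tensList 𝔉.ι y m)
  obtain ⟨t, ht⟩ := WordIso.exists_toSymHom rfl s
  refine ⟨t, ?_⟩
  have h := t.map_tensList 𝔉.ι
  dsimp only at ht
  rw [ht, hs] at h
  simpa using h

end FeynmanCategory
end WordIso

section Split
variable {V : Type u₁} [Groupoid.{v₁} V] {A B : Type*} {x : A → V} {y : B → V}

/-- Insertion into the first part of a concatenated list. -/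
def Ins.appendRight {W : Type*} {b : W} (k : List W) :
    ∀ {m m' : List W}, Ins b m m' → Ins b (m ++ k) (m' ++ k)
  | _, _, .here l => .here (l ++ k)
  | _, _, .there c i => .there c (i.appendRight k)

theorem Ins.pos_appendRight {W : Type*} {b : W} (k : List W) {m m' : List W} (i : Ins b m m') :
    (i.appendRight k).pos = i.pos := by
  induction i with
  | here l => rfl
  | there c i ih => exact congrArg (· + 1) ih

namespace WordIso

/-- Juxtaposition. -/
def append : ∀ {l l' : List A} {m m' : List B}, WordIso x y l m → WordIso x y l' m' →
    WordIso x y (l ++ l') (m ++ m')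
  | _, _, _, _, .nil, t => t
  | _, _, _, _, .cons f h i, t => .cons f (h.append t) (i.appendRight _)

theorem append_cons {a : A} {b : B} {l l' : List A} {m m' k : List B} (f : x a ≅ y b)
    (h : WordIso x y l m) (i : Ins b m m') (t : WordIso x y l' k) :
    (cons f h i).append t = .cons f (h.append t) (i.appendRight _) := rfl

theorem append_left_injective {l l' : List A} {m m' : List B} {s s' : WordIso x y l m}
    {t t' : WordIso x y l' m'} (h : s.append t = s'.append t') : s = s' ∧ t = t' := by
  induction s with
  | nil => cases s'; exact ⟨rfl, h⟩
  | cons f r i ih =>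
    cases s' with
    | cons f' r' i' =>
      rw [append_cons, append_cons] at h
      injection h with h1 h2 h3 h4 h5 h6 h7 h8
      have hp := Ins.pos_congr h2 h4 h8
      rw [Ins.pos_appendRight, Ins.pos_appendRight] at hp
      obtain ⟨rfl, rfl, h9⟩ := Ins.eq_of_pos_eq hp
      obtain ⟨rfl, rfl⟩ := ih (eq_of_heq h7)
      rw [eq_of_heq h6, eq_of_heq h9]
      exact ⟨rfl, rfl⟩

end WordIso

variable {C : Type u} [Category.{v} C] [MonoidalCategory C] [SymmetricCategory C]

theorem Ins.map_appendRight {A : Type*} {X : A → C} {b : A} {m m' : List A} (i : Ins b m m')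
    (k : List A) : (i.appendRight k).map X = appendHom (i.map X) (𝟙 (tens X k)) := by
  induction i with
  | here l => rw [map_here, appendHom_id]; rfl
  | @there c l m i ih =>
    have e : (there c i).appendRight k = there c (i.appendRight k) := rfl
    rw [e, map_there, map_there, ih, ← Category.comp_id (𝟙 (tens X k)), ← appendHom_comp,
      swapHom_append, appendHom_cons, Category.comp_id]

theorem WordIso.map_append (ι : V ⥤ C) {l l' : List A} {m m' : List B} (s : WordIso x y l m)
    (t : WordIso x y l' m') : (s.append t).map ι = appendHom (s.map ι) (t.map ι) := by
  induction s with
  | nil => exact (appendHom_nil _).symm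
  | cons f h i ih =>
    rw [append_cons, WordIso.map_cons, WordIso.map_cons, ih, Ins.map_appendRight]
    rw [← Category.comp_id (t.map ι), ← appendHom_comp, appendHom_cons, Category.comp_id]

/-- The underlying isomorphism of words of a family of isomorphisms. -/
def SymHom.toWordIso {W : Type*} [Category W] (G : W ⥤ V) :
    ∀ {l m : List W}, SymHom W l m → WordIso G.obj G.obj l m
  | _, _, .nil => .nil
  | _, _, .cons f h i => .cons (G.mapIso f) (h.toWordIso G) i

theorem SymHom.map_toWordIso {W : Type*} [Category W] (G : W ⥤ V) (ι : V ⥤ C) {l m : List W}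
    (s : SymHom W l m) : (s.toWordIso G).map ι = s.map (G ⋙ ι) := by
  induction s with
  | nil => rfl
  | cons f h i ih =>
    have e : (cons f h i).toWordIso G = .cons (G.mapIso f) (h.toWordIso G) i := rfl
    rw [e, WordIso.map_cons, ih]; rfl

/-- Juxtaposition. -/
def SymHom.append {W : Type*} [Category W] : ∀ {l l' m m' : List W}, SymHom W l m →
    SymHom W l' m' → SymHom W (l ++ l') (m ++ m')
  | _, _, _, _, .nil, t => t
  | _, _, _, _, .cons f h i, t => .cons f (h.append t) (i.appendRight _)

theorem SymHom.map_append {W : Type*} [Category W] (G : W ⥤ C) {l l' m m' : List W}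
    (s : SymHom W l m) (t : SymHom W l' m') :
    (s.append t).map G = appendHom (s.map G) (t.map G) := by
  induction s with
  | nil => exact (appendHom_nil _).symm
  | cons f h i ih =>
    have e : (cons f h i).append t = .cons f (h.append t) (i.appendRight _) := rfl
    have e' {a b : W} {l m m' : List W} (f : a ≅ b) (h : SymHom W l m) (i : Ins b m m') :
      (cons f h i).map G = consHom (G.map f.hom) (h.map G) ≫ i.map G.obj := rfl
    rw [e, e', e', ih, Ins.map_appendRight]
    rw [← Category.comp_id (t.map G), ← appendHom_comp, appendHom_cons, Category.comp_id]

theorem SymHom.exists_append {W : Type*} [Category W] (G : W ⥤ V) {l l' m m' : List W}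
    (s : SymHom W (l ++ l') (m ++ m')) (t : WordIso G.obj G.obj l m) (t' : WordIso G.obj G.obj l' m')
    (h : s.toWordIso G = t.append t') : ∃ (r : SymHom W l m) (r' : SymHom W l' m'),
      s = r.append r' ∧ r.toWordIso G = t ∧ r'.toWordIso G = t' := by
  induction t with
  | nil => exact ⟨.nil, s, rfl, rfl, h⟩
  | @cons a b l m₀ m f r i ih =>
    change SymHom W (a :: (l ++ l')) _ at s
    cases s with
    | cons g q j =>
      change WordIso.cons _ _ _ = WordIso.cons _ _ _ at h
      injection h with h1 h2 h3 h4 h5 h6 h7 h8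
      subst h2
      subst h4
      obtain ⟨r₁, r₂, rfl, rfl, rfl⟩ := ih q (eq_of_heq h7)
      rw [← eq_of_heq h6, eq_of_heq h8]
      exact ⟨.cons g r₁ i, r₂, rfl, rfl, rfl⟩

/-- The isomorphism of words given by a reordering. -/
def Reorder.toWordIso (x : A → V) : ∀ {l m : List A}, Reorder l m → WordIso x x l m
  | _, _, .nil => .nil
  | _, _, .cons a h i => .cons (Iso.refl (x a)) (h.toWordIso x) i

theorem Reorder.map_toWordIso (ι : V ⥤ C) {l m : List A}
    (s : Reorder l m) : (s.toWordIso x).map ι = s.map (fun a => ι.obj (x a)) := by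
  induction s with
  | nil => rfl
  | cons a h i ih =>
    have e : (cons a h i).toWordIso x = .cons (Iso.refl (x a)) (h.toWordIso x) i := rfl
    rw [e, WordIso.map_cons, ih, Iso.refl_hom, ι.map_id]; rfl

theorem Reorder.exists_append {l l' m m' : List A}
    (s : Reorder (l ++ l') (m ++ m')) (t : WordIso x x l m) (t' : WordIso x x l' m')
    (h : s.toWordIso x = t.append t') : ∃ (r : Reorder l m) (r' : Reorder l' m'),
       r.toWordIso x = t ∧ r'.toWordIso x = t' := by
  induction t with
  | nil => exact ⟨.nil, s, rfl, h⟩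
  | @cons a b l m₀ m f r i ih =>
    change Reorder (a :: (l ++ l')) _ at s
    cases s with
    | cons a q j =>
      change WordIso.cons _ _ _ = WordIso.cons _ _ _ at h
      injection h with h1 h2 h3 h4 h5 h6 h7 h8
      subst h2
      subst h4
      obtain ⟨r₁, r₂, rfl, rfl⟩ := ih q (eq_of_heq h7)
      rw [← eq_of_heq h6]
      exact ⟨.cons a r₁ i, r₂, rfl, rfl⟩

/-- A decomposition of the source of an isomorphism of words induces one of its target, up to a
reordering. -/
theorem WordIso.exists_split (ι : V ⥤ C) {l l' : List A} {m : List B} (s : WordIso x y (l ++ l') m) :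
    ∃ (k k' : List B) (t : WordIso x y l k) (t' : WordIso x y l' k') (d : Reorder (k ++ k') m),
      s.map ι = appendHom (t.map ι) (t'.map ι) ≫ d.map (fun b => ι.obj (y b)) := by
  induction l generalizing m with
  | nil =>
    refine ⟨[], m, .nil, s, .refl m, ?_⟩
    exact (((Category.comp_id _).trans (appendHom_nil _)).symm).trans
      (congrArg (appendHom _ (s.map ι) ≫ ·)
        (Reorder.map_refl (X := fun b => ι.obj (y b)) m).symm)
  | cons a l ih =>
    change WordIso x y (a :: (l ++ l')) _ at s
    cases s with
    | cons f h i =>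
      obtain ⟨k, k', t, t', d, e⟩ := ih h
      refine ⟨_, k', .cons f t (.here k), t', .cons _ d i, ?_⟩
      rw [WordIso.map_cons, WordIso.map_cons, e, Reorder.map_cons, Ins.map_here, Category.comp_id,
        appendHom_cons]
      rw [← Category.assoc, consHom_comp, Category.comp_id]

end Split

section Tensor
variable {V : Type u₁} [Groupoid.{v₁} V] {C : Type u} [Category.{v} C]
    [MonoidalCategory C] [SymmetricCategory C]

/-- The tensor product of two isomorphisms, on a concatenated list. -/
def splitIso {A : Type*} {X : A → C} {l m : List A} {P Q : C} (e : tens X l ≅ P)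
    (e' : tens X m ≅ Q) : tens X (l ++ m) ≅ P ⊗ Q :=
  tensAppend X l m ≪≫ (e ⊗ᵢ e')

theorem splitIso_hom {A : Type*} {X : A → C} {l m : List A} {P Q : C} (e : tens X l ≅ P)
    (e' : tens X m ≅ Q) :
    (splitIso e e').hom = (tensAppend X l m).hom ≫ (e.hom ⊗ₘ e'.hom) := rfl

theorem splitIso_inv {A : Type*} {X : A → C} {l m : List A} {P Q : C} (e : tens X l ≅ P)
    (e' : tens X m ≅ Q) :
    (splitIso e e').inv = (e.inv ⊗ₘ e'.inv) ≫ (tensAppend X l m).inv := rfl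

theorem splitIso_inv_appendHom {A B : Type*} {X : A → C} {Y : B → C} {l m : List A} {l' m' : List B}
    {P Q P' Q' : C} (e : tens X l ≅ P) (e' : tens X m ≅ Q) (f : tens Y l' ≅ P')
    (f' : tens Y m' ≅ Q') (s : tens X l ⟶ tens Y l') (t : tens X m ⟶ tens Y m') :
    (splitIso e e').inv ≫ appendHom s t ≫ (splitIso f f').hom =
      (e.inv ≫ s ≫ f.hom) ⊗ₘ (e'.inv ≫ t ≫ f'.hom) := by
  simp [splitIso_inv, splitIso_hom, appendHom]

theorem splitIso_hom_comp {A B : Type*} {X : A → C} {Y : B → C} {l m : List A} {l' m' : List B}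
    {P Q P' Q' : C} (e : tens X l ≅ P) (e' : tens X m ≅ Q) (f : tens Y l' ≅ P')
    (f' : tens Y m' ≅ Q') (s : P ⟶ P') (t : Q ⟶ Q') :
    (splitIso e e').hom ≫ (s ⊗ₘ t) ≫ (splitIso f f').inv =
      appendHom (e.hom ≫ s ≫ f.inv) (e'.hom ≫ t ≫ f'.inv) := by
  simp [splitIso_inv, splitIso_hom, appendHom]

theorem tensArrow_append (ι : V ⥤ C) (L M : List (Comma (𝟭 C) ι)) : tensArrow ι (L ++ M) =
    appendHom (tensArrow ι L) (tensArrow ι M) := by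
  rw [tensArrow_eq, tensArrow_eq, tensArrow_eq, tensMap_append]

theorem SymHom.map_tensArrow (ι : V ⥤ C) {L M : List (Comma (𝟭 C) ι)}
    (s : SymHom (Comma (𝟭 C) ι) L M) : s.map (Comma.fst (𝟭 C) ι) ≫ tensArrow ι M =
      tensArrow ι L ≫ s.map (Comma.snd (𝟭 C) ι ⋙ ι) := by
  induction s with
  | nil => rfl
  | @cons φ ψ l m m' f h i ih =>
    have e' {W : Type _} [Category W] (G : W ⥤ C) {a b : W} {l m m' : List W} (f : a ≅ b)
        (h : SymHom W l m) (i : Ins b m m') :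
      (SymHom.cons f h i).map G = consHom (G.map f.hom) (h.map G) ≫ i.map G.obj := rfl
    have e2 := Ins.map_naturality (X := (Comma.fst (𝟭 C) ι).obj) (Y := (Comma.snd (𝟭 C) ι ⋙ ι).obj)
      (fun φ => φ.hom) i
    rw [← tensArrow_eq, ← tensArrow_eq] at e2
    rw [e', e', Category.assoc, e2, ← Category.assoc, ← Category.assoc]
    congr 1
    have e3 : ∀ (φ : Comma (𝟭 C) ι) l, tensArrow ι (φ :: l) =
      consHom (X := (Comma.fst (𝟭 C) ι).obj) (Y := (Comma.snd (𝟭 C) ι ⋙ ι).obj) φ.hom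
        (tensArrow ι l) := fun _ _ => rfl
    rw [e3, e3, consHom_comp, consHom_comp, ih]
    congr 1
    exact f.hom.w

namespace FeynmanCategory
variable (𝔉 : FeynmanCategory V C)
include 𝔉

theorem tensorHom_injective_of_isIso {X X' Y Y' : C} {p q : X ⟶ Y} {p' q' : X' ⟶ Y'} [IsIso p]
    [IsIso q] [IsIso p'] [IsIso q'] (h : p ⊗ₘ p' = q ⊗ₘ q') : p = q ∧ p' = q' := by
  obtain ⟨l, ⟨e⟩⟩ := 𝔉.exists_tens X
  obtain ⟨l', ⟨e'⟩⟩ := 𝔉.exists_tens X'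
  obtain ⟨m, ⟨f⟩⟩ := 𝔉.exists_tens Y
  obtain ⟨m', ⟨f'⟩⟩ := 𝔉.exists_tens Y'
  obtain ⟨s, hs⟩ := 𝔉.exists_sym (x := id) (y := id) (e.hom ≫ p ≫ f.inv)
  obtain ⟨s', hs'⟩ := 𝔉.exists_sym (x := id) (y := id) (e'.hom ≫ p' ≫ f'.inv)
  obtain ⟨t, ht⟩ := 𝔉.exists_sym (x := id) (y := id) (e.hom ≫ q ≫ f.inv)
  obtain ⟨t', ht'⟩ := 𝔉.exists_sym (x := id) (y := id) (e'.hom ≫ q' ≫ f'.inv)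
  have : s.append s' = t.append t' := by
    apply 𝔉.sym_map_injective
    rw [WordIso.map_append, WordIso.map_append, hs, hs', ht, ht']
    exact (splitIso_hom_comp e e' f f' p p').symm.trans ((congrArg _ (congrArg (· ≫ _) h)).trans
      (splitIso_hom_comp e e' f f' q q'))
  obtain ⟨rfl, rfl⟩ := WordIso.append_left_injective this
  constructor
  · simpa using hs.symm.trans ht
  · simpa using hs'.symm.trans ht'

theorem exists_presentation {X Z : C} (u : X ⟶ Z) : ∃ (L : List (Comma (𝟭 C) 𝔉.ι))
    (l : tens (Comma.fst (𝟭 C) 𝔉.ι).obj L ≅ X) (r : tens (Comma.snd (𝟭 C) 𝔉.ι ⋙ 𝔉.ι).obj L ≅ Z),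
      l.hom ≫ u = tensArrow 𝔉.ι L ≫ r.hom := by
  obtain ⟨L, ⟨e⟩⟩ := 𝔉.exists_tensArrow u
  exact ⟨L, Arrow.leftFunc.mapIso e, Arrow.rightFunc.mapIso e, e.hom.w⟩

/-- An isomorphism of arrows between tensor products of morphisms with the same targets is a tensor
product of isomorphisms. -/
theorem exists_tensor_iso {X₁ X₂ X₁' X₂' Z₁ Z₂ : C} {u₁ : X₁ ⟶ Z₁} {u₂ : X₂ ⟶ Z₂} {u₁' : X₁' ⟶ Z₁}
    {u₂' : X₂' ⟶ Z₂} {p : X₁ ⊗ X₂ ⟶ X₁' ⊗ X₂'} [IsIso p] (h : p ≫ (u₁' ⊗ₘ u₂') = u₁ ⊗ₘ u₂) :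
    ∃ (p₁ : X₁ ⟶ X₁') (p₂ : X₂ ⟶ X₂'), IsIso p₁ ∧ IsIso p₂ ∧ p = p₁ ⊗ₘ p₂ ∧ p₁ ≫ u₁' = u₁ ∧
      p₂ ≫ u₂' = u₂ := by
  obtain ⟨L₁, l₁, r₁, hl₁⟩ := 𝔉.exists_presentation u₁
  obtain ⟨L₂, l₂, r₂, hl₂⟩ := 𝔉.exists_presentation u₂
  obtain ⟨M₁, m₁, q₁, hm₁⟩ := 𝔉.exists_presentation u₁'
  obtain ⟨M₂, m₂, q₂, hm₂⟩ := 𝔉.exists_presentation u₂'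
  have hw : (splitIso l₁ l₂).hom ≫ (u₁ ⊗ₘ u₂) = tensArrow 𝔉.ι (L₁ ++ L₂) ≫
      (splitIso r₁ r₂).hom := by
    rw [tensArrow_append, ← Iso.eq_inv_comp, splitIso_inv_appendHom, ← hl₁, ← hl₂]; simp
  have hw' : (splitIso m₁ m₂).hom ≫ (u₁' ⊗ₘ u₂') =
      tensArrow 𝔉.ι (M₁ ++ M₂) ≫ (splitIso q₁ q₂).hom := by
    rw [tensArrow_append, ← Iso.eq_inv_comp, splitIso_inv_appendHom, ← hm₁, ← hm₂]; simp
  let a := splitIso l₁ l₂ ≪≫ asIso p ≪≫ (splitIso m₁ m₂).symm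
  let b := splitIso r₁ r₂ ≪≫ (splitIso q₁ q₂).symm
  have hab : a.hom ≫ tensArrow 𝔉.ι (M₁ ++ M₂) = tensArrow 𝔉.ι (L₁ ++ L₂) ≫ b.hom := by
    simp only [a, b, Iso.trans_hom, asIso_hom, Iso.symm_hom, Category.assoc]
    rw [← Category.assoc (tensArrow _ _), ← hw, ← h, Iso.eq_comp_inv] 
    simp only [Category.assoc]
    rw [← hw', Iso.inv_hom_id_assoc]
  obtain ⟨s, ⟨hs, hs'⟩, -⟩ := 𝔉.existsUnique_arrowIso
    (Arrow.isoMk (f := Arrow.mk (tensArrow 𝔉.ι (L₁ ++ L₂)))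
      (g := Arrow.mk (tensArrow 𝔉.ι (M₁ ++ M₂))) a b hab)
  replace hs : s.map (Comma.fst (𝟭 C) 𝔉.ι) = a.hom := hs
  replace hs' : s.map (Comma.snd (𝟭 C) 𝔉.ι ⋙ 𝔉.ι) = b.hom := hs'
  obtain ⟨t₁, ht₁⟩ := 𝔉.exists_sym (x := (Comma.snd (𝟭 C) 𝔉.ι).obj)
    (y := (Comma.snd (𝟭 C) 𝔉.ι).obj) (r₁ ≪≫ q₁.symm).hom
  obtain ⟨t₂, ht₂⟩ := 𝔉.exists_sym (x := (Comma.snd (𝟭 C) 𝔉.ι).obj)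
    (y := (Comma.snd (𝟭 C) 𝔉.ι).obj) (r₂ ≪≫ q₂.symm).hom
  have hst : s.toWordIso (Comma.snd (𝟭 C) 𝔉.ι) = t₁.append t₂ := by
    apply 𝔉.sym_map_injective
    rw [SymHom.map_toWordIso, WordIso.map_append, ht₁, ht₂, hs']
    have := splitIso_hom_comp r₁ r₂ q₁ q₂ (𝟙 _) (𝟙 _)
    rw [id_tensorHom_id, Category.id_comp, Category.id_comp, Category.id_comp] at this
    exact this
  obtain ⟨s₁, s₂, rfl, rfl, rfl⟩ := s.exists_append _ t₁ t₂ hst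
  rw [SymHom.map_toWordIso] at ht₁ ht₂
  have hp : p = (l₁.inv ≫ s₁.map _ ≫ m₁.hom) ⊗ₘ (l₂.inv ≫ s₂.map _ ≫ m₂.hom) := by
    rw [← splitIso_inv_appendHom, ← SymHom.map_append, hs]
    simp [a]
  have h1 : (l₁.inv ≫ s₁.map _ ≫ m₁.hom) ≫ u₁' = u₁ := by
    rw [Category.assoc, Iso.inv_comp_eq, hl₁, Category.assoc, hm₁, ← Category.assoc,
      SymHom.map_tensArrow, ht₁]
    simp
  have h2 : (l₂.inv ≫ s₂.map _ ≫ m₂.hom) ≫ u₂' = u₂ := by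
    rw [Category.assoc, Iso.inv_comp_eq, hl₂, Category.assoc, hm₂, ← Category.assoc,
      SymHom.map_tensArrow, ht₂]
    simp
  have hiso : ∀ {L M : List (Comma (𝟭 C) 𝔉.ι)} (s : SymHom (Comma (𝟭 C) 𝔉.ι) L M),
      IsIso (s.map (Comma.fst (𝟭 C) 𝔉.ι)) := fun s => by
    induction s with
    | nil => exact inferInstanceAs (IsIso (𝟙 (𝟙_ C)))
    | cons f h i ih =>
      have := isIso_consHom ((Comma.fst (𝟭 C) 𝔉.ι).map f.hom) (h.map (Comma.fst (𝟭 C) 𝔉.ι))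
      exact IsIso.comp_isIso
  have := hiso s₁
  have := hiso s₂
  exact ⟨_, _, inferInstance, inferInstance, hp, h1, h2⟩

theorem tensorHom_injective {X₁ X₂ Z₁ Z₂ : C} {u₁ u₁' : X₁ ⟶ Z₁} {u₂ u₂' : X₂ ⟶ Z₂}
    (h : u₁ ⊗ₘ u₂ = u₁' ⊗ₘ u₂') : u₁ = u₁' ∧ u₂ = u₂' := by
  obtain ⟨p₁, p₂, _, _, h0, rfl, rfl⟩ := 𝔉.exists_tensor_iso (p := 𝟙 _)
    ((Category.id_comp _).trans h.symm)
  rw [← id_tensorHom_id] at h0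
  obtain ⟨rfl, rfl⟩ := 𝔉.tensorHom_injective_of_isIso h0
  simp

/-- A morphism to a tensor product is a tensor product of morphisms, up to an isomorphism of its
source. -/
theorem exists_tensor_factor {X Z₁ Z₂ : C} (u : X ⟶ Z₁ ⊗ Z₂) : ∃ (X₁ X₂ : C) (p : X ≅ X₁ ⊗ X₂)
    (u₁ : X₁ ⟶ Z₁) (u₂ : X₂ ⟶ Z₂), u = p.hom ≫ (u₁ ⊗ₘ u₂) := by
  obtain ⟨L, l, r, hl⟩ := 𝔉.exists_presentation u
  obtain ⟨l₁, ⟨e₁⟩⟩ := 𝔉.exists_tens Z₁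
  obtain ⟨l₂, ⟨e₂⟩⟩ := 𝔉.exists_tens Z₂
  obtain ⟨s, hs⟩ := 𝔉.exists_sym (x := id) (y := (Comma.snd (𝟭 C) 𝔉.ι).obj)
    (splitIso e₁ e₂ ≪≫ r.symm).hom
  obtain ⟨L₁, L₂, t₁, t₂, d, hd⟩ := s.exists_split 𝔉.ι
  rw [hs] at hd
  have hn := d.map_naturality (X := (Comma.fst (𝟭 C) 𝔉.ι).obj)
    (Y := (Comma.snd (𝟭 C) 𝔉.ι ⋙ 𝔉.ι).obj) (fun φ => φ.hom)
  rw [← tensArrow_eq, ← tensArrow_eq, tensArrow_append] at hn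
  have : IsIso (d.map (Comma.fst (𝟭 C) 𝔉.ι).obj) := d.canonical.isIso
  have : IsIso (d.map (Comma.snd (𝟭 C) 𝔉.ι ⋙ 𝔉.ι).obj) := d.canonical.isIso
  refine ⟨tens (Comma.fst (𝟭 C) 𝔉.ι).obj L₁, tens (Comma.fst (𝟭 C) 𝔉.ι).obj L₂,
    l.symm ≪≫ (asIso (d.map (Comma.fst (𝟭 C) 𝔉.ι).obj)).symm ≪≫ tensAppend _ _ _,
    tensArrow 𝔉.ι L₁ ≫ inv (t₁.map 𝔉.ι) ≫ e₁.hom, tensArrow 𝔉.ι L₂ ≫ inv (t₂.map 𝔉.ι) ≫ e₂.hom, ?_⟩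
  have h1 : d.map (Comma.snd (𝟭 C) 𝔉.ι ⋙ 𝔉.ι).obj ≫ r.hom =
      appendHom (inv (t₁.map 𝔉.ι)) (inv (t₂.map 𝔉.ι)) ≫ (splitIso e₁ e₂).hom := by
    rw [← cancel_epi (appendHom (t₁.map 𝔉.ι) (t₂.map 𝔉.ι)), ← Category.assoc, ← Category.assoc,
      appendHom_comp, IsIso.hom_inv_id, IsIso.hom_inv_id, appendHom_id, Category.id_comp]
    refine (congrArg (· ≫ r.hom) hd.symm).trans ?_
    simp
  have h2 : d.map (Comma.fst (𝟭 C) 𝔉.ι).obj ≫ l.hom ≫ u =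
      appendHom (tensArrow 𝔉.ι L₁) (tensArrow 𝔉.ι L₂) ≫
        appendHom (inv (t₁.map 𝔉.ι)) (inv (t₂.map 𝔉.ι)) ≫ (splitIso e₁ e₂).hom := by
    rw [hl, ← Category.assoc, hn, Category.assoc, h1]
  simp only [Iso.trans_hom, Iso.symm_hom, asIso_inv, Category.assoc]
  rw [Iso.eq_inv_comp, IsIso.eq_inv_comp, h2]
  simp [appendHom, splitIso_hom]

end FeynmanCategory
end Tensor

section Dec
variable {V : Type u₁} [Groupoid.{v₁} V] {C : Type u} [Category.{v} C]
    [MonoidalCategory C] [SymmetricCategory C]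

namespace FeynmanCategory
variable (𝔉 : FeynmanCategory V C)
include 𝔉

/-- A factorization of a tensor product of morphisms is a tensor product of factorizations. -/
theorem exists_dec {X Z X₁ X₂ Z₁ Z₂ : C} {u : X ⟶ Z} {h : Z ⟶ Z₁ ⊗ Z₂} {p : X ⟶ X₁ ⊗ X₂} [IsIso p]
    {U₁ : X₁ ⟶ Z₁} {U₂ : X₂ ⟶ Z₂} (e : u ≫ h = p ≫ (U₁ ⊗ₘ U₂)) :
    ∃ (Q₁ Q₂ : C) (q : Z ⟶ Q₁ ⊗ Q₂) (x₁ : X₁ ⟶ Q₁) (x₂ : X₂ ⟶ Q₂) (h₁ : Q₁ ⟶ Z₁) (h₂ : Q₂ ⟶ Z₂),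
      IsIso q ∧ u ≫ q = p ≫ (x₁ ⊗ₘ x₂) ∧ h = q ≫ (h₁ ⊗ₘ h₂) ∧ x₁ ≫ h₁ = U₁ ∧ x₂ ≫ h₂ = U₂ := by
  obtain ⟨Q₁, Q₂, q, h₁, h₂, rfl⟩ := 𝔉.exists_tensor_factor h
  obtain ⟨R₁, R₂, r, u₁, u₂, hu⟩ := 𝔉.exists_tensor_factor (u ≫ q.hom)
  obtain ⟨p₁, p₂, _, _, hp, rfl, rfl⟩ := 𝔉.exists_tensor_iso (p := inv p ≫ r.hom)
    (u₁' := u₁ ≫ h₁) (u₂' := u₂ ≫ h₂) (u₁ := U₁) (u₂ := U₂) (by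
      rw [Category.assoc, IsIso.inv_comp_eq, ← e, ← Category.assoc u, hu,
        ← tensorHom_comp_tensorHom]
      simp only [Category.assoc])
  refine ⟨Q₁, Q₂, q.hom, p₁ ≫ u₁, p₂ ≫ u₂, h₁, h₂, inferInstance, ?_, rfl, by simp, by simp⟩
  rw [← tensorHom_comp_tensorHom, ← hp, hu]; simp

theorem exists_dec_of_isIso {X₁ X₂ Z Z₁ Z₂ : C} {h : X₁ ⊗ X₂ ⟶ Z} {q : Z ⟶ Z₁ ⊗ Z₂} {Y₁ Y₂ : C}
    {g₁ : Z₁ ⟶ Y₁} {g₂ : Z₂ ⟶ Y₂} {U₁ : X₁ ⟶ Y₁} {U₂ : X₂ ⟶ Y₂}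
    (e : h ≫ q ≫ (g₁ ⊗ₘ g₂) = U₁ ⊗ₘ U₂) : ∃ (h₁ : X₁ ⟶ Z₁) (h₂ : X₂ ⟶ Z₂),
      h ≫ q = h₁ ⊗ₘ h₂ ∧ h₁ ≫ g₁ = U₁ ∧ h₂ ≫ g₂ = U₂ := by
  obtain ⟨R₁, R₂, r, u₁, u₂, hu⟩ := 𝔉.exists_tensor_factor (h ≫ q)
  rw [← Category.assoc, hu, Category.assoc, tensorHom_comp_tensorHom] at e
  obtain ⟨p₁, p₂, _, _, hp, rfl, rfl⟩ := 𝔉.exists_tensor_iso e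
  exact ⟨p₁ ≫ u₁, p₂ ≫ u₂, by rw [hu, hp, tensorHom_comp_tensorHom], by simp, by simp⟩

end FeynmanCategory

variable {𝔉 : FeynmanCategory V C} {δ : ProperDegree 𝔉} {n : ℕ}

theorem deg_of_isIso {X Y : C} (f : X ⟶ Y) [IsIso f] : δ.deg f = 0 :=
  (δ.deg_eq_zero_iff f).2 inferInstance

theorem isIso_of_comp {X Y Z : C} {f : X ⟶ Y} {g : Y ⟶ Z} [IsIso (f ≫ g)] (δ : ProperDegree 𝔉) :
    IsIso f ∧ IsIso g := by
  have h : δ.deg (f ≫ g) = 0 := deg_of_isIso _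
  rw [δ.deg_comp] at h
  exact ⟨(δ.deg_eq_zero_iff f).1 (by omega), (δ.deg_eq_zero_iff g).1 (by omega)⟩

theorem isIso_of_comp_eq_id {X Y : C} {f : X ⟶ Y} {g : Y ⟶ X} (h : f ≫ g = 𝟙 X)
    (δ : ProperDegree 𝔉) : IsIso f ∧ IsIso g := by
  have : IsIso (f ≫ g) := h ▸ inferInstance
  exact isIso_of_comp δ

namespace Chart

/-- The factorizations of the first factor of a tensor product. -/
def left {X X₁ X₂ Y₁ Y₂ : C} {p : X ⟶ X₁ ⊗ X₂} [IsIso p] {ψ₁ : X₁ ⟶ Y₁} {ψ₂ : X₂ ⟶ Y₂}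
    (χ : Chart δ (p ≫ (ψ₁ ⊗ₘ ψ₂)) n) : Chart δ ψ₁ n where
  toFun x y := χ.toFun (p ≫ (x ⊗ₘ 𝟙 X₂)) (y ⊗ₘ ψ₂)
  card_eq {Z f g} h := by
    rw [χ.card_eq (by rw [Category.assoc, tensorHom_comp_tensorHom, h, Category.id_comp]),
      δ.deg_comp, δ.deg_tensor, deg_of_isIso p, deg_of_isIso (𝟙 X₂)]
    omega
  subset_iff {Z Z' f g f' g'} h h' := by
    rw [χ.subset_iff (by rw [Category.assoc, tensorHom_comp_tensorHom, h, Category.id_comp])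
      (by rw [Category.assoc, tensorHom_comp_tensorHom, h', Category.id_comp])]
    constructor
    · rintro ⟨z, hz, hz'⟩
      obtain ⟨h₁, h₂, e, e₁, e₂⟩ := 𝔉.exists_dec_of_isIso (h := z) (q := 𝟙 _)
        (by rw [Category.id_comp]; exact hz')
      rw [Category.comp_id] at e
      rw [Category.assoc, cancel_epi, e, tensorHom_comp_tensorHom] at hz
      exact ⟨h₁, (𝔉.tensorHom_injective hz).1, e₁⟩
    · rintro ⟨z, rfl, rfl⟩
      exact ⟨z ⊗ₘ 𝟙 X₂, by simp only [Category.assoc, tensorHom_comp_tensorHom,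
          Category.comp_id], by rw [tensorHom_comp_tensorHom, Category.id_comp]⟩
  exists_eq {S} hS := by
    have h0 : (p ≫ (ψ₁ ⊗ₘ 𝟙 X₂)) ≫ (𝟙 Y₁ ⊗ₘ ψ₂) = p ≫ (ψ₁ ⊗ₘ ψ₂) := by
        simp only [Category.assoc, tensorHom_comp_tensorHom,
        Category.id_comp, Category.comp_id]
    obtain ⟨Z, u, w, e, rfl⟩ := χ.exists_eq (hS.trans (χ.subset_ground h0))
    obtain ⟨h, hu, rfl⟩ := (χ.subset_iff e h0).1 hS
    obtain ⟨Q₁, Q₂, q, x₁, x₂, h₁, h₂, _, e₁, rfl, e₂, e₃⟩ := 𝔉.exists_dec hu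
    obtain ⟨_, _⟩ := isIso_of_comp_eq_id e₃ δ
    have e4 : (p ≫ (x₁ ⊗ₘ 𝟙 X₂)) ≫ (h₁ ⊗ₘ ψ₂) = p ≫ (ψ₁ ⊗ₘ ψ₂) := by
      rw [Category.assoc, tensorHom_comp_tensorHom, e₂, Category.id_comp]
    refine ⟨Q₁, x₁, h₁, e₂, (χ.eq_iff e4 e).2 (IsoFactors.symm ⟨asIso (q ≫ (𝟙 _ ⊗ₘ h₂)), ?_, ?_⟩)⟩
    · rw [asIso_hom, ← Category.assoc, e₁, Category.assoc, tensorHom_comp_tensorHom, e₃,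
        Category.comp_id]
    · rw [asIso_hom, Category.assoc, Category.assoc, tensorHom_comp_tensorHom,
        tensorHom_comp_tensorHom, Category.comp_id, Category.id_comp]

/-- The factorizations of the second factor of a tensor product. -/
def right {X X₁ X₂ Y₁ Y₂ : C} {p : X ⟶ X₁ ⊗ X₂} [IsIso p] {ψ₁ : X₁ ⟶ Y₁} {ψ₂ : X₂ ⟶ Y₂}
    (χ : Chart δ (p ≫ (ψ₁ ⊗ₘ ψ₂)) n) : Chart δ ψ₂ n where
  toFun x y := χ.toFun (p ≫ (𝟙 X₁ ⊗ₘ x)) (ψ₁ ⊗ₘ y)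
  card_eq {Z f g} h := by
    rw [χ.card_eq (by rw [Category.assoc, tensorHom_comp_tensorHom, h, Category.id_comp]),
      δ.deg_comp, δ.deg_tensor, deg_of_isIso p, deg_of_isIso (𝟙 X₁)]
    omega
  subset_iff {Z Z' f g f' g'} h h' := by
    rw [χ.subset_iff (by rw [Category.assoc, tensorHom_comp_tensorHom, h, Category.id_comp])
      (by rw [Category.assoc, tensorHom_comp_tensorHom, h', Category.id_comp])]
    constructor
    · rintro ⟨z, hz, hz'⟩
      obtain ⟨h₁, h₂, e, e₁, e₂⟩ := 𝔉.exists_dec_of_isIso (h := z) (q := 𝟙 _)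
        (by rw [Category.id_comp]; exact hz')
      rw [Category.comp_id] at e
      rw [Category.assoc, cancel_epi, e, tensorHom_comp_tensorHom] at hz
      exact ⟨h₂, (𝔉.tensorHom_injective hz).2, e₂⟩
    · rintro ⟨z, rfl, rfl⟩
      exact ⟨𝟙 X₁ ⊗ₘ z, by simp only [Category.assoc, tensorHom_comp_tensorHom,
          Category.comp_id], by rw [tensorHom_comp_tensorHom, Category.id_comp]⟩
  exists_eq {S} hS := by
    have h0 : (p ≫ (𝟙 X₁ ⊗ₘ ψ₂)) ≫ (ψ₁ ⊗ₘ 𝟙 Y₂) = p ≫ (ψ₁ ⊗ₘ ψ₂) := by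
        simp only [Category.assoc, tensorHom_comp_tensorHom,
        Category.id_comp, Category.comp_id]
    obtain ⟨Z, u, w, e, rfl⟩ := χ.exists_eq (hS.trans (χ.subset_ground h0))
    obtain ⟨h, hu, rfl⟩ := (χ.subset_iff e h0).1 hS
    obtain ⟨Q₁, Q₂, q, x₁, x₂, h₁, h₂, _, e₁, rfl, e₂, e₃⟩ := 𝔉.exists_dec hu
    obtain ⟨_, _⟩ := isIso_of_comp_eq_id e₂ δ
    have e4 : (p ≫ (𝟙 X₁ ⊗ₘ x₂)) ≫ (ψ₁ ⊗ₘ h₂) = p ≫ (ψ₁ ⊗ₘ ψ₂) := by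
      rw [Category.assoc, tensorHom_comp_tensorHom, e₃, Category.id_comp]
    refine ⟨Q₂, x₂, h₂, e₃, (χ.eq_iff e4 e).2 (IsoFactors.symm ⟨asIso (q ≫ (h₁ ⊗ₘ 𝟙 _)), ?_, ?_⟩)⟩
    · rw [asIso_hom, ← Category.assoc, e₁, Category.assoc, tensorHom_comp_tensorHom, e₂,
        Category.comp_id]
    · rw [asIso_hom, Category.assoc, Category.assoc, tensorHom_comp_tensorHom,
        tensorHom_comp_tensorHom, Category.comp_id, Category.id_comp]

variable {X Y X₁ X₂ Y₁ Y₂ : C} {φ : X ⟶ Y}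

theorem union_subset (χ : Chart δ φ n) {p : X ⟶ X₁ ⊗ X₂} {U₁ : X₁ ⟶ Y₁} {U₂ : X₂ ⟶ Y₂}
    {W : Y₁ ⊗ Y₂ ⟶ Y} (h : (p ≫ (U₁ ⊗ₘ U₂)) ≫ W = φ) :
    χ.toFun (p ≫ (U₁ ⊗ₘ 𝟙 X₂)) ((𝟙 Y₁ ⊗ₘ U₂) ≫ W) ∪
        χ.toFun (p ≫ (𝟙 X₁ ⊗ₘ U₂)) ((U₁ ⊗ₘ 𝟙 Y₂) ≫ W) ⊆ χ.toFun (p ≫ (U₁ ⊗ₘ U₂)) W := by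
  apply Finset.union_subset
  · refine (χ.subset_iff ?_ h).2 ⟨𝟙 Y₁ ⊗ₘ U₂, by simp only [Category.assoc,
        tensorHom_comp_tensorHom,
        Category.id_comp, Category.comp_id], rfl⟩
    rw [← h]; simp only [Category.assoc, tensorHom_comp_tensorHom_assoc,
      Category.id_comp, Category.comp_id]
  · refine (χ.subset_iff ?_ h).2 ⟨U₁ ⊗ₘ 𝟙 Y₂, by simp only [Category.assoc,
        tensorHom_comp_tensorHom,
        Category.id_comp, Category.comp_id], rfl⟩
    rw [← h]; simp only [Category.assoc, tensorHom_comp_tensorHom_assoc,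
      Category.id_comp, Category.comp_id]

theorem toFun_tensor (𝔠 : CubicalStructure δ) (χ : Chart δ φ n) {p : X ⟶ X₁ ⊗ X₂} [IsIso p]
    {U₁ : X₁ ⟶ Y₁} {U₂ : X₂ ⟶ Y₂} {W : Y₁ ⊗ Y₂ ⟶ Y} (h : (p ≫ (U₁ ⊗ₘ U₂)) ≫ W = φ) :
    χ.toFun (p ≫ (U₁ ⊗ₘ U₂)) W = χ.toFun (p ≫ (U₁ ⊗ₘ 𝟙 X₂)) ((𝟙 Y₁ ⊗ₘ U₂) ≫ W) ∪
        χ.toFun (p ≫ (𝟙 X₁ ⊗ₘ U₂)) ((U₁ ⊗ₘ 𝟙 Y₂) ≫ W) := by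
  have hA : (p ≫ (U₁ ⊗ₘ 𝟙 X₂)) ≫ ((𝟙 Y₁ ⊗ₘ U₂) ≫ W) = φ := by
      rw [← h]; simp only [Category.assoc, tensorHom_comp_tensorHom_assoc,
      Category.id_comp, Category.comp_id]
  have hB : (p ≫ (𝟙 X₁ ⊗ₘ U₂)) ≫ ((U₁ ⊗ₘ 𝟙 Y₂) ≫ W) = φ := by
      rw [← h]; simp only [Category.assoc, tensorHom_comp_tensorHom_assoc,
      Category.id_comp, Category.comp_id]
  have hs := χ.union_subset h
  obtain ⟨Z, u, w, e, he⟩ := χ.exists_eq (hs.trans (χ.subset_ground h))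
  rw [← he] at hs ⊢
  obtain ⟨g, hg, rfl⟩ := (χ.subset_iff e h).1 hs
  have hA' := (χ.subset_iff hA e).1 (he ▸ Finset.subset_union_left)
  have hB' := (χ.subset_iff hB e).1 (he ▸ Finset.subset_union_right)
  obtain ⟨a, ha, ha'⟩ := 𝔠.refines_of_comp (by rw [hg]; simp only [Category.assoc,
      tensorHom_comp_tensorHom,
        Category.id_comp, Category.comp_id]) hA'
  obtain ⟨b, hb, hb'⟩ := 𝔠.refines_of_comp (by rw [hg]; simp only [Category.assoc,
      tensorHom_comp_tensorHom,
        Category.id_comp, Category.comp_id]) hB'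
  obtain ⟨Q₁, Q₂, q, x₁, x₂, g₁, g₂, _, -, rfl, -, -⟩ := 𝔉.exists_dec hg
  obtain ⟨a₁, a₂, -, e₁, -⟩ := 𝔉.exists_dec_of_isIso ha'
  obtain ⟨b₁, b₂, -, -, e₂⟩ := 𝔉.exists_dec_of_isIso hb'
  have i₁ := (isIso_of_comp_eq_id e₁ δ).2
  have i₂ := (isIso_of_comp_eq_id e₂ δ).2
  refine (Finset.eq_of_subset_of_card_le hs ?_).symm
  rw [χ.card_eq e, χ.card_eq h, ← hg, δ.deg_comp, deg_of_isIso (q ≫ _)]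
  simp

theorem disjoint_tensor (𝔠 : CubicalStructure δ) (χ : Chart δ φ n) {p : X ⟶ X₁ ⊗ X₂} [IsIso p]
    {U₁ : X₁ ⟶ Y₁} {U₂ : X₂ ⟶ Y₂} {W : Y₁ ⊗ Y₂ ⟶ Y} (h : (p ≫ (U₁ ⊗ₘ U₂)) ≫ W = φ) :
    Disjoint (χ.toFun (p ≫ (U₁ ⊗ₘ 𝟙 X₂)) ((𝟙 Y₁ ⊗ₘ U₂) ≫ W))
        (χ.toFun (p ≫ (𝟙 X₁ ⊗ₘ U₂)) ((U₁ ⊗ₘ 𝟙 Y₂) ≫ W)) := by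
  have hA : (p ≫ (U₁ ⊗ₘ 𝟙 X₂)) ≫ ((𝟙 Y₁ ⊗ₘ U₂) ≫ W) = φ := by
      rw [← h]; simp only [Category.assoc, tensorHom_comp_tensorHom_assoc,
      Category.id_comp, Category.comp_id]
  have hB : (p ≫ (𝟙 X₁ ⊗ₘ U₂)) ≫ ((U₁ ⊗ₘ 𝟙 Y₂) ≫ W) = φ := by
      rw [← h]; simp only [Category.assoc, tensorHom_comp_tensorHom_assoc,
      Category.id_comp, Category.comp_id]
  rw [← Finset.card_union_eq_card_add_card, ← χ.toFun_tensor 𝔠 h, χ.card_eq h, χ.card_eq hA,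
    χ.card_eq hB]
  simp only [δ.deg_comp, δ.deg_tensor, deg_of_isIso (𝟙 X₁), deg_of_isIso (𝟙 X₂),
    deg_of_isIso p]
  omega

end Chart

section Connected

variable (δ) in
/-- The morphism has positive degree and is not a tensor product of two such morphisms. -/
def Connected {X Z : C} (u : X ⟶ Z) : Prop :=
  0 < δ.deg u ∧ ∀ {X₁ X₂ Z₁ Z₂ : C} (p : X ⟶ X₁ ⊗ X₂) (q : Z₁ ⊗ Z₂ ⟶ Z) [IsIso p] [IsIso q]
    (u₁ : X₁ ⟶ Z₁) (u₂ : X₂ ⟶ Z₂), u = p ≫ (u₁ ⊗ₘ u₂) ≫ q → δ.deg u₁ = 0 ∨ δ.deg u₂ = 0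

theorem deg_tensArrow (L : List (Comma (𝟭 C) 𝔉.ι)) :
    δ.deg (tensArrow 𝔉.ι L) = (L.map fun φ => δ.deg φ.hom).sum := by
  induction L with
  | nil => exact deg_of_isIso (𝟙 (𝟙_ C))
  | cons φ L ih => exact (δ.deg_tensor _ _).trans (by rw [ih]; rfl)

variable (δ) in
/-- The number of factors of positive degree. -/
def numPos (L : List (Comma (𝟭 C) 𝔉.ι)) : ℕ := L.countP fun φ => 0 < δ.deg φ.hom

theorem numPos_pos {L : List (Comma (𝟭 C) 𝔉.ι)} :
    0 < numPos δ L ↔ 0 < δ.deg (tensArrow 𝔉.ι L) := by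
  rw [numPos, List.countP_pos_iff, deg_tensArrow]
  simp only [decide_eq_true_eq, pos_iff_ne_zero (a := List.sum _), ne_eq, List.sum_eq_zero_iff]
  simp [Nat.pos_iff_ne_zero]

theorem SymHom.numPos_eq {L M : List (Comma (𝟭 C) 𝔉.ι)} (s : SymHom (Comma (𝟭 C) 𝔉.ι) L M) :
    numPos δ L = numPos δ M := by
  induction s with
  | nil => rfl
  | @cons φ ψ l m m' f h i ih =>
    rw [numPos, numPos, ← i.perm.countP_eq, List.countP_cons, List.countP_cons]
    rw [numPos, numPos] at ih
    have hw : f.hom.left ≫ ψ.hom = φ.hom ≫ 𝔉.ι.map f.hom.right := f.hom.w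
    have h1 : IsIso f.hom.left := inferInstanceAs (IsIso ((Comma.fst _ _).map f.hom))
    have : δ.deg φ.hom = δ.deg ψ.hom := by
      have := congrArg δ.deg hw
      rw [δ.deg_comp, δ.deg_comp, deg_of_isIso f.hom.left, deg_of_isIso (𝔉.ι.map _)] at this
      omega
    rw [ih, this]

theorem numPos_append (L M : List (Comma (𝟭 C) 𝔉.ι)) :
    numPos δ (L ++ M) = numPos δ L + numPos δ M := List.countP_append

theorem numPos_eq_of_isos {L M : List (Comma (𝟭 C) 𝔉.ι)} {P Q : C} {f : P ⟶ Q}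
    (l : tens (Comma.fst (𝟭 C) 𝔉.ι).obj L ≅ P) (r : tens (Comma.snd (𝟭 C) 𝔉.ι ⋙ 𝔉.ι).obj L ≅ Q)
    (h : l.hom ≫ f = tensArrow 𝔉.ι L ≫ r.hom) {P' Q' : C} {f' : P' ⟶ Q'}
    (l' : tens (Comma.fst (𝟭 C) 𝔉.ι).obj M ≅ P') (r' : tens (Comma.snd (𝟭 C) 𝔉.ι ⋙ 𝔉.ι).obj M ≅ Q')
    (h' : l'.hom ≫ f' = tensArrow 𝔉.ι M ≫ r'.hom) (p : P ≅ P') (q : Q ≅ Q')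
    (e : p.hom ≫ f' = f ≫ q.hom) : numPos δ L = numPos δ M := by
  obtain ⟨s, -, -⟩ := 𝔉.existsUnique_arrowIso
    (Arrow.isoMk (f := Arrow.mk (tensArrow 𝔉.ι L)) (g := Arrow.mk (tensArrow 𝔉.ι M))
      (l ≪≫ p ≪≫ l'.symm) (r ≪≫ q ≪≫ r'.symm) (by
        have h'' : tensArrow 𝔉.ι M = l'.hom ≫ f' ≫ r'.inv := by
          rw [← Category.assoc, h', Category.assoc, Iso.hom_inv_id, Category.comp_id]
        simp only [Iso.trans_hom, Iso.symm_hom, Arrow.mk_hom, Category.assoc]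
        rw [h'', Iso.inv_hom_id_assoc, ← Category.assoc (tensArrow 𝔉.ι L), ← h,
          ← Category.assoc p.hom, e]
        simp only [Category.assoc]))
  exact s.numPos_eq

/-- A basic morphism of positive degree, tensored with an identity, is connected. -/
theorem connected_of_basic {X Z W R : C} {v : V} {u : X ⟶ Z} {f : W ⟶ 𝔉.ι.obj v} (hf : 0 < δ.deg f)
    (p : X ⟶ W ⊗ R) (q : 𝔉.ι.obj v ⊗ R ⟶ Z) [IsIso p] [IsIso q] (h : u = p ≫ (f ⊗ₘ 𝟙 R) ≫ q) :
    Connected δ u := by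
  refine ⟨by rw [h]; simp only [δ.deg_comp, δ.deg_tensor]; omega, ?_⟩
  intro X₁ X₂ Z₁ Z₂ p' q' _ _ u₁ u₂ h'
  by_contra! hu
  obtain ⟨L₁, l₁, r₁, e₁⟩ := 𝔉.exists_presentation u₁
  obtain ⟨L₂, l₂, r₂, e₂⟩ := 𝔉.exists_presentation u₂
  obtain ⟨M, m, r, e⟩ := 𝔉.exists_presentation (𝟙 R)
  let φ : Comma (𝟭 C) 𝔉.ι := ⟨W, v, f⟩
  have hw : (splitIso l₁ l₂).hom ≫ (u₁ ⊗ₘ u₂) = tensArrow 𝔉.ι (L₁ ++ L₂) ≫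
      (splitIso r₁ r₂).hom := by
    rw [tensArrow_append, ← Iso.eq_inv_comp, splitIso_inv_appendHom, ← e₁, ← e₂]; simp
  let l' : tens (Comma.fst (𝟭 C) 𝔉.ι).obj (φ :: M) ≅ W ⊗ R := Iso.refl W ⊗ᵢ m
  let r' : tens (Comma.snd (𝟭 C) 𝔉.ι ⋙ 𝔉.ι).obj (φ :: M) ≅ 𝔉.ι.obj v ⊗ R :=
    Iso.refl (𝔉.ι.obj v) ⊗ᵢ r
  have hw' : l'.hom ≫ (f ⊗ₘ 𝟙 R) = tensArrow 𝔉.ι (φ :: M) ≫ r'.hom := by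
    refine (tensorHom_comp_tensorHom (𝟙 W) m.hom f (𝟙 R)).trans (Eq.trans ?_
      (tensorHom_comp_tensorHom f (tensArrow 𝔉.ι M) (𝟙 (𝔉.ι.obj v)) r.hom).symm)
    rw [e, Category.id_comp, Category.comp_id]
  have := numPos_eq_of_isos (δ := δ) _ _ hw l' r' hw'
    (asIso (inv p' ≫ p)) (asIso (q' ≫ inv q)) (by
      simp only [asIso_hom, Category.assoc, IsIso.inv_comp_eq]
      rw [← Category.assoc _ q', ← Category.assoc p', ← h', h]
      simp only [Category.assoc, IsIso.hom_inv_id, Category.comp_id])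
  have hM : numPos δ M = 0 := by
    by_contra hM
    rw [← ne_eq, ← Nat.pos_iff_ne_zero, numPos_pos] at hM
    have := congrArg δ.deg e
    rw [δ.deg_comp, δ.deg_comp, deg_of_isIso m.hom, deg_of_isIso (𝟙 R)] at this
    omega
  have h1 : numPos δ (φ :: M) ≤ 1 := by
    rw [numPos, List.countP_cons]
    rw [numPos] at hM
    rw [hM]; split_ifs <;> omega
  have key : ∀ {A B : C} {g : A ⟶ B} {L : List (Comma (𝟭 C) 𝔉.ι)}
      {l : tens (Comma.fst (𝟭 C) 𝔉.ι).obj L ≅ A} {r : tens (Comma.snd (𝟭 C) 𝔉.ι ⋙ 𝔉.ι).obj L ≅ B}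
      (_ : l.hom ≫ g = tensArrow 𝔉.ι L ≫ r.hom) (_ : δ.deg g ≠ 0), 0 < numPos δ L := by
    intro A B g L l r hg hd
    rw [numPos_pos]
    have := congrArg δ.deg hg
    rw [δ.deg_comp, δ.deg_comp, deg_of_isIso l.hom, deg_of_isIso r.hom] at this
    omega
  have k₁ := key e₁ hu.1
  have k₂ := key e₂ hu.2
  rw [numPos_append] at this
  omega

theorem connected_of_target {X : C} {v : V} {u : X ⟶ 𝔉.ι.obj v} (hu : 0 < δ.deg u) :
    Connected δ u :=
  connected_of_basic hu (ρ_ X).inv (ρ_ _).hom (by simp)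

theorem Ins.exists_of_mem {A : Type*} {x : A} {l : List A} (h : x ∈ l) :
    ∃ m, Nonempty (Ins x m l) := by
  induction l with
  | nil => cases h
  | cons y l ih =>
    rcases List.mem_cons.1 h with rfl | h
    · exact ⟨l, ⟨.here l⟩⟩
    · obtain ⟨m, ⟨i⟩⟩ := ih h
      exact ⟨_, ⟨.there y i⟩⟩

theorem Connected.exists_basic {X Z : C} {u : X ⟶ Z} (h : Connected δ u) :
    ∃ (W R : C) (v : V) (f : W ⟶ 𝔉.ι.obj v) (p : X ⟶ W ⊗ R) (q : 𝔉.ι.obj v ⊗ R ⟶ Z),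
      IsIso p ∧ IsIso q ∧ 0 < δ.deg f ∧ u = p ≫ (f ⊗ₘ 𝟙 R) ≫ q := by
  obtain ⟨L, l, r, e⟩ := 𝔉.exists_presentation u
  have hL : 0 < numPos δ L := by
    rw [numPos_pos]
    have := congrArg δ.deg e
    rw [δ.deg_comp, δ.deg_comp, deg_of_isIso l.hom, deg_of_isIso r.hom] at this
    have := h.1
    omega
  obtain ⟨φ, hφ, hd⟩ := List.countP_pos_iff.1 hL
  rw [decide_eq_true_eq] at hd
  obtain ⟨M, ⟨i⟩⟩ := Ins.exists_of_mem hφ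
  have hi := i.map_naturality (X := (Comma.fst (𝟭 C) 𝔉.ι).obj)
    (Y := (Comma.snd (𝟭 C) 𝔉.ι ⋙ 𝔉.ι).obj) (fun φ => φ.hom)
  rw [← tensArrow_eq, ← tensArrow_eq] at hi
  let i₁ : φ.left ⊗ tens (Comma.fst (𝟭 C) 𝔉.ι).obj M ⟶ tens (Comma.fst (𝟭 C) 𝔉.ι).obj L :=
    i.map (Comma.fst (𝟭 C) 𝔉.ι).obj
  let i₂ : 𝔉.ι.obj φ.right ⊗ tens (Comma.snd (𝟭 C) 𝔉.ι ⋙ 𝔉.ι).obj M ⟶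
    tens (Comma.snd (𝟭 C) 𝔉.ι ⋙ 𝔉.ι).obj L := i.map (Comma.snd (𝟭 C) 𝔉.ι ⋙ 𝔉.ι).obj
  have I₁ : IsIso i₁ := inferInstanceAs (IsIso (i.map (Comma.fst (𝟭 C) 𝔉.ι).obj))
  have I₂ : IsIso i₂ := inferInstanceAs (IsIso (i.map (Comma.snd (𝟭 C) 𝔉.ι ⋙ 𝔉.ι).obj))
  replace hi : i₁ ≫ tensArrow 𝔉.ι L = (φ.hom ⊗ₘ tensArrow 𝔉.ι M) ≫ i₂ := hi
  have hu : u = (l.inv ≫ inv i₁) ≫ (φ.hom ⊗ₘ tensArrow 𝔉.ι M) ≫ i₂ ≫ r.hom := by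
    rw [← Category.assoc _ i₂, ← hi]
    simp only [Category.assoc]
    rw [← e]; simp
  have h0 := (h.2 (l.inv ≫ inv i₁) (i₂ ≫ r.hom) φ.hom (tensArrow 𝔉.ι M) hu).resolve_left (by
    change ¬ δ.deg φ.hom = 0; omega)
  have : IsIso (tensArrow 𝔉.ι M) := (δ.deg_eq_zero_iff _).1 h0
  refine ⟨φ.left, tens (Comma.fst (𝟭 C) 𝔉.ι).obj M, φ.right, φ.hom, l.inv ≫ inv i₁,
    (𝟙 _ ⊗ₘ tensArrow 𝔉.ι M) ≫ i₂ ≫ r.hom, inferInstance, inferInstance, hd, ?_⟩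
  rw [hu, ← Category.assoc (_ ⊗ₘ _) (_ ⊗ₘ _), tensorHom_comp_tensorHom]
  simp only [Category.id_comp, Category.comp_id]

theorem Connected.comp_iso {X Y Z W : C} {u : X ⟶ Y} (h : Connected δ u) (p : W ⟶ X) (q : Y ⟶ Z)
    [IsIso p] [IsIso q] : Connected δ (p ≫ u ≫ q) := by
  refine ⟨by rw [δ.deg_comp, δ.deg_comp]; have := h.1; omega, ?_⟩
  intro X₁ X₂ Z₁ Z₂ p' q' _ _ u₁ u₂ e
  refine h.2 (inv p ≫ p') (q' ≫ inv q) u₁ u₂ ?_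
  rw [Category.assoc, ← Category.assoc _ q', ← Category.assoc p', ← Category.assoc (inv p)]
  simp only [Category.assoc]
  rw [IsIso.eq_inv_comp, ← cancel_mono q]
  simp only [Category.assoc, IsIso.inv_hom_id, Category.comp_id]
  exact e

theorem Connected.of_isoFactors {X Y Z Z' : C} {u : X ⟶ Z} {w : Z ⟶ Y} {u' : X ⟶ Z'} {w' : Z' ⟶ Y}
    (h : Connected δ u) (e : IsoFactors u w u' w') : Connected δ u' := by
  obtain ⟨z, rfl, -⟩ := e
  have := h.comp_iso (𝟙 _) z.hom
  rwa [Category.id_comp] at this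

variable {X Y : C} {φ : X ⟶ Y}

/-- A connected part of a tensor product is a part of one of the factors. -/
theorem Chart.subset_or_of_connected (χ : Chart δ φ n) {Z X₁ X₂ Y₁ Y₂ : C} {p : X ⟶
    X₁ ⊗ X₂} [IsIso p]
    {U₁ : X₁ ⟶ Y₁} {U₂ : X₂ ⟶ Y₂} {W : Y₁ ⊗ Y₂ ⟶ Y} (h : (p ≫ (U₁ ⊗ₘ U₂)) ≫ W = φ) {u : X ⟶ Z}
    {w : Z ⟶ Y} (hw : u ≫ w = φ) (hu : Connected δ u)
    (hs : χ.toFun u w ⊆ χ.toFun (p ≫ (U₁ ⊗ₘ U₂)) W) :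
    χ.toFun u w ⊆ χ.toFun (p ≫ (U₁ ⊗ₘ 𝟙 X₂)) ((𝟙 Y₁ ⊗ₘ U₂) ≫ W) ∨
      χ.toFun u w ⊆ χ.toFun (p ≫ (𝟙 X₁ ⊗ₘ U₂)) ((U₁ ⊗ₘ 𝟙 Y₂) ≫ W) := by
  have hA : (p ≫ (U₁ ⊗ₘ 𝟙 X₂)) ≫ ((𝟙 Y₁ ⊗ₘ U₂) ≫ W) = φ := by
    rw [← h]; simp only [Category.assoc, tensorHom_comp_tensorHom_assoc, Category.id_comp,
      Category.comp_id]
  have hB : (p ≫ (𝟙 X₁ ⊗ₘ U₂)) ≫ ((U₁ ⊗ₘ 𝟙 Y₂) ≫ W) = φ := by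
    rw [← h]; simp only [Category.assoc, tensorHom_comp_tensorHom_assoc, Category.id_comp,
      Category.comp_id]
  rw [χ.subset_iff hw hA, χ.subset_iff hw hB]
  obtain ⟨g, hg, rfl⟩ := (χ.subset_iff hw h).1 hs
  obtain ⟨Q₁, Q₂, q, x₁, x₂, g₁, g₂, _, e, rfl, e₁, e₂⟩ := 𝔉.exists_dec hg
  rcases hu.2 p (inv q) x₁ x₂ (by rw [← Category.assoc, ← e]; simp) with h0 | h0
  · right
    have : IsIso x₁ := (δ.deg_eq_zero_iff _).1 h0
    refine ⟨q ≫ (inv x₁ ⊗ₘ g₂), ?_, ?_⟩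
    · rw [← Category.assoc, e, Category.assoc, tensorHom_comp_tensorHom, e₂, IsIso.hom_inv_id]
    · simp only [Category.assoc, tensorHom_comp_tensorHom_assoc, ← e₁, IsIso.inv_hom_id_assoc,
        Category.comp_id]
  · left
    have : IsIso x₂ := (δ.deg_eq_zero_iff _).1 h0
    refine ⟨q ≫ (g₁ ⊗ₘ inv x₂), ?_, ?_⟩
    · rw [← Category.assoc, e, Category.assoc, tensorHom_comp_tensorHom, e₁, IsIso.hom_inv_id]
    · simp only [Category.assoc, tensorHom_comp_tensorHom_assoc, ← e₂, IsIso.inv_hom_id_assoc,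
        Category.comp_id]

/-- The sets that correspond to the connected parts of `φ` form a building set. -/
def Chart.buildingSet (𝔠 : CubicalStructure δ) (χ : Chart δ φ n) (hφ : δ.deg φ = n) :
    BuildingSet n where
  mem S := ∃ (Z : C) (u : X ⟶ Z) (w : Z ⟶ Y), u ≫ w = φ ∧ Connected δ u ∧ χ.toFun u w = S
  nonempty := by
    rintro _ ⟨Z, u, w, h, hu, rfl⟩
    rw [← Finset.card_pos, χ.card_eq h]; exact hu.1
  singleton x := by
    obtain ⟨Z, u, w, h, e⟩ := χ.exists_eq (S := {x}) (by
      rw [χ.ground_eq_univ hφ]; exact Finset.subset_univ _)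
    have hd := χ.card_eq h
    rw [e, Finset.card_singleton] at hd
    refine ⟨Z, u, w, h, ⟨by omega, ?_⟩, e⟩
    intro X₁ X₂ Z₁ Z₂ p q _ _ u₁ u₂ hu
    rw [hu, δ.deg_comp, δ.deg_comp, δ.deg_tensor] at hd
    omega
  union := by
    rintro _ _ ⟨Z, u, w, h, hu, rfl⟩ ⟨Z', u', w', h', hu', rfl⟩ ⟨x, hx, hx'⟩
    obtain ⟨Z₀, U, W, h₀, e⟩ := χ.exists_eq (S := χ.toFun u w ∪ χ.toFun u' w') (by
      rw [χ.ground_eq_univ hφ]; exact Finset.subset_univ _)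
    refine ⟨Z₀, U, W, h₀, ⟨?_, ?_⟩, e⟩
    · rw [← χ.card_eq h₀, Finset.card_pos, e]; exact ⟨x, Finset.mem_union_left _ hx⟩
    intro X₁ X₂ Y₁ Y₂ p q _ _ U₁ U₂ hU
    have h₁ : (p ≫ (U₁ ⊗ₘ U₂)) ≫ (q ≫ W) = φ := by rw [← h₀, hU]; simp only [Category.assoc]
    have e₁ : χ.toFun (p ≫ (U₁ ⊗ₘ U₂)) (q ≫ W) = χ.toFun u w ∪ χ.toFun u' w' := by
      rw [← e, χ.eq_iff h₁ h₀]
      exact ⟨asIso q, by rw [hU, asIso_hom, Category.assoc], rfl⟩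
    have hd := χ.disjoint_tensor 𝔠 h₁
    have hA : (p ≫ (U₁ ⊗ₘ 𝟙 X₂)) ≫ ((𝟙 Y₁ ⊗ₘ U₂) ≫ q ≫ W) = φ := by
      rw [← h₁]; simp only [Category.assoc, tensorHom_comp_tensorHom_assoc, Category.id_comp,
        Category.comp_id]
    have hB : (p ≫ (𝟙 X₁ ⊗ₘ U₂)) ≫ ((U₁ ⊗ₘ 𝟙 Y₂) ≫ q ≫ W) = φ := by
      rw [← h₁]; simp only [Category.assoc, tensorHom_comp_tensorHom_assoc, Category.id_comp,
        Category.comp_id]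
    have hcA := χ.card_eq hA
    have hcB := χ.card_eq hB
    simp only [δ.deg_comp, δ.deg_tensor, deg_of_isIso (𝟙 X₁), deg_of_isIso (𝟙 X₂), deg_of_isIso p]
      at hcA hcB
    have hu1 := χ.subset_or_of_connected h₁ h hu (by rw [e₁]; exact Finset.subset_union_left)
    have hu2 := χ.subset_or_of_connected h₁ h' hu' (by rw [e₁]; exact Finset.subset_union_right)
    rw [χ.toFun_tensor 𝔠 h₁] at e₁
    set A := χ.toFun (p ≫ (U₁ ⊗ₘ 𝟙 X₂)) ((𝟙 Y₁ ⊗ₘ U₂) ≫ q ≫ W)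
    set B := χ.toFun (p ≫ (𝟙 X₁ ⊗ₘ U₂)) ((U₁ ⊗ₘ 𝟙 Y₂) ≫ q ≫ W)
    have hdis := Finset.disjoint_left.1 hd
    rcases hu1 with hu1 | hu1 <;> rcases hu2 with hu2 | hu2
    · right
      have : B = ∅ := by
        rw [Finset.eq_empty_iff_forall_notMem]
        intro y hy
        have : y ∈ A ∪ B := Finset.mem_union_right _ hy
        rw [e₁, Finset.mem_union] at this
        exact hdis (this.elim (fun h => hu1 h) fun h => hu2 h) hy
      rw [this, Finset.card_empty] at hcB; omega
    · exact absurd (hu2 hx') (hdis (hu1 hx))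
    · exact absurd (hu1 hx) (hdis (hu2 hx'))
    · left
      have : A = ∅ := by
        rw [Finset.eq_empty_iff_forall_notMem]
        intro y hy
        have : y ∈ A ∪ B := Finset.mem_union_left _ hy
        rw [e₁, Finset.mem_union] at this
        exact hdis hy (this.elim (fun h => hu1 h) fun h => hu2 h)
      rw [this, Finset.card_empty] at hcA; omega

end Connected
end Dec

section BlockSwap
variable {C : Type u} [Category.{v} C] [MonoidalCategory C] [SymmetricCategory C]
  {A : Type*} {X : A → C}

/-- The symmetry exchanging the first two of three factors. -/
def frontSwap (P Q R : C) : P ⊗ (Q ⊗ R) ⟶ Q ⊗ (P ⊗ R) :=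
  (α_ P Q R).inv ≫ (β_ P Q).hom ▷ R ≫ (α_ Q P R).hom

theorem frontSwap_unit_right (P R : C) :
    P ◁ (λ_ R).inv ≫ frontSwap P (𝟙_ C) R ≫ (λ_ _).hom = 𝟙 (P ⊗ R) := by
  simp only [frontSwap, braiding_tensorUnit_right, comp_whiskerRight, Category.assoc]
  simp

theorem frontSwap_tensor_right (P Q Q' R : C) : frontSwap P (Q ⊗ Q') R =
    P ◁ (α_ Q Q' R).hom ≫ frontSwap P Q (Q' ⊗ R) ≫ Q ◁ frontSwap P Q' R ≫ (α_ _ _ _).inv := by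
  simp only [frontSwap, BraidedCategory.braiding_tensor_right_hom, comp_whiskerRight,
    MonoidalCategory.whiskerLeft_comp, Category.assoc]
  monoidal

theorem frontSwap_tensor_left (P P' Q R : C) : frontSwap (P ⊗ P') Q R =
    (α_ P P' _).hom ≫ P ◁ frontSwap P' Q R ≫ frontSwap P Q (P' ⊗ R) ≫ Q ◁ (α_ _ _ _).inv := by
  simp only [frontSwap, BraidedCategory.braiding_tensor_left_hom, comp_whiskerRight,
    MonoidalCategory.whiskerLeft_comp, Category.assoc]
  monoidal

theorem frontSwap_naturality {P Q R P' Q' R' : C} (s : P ⟶ P') (t : Q ⟶ Q') (r : R ⟶ R') :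
    (s ⊗ₘ (t ⊗ₘ r)) ≫ frontSwap P' Q' R' = frontSwap P Q R ≫ (t ⊗ₘ (s ⊗ₘ r)) := by
  simp only [frontSwap, Category.assoc]; exact swap_aux s t r

instance (P Q R : C) : IsIso (frontSwap P Q R) := by unfold frontSwap; infer_instance

theorem canonical_frontSwap (x : A) (k : List A) : ∀ m : List A,
    Canonical X (x :: (m ++ k)) (m ++ (x :: k))
      (X x ◁ (tensAppend X m k).hom ≫ frontSwap (X x) (tens X m) (tens X k) ≫
        (tensAppend X m (x :: k)).inv)
  | [] => (Canonical.refl _).congr (frontSwap_unit_right (X x) (tens X k)).symm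
  | y :: m => ((Canonical.swap x y (m ++ k)).trans ((canonical_frontSwap x k m).cons y)).congr (by
      have aux : ∀ {x y M K N R : C} (μ : N ≅ M ⊗ K) (ν : R ≅ M ⊗ (x ⊗ K)),
          frontSwap x y N ≫ (𝟙 y ⊗ₘ (x ◁ μ.hom ≫ frontSwap x M K ≫ ν.inv)) =
          x ◁ (y ◁ μ.hom ≫ (α_ y M K).inv) ≫ frontSwap x (y ⊗ M) K ≫
            (α_ y M (x ⊗ K)).hom ≫ y ◁ ν.inv := by
        intro x y M K N R μ ν
        have h := frontSwap_naturality (𝟙 x) (𝟙 y) μ.hom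
        rw [frontSwap_tensor_right]
        simp only [id_tensorHom, MonoidalCategory.whiskerLeft_comp, Category.assoc,
          whiskerLeft_inv_hom_assoc, Iso.inv_hom_id_assoc] at h ⊢
        rw [reassoc_of% h]
      exact aux (tensAppend X m k) (tensAppend X m (x :: k)))

theorem canonical_blockSwap (m k : List A) : ∀ l : List A,
    Canonical X (l ++ (m ++ k)) (m ++ (l ++ k)) (blockSwap X l m k)
  | [] => (Canonical.refl _).congr (by
      have aux : ∀ {M K N : C} (μ : N ≅ M ⊗ K), (λ_ N).inv ≫ (𝟙_ C) ◁ μ.hom ≫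
          (α_ _ _ _).inv ≫ (β_ (𝟙_ C) M).hom ▷ K ≫ (α_ _ _ _).hom ≫
            M ◁ (λ_ K).hom ≫ μ.inv = 𝟙 N := by
        intro M K N μ
        simp only [braiding_tensorUnit_left, comp_whiskerRight, Category.assoc]
        simp
      exact (aux (tensAppend X m k)).symm)
  | x :: l => (((canonical_blockSwap m k l).cons x).trans
      (canonical_frontSwap x (l ++ k) m)).congr (by
      have aux : ∀ {x L M K MK LK LMK MLK MxLK : C} (μ : MK ≅ M ⊗ K) (ν : LK ≅ L ⊗ K)
          (ξ : LMK ≅ L ⊗ MK) (ο : MLK ≅ M ⊗ LK) (θ : MxLK ≅ M ⊗ (x ⊗ LK)),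
          (𝟙 x ⊗ₘ (ξ.hom ≫ L ◁ μ.hom ≫ (α_ _ _ _).inv ≫ (β_ L M).hom ▷ K ≫ (α_ _ _ _).hom ≫
            M ◁ ν.inv ≫ ο.inv)) ≫ x ◁ ο.hom ≫ frontSwap x M LK ≫ θ.inv =
          (x ◁ ξ.hom ≫ (α_ x L MK).inv) ≫ (x ⊗ L) ◁ μ.hom ≫ (α_ _ _ _).inv ≫
            (β_ (x ⊗ L) M).hom ▷ K ≫ (α_ _ _ _).hom ≫
            M ◁ ((α_ x L K).hom ≫ x ◁ ν.inv) ≫ θ.inv := by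
        intro x L M K MK LK LMK MLK MxLK μ ν ξ ο θ
        have h := frontSwap_naturality (𝟙 x) (𝟙 M) ν.inv
        have h2 := frontSwap_tensor_left x L M K
        simp only [frontSwap, MonoidalCategory.whiskerLeft_comp] at h2 h ⊢
        simp only [id_tensorHom, MonoidalCategory.whiskerLeft_comp, Category.assoc,
          whiskerLeft_inv_hom_assoc] at h h2 ⊢
        rw [reassoc_of% h2, reassoc_of% h]
        simp
      exact aux (tensAppend X m k) (tensAppend X l k) (tensAppend X l (m ++ k))
        (tensAppend X m (l ++ k)) (tensAppend X m (x :: (l ++ k))))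

/-- Exchanging two single factors. -/
theorem blockSwap_singleton (x y : A) (k : List A) :
    blockSwap X [x] [y] k = swapHom X x y k := by
  have e : ∀ x K : C, x ◁ (λ_ K).inv ≫ (α_ x (𝟙_ C) K).inv = (ρ_ x).inv ▷ K := by
    intro x K; simp
  have e' : ∀ x K : C, (α_ x (𝟙_ C) K).hom ≫ x ◁ (λ_ K).hom = (ρ_ x).hom ▷ K := by
    intro x K; simp
  have aux : ∀ x y K : C, (x ◁ (λ_ (y ⊗ K)).inv ≫ (α_ x (𝟙_ C) _).inv) ≫ (x ⊗ 𝟙_ C) ◁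
      (y ◁ (λ_ K).inv ≫ (α_ y (𝟙_ C) _).inv) ≫ (α_ _ _ _).inv ≫
      (β_ (x ⊗ 𝟙_ C) (y ⊗ 𝟙_ C)).hom ▷ K ≫ (α_ _ _ _).hom ≫
      (y ⊗ 𝟙_ C) ◁ ((α_ x (𝟙_ C) _).hom ≫ x ◁ (λ_ K).hom) ≫
      ((α_ y (𝟙_ C) _).hom ≫ y ◁ (λ_ _).hom) =
      (α_ x y K).inv ≫ (β_ x y).hom ▷ K ≫ (α_ y x K).hom := by
    intro x y K
    have h := frontSwap_naturality (ρ_ x).inv (ρ_ y).inv (𝟙 K)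
    simp only [frontSwap, Category.assoc] at h
    rw [e, e, e', e', ← whisker_exchange_assoc, ← tensorHom_id, ← tensorHom_id, ← id_tensorHom,
      ← id_tensorHom, tensorHom_comp_tensorHom_assoc, Category.id_comp, Category.comp_id,
      reassoc_of% h]
    have e₃ : ((ρ_ y).inv ⊗ₘ ((ρ_ x).inv ⊗ₘ 𝟙 K)) ≫ (𝟙 (y ⊗ 𝟙_ C) ⊗ₘ ((ρ_ x).hom ⊗ₘ 𝟙 K)) ≫
        (ρ_ y).hom ▷ (x ⊗ K) = 𝟙 _ := by
      simp only [← tensorHom_id, tensorHom_comp_tensorHom, Category.comp_id, Iso.inv_hom_id]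
      simp
    simp only [← tensorHom_id] at e₃ ⊢
    rw [e₃, Category.comp_id]
  exact aux (X x) (X y) (tens X k)

end BlockSwap

section Factor
variable {C : Type u} [Category.{v} C] [MonoidalCategory C] {W X Y Z X' Y' Z' X'' Y'' P Q P' Q' : C}

namespace Factor

/-- The composite of a factorization. -/
def comp (A : Factor X Y) : X ⟶ Y := A.left ≫ A.right

/-- The trivial factorization of the identity. -/
def id (X : C) : Factor X X := ⟨X, 𝟙 X, 𝟙 X⟩

/-- The tensor product of two factorizations. -/
def tensor (A : Factor X Y) (B : Factor P Q) : Factor (X ⊗ P) (Y ⊗ Q) :=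
  ⟨A.mid ⊗ B.mid, A.left ⊗ₘ B.left, A.right ⊗ₘ B.right⟩

omit [MonoidalCategory C] in
/-- Composition with a morphism to the source. -/
def precomp (p : W ⟶ X) (A : Factor X Y) : Factor W Y := ⟨A.mid, p ≫ A.left, A.right⟩

omit [MonoidalCategory C] in
/-- Composition with a morphism from the target. -/
def postcomp (A : Factor X Y) (q : Y ⟶ Z) : Factor X Z := ⟨A.mid, A.left, A.right ≫ q⟩

open Classical in
/-- The factorization of `A.comp ≫ f` in which `f` belongs to the left part if `b` holds; otherwise
the left part is that of `A`. -/
noncomputable def node (b : Prop) (A : Factor X Y) (f : Y ⟶ Z) : Factor X Z :=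
  if b then ⟨Z, A.comp ≫ f, 𝟙 Z⟩ else A.postcomp f

/-- The factorizations correspond under morphisms of sources and targets. -/
def Rel (A : Factor X Y) (B : Factor X' Y') (p : X ⟶ X') (q : Y ⟶ Y') : Prop :=
  ∃ h : A.mid ≅ B.mid, A.left ≫ h.hom = p ≫ B.left ∧ h.hom ≫ B.right = A.right ≫ q

variable {A : Factor X Y} {B : Factor X' Y'} {p : X ⟶ X'} {q : Y ⟶ Y'}

theorem Rel.refl (A : Factor X Y) : A.Rel A (𝟙 X) (𝟙 Y) := ⟨Iso.refl _, by simp, by simp⟩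

theorem Rel.congr (h : A.Rel B p q) {p' : X ⟶ X'} {q' : Y ⟶ Y'} (e : p = p') (e' : q = q') :
    A.Rel B p' q' := e ▸ e' ▸ h

theorem Rel.trans {D : Factor X'' Y''} {p' : X' ⟶ X''} {q' : Y' ⟶ Y''} (h : A.Rel B p q)
    (h' : B.Rel D p' q') : A.Rel D (p ≫ p') (q ≫ q') := by
  obtain ⟨z, h1, h2⟩ := h
  obtain ⟨z', h3, h4⟩ := h'
  exact ⟨z ≪≫ z', by simp [reassoc_of% h1, h3], by simp [h4, reassoc_of% h2]⟩

theorem Rel.symm (h : A.Rel B p q) {p' : X' ⟶ X} {q' : Y' ⟶ Y} (hp : p' ≫ p = 𝟙 _)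
    (hq : q ≫ q' = 𝟙 _) : B.Rel A p' q' := by
  obtain ⟨z, h1, h2⟩ := h
  refine ⟨z.symm, ?_, ?_⟩
  · rw [Iso.symm_hom, Iso.comp_inv_eq, Category.assoc, h1, reassoc_of% hp]
  · rw [Iso.symm_hom, Iso.inv_comp_eq, reassoc_of% h2, hq, Category.comp_id]

theorem Rel.tensor {A' : Factor P Q} {B' : Factor P' Q'} {p' : P ⟶ P'} {q' : Q ⟶ Q'}
    (h : A.Rel B p q) (h' : A'.Rel B' p' q') :
    (A.tensor A').Rel (B.tensor B') (p ⊗ₘ p') (q ⊗ₘ q') := by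
  obtain ⟨z, h1, h2⟩ := h
  obtain ⟨z', h3, h4⟩ := h'
  refine ⟨z ⊗ᵢ z', ?_, ?_⟩
  · exact (tensorHom_comp_tensorHom _ _ _ _).trans
      ((congrArg₂ _ h1 h3).trans (tensorHom_comp_tensorHom _ _ _ _).symm)
  · exact (tensorHom_comp_tensorHom _ _ _ _).trans
      ((congrArg₂ _ h2 h4).trans (tensorHom_comp_tensorHom _ _ _ _).symm)

theorem Rel.comp_eq (h : A.Rel B p q) : p ≫ B.comp = A.comp ≫ q := by
  obtain ⟨z, h1, h2⟩ := h
  rw [comp, comp, ← reassoc_of% h1, h2, Category.assoc]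

theorem Rel.precomp (h : A.Rel B p q) {r : W ⟶ X} {r' : Z ⟶ X'} {p' : W ⟶ Z}
    (e : p' ≫ r' = r ≫ p) : (A.precomp r).Rel (B.precomp r') p' q := by
  obtain ⟨z, h1, h2⟩ := h
  exact ⟨z, by simp only [Factor.precomp, Category.assoc]; rw [h1, reassoc_of% e], h2⟩

theorem Rel.postcomp (h : A.Rel B p q) {r : Y ⟶ Z} {r' : Y' ⟶ Z'} {q' : Z ⟶ Z'}
    (e : q ≫ r' = r ≫ q') : (A.postcomp r).Rel (B.postcomp r') p q' := by
  obtain ⟨z, h1, h2⟩ := h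
  exact ⟨z, h1, by simp only [Factor.postcomp, Category.assoc]; rw [← e, reassoc_of% h2]⟩

theorem Rel.node (h : A.Rel B p q) {b b' : Prop} (hb : b ↔ b') {r : Y ⟶ Z} {r' : Y' ⟶ Z'}
    {q' : Z ⟶ Z'} [IsIso q'] (e : q ≫ r' = r ≫ q') : (A.node b r).Rel (B.node b' r') p q' := by
  obtain rfl : b = b' := propext hb
  by_cases hb : b
  · rw [Factor.node, Factor.node, if_pos hb, if_pos hb]
    exact ⟨asIso q', by simp only [asIso_hom, Category.assoc]; rw [← e, ← Category.assoc p,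
        h.comp_eq, Category.assoc], by simp⟩
  · rw [Factor.node, Factor.node, if_neg hb, if_neg hb]
    exact h.postcomp e

theorem comp_node (b : Prop) (A : Factor X Y) (f : Y ⟶ Z) : (A.node b f).comp = A.comp ≫ f := by
  rw [node]; split_ifs
  · exact Category.comp_id _
  · exact (Category.assoc _ _ _).symm

theorem comp_tensor (A : Factor X Y) (B : Factor P Q) : (A.tensor B).comp = A.comp ⊗ₘ B.comp :=
  tensorHom_comp_tensorHom _ _ _ _

theorem node_pos {b : Prop} (hb : b) (A : Factor X Y) (f : Y ⟶ Z) :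
    A.node b f = ⟨Z, A.comp ≫ f, 𝟙 Z⟩ := if_pos hb

theorem node_neg {b : Prop} (hb : ¬ b) (A : Factor X Y) (f : Y ⟶ Z) :
    A.node b f = A.postcomp f := if_neg hb

/-- The tensor product of factorizations, on concatenated lists. -/
def append {A B : Type*} {X : A → C} {Y : B → C} {l m : List A} {l' m' : List B}
    (F : Factor (tens X l) (tens Y l')) (G : Factor (tens X m) (tens Y m')) :
    Factor (tens X (l ++ m)) (tens Y (l' ++ m')) :=
  ((F.tensor G).precomp (tensAppend X l m).hom).postcomp (tensAppend Y l' m').inv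

/-- The tensor product of factorizations, on a concatenated list of sources. -/
def splice {A B : Type*} {X : A → C} {Y : B → C} {l m : List A} {y : B} {m' : List B}
    (F : Factor (tens X l) (Y y)) (G : Factor (tens X m) (tens Y m')) :
    Factor (tens X (l ++ m)) (tens Y (y :: m')) :=
  (F.tensor G).precomp (tensAppend X l m).hom

/-- The tensor product of factorizations. -/
def cons {A B : Type*} {X : A → C} {Y : B → C} {x : A} {y : B} {m : List A} {m' : List B}
    (F : Factor (X x) (Y y)) (G : Factor (tens X m) (tens Y m')) :
    Factor (tens X (x :: m)) (tens Y (y :: m')) :=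
  F.tensor G

section Lists
variable {A B D : Type*} {X : A → C} {Y : B → C} {l m l' m' : List A} {k n k' n' : List B}

theorem Rel.append {F : Factor (tens X l) (tens Y k)} {F' : Factor (tens X l') (tens Y k')}
    {G : Factor (tens X m) (tens Y n)} {G' : Factor (tens X m') (tens Y n')}
    {p : tens X l ⟶ tens X l'} {p' : tens X m ⟶ tens X m'} {q : tens Y k ⟶ tens Y k'}
    {q' : tens Y n ⟶ tens Y n'} (h : F.Rel F' p q) (h' : G.Rel G' p' q') :
    (F.append G).Rel (F'.append G') (appendHom p p') (appendHom q q') := by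
  refine ((h.tensor h').precomp ?_).postcomp ?_ <;> simp [appendHom]

theorem Rel.splice {y y' : B} {F : Factor (tens X l) (Y y)} {F' : Factor (tens X l') (Y y')}
    {G : Factor (tens X m) (tens Y n)} {G' : Factor (tens X m') (tens Y n')}
    {p : tens X l ⟶ tens X l'} {p' : tens X m ⟶ tens X m'} {q : Y y ⟶ Y y'}
    {q' : tens Y n ⟶ tens Y n'} (h : F.Rel F' p q) (h' : G.Rel G' p' q') :
    (F.splice G).Rel (F'.splice G') (appendHom p p') (consHom q q') := by
  refine (h.tensor h').precomp ?_; simp [appendHom]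

theorem Rel.cons {x x' : A} {y y' : B} {F : Factor (X x) (Y y)} {F' : Factor (X x') (Y y')}
    {G : Factor (tens X m) (tens Y n)} {G' : Factor (tens X m') (tens Y n')}
    {p : X x ⟶ X x'} {p' : tens X m ⟶ tens X m'} {q : Y y ⟶ Y y'}
    {q' : tens Y n ⟶ tens Y n'} (h : F.Rel F' p q) (h' : G.Rel G' p' q') :
    (F.cons G).Rel (F'.cons G') (consHom p p') (consHom q q') := h.tensor h'

theorem Rel.append_splice {F : Factor (tens X l) (tens Y k)} {F' : Factor (tens X l') (tens Y k')}
    {G : Factor (tens X m) (tens Y n)} {G' : Factor (tens X m') (tens Y n')}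
    {p : tens X l ⟶ tens X l'} {p' : tens X m ⟶ tens X m'} {q : tens Y k ⟶ tens Y k'}
    {q' : tens Y n ⟶ tens Y n'} (h : F.Rel F' p q) (h' : G.Rel G' p' q') {y : B}
    (f : tens Y k' ⟶ Y y) : (F.append G).Rel ((F'.postcomp f).splice G') (appendHom p p')
      (spliceHom (q ≫ f) q') := by
  have h1 : F.postcomp (q ≫ f) |>.Rel (F'.postcomp f) p (𝟙 (Y y)) := h.postcomp (by simp)
  obtain ⟨z, h1, h2⟩ := (h1.tensor h').precomp (r := (tensAppend X l m).hom)
    (r' := (tensAppend X l' m').hom) (p' := appendHom p p') (by simp [appendHom])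
  refine ⟨z, h1, h2.trans ?_⟩
  have aux : ∀ {L M L' M' N P Q : C} (μ : N ≅ L' ⊗ M') (r : L ⟶ L') (g : M ⟶ M') (u : L' ⟶ P)
      (v : M' ⟶ Q), ((r ⊗ₘ g) ≫ μ.inv) ≫ μ.hom ≫ (u ⊗ₘ v) = (r ≫ u) ⊗ₘ (g ≫ v) := by
    intros; simp
  have e := aux (tensAppend Y k n) F.right G.right (q ≫ f) q'
  refine Eq.trans ?_ e.symm
  exact (tensorHom_comp_tensorHom _ _ _ _).trans (congrArg (· ⊗ₘ _) (Category.comp_id _))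

theorem append_nil_rel (G : Factor (tens X m) (tens Y n)) :
    G.Rel (append (l := []) (l' := []) (X := X) (Y := Y) (Factor.id (𝟙_ C)) G) (𝟙 _) (𝟙 _) := by
  refine ⟨(λ_ G.mid).symm, ?_, ?_⟩
  · change G.left ≫ (λ_ G.mid).inv = 𝟙 _ ≫ (λ_ _).inv ≫ (𝟙 _ ⊗ₘ G.left)
    simp
  · change (λ_ G.mid).inv ≫ (𝟙 _ ⊗ₘ G.right) ≫ (λ_ _).hom = G.right ≫ 𝟙 _
    simp

theorem append_cons_rel {x : A} {y : B} (E : Factor (X x) (Y y)) (F : Factor (tens X l) (tens Y k))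
    (G : Factor (tens X m) (tens Y n)) :
    (E.cons (F.append G)).Rel ((E.cons F).append G) (𝟙 (tens X (x :: (l ++ m)))) (𝟙 _) := by
  have aux : ∀ {P P' L M N L' M' N' : C} (μ : N ≅ L ⊗ M) (μ' : N' ≅ L' ⊗ M') (E : Factor P P')
      (F : Factor L L') (G : Factor M M'),
      (E.tensor (((F.tensor G).precomp μ.hom).postcomp μ'.inv)).Rel
        ((((E.tensor F).tensor G).precomp (P ◁ μ.hom ≫ (α_ _ _ _).inv)).postcomp
          ((α_ _ _ _).hom ≫ P' ◁ μ'.inv)) (𝟙 _) (𝟙 _) := by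
    intro P P' L M N L' M' N' μ μ' E F G
    refine ⟨(α_ _ _ _).symm, ?_, ?_⟩
    · simp only [tensor, precomp, postcomp, Iso.symm_hom, Category.assoc, Category.id_comp]
      rw [← associator_inv_naturality, ← id_tensorHom, tensorHom_comp_tensorHom_assoc,
        Category.id_comp]
    · simp only [tensor, precomp, postcomp, Iso.symm_hom, Category.comp_id]
      rw [associator_naturality_assoc, Iso.inv_hom_id_assoc, ← id_tensorHom,
        tensorHom_comp_tensorHom, Category.comp_id]
  exact aux (tensAppend X l m) (tensAppend Y k n) E F G

theorem append_splice_rel {L : List A} {y : B} (E : Factor (tens X L) (Y y))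
    (F : Factor (tens X l) (tens Y k)) (G : Factor (tens X m) (tens Y n)) :
    (E.splice (F.append G)).Rel ((E.splice F).append G) (inv (assocHom X L l m))
      (𝟙 (tens Y (y :: (k ++ n)))) := by
  have aux : ∀ {P P' L M N L' M' N' R S T : C} (μ : N ≅ L ⊗ M) (μ' : N' ≅ L' ⊗ M') (ν : R ≅ P ⊗ L)
      (ξ : S ≅ R ⊗ M) (ζ : T ≅ P ⊗ N) (E : Factor P P')
      (F : Factor L L') (G : Factor M M') (z : T ⟶ S) (_ : z ≫ ξ.hom ≫ ν.hom ▷ M ≫ (α_ _ _ _).hom =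
        ζ.hom ≫ P ◁ μ.hom),
      ((E.tensor (((F.tensor G).precomp μ.hom).postcomp μ'.inv)).precomp ζ.hom).Rel
        (((((E.tensor F).precomp ν.hom).tensor G).precomp ξ.hom).postcomp
          ((α_ _ _ _).hom ≫ P' ◁ μ'.inv)) z (𝟙 _) := by
    intro P P' L M N L' M' N' R S T μ μ' ν ξ ζ E F G z hz
    refine ⟨(α_ _ _ _).symm, ?_, ?_⟩
    · simp only [tensor, precomp, postcomp, Iso.symm_hom, Category.assoc]
      have h1 : (ν.hom ≫ (E.left ⊗ₘ F.left) ⊗ₘ G.left) =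
          ν.hom ▷ M ≫ ((E.left ⊗ₘ F.left) ⊗ₘ G.left) := by
        rw [← tensorHom_id, tensorHom_comp_tensorHom, Category.id_comp]
      have h2 : (E.left ⊗ₘ μ.hom ≫ (F.left ⊗ₘ G.left)) =
          P ◁ μ.hom ≫ (E.left ⊗ₘ (F.left ⊗ₘ G.left)) := by
        rw [← id_tensorHom, tensorHom_comp_tensorHom, Category.id_comp]
      rw [← cancel_mono (α_ _ _ _).hom]
      simp only [Category.assoc, Iso.inv_hom_id, Category.comp_id]
      rw [h1, h2, Category.assoc, associator_naturality, ← reassoc_of% hz]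
    · simp only [tensor, precomp, postcomp, Iso.symm_hom, Category.comp_id]
      rw [associator_naturality_assoc, Iso.inv_hom_id_assoc, ← id_tensorHom,
        tensorHom_comp_tensorHom, Category.comp_id]
  refine aux (tensAppend X l m) (tensAppend Y k n) (tensAppend X L l) (tensAppend X (L ++ l) m)
    (tensAppend X L (l ++ m)) E F G _ ?_
  rw [IsIso.inv_comp_eq]
  simp [assocHom]

variable [SymmetricCategory C] in
theorem append_swap_rel {A B : Type*} {X : A → C} {Y : B → C} {l m p : List A} {k n q : List B}
    (E : Factor (tens X l) (tens Y k)) (F : Factor (tens X m) (tens Y n))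
    (G : Factor (tens X p) (tens Y q)) :
    (E.append (F.append G)).Rel (F.append (E.append G)) (blockSwap X l m p)
      (blockSwap Y k n q) := by
  have h1 := swap_aux E.left F.left G.left
  have h2 := swap_aux E.right F.right G.right
  have e : ∀ {P Q R S T : C} (f : P ⟶ Q) (g : R ⟶ S) (g' : S ⟶ T), (f ⊗ₘ (g ≫ g')) =
    P ◁ g ≫ (f ⊗ₘ g') := by
    intros; rw [← id_tensorHom, tensorHom_comp_tensorHom, Category.id_comp]
  have e' : ∀ {P Q R S T : C} (f : P ⟶ Q) (g : R ⟶ S) (g' : S ⟶ T), (f ⊗ₘ (g ≫ g')) =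
    (f ⊗ₘ g) ≫ Q ◁ g' := by
    intros; rw [← id_tensorHom, tensorHom_comp_tensorHom, Category.comp_id]
  refine ⟨⟨frontSwap E.mid F.mid G.mid, frontSwap F.mid E.mid G.mid, ?_, ?_⟩, ?_, ?_⟩
  · exact swap_swap_aux _ _ _
  · exact swap_swap_aux _ _ _
  · simp only [append, tensor, precomp, postcomp, blockSwap, frontSwap, Category.assoc] at h1 ⊢
    rw [e, e, Category.assoc, h1]
    simp
  · simp only [append, tensor, precomp, postcomp, blockSwap, frontSwap, Category.assoc] at h2 ⊢
    rw [e', e', Category.assoc, Category.assoc]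
    simp only [whiskerLeft_inv_hom_assoc, Iso.inv_hom_id_assoc]
    rw [reassoc_of% h2]

end Lists
end Factor
end Factor

section Cut
variable {V : Type u₁} [Groupoid.{v₁} V] {C : Type u} [Category.{v} C]
    [MonoidalCategory C] [SymmetricCategory C] {𝔉 : FeynmanCategory V C} {δ : ProperDegree 𝔉}
    {n : ℕ} {a : Fin n → V}

namespace Forest

/-- The factorization of the composite of a forest obtained by
    cutting the edges with names in `P`. -/
noncomputable def cut (P : Set ℕ) : ∀ {l : List V} (F : Forest δ a l),
    Factor (tens (fun i => 𝔉.ι.obj (a i)) F.leaves) (tens 𝔉.ι.obj l)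
  | _, .nil => Factor.id (𝟙_ C)
  | _, .leaf i F => Factor.cons (X := fun i => 𝔉.ι.obj (a i)) (Y := 𝔉.ι.obj) (x := i) (y := a i)
      (Factor.id (𝔉.ι.obj (a i))) (F.cut P)
  | _, .node e f _ ch F => Factor.splice (X := fun i => 𝔉.ι.obj (a i)) (Y := 𝔉.ι.obj)
      ((ch.cut P).node (e ∈ P) f) (F.cut P)

theorem comp_cut (P : Set ℕ) {l : List V} (F : Forest δ a l) : (F.cut P).comp = F.comp := by
  induction F with
  | nil => exact Category.id_comp _
  | leaf i F ih =>
    refine (Factor.comp_tensor _ _).trans ?_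
    rw [ih]
    exact congrArg (· ⊗ₘ _) (Category.id_comp (𝟙 (𝔉.ι.obj (a i))))
  | node e f hf ch F ih1 ih2 =>
    refine (Category.assoc _ _ _).trans ?_
    refine (congrArg _ (Factor.comp_tensor _ _)).trans ?_
    rw [Factor.comp_node, ih1, ih2]; rfl

theorem cut_congr {P Q : Set ℕ} {l : List V} (F : Forest δ a l) (h : ∀ e ∈ F.names, e ∈ P ↔ e ∈ Q) :
    F.cut P = F.cut Q := by
  induction F with
  | nil => rfl
  | leaf i F ih => simp only [cut]; rw [ih h]
  | node e f hf ch F ih1 ih2 =>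
    simp only [names, List.mem_cons, List.mem_append] at h
    have he : (e ∈ P) = (e ∈ Q) := propext (h e (.inl rfl))
    simp only [cut]
    rw [ih1 fun x hx => h x (.inr (.inl hx)), ih2 fun x hx => h x (.inr (.inr hx)), he]

theorem cut_append {l m : List V} (A : Forest δ a l) (B : Forest δ a m) :
    ∃ π, Canonical (fun i => 𝔉.ι.obj (a i)) (A.append B).leaves (A.leaves ++ B.leaves) π ∧
      ∀ P : Set ℕ, ((A.append B).cut P).Rel ((A.cut P).append (B.cut P)) π (𝟙 _) := by
  induction A with
  | nil => exact ⟨_, Canonical.refl B.leaves, fun P => Factor.append_nil_rel _⟩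
  | leaf i A ih =>
    obtain ⟨π, h1, h2⟩ := ih
    refine ⟨_, h1.cons i, fun P => ?_⟩
    have h3 := Factor.Rel.cons (X := fun i => 𝔉.ι.obj (a i)) (Y := 𝔉.ι.obj) (x := i) (y := a i)
      (x' := i) (y' := a i) (Factor.Rel.refl (Factor.id (𝔉.ι.obj (a i)))) (h2 P)
    refine (h3.trans (Factor.append_cons_rel (X := fun i => 𝔉.ι.obj (a i)) (Y := 𝔉.ι.obj)
      (x := i) (y := a i) (Factor.id (𝔉.ι.obj (a i))) (A.cut P) (B.cut P))).congr ?_ ?_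
    · exact Category.comp_id _
    · rw [consHom_id]; exact Category.comp_id _
  | node e f hf ch A ih1 ih2 =>
    obtain ⟨π, h1, h2⟩ := ih2
    refine ⟨_, (h1.append_left ch.leaves).trans (Canonical.assoc_inv _ _ _), fun P => ?_⟩
    have h3 := Factor.Rel.splice (Y := 𝔉.ι.obj) (Factor.Rel.refl ((ch.cut P).node (e ∈ P) f)) (h2 P)
    refine (h3.trans (Factor.append_splice_rel ((ch.cut P).node (e ∈ P) f) (A.cut P)
      (B.cut P))).congr rfl ?_
    rw [consHom_id]; exact Category.comp_id _

theorem Iso.cut {l l' : List V} {F : Forest δ a l} {F' : Forest δ a l'}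
    {s : tens 𝔉.ι.obj l ⟶ tens 𝔉.ι.obj l'} (h : Iso F F' s) :
    ∃ π, Canonical (fun i => 𝔉.ι.obj (a i)) F.leaves F'.leaves π ∧
      ∀ P : Set ℕ, (F.cut P).Rel (F'.cut P) π s := by
  induction h with
  | nil => exact ⟨_, .nil, fun P => Factor.Rel.refl _⟩
  | leaf i h ih =>
    obtain ⟨π, h1, h2⟩ := ih
    exact ⟨_, h1.cons i, fun P => Factor.Rel.cons (X := fun i => 𝔉.ι.obj (a i)) (Y := 𝔉.ι.obj)
      (x := i) (y := a i) (x' := i) (y' := a i) (Factor.Rel.refl _) (h2 P)⟩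
  | node e hf hf' hch b hb h ih1 ih2 =>
    obtain ⟨π, h1, h2⟩ := ih2
    obtain ⟨ρ, h3, h4⟩ := ih1
    exact ⟨_, h3.append h1, fun P => Factor.Rel.splice (Y :=
        𝔉.ι.obj) ((h4 P).node Iff.rfl hb) (h2 P)⟩
  | swap A B F =>
    obtain ⟨π₁, h1, h1'⟩ := cut_append A (B.append F)
    obtain ⟨π₂, h2, h2'⟩ := cut_append B F
    obtain ⟨π₃, h3, h3'⟩ := cut_append B (A.append F)
    obtain ⟨π₄, h4, h4'⟩ := cut_append A F
    obtain ⟨π₅, h5, h5', h5''⟩ := (h3.trans (h4.append_left B.leaves)).symm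
    refine ⟨_, (h1.trans (h2.append_left A.leaves)).trans
      ((canonical_blockSwap _ _ _).trans h5), fun P => ?_⟩
    have H1 := (h1' P).trans ((Factor.Rel.refl (A.cut P)).append (h2' P))
    have H2 := (h3' P).trans ((Factor.Rel.refl (B.cut P)).append (h4' P))
    refine ((H1.trans (Factor.append_swap_rel _ _ _)).trans (H2.symm h5'' (q' :=
        𝟙 _) ?_)).congr ?_ ?_
    · simp [appendHom_id]
    · simp only [Category.assoc]
    · simp [appendHom_id]
  | trans h h' ih1 ih2 =>
    obtain ⟨π, h1, h2⟩ := ih1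
    obtain ⟨ρ, h3, h4⟩ := ih2
    exact ⟨_, h1.trans h3, fun P => (h2 P).trans (h4 P)⟩

theorem cut_contract (e : ℕ) {l : List V} (A : Forest δ a l) :
    ∃ π, Canonical (fun i => 𝔉.ι.obj (a i)) (A.contract e).forest.leaves A.leaves π ∧
      ∀ P : Set ℕ, e ∉ P → ((A.contract e).forest.cut P).Rel (A.cut P) π (A.contract e).layer := by
  induction A with
  | nil => exact ⟨_, Canonical.refl [], fun P _ => Factor.Rel.refl _⟩
  | leaf i A ih =>
    obtain ⟨π, h1, h2⟩ := ih
    exact ⟨_, h1.cons i, fun P hP => Factor.Rel.cons (X := fun i => 𝔉.ι.obj (a i)) (Y := 𝔉.ι.obj)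
      (x := i) (y := a i) (x' := i) (y' := a i) (Factor.Rel.refl _) (h2 P hP)⟩
  | node e' f hf ch A ih1 ih2 =>
    obtain ⟨π, h1, h2⟩ := ih2
    obtain ⟨ρ, h3, h4⟩ := ih1
    by_cases he : e' = e
    · rw [contract_node_pos he]
      obtain ⟨τ, h5, h6⟩ := cut_append (ch.contract e).forest (A.contract e).forest
      refine ⟨_, h5.trans (h3.append h1), fun P hP => ?_⟩
      have : e' ∉ P := he ▸ hP
      have h7 : (((ch.contract e).forest.cut P).append ((A.contract e).forest.cut P)).Rel
          (((ch.cut P).node (e' ∈ P) f).splice (A.cut P)) (appendHom ρ π)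
          (spliceHom ((ch.contract e).layer ≫ f) (A.contract e).layer) := by
        rw [Factor.node_neg this]
        exact (h4 P hP).append_splice (h2 P hP) f
      exact ((h6 P).trans h7).congr rfl (Category.id_comp _)
    · rw [contract_node_neg he]
      refine ⟨_, h3.append h1, fun P hP => ?_⟩
      refine Factor.Rel.splice (Y := 𝔉.ι.obj) ((h4 P hP).node Iff.rfl ?_) (h2 P hP)
      rw [Category.comp_id]

theorem cut_rename (ρ : ℕ → ℕ) {l : List V} (A : Forest δ a l) :
    ∃ π, Canonical (fun i => 𝔉.ι.obj (a i)) (A.rename ρ).leaves A.leaves π ∧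
      ∀ P : Set ℕ, ((A.rename ρ).cut P).Rel (A.cut (ρ ⁻¹' P)) π (𝟙 _) := by
  induction A with
  | nil => exact ⟨_, .nil, fun P => Factor.Rel.refl _⟩
  | leaf i A ih =>
    obtain ⟨π, h1, h2⟩ := ih
    exact ⟨_, h1.cons i, fun P => (Factor.Rel.cons (X := fun i => 𝔉.ι.obj (a i)) (Y := 𝔉.ι.obj)
      (x := i) (y := a i) (x' := i) (y' := a i) (Factor.Rel.refl _) (h2 P)).congr rfl (consHom_id _ _)⟩
  | node e f hf ch A ih1 ih2 =>
    obtain ⟨π, h1, h2⟩ := ih2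
    obtain ⟨σ, h3, h4⟩ := ih1
    exact ⟨_, h3.append h1, fun P => (Factor.Rel.splice (Y := 𝔉.ι.obj) ((h4 P).node Iff.rfl
      (q' := 𝟙 _) (by simp)) (h2 P)).congr rfl (consHom_id _ _)⟩

end Forest
end Cut

section Uniqueness
variable {V : Type u₁} [Groupoid.{v₁} V] {C : Type u} [Category.{v} C]
    [MonoidalCategory C] [SymmetricCategory C] {𝔉 : FeynmanCategory V C} {δ : ProperDegree 𝔉}
    {n : ℕ} {a : Fin n → V}

namespace Factor

theorem Rel.of_precomp {X Y X' Y' W W' : C} {A : Factor X Y} {B : Factor X' Y'} {r : W ≅ X}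
    {r' : W' ≅ X'} {p : W ⟶ W'} {q : Y ⟶ Y'} (h : (A.precomp r.hom).Rel (B.precomp r'.hom) p q) :
    A.Rel B (r.inv ≫ p ≫ r'.hom) q := by
  obtain ⟨z, h1, h2⟩ := h
  let z' : A.mid ≅ B.mid := z
  replace h1 : (r.hom ≫ A.left) ≫ z'.hom = p ≫ r'.hom ≫ B.left := h1
  refine ⟨z', ?_, h2⟩
  rw [Category.assoc, Iso.eq_inv_comp, ← Category.assoc, h1, Category.assoc]

theorem Rel.of_tensor (𝔉 : FeynmanCategory V C) {X Y X' Y' P Q P' Q' : C} {A : Factor X Y}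
    {A' : Factor X' Y'} {B : Factor P Q} {B' : Factor P' Q'} {p : X ⟶ X'} {q : Y ⟶ Y'} {p' : P ⟶ P'}
    {q' : Q ⟶ Q'} (h : (A.tensor B).Rel (A'.tensor B') (p ⊗ₘ p') (q ⊗ₘ q')) :
    A.Rel A' p q ∧ B.Rel B' p' q' := by
  obtain ⟨z, h1, h2⟩ := h
  let y : A.mid ⊗ B.mid ≅ A'.mid ⊗ B'.mid := z
  replace h1 : (A.left ⊗ₘ B.left) ≫ y.hom = (p ⊗ₘ p') ≫ (A'.left ⊗ₘ B'.left) := h1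
  replace h2 : y.hom ≫ (A'.right ⊗ₘ B'.right) = (A.right ⊗ₘ B.right) ≫ (q ⊗ₘ q') := h2
  rw [tensorHom_comp_tensorHom] at h1 h2
  obtain ⟨z₁, z₂, _, _, hz, e₁, e₂⟩ := 𝔉.exists_tensor_iso h2
  rw [hz, tensorHom_comp_tensorHom] at h1
  obtain ⟨e₃, e₄⟩ := 𝔉.tensorHom_injective h1
  exact ⟨⟨asIso z₁, e₃, e₁⟩, ⟨asIso z₂, e₄, e₂⟩⟩

theorem Rel.exists_tensor (𝔉 : FeynmanCategory V C) {ι : Type*} [Nonempty ι]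
    {X Y X' Y' P Q P' Q' : C} {A : ι → Factor X Y}
    {A' : ι → Factor X' Y'} {B : ι → Factor P Q} {B' : ι → Factor P' Q'} {π : X ⊗ P ⟶ X' ⊗ P'}
    [IsIso π] {q : Y ⟶ Y'} {q' : Q ⟶ Q'}
    (h : ∀ i, ((A i).tensor (B i)).Rel ((A' i).tensor (B' i)) π (q ⊗ₘ q')) :
    ∃ (p : X ⟶ X') (p' : P ⟶ P'), IsIso p ∧ IsIso p' ∧ π = p ⊗ₘ p' ∧
      (∀ i, (A i).Rel (A' i) p q) ∧ ∀ i, (B i).Rel (B' i) p' q' := by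
  obtain ⟨i₀⟩ := ‹Nonempty ι›
  have h0 := (h i₀).comp_eq
  rw [comp_tensor, comp_tensor, tensorHom_comp_tensorHom] at h0
  obtain ⟨p, p', i1, i2, rfl, -, -⟩ := 𝔉.exists_tensor_iso h0
  exact ⟨p, p', i1, i2, rfl, fun i => (Rel.of_tensor 𝔉 (h i)).1, fun i => (Rel.of_tensor 𝔉 (h i)).2⟩

end Factor

theorem FeynmanCategory.canonical_of_append (𝔉 : FeynmanCategory V C) {L L' M M' : List (Fin n)}
    {p : tens (fun i => 𝔉.ι.obj (a i)) L ⟶ tens (fun i => 𝔉.ι.obj (a i)) L'}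
    {p' : tens (fun i => 𝔉.ι.obj (a i)) M ⟶ tens (fun i => 𝔉.ι.obj (a i)) M'} [IsIso p] [IsIso p']
    (h : Canonical (fun i => 𝔉.ι.obj (a i)) (L ++ M) (L' ++ M') (appendHom p p')) :
    Canonical (fun i => 𝔉.ι.obj (a i)) L L' p ∧ Canonical (fun i => 𝔉.ι.obj (a i)) M M' p' := by
  obtain ⟨d, hd⟩ := h.exists_reorder
  obtain ⟨t, rfl⟩ := 𝔉.exists_sym (x := a) (y := a) p
  obtain ⟨t', rfl⟩ := 𝔉.exists_sym (x := a) (y := a) p'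
  rw [← WordIso.map_append, ← Reorder.map_toWordIso] at hd
  obtain ⟨r, r', rfl, rfl⟩ := d.exists_append t t' (𝔉.sym_map_injective hd)
  rw [Reorder.map_toWordIso, Reorder.map_toWordIso]
  exact ⟨r.canonical, r'.canonical⟩

theorem FeynmanCategory.canonical_of_cons (𝔉 : FeynmanCategory V C) {i i' : Fin n}
    {M M' : List (Fin n)} {p : 𝔉.ι.obj (a i) ⟶ 𝔉.ι.obj (a i')}
    {p' : tens (fun i => 𝔉.ι.obj (a i)) M ⟶ tens (fun i => 𝔉.ι.obj (a i)) M'} [IsIso p] [IsIso p']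
    (h : Canonical (fun i => 𝔉.ι.obj (a i)) (i :: M) (i' :: M')
      (consHom (X := fun i => 𝔉.ι.obj (a i)) (Y := fun i => 𝔉.ι.obj (a i)) p p')) :
    (∃ e : i = i', p = eqToHom (by rw [e])) ∧ Canonical (fun i => 𝔉.ι.obj (a i)) M M' p' := by
  have hI : IsIso (consHom (X := fun i => 𝔉.ι.obj (a i)) (Y := fun i => 𝔉.ι.obj (a i)) (l := [])
    (m := []) p (𝟙 (tens (fun i => 𝔉.ι.obj (a i)) []))) := inferInstanceAs (IsIso (p ⊗ₘ 𝟙 _))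
  obtain ⟨h1, h2⟩ := 𝔉.canonical_of_append (L := [i]) (L' := [i']) (p := consHom (X :=
      fun i => 𝔉.ι.obj (a i)) (Y := fun i => 𝔉.ι.obj (a i)) (l := []) (m :=
          []) p (𝟙 (tens (fun i => 𝔉.ι.obj (a i)) []))) (p' := p')
    (h.congr (by rw [appendHom_cons]; exact (congrArg _ (appendHom_nil p')).symm))
  refine ⟨?_, h2⟩
  obtain ⟨d, hd⟩ := h1.exists_reorder
  obtain rfl : i = i' := by simpa using h1.perm
  refine ⟨rfl, ?_⟩
  have h3 := h1.eq_of_nodup (Canonical.refl [i]) (List.nodup_singleton i)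
  exact (𝔉.tensorHom_injective (h3.trans (id_tensorHom_id _ _).symm)).1

namespace Forest

theorem exists_singleton {v : V} {m : List V} (F : Forest δ a (v :: m)) :
    ∃ (T : Forest δ a [v]) (G : Forest δ a m), F = T.append G := by
  cases F with
  | leaf i G => exact ⟨.leaf i .nil, G, rfl⟩
  | node e f hf ch G => exact ⟨.node e f hf ch .nil, G, rfl⟩

theorem Iso.append_singleton {v : V} (T : Forest δ a [v]) {m m' : List V} {G : Forest δ a m}
    {G' : Forest δ a m'} {s : tens 𝔉.ι.obj m ⟶ tens 𝔉.ι.obj m'} (h : Iso G G' s) :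
    Iso (T.append G) (T.append G') (consHom (𝟙 (𝔉.ι.obj v)) s) :=
  ((Iso.refl T).append h).congr (by
    rw [← consHom_id, appendHom_cons]
    exact congrArg (consHom _) (appendHom_nil s))

/-- Any tree of a forest can be moved to the front. -/
theorem exists_front {v : V} {m m' : List V} (i : Ins v m m') (F : Forest δ a m') :
    ∃ F' : Forest δ a (v :: m), Iso F' F (i.map 𝔉.ι.obj) := by
  induction i with
  | here l => exact ⟨F, Iso.refl F⟩
  | there y i ih =>
    obtain ⟨T, G, rfl⟩ := F.exists_singleton
    obtain ⟨G', hG⟩ := ih G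
    obtain ⟨T', H, rfl⟩ := G'.exists_singleton
    refine ⟨T'.append (T.append H), ((Iso.swap T' T H).trans (Iso.append_singleton T hG)).congr ?_⟩
    rw [blockSwap_singleton, Ins.map_there]

theorem isIso_left_cut {P : Set ℕ} {l : List V} (F : Forest δ a l) (h : ∀ e ∈ F.names, e ∉ P) :
    IsIso (F.cut P).left := by
  induction F with
  | nil => exact inferInstanceAs (IsIso (𝟙 _))
  | leaf i F ih => 
    have := ih h
    exact inferInstanceAs (IsIso (𝟙 (𝔉.ι.obj (a i)) ⊗ₘ (F.cut P).left))
  | node e f hf ch F ih1 ih2 =>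
    simp only [names, List.mem_cons, List.mem_append] at h
    have h1 := ih1 fun x hx => h x (.inr (.inl hx))
    have h2 := ih2 fun x hx => h x (.inr (.inr hx))
    simp only [cut]
    rw [Factor.node_neg (h e (.inl rfl))]
    exact inferInstanceAs (IsIso ((tensAppend _ _ _).hom ≫ ((ch.cut P).left ⊗ₘ (F.cut P).left)))

theorem isIso_right_cut {P : Set ℕ} {l : List V} (F : Forest δ a l) (h : ∀ e ∈ F.names, e ∈ P) :
    IsIso (F.cut P).right := by
  induction F with
  | nil => exact inferInstanceAs (IsIso (𝟙 _))
  | leaf i F ih =>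
    have := ih h
    exact inferInstanceAs (IsIso (𝟙 (𝔉.ι.obj (a i)) ⊗ₘ (F.cut P).right))
  | node e f hf ch F ih1 ih2 =>
    simp only [names, List.mem_cons, List.mem_append] at h
    have h2 := ih2 fun x hx => h x (.inr (.inr hx))
    simp only [cut]
    rw [Factor.node_pos (h e (.inl rfl))]
    exact inferInstanceAs (IsIso (𝟙 _ ⊗ₘ (F.cut P).right))

theorem Iso.of_cut_node (𝔠 : CubicalStructure δ) {l l' : List V} {v v' : V} {e e' : ℕ}
    {f : tens 𝔉.ι.obj l ⟶ 𝔉.ι.obj v} {f' : tens 𝔉.ι.obj l' ⟶ 𝔉.ι.obj v'} (hf' : 0 < δ.deg f')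
    {ch : Forest δ a l} {ch' : Forest δ a l'}
    {p : tens (fun i => 𝔉.ι.obj (a i)) ch.leaves ⟶ tens (fun i => 𝔉.ι.obj (a i)) ch'.leaves}
    {b : v ⟶ v'} (he : e ∉ ch.names) (he' : e' ∉ ch'.names)
    (h : ∀ P : Set ℕ, ((ch.cut P).node (e ∈ P) f).Rel ((ch'.cut P).node (e' ∈ P) f') p (𝔉.ι.map b)) :
    e = e' ∧ ∃ r : tens 𝔉.ι.obj l ⟶ tens 𝔉.ι.obj l', IsIso r ∧ r ≫ f' = f ≫ 𝔉.ι.map b ∧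
      ∀ P, (ch.cut P).Rel (ch'.cut P) p r := by
  have hee : e = e' := by
    by_contra hee
    have h0 := h {e}
    rw [Factor.node_pos (Set.mem_singleton e), Factor.node_neg (by simpa using Ne.symm hee)] at h0
    obtain ⟨z, -, h2⟩ := h0
    have := congrArg δ.deg h2
    have hz := deg_of_isIso (δ := δ) z.hom
    simp only [Factor.postcomp, δ.deg_comp, deg_of_isIso (𝟙 (𝔉.ι.obj v)),
      deg_of_isIso (𝔉.ι.map b)] at this
    omega
  subst hee
  refine ⟨rfl, ?_⟩
  have key : ∀ P : Set ℕ, e ∉ P → ∃ z : (ch.cut P).mid ≅ (ch'.cut P).mid,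
      (ch.cut P).left ≫ z.hom = p ≫ (ch'.cut P).left ∧
      z.hom ≫ (ch'.cut P).right ≫ f' = (ch.cut P).right ≫ f ≫ 𝔉.ι.map b := by
    intro P hP
    have := h P
    rw [Factor.node_neg hP, Factor.node_neg hP] at this
    obtain ⟨z, h1, h2⟩ := this
    exact ⟨z, h1, h2.trans (Category.assoc _ _ _)⟩
  have I1 : IsIso (ch.cut {e}ᶜ).right :=
    ch.isIso_right_cut fun x hx => by rintro rfl; exact he hx
  have I2 : IsIso (ch'.cut {e}ᶜ).right :=
    ch'.isIso_right_cut fun x hx => by rintro rfl; exact he' hx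
  obtain ⟨z, h1, h2⟩ := key {e}ᶜ (by simp)
  have hr : ch.comp ≫ CategoryTheory.inv (ch.cut {e}ᶜ).right ≫ z.hom ≫
      (ch'.cut {e}ᶜ).right = p ≫ ch'.comp := by
    rw [← comp_cut {e}ᶜ, ← comp_cut {e}ᶜ, Factor.comp, Factor.comp, Category.assoc,
      IsIso.hom_inv_id_assoc, ← Category.assoc, h1, Category.assoc]
  have hr' : (CategoryTheory.inv (ch.cut {e}ᶜ).right ≫ z.hom ≫ (ch'.cut {e}ᶜ).right) ≫ f' = f ≫
      𝔉.ι.map b := by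
    rw [Category.assoc, Category.assoc, IsIso.inv_comp_eq, h2]
  refine ⟨_, inferInstance, hr', fun P => ?_⟩
  set r := CategoryTheory.inv (ch.cut {e}ᶜ).right ≫ z.hom ≫ (ch'.cut {e}ᶜ).right
  rw [ch.cut_congr (P := P) (Q := P \ {e}), ch'.cut_congr (P := P) (Q := P \ {e})]
  rotate_left
  · intro x hx; simp only [Set.mem_sdiff, Set.mem_singleton_iff, iff_self_and]
    rintro - rfl; exact he' hx
  · intro x hx; simp only [Set.mem_sdiff, Set.mem_singleton_iff, iff_self_and]
    rintro - rfl; exact he hx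
  obtain ⟨z', h3, h4⟩ := key (P \ {e}) (by simp)
  obtain ⟨y, h5, h6⟩ := 𝔠.isoFactors_of_comp (u := (ch.cut (P \ {e})).left)
    (w := (ch.cut (P \ {e})).right ≫ r) (u' := p ≫ (ch'.cut (P \ {e})).left)
    (w' := (ch'.cut (P \ {e})).right) (by
      rw [← Category.assoc, Category.assoc p]
      change (ch.cut _).comp ≫ r = p ≫ (ch'.cut _).comp
      rw [comp_cut, comp_cut, hr]) (f := f') ⟨z', h3, by
      rw [h4, Category.assoc _ r, hr']⟩
  exact ⟨y, h5, h6⟩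

theorem Iso.of_cut_front {v : V} {m l' : List V} {F : Forest δ a (v :: m)} {F' : Forest δ a l'}
    {s : tens 𝔉.ι.obj (v :: m) ⟶ tens 𝔉.ι.obj l'} [IsIso s]
    {π : tens (fun i => 𝔉.ι.obj (a i)) F.leaves ⟶ tens (fun i => 𝔉.ι.obj (a i)) F'.leaves}
    (hπ : Canonical (fun i => 𝔉.ι.obj (a i)) F.leaves F'.leaves π) (hF' : F'.names.Nodup)
    (h : ∀ P : Set ℕ, (F.cut P).Rel (F'.cut P) π s) :
    ∃ (v' : V) (m' : List V) (b : v ⟶ v') (r : tens 𝔉.ι.obj m ⟶ tens 𝔉.ι.obj m')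
      (F'' : Forest δ a (v' :: m'))
      (ρ : tens (fun i => 𝔉.ι.obj (a i)) F.leaves ⟶ tens (fun i => 𝔉.ι.obj (a i)) F''.leaves),
      IsIso r ∧ F''.names.Nodup ∧ Canonical (fun i => 𝔉.ι.obj (a i)) F.leaves F''.leaves ρ ∧
      (∀ P : Set ℕ, (F.cut P).Rel (F''.cut P) ρ (consHom (𝔉.ι.map b) r)) ∧
      (Iso F F'' (consHom (𝔉.ι.map b) r) → Iso F F' s) := by
  obtain ⟨w, rfl⟩ := 𝔉.exists_sym (x := fun v => v) (y := fun v => v) s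
  cases w with
  | @cons _ v' _ m' _ b w j =>
    obtain ⟨F'', hF''⟩ := exists_front j F'
    obtain ⟨τ, hτ, hc⟩ := hF''.cut
    obtain ⟨τ', hτ', e1, e2⟩ := hτ.symm
    refine ⟨v', m', b.hom, w.map 𝔉.ι, F'', π ≫ τ', inferInstance, hF''.names_perm.nodup_iff.2 hF',
      hπ.trans hτ', fun P => ?_, fun h' => ?_⟩
    · refine ((h P).trans ((hc P).symm e2 (IsIso.hom_inv_id _))).congr rfl ?_
      rw [WordIso.map_cons, Category.assoc]
      exact (congrArg _ (IsIso.hom_inv_id _)).trans (Category.comp_id _)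
    · exact h'.trans hF''

theorem Iso.of_cut (𝔠 : CubicalStructure δ) {l l' : List V} {F : Forest δ a l} {F' : Forest δ a l'}
    {s : tens 𝔉.ι.obj l ⟶ tens 𝔉.ι.obj l'} [IsIso s]
    {π : tens (fun i => 𝔉.ι.obj (a i)) F.leaves ⟶ tens (fun i => 𝔉.ι.obj (a i)) F'.leaves}
    (hπ : Canonical (fun i => 𝔉.ι.obj (a i)) F.leaves F'.leaves π) (hF : F.names.Nodup)
    (hF' : F'.names.Nodup) (h : ∀ P : Set ℕ, (F.cut P).Rel (F'.cut P) π s) : Iso F F' s := by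
  induction F generalizing l' with
  | nil =>
    obtain ⟨w, rfl⟩ := 𝔉.exists_sym (x := fun v => v) (y := fun v => v) s
    cases w
    cases F'
    exact Iso.nil
  | leaf i F ih =>
    obtain ⟨v', m', b, r, F'', ρ, _, hn, hρ, hc, himp⟩ := Iso.of_cut_front hπ hF' h
    refine himp ?_
    have Iρ := hρ.isIso
    cases F'' with
    | leaf i' G =>
      let ρ' : 𝔉.ι.obj (a i) ⊗ tens (fun i => 𝔉.ι.obj (a i)) F.leaves ⟶
        𝔉.ι.obj (a i') ⊗ tens (fun i => 𝔉.ι.obj (a i)) G.leaves := ρ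
      have : IsIso ρ' := Iρ
      obtain ⟨p, p', _, _, hp, h1, h2⟩ := Factor.Rel.exists_tensor 𝔉 (π := ρ') hc
      obtain rfl : ρ = consHom (X := fun i => 𝔉.ι.obj (a i)) (Y :=
          fun i => 𝔉.ι.obj (a i)) p p' := hp
      obtain ⟨⟨rfl, rfl⟩, hp'⟩ := 𝔉.canonical_of_cons hρ
      have hb := (h1 ∅).comp_eq
      have hb' : 𝔉.ι.map b = 𝟙 _ := by
        simpa [Factor.comp, Factor.id] using hb.symm
      rw [hb']
      exact Iso.leaf i (ih hp' hF hn h2)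
    | node e f hf ch G =>
      exfalso
      let ρ' : 𝔉.ι.obj (a i) ⊗ tens (fun i => 𝔉.ι.obj (a i)) F.leaves ⟶
        tens (fun i => 𝔉.ι.obj (a i)) ch.leaves ⊗ tens (fun i => 𝔉.ι.obj (a i)) G.leaves :=
        ρ ≫ (tensAppend _ _ _).hom
      have : IsIso ρ' := IsIso.comp_isIso' Iρ (tensAppend _ ch.leaves G.leaves).isIso_hom
      have h0 : ρ' ≫ ((ch.comp ≫ f) ⊗ₘ G.comp) = 𝔉.ι.map b ⊗ₘ (F.comp ≫ r) := by
        have h0 := (hc ∅).comp_eq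
        rw [comp_cut, comp_cut] at h0
        exact (Category.assoc _ _ _).trans (h0.trans
          ((tensorHom_comp_tensorHom _ _ _ _).trans (congrArg (· ⊗ₘ _) (Category.id_comp _))))
      obtain ⟨p, p', _, _, -, h1, -⟩ := 𝔉.exists_tensor_iso h0
      have := congrArg δ.deg h1
      rw [δ.deg_comp, δ.deg_comp, deg_of_isIso (𝔉.ι.map b)] at this
      omega
  | node e f hf ch F ih1 ih2 =>
    obtain ⟨v', m', b, r, F'', ρ, _, hn, hρ, hc, himp⟩ := Iso.of_cut_front hπ hF' h
    refine himp ?_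
    have Iρ := hρ.isIso
    cases F'' with
    | leaf i' G =>
      exfalso
      let ρ' : tens (fun i => 𝔉.ι.obj (a i)) ch.leaves ⊗ tens (fun i => 𝔉.ι.obj (a i)) F.leaves ⟶ 𝔉.ι.obj (a i') ⊗ tens (fun i => 𝔉.ι.obj (a i)) G.leaves :=
         (tensAppend _ _ _).inv ≫ ρ
      have : IsIso ρ' := IsIso.comp_isIso' inferInstance Iρ
      have h0 : ρ' ≫ (𝟙 _ ⊗ₘ G.comp) = ((ch.comp ≫ f) ≫ 𝔉.ι.map b) ⊗ₘ (F.comp ≫ r) := by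
        have h0 := (hc ∅).comp_eq
        rw [comp_cut, comp_cut] at h0
        have aux : ∀ {N L M L' M' L'' M'' : C} (μ : N ≅ L ⊗ M) (x : L ⟶ L') (y : M ⟶ M')
            (x' : L' ⟶ L'') (y' : M' ⟶ M''),
            μ.inv ≫ (μ.hom ≫ (x ⊗ₘ y)) ≫ (x' ⊗ₘ y') = (x ≫ x') ⊗ₘ (y ≫ y') := by
          intros; simp
        exact (Category.assoc _ _ _).trans ((congrArg _ h0).trans (aux _ _ _ _ _))
      obtain ⟨p, p', _, _, -, h1, -⟩ := 𝔉.exists_tensor_iso h0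
      have := congrArg δ.deg h1
      rw [δ.deg_comp, δ.deg_comp, δ.deg_comp, deg_of_isIso p,
        deg_of_isIso (𝟙 (𝔉.ι.obj (a i')))] at this
      omega
    | node e' f' hf' ch' G =>
      let ρ' : tens (fun i => 𝔉.ι.obj (a i)) ch.leaves ⊗ tens (fun i => 𝔉.ι.obj (a i)) F.leaves ⟶
        tens (fun i => 𝔉.ι.obj (a i)) ch'.leaves ⊗ tens (fun i => 𝔉.ι.obj (a i)) G.leaves :=
        (tensAppend _ _ _).inv ≫ ρ ≫ (tensAppend _ _ _).hom
      have : IsIso ρ' :=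
        IsIso.comp_isIso' (tensAppend _ ch.leaves F.leaves).isIso_inv
          (IsIso.comp_isIso' Iρ (tensAppend _ ch'.leaves G.leaves).isIso_hom)
      obtain ⟨p, p', _, _, hp, h1, h2⟩ := Factor.Rel.exists_tensor 𝔉 (π := ρ')
        (A := fun P => (ch.cut P).node (e ∈ P) f) (B := fun P => F.cut P)
        (A' := fun P => (ch'.cut P).node (e' ∈ P) f') (B' := fun P => G.cut P)
        (q := 𝔉.ι.map b) (q' := r) (fun P =>
          (Factor.Rel.of_precomp (r := tensAppend _ _ _) (r' := tensAppend _ _ _) (hc P)))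
      have aux : ∀ {N L N' L' : C} (μ : N ≅ L) (μ' : N' ≅ L') (x : N ⟶ N'),
          x = μ.hom ≫ (μ.inv ≫ x ≫ μ'.hom) ≫ μ'.inv := by
        intros; simp
      obtain rfl : ρ = appendHom p p' := (aux (tensAppend _ ch.leaves F.leaves)
        (tensAppend _ ch'.leaves G.leaves) ρ).trans
          (congrArg (fun z => (tensAppend _ _ _).hom ≫ z ≫ (tensAppend _ _ _).inv) hp)
      obtain ⟨hp1, hp2⟩ := 𝔉.canonical_of_append hρ
      simp only [names, List.nodup_cons, List.mem_append, not_or, List.nodup_append] at hF hn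
      obtain ⟨rfl, t, _, ht, h3⟩ := Iso.of_cut_node 𝔠 hf' hF.1.1 hn.1.1 h1
      exact Iso.node e hf hf' (ih1 hp1 hF.2.1 hn.2.1 h3) b ht (ih2 hp2 hF.2.2.1 hn.2.2.1 h2)

end Forest
end Uniqueness

section Parts
variable {V : Type u₁} [Groupoid.{v₁} V] {C : Type u} [Category.{v} C]
    [MonoidalCategory C] [SymmetricCategory C] {𝔉 : FeynmanCategory V C} {δ : ProperDegree 𝔉}
    {n N : ℕ} {a : Fin n → V}

theorem frontSwap_frontSwap (P Q R : C) : frontSwap P Q R ≫ frontSwap Q P R = 𝟙 _ :=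
  swap_swap_aux P Q R

theorem Connected.id_tensor {X Z : C} {u : X ⟶ Z} (h : Connected δ u) (P : C) :
    Connected δ (𝟙 P ⊗ₘ u) := by
  obtain ⟨W, R, v, f, p, q, _, _, hd, rfl⟩ := h.exists_basic
  refine connected_of_basic hd ((𝟙 P ⊗ₘ p) ≫ frontSwap P W R) (frontSwap _ P R ≫ (𝟙 P ⊗ₘ q)) ?_
  have := frontSwap_naturality (𝟙 P) f (𝟙 R)
  rw [id_tensorHom_id] at this
  rw [Category.assoc, ← reassoc_of% this, reassoc_of% frontSwap_frontSwap,
    tensorHom_comp_tensorHom, tensorHom_comp_tensorHom, Category.comp_id, Category.comp_id]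

theorem Connected.tensor_id {X Z : C} {u : X ⟶ Z} (h : Connected δ u) (P : C) :
    Connected δ (u ⊗ₘ 𝟙 P) := by
  have := (h.id_tensor P).comp_iso (β_ X P).hom (β_ P Z).hom
  rwa [BraidedCategory.braiding_naturality, SymmetricCategory.symmetry_assoc] at this

theorem Connected.of_id_tensor {X Z P : C} {u : X ⟶ Z} (h : Connected δ (𝟙 P ⊗ₘ u)) :
    Connected δ u := by
  refine ⟨by simpa only [δ.deg_tensor, deg_of_isIso (𝟙 P), zero_add] using h.1, ?_⟩
  rintro X₁ X₂ Z₁ Z₂ p q _ _ u₁ u₂ rfl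
  have := h.2 ((𝟙 P ⊗ₘ p) ≫ (α_ P X₁ X₂).inv) ((α_ P Z₁ Z₂).hom ≫ (𝟙 P ⊗ₘ q)) (𝟙 P ⊗ₘ u₁) u₂ (by
    rw [Category.assoc, associator_naturality_assoc, Iso.inv_hom_id_assoc,
      tensorHom_comp_tensorHom, tensorHom_comp_tensorHom, Category.comp_id, Category.comp_id])
  simpa only [δ.deg_tensor, deg_of_isIso (𝟙 P), zero_add] using this

theorem Connected.of_tensor_id {X Z P : C} {u : X ⟶ Z} (h : Connected δ (u ⊗ₘ 𝟙 P)) :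
    Connected δ u := by
  have := h.comp_iso (β_ P X).hom (β_ Z P).hom
  rw [BraidedCategory.braiding_naturality, SymmetricCategory.symmetry_assoc] at this
  exact this.of_id_tensor

theorem connected_comp_iso_iff {X Z W : C} {u : X ⟶ Z} (p : W ⟶ X) [IsIso p] :
    Connected δ (p ≫ u) ↔ Connected δ u := by
  constructor <;> intro h
  · have := h.comp_iso (inv p) (𝟙 _)
    simpa using this
  · have := h.comp_iso p (𝟙 _)
    simpa using this

namespace Chart
variable {X X₁ X₂ Y₁ Y₂ : C} {p : X ⟶ X₁ ⊗ X₂} [IsIso p] {ψ₁ : X₁ ⟶ Y₁} {ψ₂ : X₂ ⟶ Y₂}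

theorem toFun_tensor_factor (𝔠 : CubicalStructure δ) (χ : Chart δ (p ≫ (ψ₁ ⊗ₘ ψ₂)) N)
    {A : Factor X₁ Y₁} {B : Factor X₂ Y₂} (hA : A.comp = ψ₁) (hB : B.comp = ψ₂) :
    χ.toFun (p ≫ (A.left ⊗ₘ B.left)) (A.right ⊗ₘ B.right) =
      χ.left.toFun A.left A.right ∪ χ.right.toFun B.left B.right := by
  have h1 : A.left ≫ A.right = ψ₁ := hA
  have h2 : B.left ≫ B.right = ψ₂ := hB
  rw [χ.toFun_tensor 𝔠 (by rw [Category.assoc, tensorHom_comp_tensorHom, h1, h2]),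
    tensorHom_comp_tensorHom, tensorHom_comp_tensorHom, Category.id_comp, Category.id_comp, h1, h2]
  rfl

theorem disjoint_left_right (𝔠 : CubicalStructure δ) (χ : Chart δ (p ≫ (ψ₁ ⊗ₘ ψ₂)) N) :
    Disjoint (χ.left.toFun ψ₁ (𝟙 _)) (χ.right.toFun ψ₂ (𝟙 _)) := by
  have h1 := χ.disjoint_tensor 𝔠 (p := p) (U₁ := ψ₁) (U₂ := ψ₂) (W := 𝟙 _) (Category.comp_id _)
  rw [Category.comp_id, Category.comp_id] at h1
  exact h1

end Chart

namespace Factor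

theorem rel_of_isIso {X Y : C} {A B : Factor X Y} (h : A.comp = B.comp) [IsIso A.left]
    [IsIso B.left] : A.Rel B (𝟙 _) (𝟙 _) := by
  refine ⟨asIso (inv A.left ≫ B.left), by simp, ?_⟩
  rw [asIso_hom, Category.assoc, IsIso.inv_comp_eq, Category.comp_id]
  exact h.symm

end Factor

namespace Forest

theorem connected_cut {l : List V} {F : Forest δ a l} (hF : F.names.Nodup) {e : ℕ}
    (he : e ∈ F.names) : Connected δ (F.cut {e}).left := by
  induction F with
  | nil => cases he
  | leaf i F ih => exact (ih hF he).id_tensor _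
  | node e₀ f hf ch F ih1 ih2 =>
    simp only [names, List.nodup_cons, List.mem_append, not_or, List.nodup_append] at hF
    simp only [names, List.mem_cons, List.mem_append] at he
    have key : Connected δ (((ch.cut {e}).node (e₀ ∈ ({e} : Set ℕ)) f).left ⊗ₘ (F.cut {e}).left) := by
      rcases he with rfl | he | he
      · rw [Factor.node_pos (Set.mem_singleton e)]
        have := F.isIso_left_cut (P := {e}) fun x hx h => hF.1.2 (by rwa [Set.mem_singleton_iff.1 h] at hx)
        have h1 : Connected δ ((ch.cut {e}).comp ≫ f) := connected_of_target (by
          rw [δ.deg_comp]; omega)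
        have := (h1.tensor_id (tens (fun i => 𝔉.ι.obj (a i)) F.leaves)).comp_iso (𝟙 _)
          (𝟙 _ ⊗ₘ (F.cut {e}).left)
        simpa only [Category.id_comp, tensorHom_comp_tensorHom, Category.comp_id] using this
      · have hne : e₀ ∉ ({e} : Set ℕ) := by rintro rfl; exact hF.1.1 he
        rw [Factor.node_neg hne]
        have := F.isIso_left_cut (P := {e}) fun x hx h =>
          hF.2.2.2 e he x hx (Set.mem_singleton_iff.1 h).symm
        have := ((ih1 hF.2.1 he).tensor_id (tens (fun i => 𝔉.ι.obj (a i)) F.leaves)).comp_iso (𝟙 _)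
          (𝟙 _ ⊗ₘ (F.cut {e}).left)
        simp only [Category.id_comp, tensorHom_comp_tensorHom, Category.comp_id] at this
        exact this
      · have hne : e₀ ∉ ({e} : Set ℕ) := by rintro rfl; exact hF.1.2 he
        rw [Factor.node_neg hne]
        have := ch.isIso_left_cut (P := {e}) fun x hx h =>
          hF.2.2.2 x hx e he (Set.mem_singleton_iff.1 h)
        have := ((ih2 hF.2.2.1 he).id_tensor (tens (fun i => 𝔉.ι.obj (a i)) ch.leaves)).comp_iso (𝟙 _)
          ((ch.cut {e}).left ⊗ₘ 𝟙 _)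
        simp only [Category.id_comp, tensorHom_comp_tensorHom, Category.comp_id] at this
        exact this
    have := (tensAppend (fun i => 𝔉.ι.obj (a i)) ch.leaves F.leaves).isIso_hom
    exact (connected_comp_iso_iff (tensAppend (fun i => 𝔉.ι.obj (a i)) ch.leaves F.leaves).hom).2 key

theorem exists_of_connected {l : List V} {F : Forest δ a l} (hF : F.names.Nodup) {P : Set ℕ}
    (h : Connected δ (F.cut P).left) :
    ∃ e ∈ F.names, e ∈ P ∧ (F.cut P).Rel (F.cut {e}) (𝟙 _) (𝟙 _) := by
  induction F with
  | nil =>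
    have h1 : 0 < δ.deg (𝟙 (𝟙_ C)) := h.1
    have h2 : δ.deg (𝟙 (𝟙_ C)) = 0 := deg_of_isIso _
    omega
  | leaf i F ih =>
    obtain ⟨e, he, he', hr⟩ := ih hF (Connected.of_id_tensor (P := 𝔉.ι.obj (a i)) h)
    exact ⟨e, he, he', (Factor.Rel.cons (X := fun i => 𝔉.ι.obj (a i)) (Y := 𝔉.ι.obj)
      (x := i) (y := a i) (x' := i) (y' := a i) (Factor.Rel.refl _) hr).congr (consHom_id _ _)
        (consHom_id _ _)⟩
  | node e₀ f hf ch F ih1 ih2 =>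
    simp only [names, List.nodup_cons, List.mem_append, not_or, List.nodup_append] at hF
    simp only [names, List.mem_cons, List.mem_append]
    have h' : Connected δ (((ch.cut P).node (e₀ ∈ P) f).left ⊗ₘ (F.cut P).left) :=
      (connected_comp_iso_iff (tensAppend (fun i => 𝔉.ι.obj (a i)) ch.leaves F.leaves).hom).1 h
    have splice : ∀ {e : ℕ}, ((ch.cut P).node (e₀ ∈ P) f).Rel ((ch.cut {e}).node (e₀ ∈ ({e} : Set ℕ)) f) (𝟙 _) (𝟙 _) →
        (F.cut P).Rel (F.cut {e}) (𝟙 _) (𝟙 _) →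
        (Forest.cut P (.node e₀ f hf ch F)).Rel (Forest.cut {e} (.node e₀ f hf ch F)) (𝟙 _) (𝟙 _) :=
      fun h1 h2 => (Factor.Rel.splice (Y := 𝔉.ι.obj) h1 h2).congr (appendHom_id _ _) (consHom_id _ _)
    have trivF : ∀ {e : ℕ}, IsIso (F.cut P).left → e ∉ F.names →
        (F.cut P).Rel (F.cut {e}) (𝟙 _) (𝟙 _) := by
      intro e _ he
      have := F.isIso_left_cut (P := {e}) fun x hx h => he (by rwa [Set.mem_singleton_iff.1 h] at hx)
      exact Factor.rel_of_isIso (by rw [comp_cut, comp_cut])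
    have hor := h'.2 (𝟙 _) (𝟙 _) ((ch.cut P).node (e₀ ∈ P) f).left (F.cut P).left
      (by simp only [Category.id_comp, Category.comp_id])
    rcases hor with h0 | h0
    · have heP : e₀ ∉ P := by
        intro heP
        rw [Factor.node_pos heP] at h0
        have := δ.deg_comp (ch.cut P).comp f
        have h0 : δ.deg ((ch.cut P).comp ≫ f) = 0 := h0
        omega
      rw [Factor.node_neg heP] at h0 h'
      have i1 : IsIso (ch.cut P).left := (δ.deg_eq_zero_iff _).1 h0
      have h1 := h'.comp_iso (CategoryTheory.inv (ch.cut P).left ⊗ₘ 𝟙 _) (𝟙 _)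
      have h2 : Connected δ (𝟙 (ch.cut P).mid ⊗ₘ (F.cut P).left) := by
        have e1 : (CategoryTheory.inv (ch.cut P).left ⊗ₘ 𝟙 _) ≫
            ((ch.cut P).left ⊗ₘ (F.cut P).left) ≫ 𝟙 _ =
            (𝟙 (ch.cut P).mid ⊗ₘ (F.cut P).left) := by
          rw [Category.comp_id, tensorHom_comp_tensorHom, Category.id_comp, IsIso.inv_hom_id]
        rw [← e1]
        exact h1
      obtain ⟨e, he, he', hr⟩ := ih2 hF.2.2.1 h2.of_id_tensor
      have hne : e₀ ∉ ({e} : Set ℕ) := by rintro rfl; exact hF.1.2 he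
      refine ⟨e, .inr (.inr he), he', splice ?_ hr⟩
      rw [Factor.node_neg hne, Factor.node_neg heP]
      have := ch.isIso_left_cut (P := {e}) fun x hx h =>
          hF.2.2.2 x hx e he (Set.mem_singleton_iff.1 h)
      exact (Factor.rel_of_isIso (by rw [comp_cut, comp_cut])).postcomp (by simp)
    · have i1 : IsIso (F.cut P).left := (δ.deg_eq_zero_iff _).1 h0
      have h1 := h'.comp_iso (𝟙 _) (𝟙 _ ⊗ₘ CategoryTheory.inv (F.cut P).left)
      rw [Category.id_comp, tensorHom_comp_tensorHom, Category.comp_id, IsIso.hom_inv_id] at h1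
      replace h1 := h1.of_tensor_id
      by_cases heP : e₀ ∈ P
      · refine ⟨e₀, .inl rfl, heP, splice ?_ (trivF i1 hF.1.2)⟩
        rw [Factor.node_pos heP, Factor.node_pos (Set.mem_singleton e₀), comp_cut, comp_cut]
        exact Factor.Rel.refl _
      · rw [Factor.node_neg heP] at h1
        obtain ⟨e, he, he', hr⟩ := ih1 hF.2.1 h1
        have hne : e₀ ∉ ({e} : Set ℕ) := by rintro rfl; exact hF.1.1 he
        refine ⟨e, .inr (.inl he), he', splice ?_ (trivF i1 fun h => hF.2.2.2 e he e h rfl)⟩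
        rw [Factor.node_neg hne, Factor.node_neg heP]
        exact hr.postcomp (by simp)

/-- The set that corresponds to a cut of a forest. -/
noncomputable def part {X : C} {l : List V} {ψ : X ⟶ tens 𝔉.ι.obj l} (χ : Chart δ ψ N)
    (F : Forest δ a l) (p : X ⟶ tens (fun i => 𝔉.ι.obj (a i)) F.leaves) (P : Set ℕ) :
    Finset (Fin N) :=
  χ.toFun (p ≫ (F.cut P).left) (F.cut P).right

theorem exists_part_leaf {X : C} {i : Fin n} {l : List V}
    {F : Forest δ a l} {ψ : X ⟶ tens 𝔉.ι.obj (a i :: l)} (χ : Chart δ ψ N)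
    {p : X ⟶ tens (fun i => 𝔉.ι.obj (a i)) (i :: F.leaves)} (hp : IsIso p)
    (hψ : p ≫ (Forest.leaf i F).comp = ψ) :
    ∃ χR : Chart δ F.comp N, ∀ P, part χ (.leaf i F) p P = part χR F (𝟙 _) P := by
  let p' : X ⟶ 𝔉.ι.obj (a i) ⊗ tens (fun i => 𝔉.ι.obj (a i)) F.leaves := p
  have : IsIso p' := hp
  obtain rfl : ψ = p' ≫ (𝟙 _ ⊗ₘ F.comp) := hψ.symm
  refine ⟨χ.right, fun P => ?_⟩
  simp only [part, Chart.right, Category.id_comp]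
  rfl

theorem exists_part_node (𝔠 : CubicalStructure δ) {X : C} {l m : List V} {v : V} {e : ℕ}
    {f : tens 𝔉.ι.obj l ⟶ 𝔉.ι.obj v} (hf : 0 < δ.deg f) {ch : Forest δ a l} {F : Forest δ a m}
    {ψ : X ⟶ tens 𝔉.ι.obj (v :: m)} (χ : Chart δ ψ N)
    {p : X ⟶ tens (fun i => 𝔉.ι.obj (a i)) (ch.leaves ++ F.leaves)} (hp : IsIso p)
    (hψ : p ≫ (Forest.node e f hf ch F).comp = ψ) :
    ∃ (χL : Chart δ ch.comp N) (χR : Chart δ F.comp N) (G : Finset (Fin N)),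
      (∀ P, part χL ch (𝟙 _) P ⊂ G) ∧ (∀ P, Disjoint G (part χR F (𝟙 _) P)) ∧
      (∀ P, e ∈ P → part χ (.node e f hf ch F) p P = G ∪ part χR F (𝟙 _) P) ∧
      ∀ P, e ∉ P → part χ (.node e f hf ch F) p P =
        part χL ch (𝟙 _) P ∪ part χR F (𝟙 _) P := by
  let p' := p ≫ (tensAppend (fun i => 𝔉.ι.obj (a i)) ch.leaves F.leaves).hom
  obtain rfl : ψ = p' ≫ ((ch.comp ≫ f) ⊗ₘ F.comp) := hψ.symm.trans (Category.assoc _ _ _).symm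
  let χL₀ := χ.left
  let χR := χ.right
  let χL := χL₀.restrict 𝔠 (u := ch.comp) (w := f) rfl
  have hL : ∀ P, χL₀.toFun (ch.cut P).left ((ch.cut P).right ≫ f) = part χL ch (𝟙 _) P := by
    intro P; simp only [part, Category.id_comp]; rfl
  have hR : ∀ P, χR.toFun (F.cut P).left (F.cut P).right = part χR F (𝟙 _) P := by
    intro P; simp only [part, Category.id_comp]
  have key : ∀ P, part χ (.node e f hf ch F) p P =
      χL₀.toFun ((ch.cut P).node (e ∈ P) f).left ((ch.cut P).node (e ∈ P) f).right ∪
        χR.toFun (F.cut P).left (F.cut P).right := by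
    intro P
    have h1 : ((ch.cut P).node (e ∈ P) f).comp = ch.comp ≫ f := by
      rw [Factor.comp_node, comp_cut]
    refine Eq.trans ?_ (χ.toFun_tensor_factor 𝔠 h1 (F.comp_cut P))
    simp only [part, p', Category.assoc]; rfl
  refine ⟨χL, χR, χL₀.toFun (ch.comp ≫ f) (𝟙 _), fun P => ?_, fun P => ?_, fun P hP => ?_,
    fun P hP => ?_⟩
  · rw [← hL, Finset.ssubset_iff_subset_ne]
    have h1 : (ch.cut P).left ≫ (ch.cut P).right ≫ f = ch.comp ≫ f := by
      rw [← Category.assoc]; exact congrArg (· ≫ f) (ch.comp_cut P)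
    refine ⟨χL₀.subset_ground h1, fun h => ?_⟩
    have := congrArg Finset.card h
    rw [χL₀.card_eq h1, χL₀.card_eq (Category.comp_id _), ← h1, δ.deg_comp, δ.deg_comp] at this
    omega
  · have h1 := χ.disjoint_left_right 𝔠
    refine h1.mono_right ?_
    rw [← hR]
    exact χR.subset_ground (F.comp_cut P)
  · rw [key, Factor.node_pos hP, hR, comp_cut]
  · rw [key, Factor.node_neg hP, ← hL, hR]; rfl

theorem mem_part (𝔠 : CubicalStructure δ) {X : C} {l : List V} {F : Forest δ a l}
    (hF : F.names.Nodup) {ψ : X ⟶ tens 𝔉.ι.obj l} (χ : Chart δ ψ N)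
    {p : X ⟶ tens (fun i => 𝔉.ι.obj (a i)) F.leaves} [IsIso p] (hψ : p ≫ F.comp = ψ) {P : Set ℕ}
    (x : Fin N) : x ∈ part χ F p P ↔ ∃ e ∈ F.names, e ∈ P ∧ x ∈ part χ F p {e} := by
  induction F generalizing X P x with
  | nil =>
    have h0 : (part χ .nil p P).card = 0 := by
      rw [part, χ.card_eq (by rw [Category.assoc]; exact (congrArg _ (comp_cut P .nil)).trans hψ), δ.deg_comp, deg_of_isIso p]
      exact (zero_add _).trans (deg_of_isIso (𝟙 (𝟙_ C)))
    rw [Finset.card_eq_zero.1 h0]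
    simp [names]
  | leaf i F ih =>
    obtain ⟨χR, h⟩ := exists_part_leaf χ ‹_› hψ
    simp only [h]
    exact ih hF χR (Category.id_comp _) x
  | node e f hf ch F ih1 ih2 =>
    simp only [names, List.nodup_cons, List.mem_append, not_or, List.nodup_append] at hF
    obtain ⟨χL, χR, G, hG, hd, h1, h2⟩ := exists_part_node 𝔠 hf χ ‹_› hψ
    replace ih1 := fun {P x} => ih1 hF.2.1 χL (Category.id_comp _) (P := P) x
    replace ih2 := fun {P x} => ih2 hF.2.2.1 χR (Category.id_comp _) (P := P) x
    have g1 : ∀ e' ∈ ch.names, part χ (.node e f hf ch F) p {e'} = part χL ch (𝟙 _) {e'} := by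
      intro e' he'
      rw [h2 _ (by rintro rfl; exact hF.1.1 he'), Finset.union_eq_left]
      intro y hy
      obtain ⟨e₁, h3, rfl, -⟩ := ih2.1 hy
      exact (hF.2.2.2 _ he' _ h3 rfl).elim
    have g2 : ∀ e' ∈ F.names, part χ (.node e f hf ch F) p {e'} = part χR F (𝟙 _) {e'} := by
      intro e' he'
      rw [h2 _ (by rintro rfl; exact hF.1.2 he'), Finset.union_eq_right]
      intro y hy
      obtain ⟨e₁, h3, rfl, -⟩ := ih1.1 hy
      exact (hF.2.2.2 _ h3 _ he' rfl).elim
    have g0 : part χ (.node e f hf ch F) p {e} = G := by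
      rw [h1 _ (Set.mem_singleton e), Finset.union_eq_left]
      intro y hy
      obtain ⟨e₁, h3, rfl, -⟩ := ih2.1 hy
      exact (hF.1.2 h3).elim
    simp only [names, List.mem_cons, List.mem_append]
    by_cases hP : e ∈ P
    · rw [h1 P hP, Finset.mem_union, ih2]
      constructor
      · rintro (h | ⟨e', h3, h4, h5⟩)
        · exact ⟨e, .inl rfl, hP, by rwa [g0]⟩
        · exact ⟨e', .inr (.inr h3), h4, by rwa [g2 _ h3]⟩
      · rintro ⟨e', rfl | h3 | h3, h4, h5⟩
        · exact .inl (by rwa [g0] at h5)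
        · exact .inl ((hG {e'}).1 (by rwa [g1 _ h3] at h5))
        · exact .inr ⟨e', h3, h4, by rwa [g2 _ h3] at h5⟩
    · rw [h2 P hP, Finset.mem_union, ih1, ih2]
      constructor
      · rintro (⟨e', h3, h4, h5⟩ | ⟨e', h3, h4, h5⟩)
        · exact ⟨e', .inr (.inl h3), h4, by rwa [g1 _ h3]⟩
        · exact ⟨e', .inr (.inr h3), h4, by rwa [g2 _ h3]⟩
      · rintro ⟨e', rfl | h3 | h3, h4, h5⟩
        · exact (hP h4).elim
        · exact .inl ⟨e', h3, h4, by rwa [g1 _ h3] at h5⟩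
        · exact .inr ⟨e', h3, h4, by rwa [g2 _ h3] at h5⟩

theorem part_injective (𝔠 : CubicalStructure δ) {X : C} {l : List V} {F : Forest δ a l}
    (hF : F.names.Nodup) {ψ : X ⟶ tens 𝔉.ι.obj l} (χ : Chart δ ψ N)
    {p : X ⟶ tens (fun i => 𝔉.ι.obj (a i)) F.leaves} [IsIso p] (hψ : p ≫ F.comp = ψ) {e e' : ℕ}
    (he : e ∈ F.names) (he' : e' ∈ F.names) (h : part χ F p {e} = part χ F p {e'}) : e = e' := by
  induction F generalizing X e e' with
  | nil => cases he
  | leaf i F ih =>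
    obtain ⟨χR, hR⟩ := exists_part_leaf χ ‹_› hψ
    rw [hR, hR] at h
    exact ih hF χR (Category.id_comp _) he he' h
  | node e₀ f hf ch F ih1 ih2 =>
    have hF' := hF
    simp only [names, List.nodup_cons, List.mem_append, not_or, List.nodup_append] at hF
    obtain ⟨χL, χR, G, hG, hd, h1, h2⟩ := exists_part_node 𝔠 hf χ ‹_› hψ
    have e1 : ∀ e' ∉ ch.names, part χL ch (𝟙 _) {e'} = ∅ := by
      intro e' he'
      rw [Finset.eq_empty_iff_forall_notMem]
      intro y hy
      obtain ⟨e₁, h3, rfl, -⟩ := (mem_part 𝔠 hF.2.1 χL (Category.id_comp _) y).1 hy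
      exact he' h3
    have e2 : ∀ e' ∉ F.names, part χR F (𝟙 _) {e'} = ∅ := by
      intro e' he'
      rw [Finset.eq_empty_iff_forall_notMem]
      intro y hy
      obtain ⟨e₁, h3, rfl, -⟩ := (mem_part 𝔠 hF.2.2.1 χR (Category.id_comp _) y).1 hy
      exact he' h3
    have g1 : ∀ e' ∈ ch.names, part χ (.node e₀ f hf ch F) p {e'} = part χL ch (𝟙 _) {e'} := by
      intro e' he'
      rw [h2 _ (by rintro rfl; exact hF.1.1 he'), e2 _ fun h => hF.2.2.2 _ he' _ h rfl,
        Finset.union_empty]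
    have g2 : ∀ e' ∈ F.names, part χ (.node e₀ f hf ch F) p {e'} = part χR F (𝟙 _) {e'} := by
      intro e' he'
      rw [h2 _ (by rintro rfl; exact hF.1.2 he'), e1 _ fun h => hF.2.2.2 _ h _ he' rfl,
        Finset.empty_union]
    have g0 : part χ (.node e₀ f hf ch F) p {e₀} = G := by
      rw [h1 _ (Set.mem_singleton _), e2 _ hF.1.2, Finset.union_empty]
    have hne : ∀ e' ∈ (Forest.node e₀ f hf ch F).names,
        (part χ (.node e₀ f hf ch F) p {e'}).Nonempty := by
      intro e' he'
      rw [← Finset.card_pos, part, χ.card_eq (by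
        rw [Category.assoc]; exact (congrArg _ (comp_cut {e'} _)).trans hψ), δ.deg_comp]
      exact Nat.add_pos_right _ (connected_cut hF' he').1
    have k1 : ∀ x ∈ F.names, ∀ S ⊆ G, part χ (.node e₀ f hf ch F) p {x} ≠ S := by
      rintro x hx S hS rfl
      have h5 := hne x (by simp [names, hx])
      obtain ⟨y, hy⟩ := h5
      exact Finset.disjoint_left.1 (hd {x}) (hS hy) (by rwa [g2 x hx] at hy)
    have k2 : ∀ x ∈ ch.names, part χ (.node e₀ f hf ch F) p {x} ⊂ G := by
      intro x hx; rw [g1 x hx]; exact hG _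
    simp only [names, List.mem_cons, List.mem_append] at he he'
    rcases he with rfl | he | he <;> rcases he' with rfl | he' | he'
    · rfl
    · rw [g0] at h; exact ((k2 _ he').ne h.symm).elim
    · rw [g0] at h; exact (k1 _ he' _ (Finset.Subset.refl _) h.symm).elim
    · rw [g0] at h; exact ((k2 _ he).ne h).elim
    · rw [g1 _ he, g1 _ he'] at h
      exact ih1 hF.2.1 χL (Category.id_comp _) he he' h
    · exact (k1 _ he' _ (k2 _ he).1 h.symm).elim
    · rw [g0] at h; exact (k1 _ he _ (Finset.Subset.refl _) h).elim
    · exact (k1 _ he _ (k2 _ he').1 h).elim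
    · rw [g2 _ he, g2 _ he'] at h
      exact ih2 hF.2.2.1 χR (Category.id_comp _) he he' h

end Forest
end Parts

section Branches
variable {V : Type u₁} [Groupoid.{v₁} V] {C : Type u} [Category.{v} C]
    [MonoidalCategory C] [SymmetricCategory C] {𝔉 : FeynmanCategory V C} {δ : ProperDegree 𝔉}
    {n N : ℕ} {a : Fin n → V}

namespace Forest
variable {Y : C} {φ : tens (fun i => 𝔉.ι.obj (a i)) (List.finRange n) ⟶ Y}

/-- The forest `F`, followed by `f`, reads as `φ`, up to the order of the inputs. -/
def Composes (φ : tens (fun i => 𝔉.ι.obj (a i)) (List.finRange n) ⟶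
    Y) {l : List V} (F : Forest δ a l) (f : tens 𝔉.ι.obj l ⟶ Y) : Prop :=
  ∃ π, Canonical (fun i => 𝔉.ι.obj (a i)) (List.finRange n) F.leaves π ∧ π ≫ F.comp ≫ f = φ

open Classical in
/-- The set that corresponds to a cut of a forest that is followed by `f`. -/
noncomputable def branch (χ : Chart δ φ N) {l : List V} (F : Forest δ a l) (f : tens 𝔉.ι.obj l ⟶ Y)
    (P : Set ℕ) : Finset (Fin N) :=
  if h : Composes φ F f then χ.toFun (h.choose ≫ (F.cut P).left) ((F.cut P).right ≫ f) else ∅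

variable {l l' : List V} {F : Forest δ a l} {F' : Forest δ a l'} {f : tens 𝔉.ι.obj l ⟶ Y}
  {f' : tens 𝔉.ι.obj l' ⟶ Y}

theorem branch_eq (χ : Chart δ φ N)
    {π : tens (fun i => 𝔉.ι.obj (a i)) (List.finRange n) ⟶ tens (fun i => 𝔉.ι.obj (a i)) F.leaves}
    (hπ : Canonical (fun i => 𝔉.ι.obj (a i)) (List.finRange n) F.leaves π)
    (h : π ≫ F.comp ≫ f = φ) (P : Set ℕ) :
    branch χ F f P = χ.toFun (π ≫ (F.cut P).left) ((F.cut P).right ≫ f) := by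
  have h' : Composes φ F f := ⟨π, hπ, h⟩
  rw [branch, dif_pos h', h'.choose_spec.1.eq_of_nodup hπ (List.nodup_finRange n)]

theorem cut_comp_eq
    {π : tens (fun i => 𝔉.ι.obj (a i)) (List.finRange n) ⟶ tens (fun i => 𝔉.ι.obj (a i)) F.leaves}
    (h : π ≫ F.comp ≫ f = φ) (P : Set ℕ) :
    (π ≫ (F.cut P).left) ≫ ((F.cut P).right ≫ f) = φ := by
  rw [← h, ← F.comp_cut P, Factor.comp, Category.assoc, Category.assoc]

theorem composes_of_rel
    {ρ : tens (fun i => 𝔉.ι.obj (a i)) F.leaves ⟶ tens (fun i => 𝔉.ι.obj (a i)) F'.leaves}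
    (hρ : Canonical (fun i => 𝔉.ι.obj (a i)) F.leaves F'.leaves ρ) {P Q : Set ℕ}
    {s : tens 𝔉.ι.obj l ⟶ tens 𝔉.ι.obj l'} (h : (F.cut P).Rel (F'.cut Q) ρ s) (hs : s ≫ f' = f) :
    Composes φ F f ↔ Composes φ F' f' := by
  have h0 := h.comp_eq
  rw [comp_cut, comp_cut] at h0
  constructor
  · rintro ⟨π, h1, h2⟩
    exact ⟨_, h1.trans hρ, by rw [← h2, ← hs, Category.assoc, reassoc_of% h0]⟩
  · rintro ⟨π, h1, h2⟩
    obtain ⟨ρ', h3, h4, h5⟩ := hρ.symm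
    exact ⟨_, h1.trans h3, by
      rw [← h2, ← hs, Category.assoc, ← reassoc_of% h0, reassoc_of% h5]⟩

theorem branch_of_rel (χ : Chart δ φ N)
    {ρ : tens (fun i => 𝔉.ι.obj (a i)) F.leaves ⟶ tens (fun i => 𝔉.ι.obj (a i)) F'.leaves}
    (hρ : Canonical (fun i => 𝔉.ι.obj (a i)) F.leaves F'.leaves ρ) {P Q : Set ℕ}
    {s : tens 𝔉.ι.obj l ⟶ tens 𝔉.ι.obj l'} (h : (F.cut P).Rel (F'.cut Q) ρ s) (hs : s ≫ f' = f) :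
    branch χ F f P = branch χ F' f' Q := by
  by_cases hc : Composes φ F f
  · obtain ⟨π, h1, h2⟩ := hc
    have h0 := h.comp_eq
    rw [comp_cut, comp_cut] at h0
    have h3 : (π ≫ ρ) ≫ F'.comp ≫ f' = φ := by
      rw [← h2, ← hs, Category.assoc, reassoc_of% h0]
    rw [branch_eq χ h1 h2, branch_eq χ (h1.trans hρ) h3,
      χ.eq_iff (cut_comp_eq h2 P) (cut_comp_eq h3 Q)]
    obtain ⟨z, h4, h5⟩ := h
    exact ⟨z, by rw [Category.assoc, h4, Category.assoc], by
      rw [← hs, ← reassoc_of% h5]⟩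
  · rw [branch, dif_neg hc, branch, dif_neg fun h' => hc ((composes_of_rel hρ h hs).2 h')]

theorem Composes.mem_branch (𝔠 : CubicalStructure δ) (h : Composes φ F f) (hF : F.names.Nodup)
    (χ : Chart δ φ N) {P : Set ℕ} (x : Fin N) :
    x ∈ branch χ F f P ↔ ∃ e ∈ F.names, e ∈ P ∧ x ∈ branch χ F f {e} := by
  obtain ⟨π, h1, h2⟩ := h
  have := h1.isIso
  simp only [branch_eq χ h1 h2]
  exact mem_part 𝔠 hF (χ.restrict 𝔠 (u := π ≫ F.comp) (w := f) (by rw [Category.assoc, h2]))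
    (p := π) rfl x

theorem Composes.branch_injective (𝔠 : CubicalStructure δ) (h : Composes φ F f)
    (hF : F.names.Nodup) (χ : Chart δ φ N) {e e' : ℕ} (he : e ∈ F.names) (he' : e' ∈ F.names)
    (hee : branch χ F f {e} = branch χ F f {e'}) : e = e' := by
  obtain ⟨π, h1, h2⟩ := h
  have := h1.isIso
  simp only [branch_eq χ h1 h2] at hee
  exact part_injective 𝔠 hF (χ.restrict 𝔠 (u := π ≫ F.comp) (w := f) (by rw [Category.assoc, h2]))
    (p := π) rfl he he' hee

theorem Composes.branch_univ (h : Composes φ F f) (χ : Chart δ φ N)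
    {Z : C} {u : tens (fun i => 𝔉.ι.obj (a i)) (List.finRange n) ⟶ Z} {w : Z ⟶
        Y} (z : tens 𝔉.ι.obj l ⟶ Z) [IsIso z] (hw : z ≫ w = f)
    (hu : ∃ π, Canonical (fun i => 𝔉.ι.obj (a i)) (List.finRange n) F.leaves π ∧
      π ≫ F.comp ≫ z = u) : branch χ F f Set.univ = χ.toFun u w := by
  obtain ⟨π, h1, h2⟩ := hu
  have h3 : π ≫ F.comp ≫ f = φ := by
    obtain ⟨π', h4, h5⟩ := h
    rw [h1.eq_of_nodup h4 (List.nodup_finRange n), h5]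
  have h4 : u ≫ w = φ := by rw [← h2, ← h3, ← hw, Category.assoc, Category.assoc]
  rw [branch_eq χ h1 h3, χ.eq_iff (cut_comp_eq h3 _) h4]
  have := F.isIso_right_cut (P := Set.univ) fun e _ => Set.mem_univ e
  refine ⟨asIso (F.cut Set.univ).right ≪≫ asIso z, ?_, ?_⟩
  · rw [← h2, ← F.comp_cut Set.univ]
    simp only [Factor.comp, Iso.trans_hom, asIso_hom, Category.assoc]
  · rw [Iso.trans_hom, asIso_hom, asIso_hom, Category.assoc, hw]

theorem Composes.card_branch_univ (h : Composes φ F f) (χ : Chart δ φ N) :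
    (branch χ F f Set.univ).card + δ.deg f = δ.deg φ := by
  obtain ⟨π, h1, h2⟩ := h
  have h3 := Composes.branch_univ ⟨π, h1, h2⟩ χ (𝟙 _) (Category.id_comp f) ⟨π, h1, rfl⟩
  rw [Category.comp_id] at h3
  have h4 : (π ≫ F.comp) ≫ f = φ := by rw [Category.assoc, h2]
  have h5 := δ.deg_comp (π ≫ F.comp) f
  rw [h3, χ.card_eq h4, ← h5, h4]

open Finset in
theorem Composes.nested (𝔠 : CubicalStructure δ) (h : Composes φ F f) (hF : F.names.Nodup)
    (χ : Chart δ φ N) (hφ : δ.deg φ = N) :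
    (χ.buildingSet 𝔠 hφ).Nested (F.names.toFinset.image fun e => branch χ F f {e}) := by
  obtain ⟨π, h1, h2⟩ := h
  have := h1.isIso
  constructor
  · intro S hS
    rw [mem_image] at hS
    obtain ⟨e, he, rfl⟩ := hS
    rw [List.mem_toFinset] at he
    rw [branch_eq χ h1 h2]
    exact ⟨_, _, _, cut_comp_eq h2 _, (connected_comp_iso_iff π).2 (connected_cut hF he), rfl⟩
  · intro J hJ ⟨Z, u, w, h3, h4, h5⟩
    have h6 : J.sup id = branch χ F f {e | branch χ F f {e} ∈ J} := by
      ext x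
      rw [Composes.mem_branch 𝔠 ⟨π, h1, h2⟩ hF χ, Finset.mem_sup]
      constructor
      · rintro ⟨S, hS, hx⟩
        obtain ⟨e, he, rfl⟩ := mem_image.1 (hJ hS)
        exact ⟨e, List.mem_toFinset.1 he, hS, hx⟩
      · rintro ⟨e, he, he', hx⟩
        exact ⟨_, he', hx⟩
    rw [h6, branch_eq χ h1 h2, χ.eq_iff h3 (cut_comp_eq h2 _)] at h5
    obtain ⟨e, he, he', z, hz, hz'⟩ :=
      exists_of_connected hF ((connected_comp_iso_iff π).1 (h4.of_isoFactors h5))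
    have h7 : branch χ F f {e | branch χ F f {e} ∈ J} = branch χ F f {e} := by
      rw [branch_eq χ h1 h2, branch_eq χ h1 h2, χ.eq_iff (cut_comp_eq h2 _) (cut_comp_eq h2 _)]
      refine ⟨z, by rw [Category.assoc, hz, Category.id_comp], ?_⟩
      rw [← Category.assoc, hz', Category.comp_id]
    rw [h6, h7]
    exact he'

/-- A forest is determined by its branches. -/
theorem Composes.exists_iso (𝔠 : CubicalStructure δ) (h : Composes φ F f) (h' : Composes φ F' f')
    (hF : F.names.Nodup) (hF' : F'.names.Nodup) (χ : Chart δ φ N)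
    (hn : ∀ e, e ∈ F.names ↔ e ∈ F'.names)
    (hb : ∀ e ∈ F.names, branch χ F f {e} = branch χ F' f' {e}) :
    ∃ s, Forest.Iso F F' s ∧ s ≫ f' = f := by
  have hP : ∀ P, branch χ F f P = branch χ F' f' P := by
    intro P
    ext x
    rw [h.mem_branch 𝔠 hF χ, h'.mem_branch 𝔠 hF' χ]
    constructor
    · rintro ⟨e, he, he', hx⟩
      exact ⟨e, (hn e).1 he, he', by rwa [← hb e he]⟩
    · rintro ⟨e, he, he', hx⟩
      exact ⟨e, (hn e).2 he, he', by rwa [hb e ((hn e).2 he)]⟩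
  obtain ⟨π, h1, h2⟩ := h
  obtain ⟨π', h1', h2'⟩ := h'
  have hP' : ∀ P, IsoFactors (π ≫ (F.cut P).left) ((F.cut P).right ≫ f)
      (π' ≫ (F'.cut P).left) ((F'.cut P).right ≫ f') := by
    intro P
    rw [← χ.eq_iff (cut_comp_eq h2 P) (cut_comp_eq h2' P), ← branch_eq χ h1 h2,
      ← branch_eq χ h1' h2', hP]
  obtain ⟨z, hz, hz'⟩ := hP' Set.univ
  have i1 := F.isIso_right_cut (P := Set.univ) fun e _ => Set.mem_univ e
  have i2 := F'.isIso_right_cut (P := Set.univ) fun e _ => Set.mem_univ e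
  let s := CategoryTheory.inv (F.cut Set.univ).right ≫ z.hom ≫ (F'.cut Set.univ).right
  have hs : s ≫ f' = f := by
    simp only [s, Category.assoc, hz', IsIso.inv_hom_id_assoc]
  have hs' : π ≫ F.comp ≫ s = π' ≫ F'.comp := by
    have e1 : F.comp ≫ CategoryTheory.inv (F.cut Set.univ).right = (F.cut Set.univ).left := by
      rw [IsIso.comp_inv_eq]; exact (F.comp_cut Set.univ).symm
    simp only [s]
    rw [reassoc_of% e1, ← Category.assoc, ← Category.assoc, hz, Category.assoc]
    exact congrArg (π' ≫ ·) (F'.comp_cut Set.univ)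
  have : IsIso s := inferInstance
  obtain ⟨ρ, h3, h4, h5⟩ := h1.symm
  refine ⟨s, Iso.of_cut 𝔠 (h3.trans h1') hF hF' fun P => ?_, hs⟩
  obtain ⟨y, hy, hy'⟩ := 𝔠.isoFactors_of_comp (u := π ≫ (F.cut P).left) (w := (F.cut P).right ≫ s)
    (u' := π' ≫ (F'.cut P).left) (w' := (F'.cut P).right) (f := f') (by
      have e1 := F.comp_cut P
      have e2 := F'.comp_cut P
      rw [Factor.comp] at e1 e2
      rw [Category.assoc, Category.assoc, reassoc_of% e1, hs', e2])
    (by rw [Category.assoc, hs]; exact hP' P)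
  refine ⟨y, ?_, hy'⟩
  rw [Category.assoc, ← hy, Category.assoc, reassoc_of% h5]

/-- The forest consisting of inputs only. -/
def ofInputs : ∀ L : List (Fin n), Forest δ a (L.map a)
  | [] => .nil
  | i :: L => .leaf i (ofInputs L)

theorem leaves_ofInputs : ∀ L : List (Fin n), (ofInputs L : Forest δ a _).leaves = L
  | [] => rfl
  | i :: L => congrArg (i :: ·) (leaves_ofInputs L)

theorem names_ofInputs : ∀ L : List (Fin n), (ofInputs L : Forest δ a _).names = []
  | [] => rfl
  | _ :: L => names_ofInputs L

theorem isIso_comp (h : F.names = []) : IsIso F.comp := by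
  have i1 := F.isIso_right_cut (P := ∅) (by rw [h]; simp)
  have i2 := F.isIso_left_cut (P := ∅) (by rw [h]; simp)
  rw [← F.comp_cut ∅]
  exact inferInstanceAs (IsIso ((F.cut ∅).left ≫ (F.cut ∅).right))

theorem exists_append : ∀ {l m : List V} (F : Forest δ a (l ++ m)),
    ∃ (A : Forest δ a l) (B : Forest δ a m), F = A.append B
  | [], _, F => ⟨.nil, F, rfl⟩
  | _ :: _, _, .leaf i F => by
    obtain ⟨A, B, rfl⟩ := exists_append F
    exact ⟨.leaf i A, B, rfl⟩
  | _ :: _, _, .node e f hf ch F => by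
    obtain ⟨A, B, rfl⟩ := exists_append F
    exact ⟨.node e f hf ch A, B, rfl⟩

theorem exists_reorder {l m : List V} (d : Reorder l m) (F : Forest δ a m) :
    ∃ F' : Forest δ a l, Iso F' F (d.map 𝔉.ι.obj) := by
  induction d with
  | nil => exact ⟨F, Iso.refl F⟩
  | cons x h i ih =>
    obtain ⟨F₁, h1⟩ := exists_front i F
    obtain ⟨T, G, rfl⟩ := exists_singleton F₁
    obtain ⟨G', h2⟩ := ih G
    exact ⟨T.append G', (Iso.append_singleton T h2).trans h1⟩

end Forest
end Branches

section Realization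
variable {V : Type u₁} [Groupoid.{v₁} V] {C : Type u} [Category.{v} C]
    [MonoidalCategory C] [SymmetricCategory C] {𝔉 : FeynmanCategory V C} {δ : ProperDegree 𝔉}
    {n N : ℕ} {a : Fin n → V}

theorem FeynmanCategory.exists_front_basic (𝔉 : FeynmanCategory V C) {δ : ProperDegree 𝔉}
    {l : List V} {Z : C} {h : tens 𝔉.ι.obj l ⟶ Z} (hh : Connected δ h) :
    ∃ (k k' : List V) (v : V) (d : Reorder (k ++ k') l) (g : tens 𝔉.ι.obj k ⟶ 𝔉.ι.obj v)
      (z : tens 𝔉.ι.obj (v :: k') ⟶ Z), IsIso z ∧ 0 < δ.deg g ∧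
        d.map 𝔉.ι.obj ≫ h = spliceHom g (𝟙 (tens 𝔉.ι.obj k')) ≫ z := by
  obtain ⟨W, R, v, f, p, q, _, _, hd, rfl⟩ := hh.exists_basic
  obtain ⟨l₁, ⟨α⟩⟩ := 𝔉.exists_tens W
  obtain ⟨l₂, ⟨β⟩⟩ := 𝔉.exists_tens R
  obtain ⟨s, hs⟩ := 𝔉.exists_sym (x := fun x : V => x) (y := fun x : V => x)
    (l := l₁ ++ l₂) (m := l) ((splitIso α β).hom ≫ inv p)
  obtain ⟨k, k', t, t', d, hd'⟩ := s.exists_split 𝔉.ι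
  rw [hs] at hd'
  let T : tens 𝔉.ι.obj l₁ ⟶ tens 𝔉.ι.obj k := t.map 𝔉.ι
  let T' : tens 𝔉.ι.obj l₂ ⟶ tens 𝔉.ι.obj k' := t'.map 𝔉.ι
  have i1 : IsIso T := WordIso.isIso_map _ _
  have i2 : IsIso T' := WordIso.isIso_map _ _
  replace hd' : (splitIso α β).hom ≫ inv p = appendHom T T' ≫ d.map 𝔉.ι.obj := hd'
  have aux : ∀ {K K' L L' N M P Q A : C} (μ : N ≅ L ⊗ L') (ν : M ≅ K ⊗ K') (T : L ⟶ K)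
      (T' : L' ⟶ K') [IsIso T] [IsIso T'] (d : M ⟶ A) (α : L ⟶ P) (β : L' ⟶ Q) (p : A ⟶ P ⊗ Q)
      [IsIso p], (μ.hom ≫ (α ⊗ₘ β)) ≫ inv p = (μ.hom ≫ (T ⊗ₘ T') ≫ ν.inv) ≫ d →
      d ≫ p = ν.hom ≫ (inv T ≫ α ⊗ₘ inv T' ≫ β) := by
    intro K K' L L' N M P Q A μ ν T T' _ _ d α β p _ h
    rw [IsIso.comp_inv_eq, Category.assoc, Category.assoc, Category.assoc, cancel_epi] at h
    rw [← tensorHom_comp_tensorHom, h, tensorHom_comp_tensorHom_assoc, IsIso.inv_hom_id,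
      IsIso.inv_hom_id, id_tensorHom_id, Category.id_comp, Iso.hom_inv_id_assoc]
  have e1 := aux _ _ T T' (d.map 𝔉.ι.obj) α.hom β.hom p hd'
  let z : 𝔉.ι.obj v ⊗ tens 𝔉.ι.obj k' ⟶ Z := (𝟙 _ ⊗ₘ (inv T' ≫ β.hom)) ≫ q
  have hz : IsIso z := inferInstance
  refine ⟨k, k', v, d, (inv T ≫ α.hom) ≫ f, z, hz, δ.deg_comp_pos_right _ hd, ?_⟩
  rw [reassoc_of% e1]
  have aux2 : ∀ {K K' M P Q Z A : C} (ν : M ⟶ K ⊗ K') (α : K ⟶ P) (β : K' ⟶ Q) (f : P ⟶ A)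
      (q : A ⊗ Q ⟶ Z), ν ≫ (α ⊗ₘ β) ≫ (f ⊗ₘ 𝟙 Q) ≫ q =
        (ν ≫ (α ≫ f ⊗ₘ 𝟙 K')) ≫ (𝟙 A ⊗ₘ β) ≫ q := by
    intros
    simp only [Category.assoc, tensorHom_comp_tensorHom_assoc, Category.id_comp, Category.comp_id]
  exact aux2 _ _ _ _ _

namespace Forest

/-- A connected morphism after a forest can be turned into a new vertex. -/
theorem exists_grow {l : List V} (F : Forest δ a l) {Z : C} {h : tens 𝔉.ι.obj l ⟶ Z}
    (hh : Connected δ h) (e : ℕ) : ∃ (l' : List V) (F' : Forest δ a l') (z : tens 𝔉.ι.obj l' ⟶ Z)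
      (ρ : tens (fun i => 𝔉.ι.obj (a i)) F.leaves ⟶ tens (fun i => 𝔉.ι.obj (a i)) F'.leaves),
      IsIso z ∧ F'.names.Perm (e :: F.names) ∧
      Canonical (fun i => 𝔉.ι.obj (a i)) F.leaves F'.leaves ρ ∧
      ∀ P : Set ℕ, e ∉ P → ∃ s, (F.cut P).Rel (F'.cut P) ρ s ∧ s ≫ z = h := by
  obtain ⟨k, k', v, d, g, z, hz, hg, e1⟩ := 𝔉.exists_front_basic hh
  obtain ⟨F₁, h1⟩ := exists_reorder d F
  obtain ⟨A, B, rfl⟩ := exists_append F₁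
  obtain ⟨d', h2, h3, h4⟩ := h1.symm
  obtain ⟨ρ₁, h5, h6⟩ := h2.cut
  obtain ⟨ρ₂, h7, h8⟩ := cut_append A B
  refine ⟨v :: k', .node e g hg A B, z, ρ₁ ≫ ρ₂, hz, ?_, h5.trans h7, fun P hP => ?_⟩
  · have := h1.names_perm
    rw [names_append] at this
    exact this.cons e
  · have h9 := ((h6 P).trans (h8 P)).trans
      (Factor.Rel.append_splice (Factor.Rel.refl (A.cut P)) (Factor.Rel.refl (B.cut P)) g)
    refine ⟨d' ≫ spliceHom g (𝟙 _), ?_, ?_⟩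
    · have e2 : (Forest.node e g hg A B).cut P = Factor.splice (X := fun i => 𝔉.ι.obj (a i))
          (Y := 𝔉.ι.obj) ((A.cut P).postcomp g) (B.cut P) := by
        change Factor.splice (X := fun i => 𝔉.ι.obj (a i)) (Y := 𝔉.ι.obj)
          ((A.cut P).node (e ∈ P) g) (B.cut P) = _
        rw [Factor.node_neg hP]
      rw [e2]
      refine h9.congr ?_ ?_
      · rw [appendHom_id]; exact Category.comp_id _
      · rw [Category.comp_id, Category.id_comp]
    · rw [Category.assoc, ← e1, reassoc_of% h4]

variable {v₀ : V} {φ : tens (fun i => 𝔉.ι.obj (a i)) (List.finRange n) ⟶ 𝔉.ι.obj v₀}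

open Finset in
/-- Every nested family is the family of branches of a forest. -/
theorem exists_branches (𝔠 : CubicalStructure δ) (χ : Chart δ φ N) (hφ : δ.deg φ = N)
    (hN : 0 < N) (I : Finset ℕ) (S : ℕ → Finset (Fin N)) (hS : Set.InjOn S I)
    (hB : (χ.buildingSet 𝔠 hφ).Nested (I.image S)) (hI : ∀ e ∈ I, S e ≠ univ) :
    ∃ (l : List V) (F : Forest δ a l) (f : tens 𝔉.ι.obj l ⟶ 𝔉.ι.obj v₀), 0 < δ.deg f ∧
      F.names.Nodup ∧ (∀ e, e ∈ F.names ↔ e ∈ I) ∧ Composes φ F f ∧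
      ∀ e ∈ I, branch χ F f {e} = S e := by
  classical
  induction hc : I.card generalizing I with
  | zero =>
    obtain rfl := card_eq_zero.1 hc
    let F : Forest δ a _ := ofInputs (List.finRange n)
    have hF : F.names = [] := names_ofInputs _
    have := isIso_comp hF
    obtain ⟨π, hπ⟩ : ∃ π, Canonical (fun i => 𝔉.ι.obj (a i)) (List.finRange n) F.leaves π := by
      rw [leaves_ofInputs]; exact ⟨_, Canonical.refl _⟩
    have := hπ.isIso
    refine ⟨_, F, CategoryTheory.inv F.comp ≫ CategoryTheory.inv π ≫ φ, ?_, ?_, ?_, ⟨π, hπ, ?_⟩, ?_⟩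
    · refine δ.deg_comp_pos_right _ (δ.deg_comp_pos_right _ ?_); omega
    · rw [hF]; exact List.nodup_nil
    · simp [hF]
    · simp
    · simp
  | succ c ih =>
    have hne : I.Nonempty := by rw [← card_pos]; omega
    obtain ⟨e, he, hmax⟩ := exists_max_image I (fun e => (S e).card) hne
    have hsub : I.erase e ⊆ I := erase_subset _ _
    obtain ⟨l, F, f, hf, hnd, hn, hcomp, hb⟩ := ih (I.erase e)
      (hS.mono (by exact_mod_cast hsub)) (hB.mono (image_subset_image hsub))
      (fun e he => hI e (hsub he)) (by rw [card_erase_of_mem he, hc]; rfl)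
    have hmem : ∀ x (P : Set ℕ), x ∈ branch χ F f P ↔ ∃ e' ∈ I.erase e, e' ∈ P ∧ x ∈ S e' := by
      intro x P
      rw [hcomp.mem_branch 𝔠 hnd χ]
      refine exists_congr fun e' => ?_
      rw [hn]
      refine and_congr_right fun h => and_congr_right fun _ => ?_
      rw [hb e' h]
    have hSe : (χ.buildingSet 𝔠 hφ).mem (S e) := hB.1 _ (mem_image_of_mem S he)
    have hout : ∀ J : Finset ℕ, J ⊆ I.erase e → J.sup S ≠ S e := by
      intro J hJ h
      have := hB.2 (J.image S) (image_subset_image (hJ.trans hsub)) (by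
        rw [sup_image]; simpa [h] using hSe)
      rw [sup_image, Function.id_comp, h, mem_image] at this
      obtain ⟨e', he', h'⟩ := this
      exact ne_of_mem_erase (hJ he') (hS (hsub (hJ he')) he h')
    obtain ⟨π, h1, h2⟩ := id hcomp
    have hU₀ := hcomp.branch_univ χ (𝟙 _) (Category.id_comp f) ⟨π, h1, rfl⟩
    rw [Category.comp_id] at hU₀
    have e0 : (π ≫ F.comp) ≫ f = φ := by rw [Category.assoc, h2]
    obtain ⟨Z, u, w, hu, hU⟩ := χ.exists_eq (S := χ.toFun (π ≫ F.comp) f ∪ S e) (by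
      rw [χ.ground_eq_univ hφ]; exact subset_univ _)
    obtain ⟨h, hh, rfl⟩ := (χ.subset_iff e0 hu).1 (by rw [hU]; exact subset_union_left)
    have hU' : χ.toFun u w = I.sup S := by
      rw [hU, ← hU₀]
      ext x
      rw [mem_union, hmem, mem_sup]
      constructor
      · rintro (⟨e', he', -, hx⟩ | hx)
        · exact ⟨e', hsub he', hx⟩
        · exact ⟨e, he, hx⟩
      · rintro ⟨e', he', hx⟩
        by_cases h' : e' = e
        · exact .inr (h' ▸ hx)
        · exact .inl ⟨e', mem_erase.2 ⟨h', he'⟩, trivial, hx⟩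
    have hw : 0 < δ.deg w := by
      by_contra h0
      have h3 : (χ.toFun u w).card = N := by
        rw [χ.card_eq hu, ← hφ, ← hu, δ.deg_comp]; omega
      have h4 : I.sup S = univ := by
        rw [← hU', ← card_eq_iff_eq_univ, h3, Fintype.card_fin]
      have h5 : (χ.buildingSet 𝔠 hφ).mem univ :=
        ⟨_, φ, 𝟙 _, Category.comp_id _, connected_of_target (by omega), χ.ground_eq_univ hφ⟩
      have := hB.2 (I.image S) (Subset.refl _) (by rw [sup_image, Function.id_comp, h4]; exact h5)
      rw [sup_image, Function.id_comp, h4, mem_image] at this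
      obtain ⟨e', he', h'⟩ := this
      exact hI e' he' h'
    have hSU : ¬ S e ⊆ branch χ F (h ≫ w) Set.univ := by
      intro h3
      refine hout ((I.erase e).filter fun e' => S e' ⊆ S e) (filter_subset _ _) ?_
      ext x
      rw [mem_sup]
      constructor
      · rintro ⟨e', he', hx⟩
        exact (mem_filter.1 he').2 hx
      · intro hx
        obtain ⟨e', he', -, hx'⟩ := (hmem x _).1 (h3 hx)
        refine ⟨e', mem_filter.2 ⟨he', ?_⟩, hx'⟩
        rcases hB.subset_or (mem_image_of_mem S (hsub he')) (mem_image_of_mem S he) hx' hx with h4 | h4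
        · exact h4
        · rw [eq_of_subset_of_card_le h4 (hmax e' (hsub he'))]
    have hdu : δ.deg u = δ.deg (π ≫ F.comp) + δ.deg h := by rw [← hh, δ.deg_comp]
    have hconn : Connected δ h := by
      constructor
      · by_contra h0
        refine hSU ?_
        have h4 : χ.toFun (π ≫ F.comp) (h ≫ w) = χ.toFun u w := by
          refine eq_of_subset_of_card_le (by rw [hU]; exact subset_union_left) ?_
          rw [χ.card_eq hu, χ.card_eq e0]; omega
        exact (subset_union_right.trans_eq (hU.symm.trans h4.symm)).trans_eq hU₀.symm
      · rintro Y₁ Y₂ Z₁ Z₂ p q _ _ U₁ U₂ rfl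
        obtain ⟨X₁, X₂, p', c₁, c₂, h3⟩ := 𝔉.exists_tensor_factor ((π ≫ F.comp) ≫ p)
        have h4 : (p'.hom ≫ (c₁ ≫ U₁ ⊗ₘ c₂ ≫ U₂)) ≫ q = u := by
          rw [← hh, ← tensorHom_comp_tensorHom, ← reassoc_of% h3]
          simp only [Category.assoc]
        have h5 : (p'.hom ≫ (c₁ ≫ U₁ ⊗ₘ c₂ ≫ U₂)) ≫ (q ≫ w) = φ := by
          rw [← Category.assoc, h4, hu]
        have h5' : (p'.hom ≫ (c₁ ⊗ₘ c₂)) ≫ ((U₁ ⊗ₘ U₂) ≫ q ≫ w) = φ := by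
          rw [← h5, ← tensorHom_comp_tensorHom]; simp only [Category.assoc]
        have h6 : χ.toFun (p'.hom ≫ (c₁ ≫ U₁ ⊗ₘ c₂ ≫ U₂)) (q ≫ w) = χ.toFun u w :=
          (χ.eq_iff h5 hu).2 ⟨asIso q, h4, rfl⟩
        have h7 : χ.toFun (p'.hom ≫ (c₁ ⊗ₘ c₂)) ((U₁ ⊗ₘ U₂) ≫ q ≫ w) =
            χ.toFun (π ≫ F.comp) ((p ≫ (U₁ ⊗ₘ U₂) ≫ q) ≫ w) :=
          (χ.eq_iff h5' e0).2 (IsoFactors.symm ⟨asIso p, h3, by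
              simp only [asIso_hom, Category.assoc]⟩)
        obtain ⟨Z', u', w', hu', hc', hS'⟩ := hSe
        have h8 := χ.subset_or_of_connected h5 hu' hc' (by
          rw [hS', h6, hU]; exact subset_union_right)
        have h9 := χ.toFun_tensor 𝔠 h5
        have h9' := χ.toFun_tensor 𝔠 h5'
        have h10 := χ.disjoint_tensor 𝔠 h5
        have g1 : (p'.hom ≫ (c₁ ≫ U₁ ⊗ₘ 𝟙 X₂)) ≫ ((𝟙 Z₁ ⊗ₘ c₂ ≫ U₂) ≫ q ≫ w) = φ := by
          rw [← h5]
          simp only [Category.assoc, tensorHom_comp_tensorHom_assoc, Category.id_comp,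
            Category.comp_id]
        have g2 : (p'.hom ≫ (𝟙 X₁ ⊗ₘ c₂ ≫ U₂)) ≫ ((c₁ ≫ U₁ ⊗ₘ 𝟙 Z₂) ≫ q ≫ w) = φ := by
          rw [← h5]
          simp only [Category.assoc, tensorHom_comp_tensorHom_assoc, Category.id_comp,
            Category.comp_id]
        have g1' : (p'.hom ≫ (c₁ ⊗ₘ 𝟙 X₂)) ≫ ((𝟙 _ ⊗ₘ c₂) ≫ (U₁ ⊗ₘ U₂) ≫ q ≫ w) = φ := by
          rw [← h5']
          simp only [Category.assoc, tensorHom_comp_tensorHom_assoc, Category.id_comp]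
        have g2' : (p'.hom ≫ (𝟙 X₁ ⊗ₘ c₂)) ≫ ((c₁ ⊗ₘ 𝟙 _) ≫ (U₁ ⊗ₘ U₂) ≫ q ≫ w) = φ := by
          rw [← h5']
          simp only [Category.assoc, tensorHom_comp_tensorHom_assoc, Category.id_comp]
        have k1 := χ.card_eq g1
        have k2 := χ.card_eq g2
        have k1' := χ.card_eq g1'
        have k2' := χ.card_eq g2'
        simp only [δ.deg_comp, δ.deg_tensor, deg_of_isIso p'.hom, deg_of_isIso (𝟙 X₂),
          deg_of_isIso (𝟙 X₁)] at k1 k2 k1' k2'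
        have s1 : χ.toFun (p'.hom ≫ (c₁ ⊗ₘ 𝟙 X₂)) ((𝟙 _ ⊗ₘ c₂) ≫ (U₁ ⊗ₘ U₂) ≫ q ≫ w) ⊆
            χ.toFun (p'.hom ≫ (c₁ ≫ U₁ ⊗ₘ 𝟙 X₂)) ((𝟙 Z₁ ⊗ₘ c₂ ≫ U₂) ≫ q ≫ w) :=
          (χ.subset_iff g1' g1).2 ⟨U₁ ⊗ₘ 𝟙 X₂, by
            simp only [Category.assoc, tensorHom_comp_tensorHom, Category.comp_id], by
            simp only [tensorHom_comp_tensorHom_assoc, Category.id_comp, Category.comp_id]⟩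
        have s2 : χ.toFun (p'.hom ≫ (𝟙 X₁ ⊗ₘ c₂)) ((c₁ ⊗ₘ 𝟙 _) ≫ (U₁ ⊗ₘ U₂) ≫ q ≫ w) ⊆
            χ.toFun (p'.hom ≫ (𝟙 X₁ ⊗ₘ c₂ ≫ U₂)) ((c₁ ≫ U₁ ⊗ₘ 𝟙 Z₂) ≫ q ≫ w) :=
          (χ.subset_iff g2' g2).2 ⟨𝟙 X₁ ⊗ₘ U₂, by
            simp only [Category.assoc, tensorHom_comp_tensorHom, Category.comp_id], by
            simp only [tensorHom_comp_tensorHom_assoc, Category.id_comp, Category.comp_id]⟩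
        rw [h6, hU, ← h7, h9', ← hS'] at h9
        rw [disjoint_left] at h10
        rcases h8 with h8 | h8
        · right
          have : χ.toFun (p'.hom ≫ (𝟙 X₁ ⊗ₘ c₂ ≫ U₂)) ((c₁ ≫ U₁ ⊗ₘ 𝟙 Z₂) ≫ q ≫ w) ⊆
              χ.toFun (p'.hom ≫ (𝟙 X₁ ⊗ₘ c₂)) ((c₁ ⊗ₘ 𝟙 _) ≫ (U₁ ⊗ₘ U₂) ≫ q ≫ w) := by
            intro x hx
            have := h9.symm ▸ mem_union_right _ hx
            rcases mem_union.1 this with h11 | h11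
            · rcases mem_union.1 h11 with h12 | h12
              · exact (h10 (s1 h12) hx).elim
              · exact h12
            · exact (h10 (h8 h11) hx).elim
          have := card_le_card this
          omega
        · left
          have : χ.toFun (p'.hom ≫ (c₁ ≫ U₁ ⊗ₘ 𝟙 X₂)) ((𝟙 Z₁ ⊗ₘ c₂ ≫ U₂) ≫ q ≫ w) ⊆
              χ.toFun (p'.hom ≫ (c₁ ⊗ₘ 𝟙 X₂)) ((𝟙 _ ⊗ₘ c₂) ≫ (U₁ ⊗ₘ U₂) ≫ q ≫ w) := by
            intro x hx
            have := h9.symm ▸ mem_union_left _ hx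
            rcases mem_union.1 this with h11 | h11
            · rcases mem_union.1 h11 with h12 | h12
              · exact h12
              · exact (h10 hx (s2 h12)).elim
            · exact (h10 hx (h8 h11)).elim
          have := card_le_card this
          omega
    obtain ⟨l', F', z, ρ, hz, hnames, hρ, hcut⟩ := F.exists_grow hconn e
    have hnotin : e ∉ F.names := by rw [hn]; exact notMem_erase e I
    have hnd' : F'.names.Nodup := hnames.nodup_iff.2 (List.nodup_cons.2 ⟨hnotin, hnd⟩)
    have hn' : ∀ e', e' ∈ F'.names ↔ e' ∈ I := by
      intro e'
      rw [hnames.mem_iff, List.mem_cons, hn, mem_erase]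
      by_cases h' : e' = e
      · simp [h', he]
      · simp [h']
    obtain ⟨s, hs, hsz⟩ := hcut ∅ (Set.notMem_empty e)
    have hcomp' : Composes φ F' (z ≫ w) := (composes_of_rel hρ hs (by rw [reassoc_of% hsz])).1 hcomp
    have hb' : ∀ e' ∈ I.erase e, branch χ F' (z ≫ w) {e'} = S e' := by
      intro e' he'
      obtain ⟨s', hs', hsz'⟩ := hcut {e'} (by rintro rfl; exact notMem_erase _ _ he')
      rw [← branch_of_rel χ hρ hs' (by rw [reassoc_of% hsz']), hb e' he']
    have hU₁ : branch χ F' (z ≫ w) Set.univ = I.sup S := by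
      rw [← hU']
      refine hcomp'.branch_univ χ z rfl ⟨π ≫ ρ, h1.trans hρ, ?_⟩
      have := hs.comp_eq
      rw [comp_cut, comp_cut] at this
      rw [Category.assoc, reassoc_of% this, hsz, ← hh, Category.assoc]
    refine ⟨l', F', z ≫ w, δ.deg_comp_pos_right _ hw, hnd', hn', hcomp', ?_⟩
    suffices hM : branch χ F' (z ≫ w) {e} = S e by
      intro e' he'
      by_cases h' : e' = e
      · rw [h', hM]
      · exact hb' e' (mem_erase.2 ⟨h', he'⟩)
    set M := branch χ F' (z ≫ w) {e} with hMdef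
    have hB' := hcomp'.nested 𝔠 hnd' χ hφ
    have himg : ∀ e' ∈ I.erase e, S e' ∈ F'.names.toFinset.image fun e => branch χ F' (z ≫ w) {e} :=
      fun e' he' => mem_image.2 ⟨e', List.mem_toFinset.2 ((hn' e').2 (hsub he')), hb' e' he'⟩
    have hMimg : M ∈ F'.names.toFinset.image fun e => branch χ F' (z ≫ w) {e} :=
      mem_image.2 ⟨e, List.mem_toFinset.2 ((hn' e).2 he), rfl⟩
    have hmem' : ∀ x, x ∈ I.sup S ↔ x ∈ M ∨ ∃ e' ∈ I.erase e, x ∈ S e' := by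
      intro x
      rw [← hU₁, hcomp'.mem_branch 𝔠 hnd' χ]
      constructor
      · rintro ⟨e', he', -, hx⟩
        rw [hn'] at he'
        by_cases h' : e' = e
        · exact .inl (by rw [h'] at hx; exact hx)
        · have := mem_erase.2 ⟨h', he'⟩
          exact .inr ⟨e', this, by rwa [hb' e' this] at hx⟩
      · rintro (hx | ⟨e', he', hx⟩)
        · exact ⟨e, (hn' e).2 he, trivial, hx⟩
        · exact ⟨e', (hn' e').2 (hsub he'), trivial, by rwa [hb' e' he']⟩
    obtain ⟨x₀, hx₀, hx₀'⟩ := not_subset.1 hSU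
    have hx₁ : ∀ e' ∈ I.erase e, x₀ ∉ S e' := fun e' he' hx => hx₀' ((hmem _ _).2 ⟨e', he',
        Set.mem_univ e', hx⟩)
    have hx₂ : x₀ ∈ M := by
      rcases (hmem' x₀).1 (mem_sup.2 ⟨e, he, hx₀⟩) with h' | ⟨e', he', h'⟩
      · exact h'
      · exact (hx₁ e' he' h').elim
    have hMB : (χ.buildingSet 𝔠 hφ).mem M := hB'.1 _ hMimg
    have hcup := (χ.buildingSet 𝔠 hφ).union hMB hSe ⟨x₀, hx₂, hx₀⟩
    have key : ∀ {A A' : Finset (Fin N)} {𝒩 : Finset (Finset (Fin N))},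
        (χ.buildingSet 𝔠 hφ).Nested 𝒩 → A ∈ 𝒩 → (∀ e' ∈ I.erase e, S e' ∈ 𝒩) → x₀ ∈ A →
        A' ⊆ I.sup S → (∀ x ∈ I.sup S, x ∈ A ∨ ∃ e' ∈ I.erase e, x ∈ S e') →
        (∀ e' ∈ I.erase e, ∀ x ∈ S e', x ∈ A' → S e' ⊆ A') →
        (χ.buildingSet 𝔠 hφ).mem (A ∪ A') → A' ⊆ A := by
      intro A A' 𝒩 hN hA hI' hxA hA' hcov hin hmemB
      have e1 : (insert A (((I.erase e).filter fun e' => S e' ⊆ A').image S)).sup id = A ∪ A' := by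
        rw [sup_insert, sup_image, Function.id_comp]
        ext x
        simp only [id, sup_eq_union, mem_union, mem_sup, mem_filter]
        constructor
        · rintro (hx | ⟨e', ⟨-, h'⟩, hx⟩)
          · exact .inl hx
          · exact .inr (h' hx)
        · rintro (hx | hx)
          · exact .inl hx
          · rcases hcov x (hA' hx) with h' | ⟨e', he', h'⟩
            · exact .inl h'
            · exact .inr ⟨e', ⟨he', hin e' he' x h' hx⟩, h'⟩
      have h3 := hN.2 (insert A (((I.erase e).filter fun e' => S e' ⊆ A').image S)) (by
        rw [insert_subset_iff]
        refine ⟨hA, ?_⟩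
        intro T hT
        obtain ⟨e', he', rfl⟩ := mem_image.1 hT
        exact hI' e' (mem_filter.1 he').1) (by rw [e1]; exact hmemB)
      rw [e1, mem_insert, mem_image] at h3
      rcases h3 with h3 | ⟨e', he', h3⟩
      · rw [← h3]; exact subset_union_right
      · exact (hx₁ e' (mem_filter.1 he').1 (by rw [h3]; exact mem_union_left _ hxA)).elim
    have hsub1 : ∀ e' ∈ I.erase e, ∀ x ∈ S e', x ∈ S e → S e' ⊆ S e := by
      intro e' he' x hx hx'
      rcases hB.subset_or (mem_image_of_mem S (hsub he')) (mem_image_of_mem S he) hx hx' with h4 | h4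
      · exact h4
      · exact (hx₁ e' he' (h4 hx₀)).elim
    have hsub2 : ∀ e' ∈ I.erase e, ∀ x ∈ S e', x ∈ M → S e' ⊆ M := by
      intro e' he' x hx hx'
      rcases hB'.subset_or (himg e' he') hMimg hx hx' with h4 | h4
      · exact h4
      · exact (hx₁ e' he' (h4 hx₂)).elim
    refine Subset.antisymm ?_ ?_
    · refine key hB (mem_image_of_mem S he) (fun e' he' => mem_image_of_mem S (hsub he')) hx₀
        (fun x hx => (hmem' x).2 (.inl hx)) ?_ hsub2 (by rwa [union_comm])
      intro x hx
      obtain ⟨e', he', hx⟩ := mem_sup.1 hx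
      by_cases h' : e' = e
      · exact .inl (h' ▸ hx)
      · exact .inr ⟨e', mem_erase.2 ⟨h', he'⟩, hx⟩
    · exact key hB' hMimg himg hx₂ (fun x hx => mem_sup.2 ⟨e, he, hx⟩) (fun x hx => (hmem' x).1 hx)
        hsub1 hcup

end Forest
end Realization

section TreeParts
variable {V : Type u₁} [Groupoid.{v₁} V] {C : Type u} [Category.{v} C]
    [MonoidalCategory C] [SymmetricCategory C] {𝔉 : FeynmanCategory V C} {δ : ProperDegree 𝔉}
    {n N : ℕ} {a : Fin n → V} {v₀ : V}

namespace OrdTree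
variable {φ : tens (fun i => 𝔉.ι.obj (a i)) (List.finRange n) ⟶ 𝔉.ι.obj v₀}

/-- The set that corresponds to the branch of the tree above an edge. -/
noncomputable def part (χ : Chart δ φ N) (T : OrdTree δ a v₀) (e : ℕ) : Finset (Fin N) :=
  Forest.branch χ T.br T.lab {e}

theorem names_nodup (T : OrdTree δ a v₀) : T.br.names.Nodup :=
  T.names_perm.nodup_iff.2 List.nodup_range

variable {T T' : OrdTree δ a v₀}

theorem ComposesTo.part_injective (𝔠 : CubicalStructure δ) (h : ComposesTo φ T) (χ : Chart δ φ N)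
    {e e' : ℕ} (he : e < T.numEdges) (he' : e' < T.numEdges) (hee : T.part χ e = T.part χ e') :
    e = e' :=
  Forest.Composes.branch_injective 𝔠 h T.names_nodup χ (mem_names.2 he) (mem_names.2 he') hee

theorem ComposesTo.nested (𝔠 : CubicalStructure δ) (h : ComposesTo φ T) (χ : Chart δ φ N)
    (hφ : δ.deg φ = N) :
    (χ.buildingSet 𝔠 hφ).Nested ((Finset.range T.numEdges).image (T.part χ)) := by
  have := Forest.Composes.nested 𝔠 h T.names_nodup χ hφ
  have e : T.br.names.toFinset = Finset.range T.numEdges := by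
    ext; rw [List.mem_toFinset, mem_names, Finset.mem_range]
  rw [e] at this
  exact this

theorem ComposesTo.card_sup (𝔠 : CubicalStructure δ) (h : ComposesTo φ T) (χ : Chart δ φ N)
    (hφ : δ.deg φ = N) : ((Finset.range T.numEdges).sup (T.part χ)).card + T.width = N := by
  have h1 := Forest.Composes.card_branch_univ h χ
  rw [hφ] at h1
  suffices h2 : (Finset.range T.numEdges).sup (T.part χ) =
      Forest.branch χ T.br T.lab Set.univ by
    rw [h2]; exact h1
  ext x
  rw [Finset.mem_sup, Forest.Composes.mem_branch 𝔠 h T.names_nodup χ]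
  constructor
  · rintro ⟨e, he, hx⟩
    exact ⟨e, mem_names.2 (Finset.mem_range.1 he), Set.mem_univ e, hx⟩
  · rintro ⟨e, he, -, hx⟩
    exact ⟨e, Finset.mem_range.2 (mem_names.1 he), hx⟩

/-- The renumbering of the remaining edges after the edge `e` has been contracted. -/
def unshift (e x : ℕ) : ℕ := if x < e then x else x + 1

theorem exists_rel_face (T : OrdTree δ a v₀) (e : ℕ) :
    ∃ ρ, Canonical (fun i => 𝔉.ι.obj (a i)) (T.face e).br.leaves T.br.leaves ρ ∧
      ∀ x, ∃ s, ((T.face e).br.cut {x}).Rel (T.br.cut {unshift e x}) ρ s ∧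
        s ≫ T.lab = (T.face e).lab := by
  obtain ⟨ρ₁, h1, h2⟩ := Forest.cut_rename (shift e) (T.br.contract e).forest
  obtain ⟨ρ₂, h3, h4⟩ := Forest.cut_contract e T.br
  refine ⟨ρ₁ ≫ ρ₂, h1.trans h3, fun x => ⟨𝟙 _ ≫ (T.br.contract e).layer, ?_, ?_⟩⟩
  · have h5 := h2 {x}
    rw [Forest.cut_congr (P := shift e ⁻¹' {x}) (Q := {unshift e x})
      (T.br.contract e).forest fun z hz => ?_] at h5
    · exact h5.trans (h4 _ fun h => by
        have := Set.mem_singleton_iff.1 h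
        unfold unshift at this; split_ifs at this <;> omega)
    · rw [Forest.names_contract, List.mem_filter] at hz
      have hz' : z ≠ e := by simpa using hz.2
      simp only [Set.mem_preimage, Set.mem_singleton_iff, shift, unshift]
      split_ifs <;> omega
  · exact congrArg (· ≫ T.lab) (Category.id_comp _)

theorem ComposesTo.face (h : ComposesTo φ T) (e : ℕ) : ComposesTo φ (T.face e) := by
  obtain ⟨ρ, h1, h2⟩ := T.exists_rel_face e
  obtain ⟨s, h3, h4⟩ := h2 0
  exact (Forest.composes_of_rel h1 h3 h4).2 h

theorem part_face (χ : Chart δ φ N) (T : OrdTree δ a v₀) (e x : ℕ) :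
    (T.face e).part χ x = T.part χ (unshift e x) := by
  obtain ⟨ρ, h1, h2⟩ := T.exists_rel_face e
  obtain ⟨s, h3, h4⟩ := h2 x
  exact Forest.branch_of_rel χ h1 h3 h4

theorem Isomorphic.exists_rel {ρ : ℕ → ℕ} (h : Isomorphic ρ T T') (hρ : Function.Injective ρ) :
    ∃ π, Canonical (fun i => 𝔉.ι.obj (a i)) T'.br.leaves T.br.leaves π ∧
      ∀ x, ∃ s, (T'.br.cut {ρ x}).Rel (T.br.cut {x}) π s ∧ s ≫ T.lab = T'.lab := by
  obtain ⟨s, h, hs⟩ := h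
  obtain ⟨s', h', h1, h2⟩ := h.symm
  obtain ⟨π₁, h3, h4⟩ := h'.cut
  obtain ⟨π₂, h5, h6⟩ := Forest.cut_rename ρ T.br
  refine ⟨π₁ ≫ π₂, h3.trans h5, fun x => ⟨s' ≫ 𝟙 _, ?_, ?_⟩⟩
  · have h7 := h6 {ρ x}
    rw [Forest.cut_congr (P := ρ ⁻¹' {ρ x}) (Q := {x}) T.br
      (fun z _ => by simp [hρ.eq_iff])] at h7
    exact (h4 _).trans h7
  · rw [Category.comp_id, ← hs, reassoc_of% h2]

theorem Isomorphic.composesTo_iff {ρ : ℕ → ℕ} (h : Isomorphic ρ T T') (hρ : Function.Injective ρ) :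
    ComposesTo φ T' ↔ ComposesTo φ T := by
  obtain ⟨π, h1, h2⟩ := h.exists_rel hρ
  obtain ⟨s, h3, h4⟩ := h2 0
  exact Forest.composes_of_rel h1 h3 h4

theorem Isomorphic.part_eq {ρ : ℕ → ℕ} (h : Isomorphic ρ T T') (hρ : Function.Injective ρ)
    (χ : Chart δ φ N) (x : ℕ) : T'.part χ (ρ x) = T.part χ x := by
  obtain ⟨π, h1, h2⟩ := h.exists_rel hρ
  obtain ⟨s, h3, h4⟩ := h2 x
  exact Forest.branch_of_rel χ h1 h3 h4

/-- A tree is determined by its branches. -/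
theorem ComposesTo.isomorphic (𝔠 : CubicalStructure δ) (h : ComposesTo φ T) (h' : ComposesTo φ T')
    (χ : Chart δ φ N) (hn : T.numEdges = T'.numEdges)
    (hp : ∀ e, e < T.numEdges → T.part χ e = T'.part χ e) : Isomorphic id T T' := by
  obtain ⟨s, h1, h2⟩ := Forest.Composes.exists_iso 𝔠 h h' T.names_nodup T'.names_nodup χ
    (fun e => by rw [mem_names, mem_names, hn]) (fun e he => hp e (mem_names.1 he))
  exact ⟨s, by rwa [Forest.rename_id], h2⟩

/-- Every nested family is the family of branches of a tree. -/
theorem exists_part_eq (𝔠 : CubicalStructure δ) (χ : Chart δ φ N) (hφ : δ.deg φ = N)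
    (hN : 0 < N) (r : ℕ) (S : ℕ → Finset (Fin N)) (hS : Set.InjOn S (Finset.range r))
    (hB : (χ.buildingSet 𝔠 hφ).Nested ((Finset.range r).image S))
    (hI : ∀ e < r, S e ≠ Finset.univ) :
    ∃ T : OrdTree δ a v₀, T.numEdges = r ∧ ComposesTo φ T ∧ ∀ e < r, T.part χ e = S e := by
  obtain ⟨l, F, f, hf, h1, h2, h3, h4⟩ := Forest.exists_branches 𝔠 χ hφ hN (Finset.range r) S hS hB
    (fun e he => hI e (Finset.mem_range.1 he))
  have h5 : F.names.Perm (List.range r) :=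
    (List.perm_ext_iff_of_nodup h1 List.nodup_range).2 fun e => by
      rw [h2, Finset.mem_range, List.mem_range]
  have h6 : F.names.length = r := by rw [h5.length_eq, List.length_range]
  exact ⟨⟨l, f, hf, F, by rw [h6]; exact h5⟩, h6, h3, fun e he => h4 e (Finset.mem_range.2 he)⟩

/-- Exchange two consecutive edges in the order. -/
def swapEdges (T : OrdTree δ a v₀) (i : ℕ) (hi : i + 1 < T.numEdges) : OrdTree δ a v₀ where
  ins := T.ins
  lab := T.lab
  lab_pos := T.lab_pos
  br := T.br.rename (Equiv.swap i (i + 1))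
  names_perm := by
    rw [Forest.names_rename, List.length_map]
    refine (List.perm_ext_iff_of_nodup (T.names_nodup.map (Equiv.swap i (i + 1)).injective)
      List.nodup_range).2 fun x => ?_
    change i + 1 < T.br.names.length at hi
    rw [List.mem_map, List.mem_range]
    constructor
    · rintro ⟨y, hy, rfl⟩
      rw [T.names_perm.mem_iff, List.mem_range] at hy
      rw [swap_eq]; split_ifs <;> omega
    · intro hx
      refine ⟨Equiv.swap i (i + 1) x, ?_, Equiv.swap_apply_self _ _ _⟩
      rw [T.names_perm.mem_iff, List.mem_range, swap_eq]; split_ifs <;> omega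

theorem isomorphic_swapEdges (T : OrdTree δ a v₀) (i : ℕ) (hi : i + 1 < T.numEdges) :
    Isomorphic (Equiv.swap i (i + 1)) T (T.swapEdges i hi) :=
  ⟨_, Forest.Iso.refl _, Category.id_comp _⟩

end OrdTree
end TreeParts

section Alternation
open Finset
variable {β : Type*} [DecidableEq β] (κ : β → ℕ) {k : Type*} [CommRing k]

variable (k) in
/-- The sign of a list without repetitions, as a permutation of its members ordered by `κ`. -/
def listSign : List β → k
  | [] => 1
  | M :: L => posSign κ k M (M :: L).toFinset * listSign L

/-- The alternating sum of a function on lists over the orderings of a set with `r` elements. -/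
def alternation : (List β → k) → ℕ → Finset β → k
  | Φ, 0, _ => Φ []
  | Φ, r + 1, N => ∑ M ∈ N, posSign κ k M N * alternation (fun L => Φ (M :: L)) r (N.erase M)

variable {κ}

theorem listSign_mul_self (L : List β) : listSign κ k L * listSign κ k L = 1 := by
  induction L with
  | nil => exact mul_one 1
  | cons M L ih =>
    rw [listSign]
    linear_combination (listSign κ k L * listSign κ k L) * posSign_mul_self κ (k :=
        k) M (M :: L).toFinset + ih

theorem erase_toFinset_cons {M : β} {L : List β} (h : (M :: L).Nodup) :
    (M :: L).toFinset.erase M = L.toFinset := by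
  rw [List.toFinset_cons, erase_insert]
  rw [List.mem_toFinset]; exact (List.nodup_cons.1 h).1

theorem erase_toFinset_append {M : β} {A R : List β} (h : (A ++ M :: R).Nodup) :
    (A ++ M :: R).toFinset.erase M = (A ++ R).toFinset := by
  have h' := h
  rw [List.nodup_middle, List.nodup_cons] at h'
  ext x
  rw [mem_erase, List.mem_toFinset, List.mem_toFinset]
  constructor
  · rintro ⟨h1, h2⟩
    simpa [h1] using h2
  · intro h1
    refine ⟨fun e => h'.1 (e ▸ h1), ?_⟩
    rcases List.mem_append.1 h1 with h2 | h2 <;> simp [h2]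

theorem listSign_append_cons (hκ : Function.Injective κ) (A R : List β) (M : β)
    (h : (A ++ M :: R).Nodup) : listSign κ k (A ++ M :: R) =
      (-1) ^ A.length * (posSign κ k M (A ++ M :: R).toFinset * listSign κ k (A ++ R)) := by
  induction A with
  | nil => simp [listSign]
  | cons a A ih =>
    have h1 := List.nodup_cons.1 h
    have hne : a ≠ M := fun e => h1.1 (by simp [e])
    have h2 := posSign_swap (k := k) hκ (M := a) (M' := M)
      (N := (a :: A ++ M :: R).toFinset) (by simp) (by simp) hne
    have h3 : (a :: A ++ M :: R).toFinset.erase a = (A ++ M :: R).toFinset :=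
      erase_toFinset_cons h
    have h4 := ih h1.2
    rw [h3, erase_toFinset_append (A := a :: A) h] at h2
    simp only [List.cons_append] at h2 h4 ⊢
    change listSign κ k (A ++ M :: R) = _ at h4
    rw [listSign, h4, listSign, List.length_cons, pow_succ]
    linear_combination ((-1) ^ A.length * listSign κ k (A ++ R)) * h2

theorem listSign_swap (hκ : Function.Injective κ) (A R : List β) (M M' : β)
    (h : (A ++ M :: M' :: R).Nodup) :
    listSign κ k (A ++ M :: M' :: R) = -listSign κ k (A ++ M' :: M :: R) := by
  have hp : (M :: M' :: R).Perm (M' :: M :: R) := List.Perm.swap _ _ _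
  have h' : (A ++ M' :: M :: R).Nodup := ((hp.append_left A).nodup_iff).1 h
  have h3 := listSign_append_cons (k := k) hκ (A ++ [M]) R M' (by simpa using h)
  have h4 := listSign_append_cons (k := k) hκ A (M :: R) M' h'
  rw [show A ++ [M] ++ M' :: R = A ++ M :: M' :: R by simp,
    show A ++ [M] ++ R = A ++ M :: R by simp, List.length_append, List.length_singleton,
    List.toFinset_eq_of_perm _ _ (hp.append_left A)] at h3
  rw [h3, h4, pow_succ]; ring

/-- A function on lists that changes its sign when two adjacent members are exchanged is determined
up to sign by its values on one ordering of every set. -/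
theorem listSign_mul_perm {Ψ : List β → k} (hκ : Function.Injective κ)
    (h : ∀ A M M' R, (A ++ M :: M' :: R).Nodup →
      Ψ (A ++ M :: M' :: R) = -Ψ (A ++ M' :: M :: R)) {L L' : List β} (hL : L.Perm L')
    (hn : L.Nodup) : listSign κ k L * Ψ L = listSign κ k L' * Ψ L' := by
  suffices ∀ D : List β, (D ++ L).Nodup →
      listSign κ k L * Ψ (D ++ L) = listSign κ k L' * Ψ (D ++ L') by simpa using this [] hn
  clear hn
  induction hL with
  | nil => intro D _; rfl
  | cons M hL ih =>
    intro D hD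
    have := ih (D ++ [M]) (by simpa using hD)
    simp only [List.append_assoc, List.singleton_append] at this
    rw [listSign, listSign, List.toFinset_eq_of_perm _ _ (hL.cons M), mul_assoc, mul_assoc, this]
  | swap M M' R =>
    intro D hD
    rw [h D M' M R hD]
    have := listSign_swap (k := k) hκ [] R M' M (List.Nodup.of_append_right hD)
    simp only [List.nil_append] at this
    rw [this]; ring
  | trans h1 h2 ih1 ih2 =>
    intro D hD
    rw [ih1 D hD, ih2 D (((h1.append_left D).nodup_iff).1 hD)]

/-- The lists that enumerate the set `N` without repetitions. -/
def Orders (N : Finset β) (L : List β) : Prop := L.Nodup ∧ L.toFinset = N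

theorem Orders.length_eq {N : Finset β} {L : List β} (h : Orders N L) : L.length = N.card := by
  rw [← h.2, List.toFinset_card_of_nodup h.1]

theorem Orders.cons {N : Finset β} {L : List β} {M : β} (hM : M ∈ N) (h : Orders (N.erase M) L) :
    Orders N (M :: L) := by
  refine ⟨List.nodup_cons.2 ⟨fun h' => ?_, h.1⟩, ?_⟩
  · rw [← List.mem_toFinset, h.2] at h'; simp at h'
  · rw [List.toFinset_cons, h.2, insert_erase hM]

theorem Orders.of_cons {N : Finset β} {L : List β} {M : β} (h : Orders N (M :: L)) :
    M ∈ N ∧ Orders (N.erase M) L :=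
  ⟨by rw [← h.2]; simp, (List.nodup_cons.1 h.1).2, by rw [← h.2, erase_toFinset_cons h.1]⟩

theorem Orders.perm {N : Finset β} {L L' : List β} (h : Orders N L) (h' : Orders N L') :
    L.Perm L' :=
  (List.perm_ext_iff_of_nodup h.1 h'.1).2 fun x => by
    rw [← List.mem_toFinset, ← List.mem_toFinset, h.2, h'.2]

theorem alternation_congr {Φ Φ' : List β → k} {r : ℕ} {N : Finset β} (hr : N.card = r)
    (h : ∀ L, Orders N L → Φ L = Φ' L) : alternation κ Φ r N = alternation κ Φ' r N := by
  induction r generalizing Φ Φ' N with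
  | zero => exact h [] ⟨List.nodup_nil, (card_eq_zero.1 hr).symm⟩
  | succ r ih =>
    refine Finset.sum_congr rfl fun M hM => ?_
    rw [ih (by rw [card_erase_of_mem hM, hr]; rfl) fun L hL => h _ (hL.cons hM)]

theorem alternation_add (Φ Φ' : List β → k) (r : ℕ) (N : Finset β) :
    alternation κ (fun L => Φ L + Φ' L) r N = alternation κ Φ r N + alternation κ Φ' r N := by
  induction r generalizing Φ Φ' N with
  | zero => rfl
  | succ r ih => simp only [alternation, ih, mul_add, sum_add_distrib]

theorem alternation_smul (s : k) (Φ : List β → k) (r : ℕ) (N : Finset β) :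
    alternation κ (fun L => s * Φ L) r N = s * alternation κ Φ r N := by
  induction r generalizing Φ N with
  | zero => rfl
  | succ r ih =>
    simp only [alternation, ih, mul_sum]; exact Finset.sum_congr rfl fun _ _ => by ring

theorem alternation_zero (r : ℕ) (N : Finset β) :
    alternation κ (fun _ => (0 : k)) r N = 0 := by
  simpa using alternation_smul (κ := κ) (0 : k) (fun _ => 0) r N

theorem alternation_sum {γ : Type*} (s : Finset γ) (Φ : γ → List β → k) (r : ℕ) (N : Finset β) :
    alternation κ (fun L => ∑ j ∈ s, Φ j L) r N = ∑ j ∈ s, alternation κ (Φ j) r N := by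
  classical
  induction s using Finset.induction_on with
  | empty => simp [alternation_zero]
  | insert a s ha ih => simp only [sum_insert ha, alternation_add, ih]

/-- The alternating sum of a function that vanishes on all orderings of the set but one. -/
theorem alternation_eq_single {Φ : List β → k} {N : Finset β} {L₀ : List β} (hL₀ : Orders N L₀)
    (h : ∀ L, Orders N L → L ≠ L₀ → Φ L = 0) :
    alternation κ Φ N.card N = listSign κ k L₀ * Φ L₀ := by
  induction L₀ generalizing Φ N with
  | nil =>
    obtain rfl : N = ∅ := by rw [← hL₀.2]; rfl
    exact (one_mul (Φ [])).symm
  | cons M₀ L₀ ih =>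
    have h1 := hL₀.of_cons
    rw [← hL₀.length_eq, List.length_cons, alternation, Finset.sum_eq_single M₀]
    · have h2 := ih (Φ := fun L => Φ (M₀ :: L)) h1.2
        fun L hL hne => h _ (hL.cons h1.1) (by simpa using hne)
      rw [← h1.2.length_eq] at h2
      rw [h2, listSign, hL₀.2, mul_assoc]
    · intro M hM hne
      have h3 : (N.erase M).card = L₀.length := by
        rw [card_erase_of_mem hM, ← hL₀.length_eq]; rfl
      rw [alternation_congr (Φ' := fun _ => 0) h3
        fun L hL => h _ (hL.cons hM) (by simp [hne]), alternation_zero, mul_zero]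
    · exact fun h' => absurd h1.1 h'

theorem alternation_eq_zero_of_symm (hκ : Function.Injective κ) {Φ : List β → k} {j r : ℕ}
    (hr : j + 2 ≤ r)
    (h : ∀ A M M' R, A.length = j → Φ (A ++ M :: M' :: R) = Φ (A ++ M' :: M :: R)) (N : Finset β) :
    alternation κ Φ r N = 0 := by
  induction j generalizing Φ r N with
  | zero =>
    obtain ⟨r, rfl⟩ : ∃ r', r = r' + 2 := ⟨r - 2, by omega⟩
    simp only [alternation, mul_sum, ← mul_assoc]
    rw [Finset.sum_sigma']
    refine Finset.sum_involution (fun p _ => ⟨p.2, p.1⟩) ?_ ?_ ?_ ?_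
    · rintro ⟨M, M'⟩ hM
      simp only [mem_sigma, mem_erase] at hM
      dsimp only
      have h1 : (fun L => Φ (M :: M' :: L)) = fun L => Φ (M' :: M :: L) :=
        funext fun L => h [] M M' L rfl
      rw [erase_right_comm, h1, ← add_mul, posSign_swap hκ hM.1 hM.2.2 hM.2.1.symm, zero_mul]
    · rintro ⟨M, M'⟩ hM -
      simp only [mem_sigma, mem_erase] at hM
      simp only [ne_eq, Sigma.mk.injEq, not_and]
      exact fun h' => absurd h' hM.2.1
    · rintro ⟨M, M'⟩ hM
      simp only [mem_sigma, mem_erase] at hM ⊢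
      exact ⟨hM.2.2, hM.2.1.symm, hM.1⟩
    · rintro ⟨M, M'⟩ _; rfl
  | succ j ih =>
    obtain ⟨r, rfl⟩ : ∃ r', r = r' + 1 := ⟨r - 1, by omega⟩
    refine Finset.sum_eq_zero fun M _ => ?_
    rw [ih (by omega) fun A M₁ M₂ R hA => h (M :: A) M₁ M₂ R (by simp [hA]), mul_zero]

theorem alternation_succ_last (hκ : Function.Injective κ) (Φ : List β → k) (r : ℕ) (N : Finset β) :
    alternation κ Φ (r + 1) N = (-1) ^ r *
      ∑ M ∈ N, posSign κ k M N * alternation κ (fun L => Φ (L ++ [M])) r (N.erase M) := by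
  induction r generalizing Φ N with
  | zero => simp [alternation]
  | succ r ih =>
    have h1 : alternation κ Φ (r + 1 + 1) N = ∑ M ∈ N, posSign κ k M N * ((-1) ^ r *
        ∑ M' ∈ N.erase M, posSign κ k M' (N.erase M) *
          alternation κ (fun L => Φ (M :: (L ++ [M']))) r ((N.erase M).erase M')) :=
      Finset.sum_congr rfl fun M _ => by rw [ih]
    have h2 : ∑ M ∈ N, posSign κ k M N *
        alternation κ (fun L => Φ (L ++ [M])) (r + 1) (N.erase M) = ∑ M ∈ N, posSign κ k M N *
        ∑ M' ∈ N.erase M, posSign κ k M' (N.erase M) *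
          alternation κ (fun L => Φ (M' :: (L ++ [M]))) r ((N.erase M).erase M') := rfl
    rw [h1, h2]
    simp only [mul_sum]
    rw [Finset.sum_sigma', Finset.sum_sigma']
    refine Finset.sum_nbij' (fun p => ⟨p.2, p.1⟩) (fun p => ⟨p.2, p.1⟩) ?_ ?_ (fun _ _ => rfl)
      (fun _ _ => rfl) ?_
    · rintro ⟨M, M'⟩ hM
      simp only [mem_sigma, mem_erase] at hM ⊢
      exact ⟨hM.2.2, hM.2.1.symm, hM.1⟩
    · rintro ⟨M, M'⟩ hM
      simp only [mem_sigma, mem_erase] at hM ⊢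
      exact ⟨hM.2.2, hM.2.1.symm, hM.1⟩
    · rintro ⟨M, M'⟩ hM
      simp only [mem_sigma, mem_erase] at hM
      have h3 := posSign_swap (k := k) hκ hM.1 hM.2.2 hM.2.1.symm
      dsimp only
      rw [erase_right_comm, pow_succ]
      linear_combination ((-1) ^ r * alternation κ (fun L => Φ (M :: (L ++ [M']))) r
        ((N.erase M').erase M)) * h3

end Alternation

section FirstPos
variable {n : ℕ}

/-- The index of the first member of the list that contains `x`, or the length of the list if there
is none. -/
def firstPos : List (Finset (Fin n)) → Fin n → ℕ
  | [], _ => 0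
  | M :: L, x => if x ∈ M then 0 else firstPos L x + 1

theorem firstPos_le (L : List (Finset (Fin n))) (x : Fin n) : firstPos L x ≤ L.length := by
  induction L with
  | nil => exact le_rfl
  | cons M L ih => rw [firstPos, List.length_cons]; split_ifs <;> omega

theorem firstPos_lt_iff {L : List (Finset (Fin n))} {x : Fin n} :
    firstPos L x < L.length ↔ ∃ M ∈ L, x ∈ M := by
  induction L with
  | nil => simp [firstPos]
  | cons M L ih =>
    rw [firstPos, List.length_cons]
    split_ifs with h
    · simp [h]
    · simp [h, ← ih]

theorem firstPos_append (A R : List (Finset (Fin n))) (x : Fin n) : firstPos (A ++ R) x =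
    if firstPos A x < A.length then firstPos A x else A.length + firstPos R x := by
  induction A with
  | nil => simp [firstPos]
  | cons M A ih =>
    rw [List.cons_append, firstPos, firstPos, ih, List.length_cons]
    split_ifs <;> omega

theorem shift_firstPos_swap (A R : List (Finset (Fin n))) (M M' : Finset (Fin n)) (x : Fin n) :
    shift A.length (firstPos (A ++ M :: M' :: R) x) =
      shift A.length (firstPos (A ++ M' :: M :: R) x) := by
  rw [firstPos_append, firstPos_append]
  simp only [firstPos, shift]
  split_ifs <;> omega

theorem shift_firstPos_concat (A : List (Finset (Fin n))) (M : Finset (Fin n)) (x : Fin n) :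
    shift A.length (firstPos (A ++ [M]) x) = firstPos A x := by
  have := firstPos_le A x
  rw [firstPos_append]
  simp only [firstPos, shift]
  split_ifs <;> omega

variable {k : Type w} [Field k]

open scoped Classical in
/-- The value of a function on the ordered partition with given positions,
    and zero if there is no such
partition. -/
noncomputable def evalPos (c : TOPartition.{t} n → k) (s : ℕ) (p : Fin n → ℕ) : k :=
  if h : ∃ α : TOPartition.{t} n, α.numBlocks = s ∧ ∀ x, α.pos x = p x then c h.choose else 0

theorem evalPos_eq (c : TOPartition.{t} n → k) {α : TOPartition.{t} n} {s : ℕ} {p : Fin n → ℕ}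
    (h : α.numBlocks = s) (hp : ∀ x, α.pos x = p x) : evalPos c s p = c α := by
  have h' : ∃ α : TOPartition.{t} n, α.numBlocks = s ∧ ∀ x, α.pos x = p x := ⟨α, h, hp⟩
  rw [evalPos, dif_pos h']
  congr 1
  exact TOPartition.ext' (h'.choose_spec.1.trans h.symm) fun x =>
    (h'.choose_spec.2 x).trans (hp x).symm

theorem exists_of_evalPos {c : TOPartition.{t} n → k} {s : ℕ} {p : Fin n → ℕ}
    (h : evalPos c s p ≠ 0) :
    ∃ α : TOPartition.{t} n, c α ≠ 0 ∧ α.numBlocks = s ∧ ∀ x, α.pos x = p x := by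
  unfold evalPos at h
  split_ifs at h with h'
  · exact ⟨_, h, h'.choose_spec⟩
  · exact absurd rfl h

theorem evalPos_eq_zero (c : TOPartition.{t} n → k) {s i : ℕ} {p : Fin n → ℕ} (hi : i < s)
    (h : ∀ x, p x ≠ i) : evalPos c s p = 0 := by
  by_contra h'
  obtain ⟨α, -, h1, h2⟩ := exists_of_evalPos h'
  obtain ⟨x, hx⟩ := α.exists_pos i (by omega)
  exact h x (by rw [← h2, hx])

theorem evalPos_add (c c' : TOPartition.{t} n → k) (s : ℕ) (p : Fin n → ℕ) :
    evalPos (c + c') s p = evalPos c s p + evalPos c' s p := by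
  unfold evalPos; split_ifs
  · rfl
  · exact (add_zero 0).symm

theorem evalPos_smul (a : k) (c : TOPartition.{t} n → k) (s : ℕ) (p : Fin n → ℕ) :
    evalPos (a • c) s p = a * evalPos c s p := by
  unfold evalPos; split_ifs
  · rfl
  · exact (mul_zero a).symm

theorem evalPos_boundary (c : TOPartition.{t} n → k) {r : ℕ} {p : Fin n → ℕ} (hp : ∀ x, p x ≤ r)
    (h0 : ∃ x, p x = 0) (hr : ∃ x, p x = r) : evalPos (TOPartition.boundary k n c) (r + 1) p =
      ∑ j ∈ Finset.range r, (-1) ^ j * evalPos c r (fun x => shift j (p x)) := by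
  by_cases h : ∀ i < r + 1, ∃ x, p x = i
  · let α : TOPartition.{t} n := ⟨r + 1, p, fun x => Nat.lt_succ_of_le (hp x), h⟩
    rw [evalPos_eq (α := α) _ rfl fun x => rfl]
    change ∑ j ∈ Finset.range r, (-1 : k) ^ j * c (α.merge j) = _
    refine Finset.sum_congr rfl fun j hj => ?_
    have hj' : j + 1 < r + 1 := Nat.succ_lt_succ (Finset.mem_range.1 hj)
    rw [evalPos_eq c (α := α.merge j) (s := r) (p := fun x => shift j (p x))
      (α.numBlocks_merge hj') (α.pos_merge hj')]
  · push Not at h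
    obtain ⟨i, hi, hx⟩ := h
    rw [evalPos_eq_zero _ hi hx]
    obtain ⟨x₀, hx₀⟩ := h0
    obtain ⟨x₁, hx₁⟩ := hr
    have h1 : i ≠ 0 := fun e => hx x₀ (by omega)
    have h2 : i ≠ r := fun e => hx x₁ (by omega)
    have h3 : i - 1 ≠ i := by omega
    rw [← Finset.sum_subset (s₁ := {i - 1, i}) (s₂ := Finset.range r)
      (f := fun j => (-1 : k) ^ j * evalPos c r fun x => shift j (p x))]
    · have h4 : (fun x => shift (i - 1) (p x)) = fun x => shift i (p x) := by
        funext x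
        have := hx x
        simp only [shift]; split_ifs <;> omega
      rw [Finset.sum_pair h3, h4]
      have h5 : (-1 : k) ^ i = (-1) ^ (i - 1) * (-1) := by
        rw [← pow_succ, Nat.sub_add_cancel (by omega)]
      rw [h5]; ring
    · intro j hj
      simp only [Finset.mem_insert, Finset.mem_singleton] at hj
      rw [Finset.mem_range]; omega
    · intro j hj hj'
      simp only [Finset.mem_insert, Finset.mem_singleton, not_or] at hj'
      rw [Finset.mem_range] at hj
      rcases Nat.lt_or_ge j i with hlt | hge
      · rw [evalPos_eq_zero c (i := i - 1) (by omega) fun x => ?_, mul_zero]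
        have := hx x
        simp only [shift]; split_ifs <;> omega
      · rw [evalPos_eq_zero c (i := i) (by omega) fun x => ?_, mul_zero]
        have := hx x
        simp only [shift]; split_ifs <;> omega

end FirstPos

open Finset

section FirstPos
variable {n : ℕ} {L : List (Finset (Fin n))} {x : Fin n} {i : ℕ}

theorem firstPos_le_of_mem (hi : i < L.length) (h : x ∈ L[i]) : firstPos L x ≤ i := by
  induction L generalizing i with
  | nil => simp at hi
  | cons M L ih =>
    rw [firstPos]
    split_ifs with hM
    · exact Nat.zero_le _
    · cases i with
      | zero => exact absurd h hM
      | succ i => exact Nat.succ_le_succ (ih (by simpa using hi) (by simpa using h))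

theorem mem_of_firstPos_eq (hi : i < L.length) (h : firstPos L x = i) : x ∈ L[i] := by
  induction L generalizing i with
  | nil => simp at hi
  | cons M L ih =>
    rw [firstPos] at h
    split_ifs at h with hM
    · subst h; exact hM
    · cases i with
      | zero => omega
      | succ i => simpa using ih (by simpa using hi) (by omega)

theorem mem_sup_toFinset : x ∈ L.toFinset.sup id ↔ firstPos L x < L.length := by
  rw [firstPos_lt_iff, Finset.mem_sup]; simp

theorem leastBlock_eq {α : TOPartition.{t} n} (h : α.numBlocks = L.length + 1)
    (hp : ∀ x, α.pos x = firstPos L x) : α.leastBlock = (L.toFinset.sup id)ᶜ := by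
  ext x
  have := firstPos_le L x
  rw [TOPartition.leastBlock, mem_filter, mem_compl, mem_sup_toFinset, hp, h]
  simp only [mem_univ, true_and]; omega

end FirstPos

namespace BuildingSet
open scoped Classical in
section
variable {n : ℕ} {B : BuildingSet n}

variable (B) in
/-- The nested families that do not contain the whole set. -/
def Adm (N : Finset (Finset (Fin n))) : Prop := B.Nested N ∧ univ ∉ N

theorem Adm.mono {N N' : Finset (Finset (Fin n))} (h : B.Adm N) (h' : N' ⊆ N) : B.Adm N' :=
  ⟨h.1.mono h', fun h'' => h.2 (h' h'')⟩

theorem Adm.sup_ne (hB : B.mem univ) {N : Finset (Finset (Fin n))} (h : B.Adm N) :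
    N.sup id ≠ univ := fun e => h.2 (by
  have := h.1.2 N subset_rfl (by rw [e]; exact hB)
  rwa [e] at this)

theorem mem_union_sup {S : Finset (Fin n)} (hS : B.mem S) {J : Finset (Finset (Fin n))}
    (h : ∀ M ∈ J, B.mem M ∧ ∃ x, x ∈ S ∧ x ∈ M) : B.mem (S ∪ J.sup id) := by
  induction J using Finset.induction_on with
  | empty => simpa using hS
  | insert M J hM ih =>
    have h1 := ih fun M' hM' => h M' (mem_insert_of_mem hM')
    obtain ⟨h2, x, hx, hx'⟩ := h M (mem_insert_self _ _)
    have := B.union h1 h2 ⟨x, mem_union_left _ hx, hx'⟩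
    rw [sup_insert, id, sup_eq_union]
    rwa [union_comm M, ← union_assoc]

theorem Nested.getElem_eq_component {L : List (Finset (Fin n))} (h : B.Nested L.toFinset)
    {i : ℕ} (hi : i < L.length) {x : Fin n} (hx : firstPos L x = i) :
    L[i] = B.component x (univ.filter fun y => firstPos L y ≤ i) := by
  have hmem : ∀ j (hj : j < L.length), B.mem L[j] := fun j hj => h.1 _ (by simp)
  have hxi := mem_of_firstPos_eq hi hx
  refine subset_antisymm (subset_component (hmem i hi) hxi fun y hy => ?_) ?_
  · rw [mem_filter]; exact ⟨mem_univ y, firstPos_le_of_mem hi hy⟩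
  · set U := univ.filter fun y => firstPos L y ≤ i
    obtain ⟨h1, h2⟩ := B.mem_component (x := x) (U := U) (by simp [U, hx])
    let J := L.toFinset.filter fun M => (∃ j, ∃ hj : j < L.length, j ≤ i ∧ L[j] = M) ∧
      ∃ y, y ∈ B.component x U ∧ y ∈ M
    have hsub : B.component x U ⊆ J.sup id := fun y hy => by
      have hy' : firstPos L y ≤ i := (mem_filter.1 (B.component_subset x U hy)).2
      have hy'' := mem_of_firstPos_eq (lt_of_le_of_lt hy' hi) rfl
      exact Finset.mem_sup.2 ⟨_, mem_filter.2 ⟨by simp, ⟨_, _, hy', rfl⟩, y, hy, hy''⟩, hy''⟩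
    have h3 : B.mem (J.sup id) := by
      have := mem_union_sup h1 (J := J) fun M hM =>
        ⟨h.1 M (mem_filter.1 hM).1, (mem_filter.1 hM).2.2⟩
      rwa [union_eq_right.2 hsub] at this
    have h4 := h.2 J (filter_subset _ _) h3
    obtain ⟨⟨j, hj, hji, hjM⟩, -⟩ := (mem_filter.1 h4).2
    have h5 : firstPos L x ≤ j := firstPos_le_of_mem hj (by rw [hjM]; exact hsub h2)
    obtain rfl : j = i := by omega
    rw [hjM]; exact hsub

theorem Nested.list_unique {L L' : List (Finset (Fin n))} (h : B.Nested L.toFinset)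
    (h' : B.Nested L'.toFinset) (hl : L.length = L'.length)
    (hp : ∀ x, firstPos L x = firstPos L' x) (hs : ∀ i < L.length, ∃ x, firstPos L x = i) :
    L = L' := by
  refine List.ext_getElem hl fun i hi hi' => ?_
  obtain ⟨x, hx⟩ := hs i hi
  rw [h.getElem_eq_component hi hx, h'.getElem_eq_component hi' ((hp x).symm.trans hx)]
  simp only [hp]

theorem Nested.exists_order {N : Finset (Finset (Fin n))} (h : B.Nested N) :
    ∃ L, Orders N L ∧ ∀ i < L.length, ∃ x, firstPos L x = i := by
  induction hr : N.card generalizing N with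
  | zero =>
    rw [card_eq_zero.1 hr]
    exact ⟨[], ⟨List.nodup_nil, rfl⟩, fun i hi => absurd hi (Nat.not_lt_zero _)⟩
  | succ r ih =>
    obtain ⟨M, hM, hmax⟩ := N.exists_max_image Finset.card (card_pos.1 (by omega))
    obtain ⟨L, hL, hs⟩ := ih (h.mono (erase_subset M N)) (by rw [card_erase_of_mem hM, hr]; rfl)
    have hmem : ∀ M', M' ∈ L ↔ M' ≠ M ∧ M' ∈ N := fun M' => by
      rw [← List.mem_toFinset, hL.2, mem_erase]
    have hML : M ∉ L := fun h' => ((hmem M).1 h').1 rfl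
    refine ⟨L ++ [M], ⟨?_, ?_⟩, fun i hi => ?_⟩
    · rw [← List.concat_eq_append]; exact hL.1.concat hML
    · ext M'; simp only [List.mem_toFinset, List.mem_append, hmem, List.mem_singleton]
      constructor
      · rintro (h' | rfl); exacts [h'.2, hM]
      · intro h'; by_cases e : M' = M; exacts [Or.inr e, Or.inl ⟨e, h'⟩]
    · rw [List.length_append, List.length_singleton] at hi
      rcases Nat.lt_succ_iff_lt_or_eq.1 hi with hi | rfl
      · obtain ⟨x, hx⟩ := hs i hi
        exact ⟨x, by rw [firstPos_append, if_pos (by omega), hx]⟩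
      · obtain ⟨x, hxM, hx⟩ : ∃ x ∈ M, ∀ M' ∈ L, x ∉ M' := by
          by_contra hcon
          push Not at hcon
          let J := (N.erase M).filter (· ⊆ M)
          have hJ : J.sup id = M := by
            refine subset_antisymm (Finset.sup_le fun M' hM' => (mem_filter.1 hM').2)
              fun x hx => ?_
            obtain ⟨M', hM', hx'⟩ := hcon x hx
            obtain ⟨h1, h2⟩ := (hmem M').1 hM'
            refine Finset.mem_sup.2 ⟨M', mem_filter.2 ⟨mem_erase.2 ⟨h1, h2⟩, ?_⟩, hx'⟩
            rcases h.subset_or hM h2 hx hx' with h3 | h3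
            · exact absurd (eq_of_subset_of_card_le h3 (hmax M' h2)).symm h1
            · exact h3
          have := h.2 J ((filter_subset _ _).trans (erase_subset _ _)) (by rw [hJ]; exact h.1 M hM)
          rw [hJ] at this
          exact (mem_erase.1 (mem_filter.1 this).1).1 rfl
        have h1 : ¬ firstPos L x < L.length := fun h' => by
          obtain ⟨M', hM', hx'⟩ := firstPos_lt_iff.1 h'
          exact hx M' hM' hx'
        exact ⟨x, by rw [firstPos_append, if_neg h1, firstPos, if_pos hxM]; rfl⟩

/-- The ordered partition of the points by the first member that contains them. -/
theorem Adm.exists_partition (hB : B.mem univ) {N : Finset (Finset (Fin n))} (h : B.Adm N) :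
    ∃ (L : List (Finset (Fin n))) (α : TOPartition.{t} n), Orders N L ∧
      α.numBlocks = L.length + 1 ∧ ∀ x, α.pos x = firstPos L x := by
  obtain ⟨L, hL, hs⟩ := h.1.exists_order
  refine ⟨L, ⟨L.length + 1, firstPos L, fun x => Nat.lt_succ_of_le (firstPos_le L x),
    fun i hi => ?_⟩, hL, rfl, fun _ => rfl⟩
  rcases Nat.lt_succ_iff_lt_or_eq.1 hi with hi | rfl
  · exact hs i hi
  · obtain ⟨x, hx⟩ : ∃ x, x ∉ N.sup id := by
      by_contra hcon
      push Not at hcon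
      exact h.sup_ne hB (eq_univ_iff_forall.2 hcon)
    rw [← hL.2, mem_sup_toFinset] at hx
    exact ⟨x, le_antisymm (firstPos_le L x) (not_lt.1 hx)⟩

theorem Adm.card_lt (hB : B.mem univ) {N : Finset (Finset (Fin n))} (h : B.Adm N) :
    N.card + 1 ≤ n := by
  obtain ⟨L, α, hL, h1, -⟩ := h.exists_partition.{0} hB
  rw [← hL.length_eq, ← h1]; exact α.numBlocks_le

theorem exists_list {α : TOPartition.{t} n} (h : ∀ x y, α.pos x = α.pos y →
      α.pos x + 1 < α.numBlocks → y ∈ B.component x (univ.filter fun z => α.pos z ≤ α.pos x)) :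
    ∃ L : List (Finset (Fin n)), L.Nodup ∧ B.Nested L.toFinset ∧
      (0 < α.numBlocks → univ ∉ L.toFinset ∧ α.numBlocks = L.length + 1 ∧
        ∀ x, α.pos x = firstPos L x) := by
  rcases Nat.eq_zero_or_pos α.numBlocks with h0 | h0
  · exact ⟨[], List.nodup_nil, ⟨by simp, fun J hJ hm => by
      obtain rfl : J = ∅ := subset_empty.1 hJ
      exact absurd (B.nonempty hm) (by simp)⟩, fun h' => absurd h' (by omega)⟩
  obtain ⟨s, hs⟩ : ∃ s, α.numBlocks = s + 1 := ⟨α.numBlocks - 1, by omega⟩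
  have : ∀ i, ∃ x, i < s → α.pos x = i := fun i => by
    obtain ⟨x₀, -⟩ := α.exists_pos 0 h0
    by_cases hi : i < s
    · exact (α.exists_pos i (by omega)).imp fun x hx _ => hx
    · exact ⟨x₀, fun h' => absurd h' hi⟩
  choose y hy using this
  let C : ℕ → Finset (Fin n) := fun i => B.component (y i) (univ.filter fun z => α.pos z ≤ i)
  have hC : ∀ i < s, B.mem (C i) ∧ y i ∈ C i := fun i hi => B.mem_component (by simp [hy i hi])
  have hCs : ∀ i z, z ∈ C i → α.pos z ≤ i := fun i z hz =>
    (mem_filter.1 (B.component_subset _ _ hz)).2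
  have hCm : ∀ z, α.pos z < s → z ∈ C (α.pos z) := fun z hz => by
    have := h (y (α.pos z)) z (hy _ hz) (by rw [hy _ hz]; omega)
    rwa [hy _ hz] at this
  let L := (List.range s).map C
  have hlen : L.length = s := by simp [L]
  have hget : ∀ i (hi : i < L.length), L[i] = C i := fun i hi => by simp [L]
  have hmemL : ∀ M, M ∈ L.toFinset ↔ ∃ i < s, C i = M := fun M => by simp [L]
  refine ⟨L, ?_, ⟨?_, ?_⟩, fun _ => ⟨?_, by omega, fun x => ?_⟩⟩
  · refine List.Nodup.map_on ?_ List.nodup_range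
    intro i hi j hj hij
    rw [List.mem_range] at hi hj
    have h1 := hCs j (y i) (hij ▸ (hC i hi).2)
    have h2 := hCs i (y j) (hij ▸ (hC j hj).2)
    rw [hy i hi] at h1; rw [hy j hj] at h2
    omega
  · intro M hM
    obtain ⟨i, hi, rfl⟩ := (hmemL M).1 hM
    exact (hC i hi).1
  · intro J hJ hm
    have hJne : J.Nonempty := by
      rw [nonempty_iff_ne_empty]
      rintro rfl
      exact absurd (B.nonempty hm) (by simp)
    have h1 : ((Finset.range s).filter fun i => C i ∈ J).Nonempty := by
      obtain ⟨M, hM⟩ := hJne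
      obtain ⟨i, hi, rfl⟩ := (hmemL M).1 (hJ hM)
      exact ⟨i, by simp [hi, hM]⟩
    obtain ⟨i, hi, hmax⟩ := Finset.exists_max_image _ (fun i => i) h1
    rw [mem_filter, Finset.mem_range] at hi
    have h2 : C i ⊆ J.sup id := le_sup (f := id) hi.2
    have h3 : J.sup id ⊆ C i := by
      refine subset_component hm (h2 (hC i hi.1).2) (Finset.sup_le fun M hM z hz => ?_)
      obtain ⟨j, hj, rfl⟩ := (hmemL M).1 (hJ hM)
      rw [mem_filter]
      exact ⟨mem_univ _, (hCs j z hz).trans (hmax j (by simp [hj, hM]))⟩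
    rw [subset_antisymm h3 h2]; exact hi.2
  · intro hu
    obtain ⟨i, hi, hiu⟩ := (hmemL _).1 hu
    obtain ⟨z, hz⟩ := α.exists_pos s (by omega)
    have := hCs i z (by rw [hiu]; exact mem_univ z)
    omega
  · have hlt := α.pos_lt x
    by_cases hx : α.pos x < s
    · refine le_antisymm ?_ ?_
      · by_contra hcon
        have h1 := mem_of_firstPos_eq (L := L) (i := firstPos L x) (by omega) rfl
        rw [hget] at h1
        exact absurd (hCs _ _ h1) (by omega)
      · exact firstPos_le_of_mem (by omega) (by rw [hget _ (by omega)]; exact hCm x hx)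
    · have h1 : ¬ firstPos L x < L.length := fun h' => by
        have h2 := mem_of_firstPos_eq h' rfl
        rw [hget] at h2
        have := hCs _ _ h2
        omega
      have := firstPos_le L x
      omega

variable (B) {k : Type w} [Field k] (κ : Finset (Fin n) → ℕ)

/-- The value of a function on ordered partitions at the partition of the points by the first member
of a list that contains them. -/
noncomputable def flagValue (c : TOPartition.{t} n → k) (L : List (Finset (Fin n))) : k :=
  evalPos c (L.length + 1) (firstPos L)

/-- The cochain on nested families whose value on a family is the alternating sum over the orderings of
the family of the values on the ordered partitions given by the first member containing a point. -/
noncomputable def transfer : (TOPartition.{t} n → k) →ₗ[k] (Finset (Finset (Fin n)) → k) where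
  toFun c N := if B.Adm N then alternation κ (flagValue c) N.card N else 0
  map_add' c c' := by
    funext N
    simp only [Pi.add_apply]
    split_ifs
    · rw [← alternation_add]; congr 1; funext L; exact evalPos_add _ _ _ _
    · exact (add_zero 0).symm
  map_smul' r c := by
    funext N
    simp only [Pi.smul_apply, RingHom.id_apply, smul_eq_mul]
    split_ifs
    · rw [← alternation_smul]; congr 1; funext L; exact evalPos_smul _ _ _ _
    · exact (mul_zero r).symm

variable {B κ}

theorem transfer_apply (c : TOPartition.{t} n → k) (N : Finset (Finset (Fin n))) :
    transfer B κ c N = if B.Adm N then alternation κ (flagValue c) N.card N else 0 := rfl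

theorem transfer_boundary (hκ : Function.Injective κ) (hB : B.mem univ)
    (c : TOPartition.{t} n → k) {N : Finset (Finset (Fin n))} (h : B.Adm N) :
    transfer B κ (TOPartition.boundary k n c) N = coboundary κ (transfer B κ c) N := by
  rw [transfer_apply, if_pos h]
  have h1 : ∀ L, Orders N L → flagValue (TOPartition.boundary k n c) L =
      ∑ j ∈ Finset.range N.card, (-1) ^ j *
        evalPos c N.card (fun x => shift j (firstPos L x)) := fun L hL => by
    rw [flagValue, evalPos_boundary c (firstPos_le L) ?_ ?_, hL.length_eq]
    · cases L with
      | nil => exact (B.nonempty hB).imp fun x _ => rfl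
      | cons M L =>
        exact (B.nonempty (h.1.1 M hL.of_cons.1)).imp fun x hx => by rw [firstPos, if_pos hx]
    · by_contra hcon
      push Not at hcon
      refine h.sup_ne hB (eq_univ_iff_forall.2 fun x => ?_)
      rw [← hL.2, mem_sup_toFinset]
      exact lt_of_le_of_ne (firstPos_le L x) (hcon x)
  rw [alternation_congr rfl h1, alternation_sum]
  rcases hr : N.card with _ | r
  · rw [card_eq_zero.1 hr]; rfl
  rw [Finset.sum_range_succ, Finset.sum_eq_zero, zero_add, alternation_succ_last hκ, coboundary,
    Finset.mul_sum]
  · refine Finset.sum_congr rfl fun M hM => ?_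
    have h2 : (N.erase M).card = r := by rw [card_erase_of_mem hM, hr]; rfl
    rw [transfer_apply, if_pos (h.mono (erase_subset M N)), h2,
      alternation_congr (Φ' := fun L => (-1) ^ r * flagValue c L) h2, alternation_smul]
    · have : ((-1 : k) ^ r) * (-1) ^ r = 1 := by rw [← mul_pow]; simp
      linear_combination (posSign κ k M N * alternation κ (flagValue c) r (N.erase M)) * this
    · intro L hL
      have h3 : L.length = r := by rw [hL.length_eq, h2]
      rw [flagValue, h3]
      congr 2
      funext x
      rw [← h3, shift_firstPos_concat]
  · intro j hj
    rw [alternation_smul, alternation_eq_zero_of_symm hκ (j := j), mul_zero]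
    · have := Finset.mem_range.1 hj; omega
    · intro A M M' R hA
      congr 1
      funext x
      rw [← hA, shift_firstPos_swap]

theorem exists_of_transfer {c : TOPartition.{t} n → k} {N : Finset (Finset (Fin n))}
    (h : transfer B κ c N ≠ 0) : B.Adm N ∧ ∃ α L, c α ≠ 0 ∧ Orders N L ∧
      α.numBlocks = L.length + 1 ∧ ∀ x, α.pos x = firstPos L x := by
  rw [transfer_apply] at h
  split_ifs at h with hN
  · refine ⟨hN, ?_⟩
    by_contra hcon
    refine h ?_
    rw [alternation_congr (Φ' := fun _ => 0) rfl fun L hL => ?_, alternation_zero]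
    by_contra hne
    obtain ⟨α, h1, h2, h3⟩ := exists_of_evalPos hne
    exact hcon ⟨α, L, h1, hL, h2, h3⟩
  · exact absurd rfl h

theorem transfer_single {α : TOPartition.{t} n} {L : List (Finset (Fin n))} (hL : L.Nodup)
    (hN : B.Adm L.toFinset) (h1 : α.numBlocks = L.length + 1) (h2 : ∀ x, α.pos x = firstPos L x)
    (r : k) (N : Finset (Finset (Fin n))) :
    transfer B κ (Pi.single α r) N = if N = L.toFinset then listSign κ k L * r else 0 := by
  have key : ∀ N' L', B.Adm N' → Orders N' L' → flagValue (Pi.single α r) L' ≠ 0 → L' = L := by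
    intro N' L' hN' hL' h
    obtain ⟨β, h3, h4, h5⟩ := exists_of_evalPos h
    obtain rfl : β = α := by
      by_contra hne; exact h3 (Pi.single_eq_of_ne hne _)
    refine (hN.1.list_unique (L' := L') (by rw [hL'.2]; exact hN'.1) (by omega)
      (fun x => by rw [← h2, h5]) fun i hi => ?_).symm
    exact (β.exists_pos i (by omega)).imp fun x hx => by rw [← h2, hx]
  rw [transfer_apply]
  by_cases hNL : N = L.toFinset
  · rw [if_pos hNL, hNL, if_pos hN, alternation_eq_single (L₀ := L) ⟨hL, rfl⟩, flagValue,
      evalPos_eq _ h1 h2, Pi.single_eq_same]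
    intro L' hL' hne
    by_contra h; exact hne (key _ L' hN hL' h)
  · rw [if_neg hNL]
    split_ifs with hA
    · rw [alternation_congr (Φ' := fun _ => 0) rfl fun L' hL' => ?_, alternation_zero]
      by_contra h
      exact hNL (by rw [← key N L' hA hL' h, hL'.2])
    · rfl

theorem exists_transfer_eq (hB : B.mem univ) {b : Finset (Finset (Fin n)) → k}
    (hb : ∀ N, b N ≠ 0 → B.Adm N) : ∃ c : TOPartition.{t} n → k, transfer B κ c = b ∧
      ∀ α, c α ≠ 0 → ∃ N, b N ≠ 0 ∧ α.numBlocks = N.card + 1 ∧ α.leastBlock = (N.sup id)ᶜ := by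
  have : ∀ N, ∃ (L : List (Finset (Fin n))) (α : TOPartition.{t} n), B.Adm N → Orders N L ∧
      α.numBlocks = L.length + 1 ∧ ∀ x, α.pos x = firstPos L x := fun N => by
    by_cases h : B.Adm N
    · obtain ⟨L, α, h'⟩ := h.exists_partition.{t} hB
      exact ⟨L, α, fun _ => h'⟩
    · obtain ⟨-, α, -⟩ := Adm.exists_partition.{t} hB (N := ∅) ⟨⟨by simp, fun J hJ hm => by
        obtain rfl : J = ∅ := subset_empty.1 hJ
        exact absurd (B.nonempty hm) (by simp)⟩, by simp⟩
      exact ⟨[], α, fun h' => absurd h' h⟩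
  choose L α hα using this
  refine ⟨∑ N, Pi.single (α N) (listSign κ k (L N) * b N), ?_, fun β hβ => ?_⟩
  · funext N'
    rw [map_sum, Finset.sum_apply, Finset.sum_eq_single N']
    · by_cases h : b N' = 0
      · rw [h, mul_zero, Pi.single_zero, map_zero]; rfl
      · obtain ⟨h1, h2, h3⟩ := hα N' (hb N' h)
        rw [transfer_single h1.1 (by rw [h1.2]; exact hb N' h) h2 h3, if_pos h1.2.symm,
          ← mul_assoc, listSign_mul_self, one_mul]
    · intro N _ hne
      by_cases h : b N = 0
      · rw [h, mul_zero, Pi.single_zero, map_zero]; rfl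
      · obtain ⟨h1, h2, h3⟩ := hα N (hb N h)
        rw [transfer_single h1.1 (by rw [h1.2]; exact hb N h) h2 h3, if_neg]
        rw [h1.2]; exact hne.symm
    · exact fun h => absurd (mem_univ _) h
  · rw [Finset.sum_apply] at hβ
    obtain ⟨N, -, h⟩ := Finset.exists_ne_zero_of_sum_ne_zero hβ
    have h1 : β = α N := by
      by_contra hne; exact h (Pi.single_eq_of_ne hne _)
    subst h1
    rw [Pi.single_eq_same] at h
    have h2 := right_ne_zero_of_mul h
    obtain ⟨h3, h4, h5⟩ := hα N (hb N h2)
    exact ⟨N, h2, by rw [h4, h3.length_eq], by rw [leastBlock_eq h4 h5, h3.2]⟩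

end
end BuildingSet

namespace BuildingSet
open scoped Classical in
section
variable {n : ℕ} {B : BuildingSet n}

variable (n) in
/-- The building set of all nonempty sets. -/
def full : BuildingSet n where
  mem S := S.Nonempty
  nonempty h := h
  singleton x := singleton_nonempty x
  union h _ _ := h.mono subset_union_left

variable (n) in
/-- The building set of the singletons and the whole set. -/
def minimal : BuildingSet n where
  mem S := S.Nonempty ∧ (S = univ ∨ ∃ x, S = {x})
  nonempty h := h.1
  singleton x := ⟨singleton_nonempty x, Or.inr ⟨x, rfl⟩⟩
  union {S T} h h' hx := by
    refine ⟨h.1.mono subset_union_left, ?_⟩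
    rcases h.2 with rfl | ⟨y, rfl⟩
    · exact Or.inl (top_sup_eq T)
    rcases h'.2 with rfl | ⟨z, rfl⟩
    · exact Or.inl (sup_top_eq _)
    · obtain ⟨x, h1, h2⟩ := hx
      rw [mem_singleton] at h1 h2
      exact Or.inr ⟨x, by rw [← h1, ← h2, union_self]⟩

theorem Adm.minimal_eq {N : Finset (Finset (Fin n))} (h : (minimal n).Adm N)
    {M : Finset (Fin n)} (hM : M ∈ N) : ∃ x, M = {x} :=
  (h.1.1 M hM).2.resolve_left fun e => h.2 (e ▸ hM)

theorem minimal_adm_iff (hn : 0 < n) {N : Finset (Finset (Fin n))} : (minimal n).Adm N ↔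
    ∃ U : Finset (Fin n), U ≠ univ ∧ N = U.image Singleton.singleton := by
  have hB : (minimal n).mem univ := ⟨⟨⟨0, hn⟩, mem_univ _⟩, Or.inl rfl⟩
  constructor
  · intro h
    refine ⟨N.sup id, h.sup_ne hB, ?_⟩
    ext M
    simp only [mem_image, Finset.mem_sup, id]
    constructor
    · intro hM
      obtain ⟨x, rfl⟩ := h.minimal_eq hM
      exact ⟨x, ⟨{x}, hM, mem_singleton_self x⟩, rfl⟩
    · rintro ⟨x, ⟨M', hM', hx⟩, rfl⟩
      obtain ⟨y, rfl⟩ := h.minimal_eq hM'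
      rw [mem_singleton] at hx
      rwa [hx]
  · rintro ⟨U, hU, rfl⟩
    have key : ∀ J ⊆ U.image Singleton.singleton, J.sup id ⊆ U :=
        fun J hJ => Finset.sup_le fun M hM => by
      obtain ⟨x, hx, rfl⟩ := mem_image.1 (hJ hM)
      exact singleton_subset_iff.2 hx
    refine ⟨⟨fun M hM => ?_, fun J hJ hm => ?_⟩, fun hu => ?_⟩
    · obtain ⟨x, -, rfl⟩ := mem_image.1 hM
      exact (minimal n).singleton x
    · rcases hm.2 with e | ⟨x, e⟩
      · exact absurd (univ_subset_iff.1 (e ▸ key J hJ)) hU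
      · rw [e]
        obtain ⟨M, hM, hx⟩ := Finset.mem_sup.1 (e ▸ mem_singleton_self x : x ∈ J.sup id)
        obtain ⟨y, -, rfl⟩ := mem_image.1 (hJ hM)
        rw [id, mem_singleton] at hx
        rwa [hx]
    · exact hU (univ_subset_iff.1 (by
        have := key {univ} (singleton_subset_iff.2 hu)
        simpa using this))

theorem sup_image_singleton (U : Finset (Fin n)) :
    (U.image Singleton.singleton : Finset (Finset (Fin n))).sup id = U := by
  ext x; simp

theorem card_image_singleton (U : Finset (Fin n)) :
    (U.image Singleton.singleton : Finset (Finset (Fin n))).card = U.card :=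
  card_image_of_injective _ singleton_injective

theorem isSimplicial_of_card {α : TOPartition.{t} n} {L : List (Finset (Fin n))}
    (hL : L.Nodup) (h1 : α.numBlocks = L.length + 1) (h2 : ∀ x, α.pos x = firstPos L x)
    (h3 : L.toFinset.card = (L.toFinset.sup id).card) : α.IsSimplicial := by
  intro x y hxy hx
  have hm : ∀ z, z ∈ L.toFinset.sup id ↔ α.pos z < L.length := fun z => by
    rw [mem_sup_toFinset, h2]
  refine Finset.inj_on_of_surj_on_of_card_le (s := L.toFinset.sup id) (t := Finset.range L.length)
    (fun z _ => α.pos z) (fun z hz => Finset.mem_range.2 ((hm z).1 hz)) (fun i hi => ?_) ?_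
    ((hm x).2 (by omega)) ((hm y).2 (by omega)) hxy
  · have hi' := Finset.mem_range.1 hi
    obtain ⟨z, hz⟩ := α.exists_pos i (by omega)
    exact ⟨z, (hm z).2 (by omega), hz⟩
  · rw [card_range, ← h3, List.toFinset_card_of_nodup hL]

theorem card_of_isSimplicial {α : TOPartition.{t} n} {L : List (Finset (Fin n))}
    (hL : L.Nodup) (h : α.IsSimplicial) (h1 : α.numBlocks = L.length + 1)
    (h2 : ∀ x, α.pos x = firstPos L x) : L.toFinset.card = (L.toFinset.sup id).card := by
  have hm : ∀ z, z ∈ L.toFinset.sup id ↔ α.pos z < L.length := fun z => by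
    rw [mem_sup_toFinset, h2]
  rw [List.toFinset_card_of_nodup hL]
  conv_lhs => rw [← card_range L.length]
  refine (Finset.card_bij (fun z _ => α.pos z) (fun z hz => Finset.mem_range.2 ((hm z).1 hz))
    (fun x hx y _ hxy => h x y hxy (by have := (hm x).1 hx; omega)) fun i hi => ?_).symm
  have hi' := Finset.mem_range.1 hi
  obtain ⟨z, hz⟩ := α.exists_pos i (by omega)
  exact ⟨z, (hm z).2 (by omega), hz⟩

variable (B) in
theorem exists_list_of_isSimplicial (hn : 0 < n) {α : TOPartition.{t} n} (h : α.IsSimplicial) :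
    ∃ L : List (Finset (Fin n)), L.Nodup ∧ B.Adm L.toFinset ∧ α.numBlocks = L.length + 1 ∧
      ∀ x, α.pos x = firstPos L x := by
  obtain ⟨L, h1, h2, h3⟩ := exists_list (B := B) (α := α) fun x y hxy hx => by
    rw [← h x y hxy hx]
    exact (B.mem_component (by simp)).2
  obtain ⟨h4, h5, h6⟩ := h3 (lt_of_le_of_lt (Nat.zero_le _) (α.pos_lt ⟨0, hn⟩))
  exact ⟨L, h1, ⟨h2, h4⟩, h5, h6⟩

/-- The points of a member that lie in no smaller member of the family. -/
def peak (N : Finset (Finset (Fin n))) (M : Finset (Fin n)) : Finset (Fin n) :=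
  M.filter fun x => ∀ M' ∈ N, M' ⊂ M → x ∉ M'

theorem map_peak {α : TOPartition.{t} n} (hα : α.IsSimplicial) {L L' : List (Finset (Fin n))}
    (h : B.Adm L.toFinset) (h' : (minimal n).Adm L'.toFinset) (h1 : α.numBlocks = L.length + 1)
    (h1' : α.numBlocks = L'.length + 1) (h2 : ∀ x, α.pos x = firstPos L x)
    (h2' : ∀ x, α.pos x = firstPos L' x) : L.map (peak L.toFinset) = L' := by
  refine List.ext_getElem (by rw [List.length_map]; omega) fun i hi hi' => ?_
  rw [List.length_map] at hi
  rw [List.getElem_map]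
  obtain ⟨x, hx⟩ := α.exists_pos i (by omega)
  have hxi := mem_of_firstPos_eq hi ((h2 x).symm.trans hx)
  have hxi' := mem_of_firstPos_eq hi' ((h2' x).symm.trans hx)
  have hle : ∀ {j z} (hj : j < L.length), z ∈ L[j] → α.pos z ≤ j := fun hj hz =>
    (h2 _).trans_le (firstPos_le_of_mem hj hz)
  obtain ⟨y, hy⟩ := h'.minimal_eq (M := L'[i]) (by simp)
  have hxy : x = y := mem_singleton.1 (hy ▸ hxi')
  subst hxy
  rw [hy]
  ext z
  rw [peak, mem_filter, mem_singleton]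
  constructor
  · rintro ⟨hz, hz'⟩
    rcases Nat.lt_or_eq_of_le (hle hi hz) with hj | hj
    · have hzj := mem_of_firstPos_eq (hj.trans hi) (h2 z).symm
      have hnot : ¬ L[i] ⊆ L[α.pos z] := fun hs => by
        have := hle _ (hs hxi)
        omega
      refine absurd hzj (hz' _ (by simp) ?_)
      exact ⟨(h.1.subset_or (S := L[α.pos z]) (T := L[i]) (by simp) (by simp) hzj hz).resolve_right
        hnot, hnot⟩
    · exact hα z x (hj.trans hx.symm) (by omega)
  · rintro rfl
    refine ⟨hxi, fun M' hM' hs hz => ?_⟩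
    obtain ⟨j, hj, rfl⟩ := List.getElem_of_mem (List.mem_toFinset.1 hM')
    obtain ⟨y, hy⟩ := α.exists_pos j (by omega)
    have h3 := hle hi (hs.1 (mem_of_firstPos_eq hj ((h2 y).symm.trans hy)))
    have h4 := hle hj hz
    obtain rfl : i = j := by omega
    exact hs.2 subset_rfl

variable (κ : Finset (Fin n) → ℕ) (k : Type w) [Field k]

/-- The sign of the list of the peaks of a list of members. -/
noncomputable def peakSign (N : Finset (Finset (Fin n))) (L : List (Finset (Fin n))) : k :=
  if (L.map (peak N)).Nodup then listSign κ k (L.map (peak N)) else 0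

/-- The linear map that sums the values on the nested families with a given union and maximal size. -/
noncomputable def collapse :
    (Finset (Finset (Fin n)) → k) →ₗ[k] (Finset (Finset (Fin n)) → k) where
  toFun b N' := if (minimal n).Adm N' then
    ∑ N with N.sup id = N'.sup id ∧ N.card = (N.sup id).card,
      listSign κ k N.toList * peakSign κ k N N.toList * b N else 0
  map_add' b b' := by
    funext N
    simp only [Pi.add_apply]
    split_ifs
    · simp only [mul_add, sum_add_distrib]
    · exact (add_zero 0).symm
  map_smul' r b := by
    funext N
    simp only [Pi.smul_apply, RingHom.id_apply, smul_eq_mul]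
    split_ifs
    · rw [mul_sum]; exact Finset.sum_congr rfl fun _ _ => by ring
    · exact (mul_zero r).symm

variable {κ k}

theorem listSign_mul_peakSign (hκ : Function.Injective κ) {N : Finset (Finset (Fin n))}
    {L : List (Finset (Fin n))} (hL : Orders N L) :
    listSign κ k N.toList * peakSign κ k N N.toList = listSign κ k L * peakSign κ k N L := by
  refine listSign_mul_perm hκ (fun A M M' R _ => ?_) (Orders.perm ⟨N.nodup_toList, by simp⟩ hL)
    N.nodup_toList
  have hp : ((A ++ M :: M' :: R).map (peak N)).Perm ((A ++ M' :: M :: R).map (peak N)) :=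
    ((List.Perm.swap _ _ _).append_left A).map _
  unfold peakSign
  by_cases h : ((A ++ M :: M' :: R).map (peak N)).Nodup
  · rw [if_pos h, if_pos (hp.nodup_iff.1 h)]
    simp only [List.map_append, List.map_cons] at h ⊢
    exact listSign_swap hκ _ _ _ _ h
  · rw [if_neg h, if_neg fun h' => h (hp.nodup_iff.2 h'), neg_zero]

theorem collapse_transfer (hκ : Function.Injective κ) (hn : 0 < n) (c : TOPartition.{t} n → k) :
    collapse κ k (transfer B κ c) = transfer (minimal n) κ c := by
  suffices (collapse κ k) ∘ₗ (transfer B κ) =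
      (transfer (minimal n) κ : (TOPartition.{t} n → k) →ₗ[k] _) from
    LinearMap.congr_fun this c
  refine LinearMap.pi_ext fun α r => ?_
  funext N'
  change (if (minimal n).Adm N' then
    ∑ N with N.sup id = N'.sup id ∧ N.card = (N.sup id).card,
      listSign κ k N.toList * peakSign κ k N N.toList * transfer B κ (Pi.single α r) N else 0) = _
  by_cases hα : α.IsSimplicial
  · obtain ⟨L, h1, h2, h3, h4⟩ := exists_list_of_isSimplicial B hn hα
    obtain ⟨L', h1', h2', h3', h4'⟩ := exists_list_of_isSimplicial (minimal n) hn hα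
    have hsup : L.toFinset.sup id = L'.toFinset.sup id := by
      rw [← compl_inj_iff, ← leastBlock_eq h3 h4, ← leastBlock_eq h3' h4']
    rw [transfer_single h1' h2' h3' h4']
    simp only [transfer_single h1 h2 h3 h4, mul_ite, mul_zero]
    rw [Finset.sum_ite_eq' _ L.toFinset]
    simp only [mem_filter, mem_univ, true_and, card_of_isSimplicial h1 hα h3 h4, and_true]
    by_cases hN : N' = L'.toFinset
    · rw [if_pos hN, hN, if_pos h2', if_pos hsup, listSign_mul_peakSign hκ ⟨h1, rfl⟩, peakSign,
        map_peak hα h2 h2' h3 h3' h4 h4', if_pos h1']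
      linear_combination (listSign κ k L' * r) * listSign_mul_self (κ := κ) (k := k) L
    · rw [if_neg hN]
      split_ifs with h5 h6
      · exfalso
        obtain ⟨U, -, rfl⟩ := (minimal_adm_iff hn).1 h5
        obtain ⟨U', -, hU'⟩ := (minimal_adm_iff hn).1 h2'
        rw [hsup, hU', sup_image_singleton, sup_image_singleton] at h6
        exact hN (by rw [hU', h6])
      · rfl
      · rfl
  · have h0 : ∀ (B : BuildingSet n) (N : Finset (Finset (Fin n))), N.card = (N.sup id).card →
        transfer B κ (Pi.single α r) N = 0 := fun B N hN => by
      by_contra h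
      obtain ⟨-, β, L, h1, h2, h3, h4⟩ := exists_of_transfer h
      have h5 : β = α := by
        by_contra hne; exact h1 (Pi.single_eq_of_ne hne _)
      subst h5
      exact hα (isSimplicial_of_card h2.1 h3 h4 (by rw [h2.2]; exact hN))
    have h6 : transfer (minimal n) κ (Pi.single α r) N' = 0 := by
      by_cases h7 : (minimal n).Adm N'
      · obtain ⟨U, -, rfl⟩ := (minimal_adm_iff hn).1 h7
        exact h0 _ _ (by rw [card_image_singleton, sup_image_singleton])
      · rw [transfer_apply, if_neg h7]
    rw [h6]
    split_ifs
    · exact Finset.sum_eq_zero fun N hN => by rw [h0 B N (mem_filter.1 hN).2.2, mul_zero]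
    · rfl

/-- The number of inversions of a list of points. -/
theorem listSign_map_singleton (hκ : ∀ x y : Fin n, κ {x} < κ {y} ↔ x < y) {l : List (Fin n)}
    (hl : l.Nodup) : listSign κ k (l.map Singleton.singleton) =
        (-1) ^ (univ.filter fun p : Fin n × Fin n =>
      p.1 < p.2 ∧ firstPos (l.map Singleton.singleton) p.2 < firstPos (l.map Singleton.singleton) p.1 ∧
        p.1 ∈ l).card := by
  induction l with
  | nil => simp [listSign]
  | cons y l ih =>
    obtain ⟨hy, hl'⟩ := List.nodup_cons.1 hl
    have hlt : ∀ x, firstPos (l.map Singleton.singleton) x < l.length ↔ x ∈ l := fun x => by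
      have := firstPos_lt_iff (L := l.map Singleton.singleton) (x := x)
      rw [List.length_map] at this
      rw [this]
      simp
    have hle : ∀ x, firstPos (l.map Singleton.singleton) x ≤ l.length := fun x => by
      simpa using firstPos_le (l.map Singleton.singleton) x
    have hset : (univ.filter fun p : Fin n × Fin n => p.1 < p.2 ∧
        firstPos ((y :: l).map Singleton.singleton) p.2 < firstPos ((y :: l).map Singleton.singleton) p.1 ∧
          p.1 ∈ y :: l) = (univ.filter fun p : Fin n × Fin n => p.1 < p.2 ∧
        firstPos (l.map Singleton.singleton) p.2 < firstPos (l.map Singleton.singleton) p.1 ∧ p.1 ∈ l) ∪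
        (univ.filter fun x => x < y ∧ x ∈ l).image fun x => (x, y) := by
      ext ⟨a, b⟩
      simp only [mem_filter, mem_univ, true_and, mem_union, mem_image, Prod.mk.injEq, List.map_cons,
        firstPos, mem_singleton, List.mem_cons]
      have h1 := hlt a
      have h2 := hle a
      have h3 := hle b
      have h4 := hlt b
      by_cases hb : b = y
      · subst hb
        by_cases ha : a = b
        · subst ha; simp
        · have : ¬ firstPos (l.map Singleton.singleton) b < l.length := fun h => hy (h4.1 h)
          constructor
          · rintro ⟨h5, -, h6⟩
            exact Or.inr ⟨a, ⟨h5, h6.resolve_left ha⟩, rfl, rfl⟩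
          · rintro (⟨h5, h6, h7⟩ | ⟨x, ⟨h5, h6⟩, rfl, -⟩)
            · omega
            · exact ⟨h5, by simp [ha], Or.inr h6⟩
      · by_cases ha : a = y
        · subst ha
          simp [hy, hb]
        · simp only [if_neg hb, ha, false_or, if_false, Nat.add_lt_add_iff_right]
          constructor
          · exact Or.inl
          · rintro (h | ⟨x, -, -, rfl⟩)
            exacts [h, absurd rfl hb]
    have hdisj : Disjoint (univ.filter fun p : Fin n × Fin n => p.1 < p.2 ∧
        firstPos (l.map Singleton.singleton) p.2 < firstPos (l.map Singleton.singleton) p.1 ∧ p.1 ∈ l)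
        ((univ.filter fun x => x < y ∧ x ∈ l).image fun x => (x, y)) := by
      rw [Finset.disjoint_left]
      rintro ⟨a, b⟩ h1 h2
      obtain ⟨x, -, h3⟩ := mem_image.1 h2
      obtain ⟨rfl, rfl⟩ := Prod.mk.inj h3
      have h4 := (mem_filter.1 h1).2.2.1
      have h5 : ¬ firstPos (l.map Singleton.singleton) y < l.length := fun h => hy ((hlt y).1 h)
      have h6 := hle x
      dsimp only at h4
      omega
    have hcard : ((univ.filter fun x => x < y ∧ x ∈ l).image fun x => (x, y)).card =
        ((({y} : Finset (Fin n)) :: l.map Singleton.singleton).toFinset.filter fun M => κ M < κ {y}).card := by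
      rw [card_image_of_injective _ fun a b h => (Prod.mk.inj h).1]
      refine Finset.card_bij (fun x _ => {x}) (fun x hx => ?_) (fun x _ x' _ h =>
        singleton_injective h) fun M hM => ?_
      · obtain ⟨h1, h2⟩ := (mem_filter.1 hx).2
        rw [mem_filter, List.mem_toFinset]
        exact ⟨by simp [h2], (hκ x y).2 h1⟩
      · obtain ⟨h1, h2⟩ := mem_filter.1 hM
        rw [List.mem_toFinset, List.mem_cons, List.mem_map] at h1
        rcases h1 with rfl | ⟨x, hx, rfl⟩
        · exact absurd h2 (lt_irrefl _)
        · exact ⟨x, mem_filter.2 ⟨mem_univ _, (hκ x y).1 h2, hx⟩, rfl⟩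
    rw [hset, card_union_of_disjoint hdisj, pow_add, ← ih hl', hcard, List.map_cons, listSign,
      posSign, mul_comm]

variable (k) in
/-- The sign of the shuffle that puts the elements of `Y` after the others. -/
def shuffleSign (Y : Finset (Fin n)) : k :=
  (-1) ^ (univ.filter fun p : Fin n × Fin n => p.1 < p.2 ∧ p.1 ∈ Y ∧ p.2 ∉ Y).card

theorem listSign_mul_shuffleSign (hκ : ∀ x y : Fin n, κ {x} < κ {y} ↔ x < y)
    {α : TOPartition.{t} n} {L : List (Finset (Fin n))} (hL : L.Nodup)
    (h : (minimal n).Adm L.toFinset) (h1 : α.numBlocks = L.length + 1)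
    (h2 : ∀ x, α.pos x = firstPos L x) :
    listSign κ k L * shuffleSign k α.leastBlock = (-1) ^ α.inversions := by
  obtain ⟨l, rfl⟩ : ∃ l : List (Fin n), L = l.map Singleton.singleton := by
    have : ∀ M ∈ L, ∃ x : Fin n, M = {x} := fun M hM => h.minimal_eq (by simpa using hM)
    suffices ∀ L : List (Finset (Fin n)), (∀ M ∈ L, ∃ x : Fin n, M = {x}) →
        ∃ l : List (Fin n), L = l.map Singleton.singleton from this L ‹_›
    clear this
    intro L this
    induction L with
    | nil => exact ⟨[], rfl⟩
    | cons M L ih =>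
      obtain ⟨x, rfl⟩ := this M (by simp)
      obtain ⟨l, rfl⟩ := ih fun M' hM' => this M' (by simp [hM'])
      exact ⟨x :: l, rfl⟩
  have hl : l.Nodup := hL.of_map
  rw [List.length_map] at h1
  have hlt : ∀ x, α.pos x < l.length ↔ x ∈ l := fun x => by
    have := firstPos_lt_iff (L := l.map Singleton.singleton) (x := x)
    rw [List.length_map] at this
    rw [h2, this]; simp
  have hlb : ∀ x, x ∈ α.leastBlock ↔ x ∉ l := fun x => by
    rw [← hlt, TOPartition.leastBlock, mem_filter]
    have := α.pos_lt x
    simp only [mem_univ, true_and]; omega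
  rw [listSign_map_singleton hκ hl, shuffleSign, ← pow_add, ← card_union_of_disjoint]
  · rw [TOPartition.inversions]
    congr 2
    ext ⟨a, b⟩
    simp only [mem_union, mem_filter, mem_univ, true_and, hlb, not_not, ← h2]
    have ha := hlt a
    have hb := hlt b
    have := α.pos_lt a
    constructor
    · rintro (⟨h3, h4, h5⟩ | ⟨h3, h4, h5⟩)
      · exact ⟨h3, h4⟩
      · rw [← ha] at h4; rw [← hb] at h5; exact ⟨h3, by omega⟩
    · rintro ⟨h3, h4⟩
      by_cases h5 : a ∈ l
      · exact Or.inl ⟨h3, h4, h5⟩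
      · exact Or.inr ⟨h3, h5, hb.1 (by omega)⟩
  · rw [Finset.disjoint_left]
    rintro ⟨a, b⟩ h3 h4
    exact (hlb a).1 (mem_filter.1 h4).2.2.1 (mem_filter.1 h3).2.2.2

end
end BuildingSet

section
section Code
variable {n : ℕ}

/-- An injective numbering of the finite sets. -/
def code (S : Finset (Fin n)) : ℕ := ∑ i ∈ S.map Fin.valEmbedding, 2 ^ i

theorem code_injective : Function.Injective (code (n := n)) :=
  (Finset.geomSum_injective le_rfl).comp (Finset.map_injective _)

theorem code_singleton_lt (x y : Fin n) : code {x} < code {y} ↔ x < y := by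
  simp only [code, map_singleton, sum_singleton, Fin.valEmbedding_apply]
  exact Nat.pow_lt_pow_iff_right one_lt_two

end Code

/-- A presentation of a chain complex by cochains on the nested families of a building set: a family
with `r` members has degree `n - 1 - r`. -/
structure FamilyModel {n : ℕ} (B : BuildingSet n) {k : Type w} [Field k]
    (K : ChainComplex (ModuleCat.{t} k) ℤ) where
  coord (i : ℤ) : K.X i →ₗ[k] (Finset (Finset (Fin n)) → k)
  injective (i : ℤ) : Function.Injective (coord i)
  support {i : ℤ} {x : K.X i} {N : Finset (Finset (Fin n))} (h : coord i x N ≠ 0) :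
    B.Adm N ∧ (N.card : ℤ) + 1 + i = n
  surjective {i : ℤ} {b : Finset (Finset (Fin n)) → k}
    (h : ∀ N, b N ≠ 0 → B.Adm N ∧ (N.card : ℤ) + 1 + i = n) : ∃ x, coord i x = b
  coord_d {i j : ℤ} (h : j + 1 = i) (x : K.X i) {N : Finset (Finset (Fin n))} (hN : B.Adm N) :
    coord j ((K.d i j).hom x) N = coboundary code (coord i x) N

open BuildingSet

section PermutohedronModel
variable {n : ℕ} {k : Type w} [Field k]

theorem component_full {x : Fin n} {U : Finset (Fin n)} (hx : x ∈ U) :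
    (full n).component x U = U :=
  subset_antisymm ((full n).component_subset x U) (subset_component ⟨x, hx⟩ hx subset_rfl)

theorem full_univ (hn : 0 < n) : (full n).mem univ := ⟨(⟨0, hn⟩ : Fin n), mem_univ _⟩

theorem pairwise_of_full {N : Finset (Finset (Fin n))} (hN : (full n).Nested N)
    {L : List (Finset (Fin n))} (hL : Orders N L) (hs : ∀ i < L.length, ∃ x, firstPos L x = i) :
    L.Pairwise fun S T => S.card < T.card := by
  have h : (full n).Nested L.toFinset := by rw [hL.2]; exact hN
  have key : ∀ i (hi : i < L.length), L[i] = univ.filter fun y => firstPos L y ≤ i :=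
    fun i hi => by
      obtain ⟨x, hx⟩ := hs i hi
      rw [h.getElem_eq_component hi hx, component_full (by simp [hx])]
  rw [List.pairwise_iff_getElem]
  intro i j hi hj hij
  obtain ⟨x, hx⟩ := hs j hj
  rw [key i hi, key j hj]
  refine Finset.card_lt_card ⟨fun y hy => ?_, fun hsub => ?_⟩
  · rw [mem_filter] at hy ⊢; exact ⟨mem_univ y, hy.2.trans hij.le⟩
  · have := (mem_filter.1 (hsub (mem_filter.2 ⟨mem_univ x, hx.le⟩))).2
    omega

theorem transfer_full_injective (hn : 0 < n) {c : TOPartition.{t} n → k}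
    (h : transfer (full n) code c = 0) : c = 0 := by
  funext α
  by_contra hα
  obtain ⟨L, h1, h2, h3⟩ := exists_list (B := full n) (α := α) fun x y hxy _ => by
    rw [component_full (by simp), mem_filter]
    exact ⟨mem_univ y, hxy.ge⟩
  obtain ⟨h4, h5, h6⟩ := h3 (lt_of_le_of_lt (Nat.zero_le _) (α.pos_lt ⟨0, hn⟩))
  have h7 := congrFun h L.toFinset
  have hs : ∀ {β : TOPartition.{t} n} {L' : List (Finset (Fin n))}, β.numBlocks = L'.length + 1 →
      (∀ x, β.pos x = firstPos L' x) → ∀ i < L'.length, ∃ x, firstPos L' x = i :=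
    fun {β L'} hb hp i hi => (β.exists_pos i (by omega)).imp fun x hx => by rw [← hp, hx]
  rw [transfer_apply, if_pos ⟨h2, h4⟩, alternation_eq_single (L₀ := L) ⟨h1, rfl⟩, flagValue,
    evalPos_eq c h5 h6] at h7
  · have h8 := listSign_mul_self (κ := code) (k := k) L
    refine hα ?_
    change _ = (0 : k) at h7
    change _ = (0 : k)
    linear_combination listSign code k L * h7 - c α * h8
  · intro L' hL' hne
    by_contra hne'
    obtain ⟨β, -, h8, h9⟩ := exists_of_evalPos hne'
    refine hne (List.Perm.eq_of_pairwise (le := fun S T => S.card < T.card)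
      (fun a b _ _ hab hba => absurd hab hba.not_gt) (pairwise_of_full h2 hL' (hs h8 h9))
      (pairwise_of_full h2 ⟨h1, rfl⟩ (hs h5 h6)) (hL'.perm ⟨h1, rfl⟩))

theorem support_transfer {B : BuildingSet n} {i : ℤ} {c : TOPartition.{t} n → k}
    (hc : c ∈ (TOPartition.cells.{w, t} k n).chains i) {N : Finset (Finset (Fin n))}
    (h : transfer B code c N ≠ 0) : B.Adm N ∧ (N.card : ℤ) + 1 + i = n := by
  obtain ⟨hN, α, L, h1, h2, h3, h4⟩ := exists_of_transfer h
  refine ⟨hN, ?_⟩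
  have h5 : (n : ℤ) - α.numBlocks = i := hc α h1
  rw [h3, h2.length_eq] at h5
  push_cast at h5
  omega

theorem exists_chain {B : BuildingSet n} (hB : B.mem univ) {i : ℤ}
    {b : Finset (Finset (Fin n)) → k} (h : ∀ N, b N ≠ 0 → B.Adm N ∧ (N.card : ℤ) + 1 + i = n) :
    ∃ c ∈ (TOPartition.cells.{w, t} k n).chains i, transfer B code c = b ∧
      ∀ α, c α ≠ 0 → ∃ N, b N ≠ 0 ∧ α.leastBlock = (N.sup id)ᶜ := by
  obtain ⟨c, h1, h2⟩ := exists_transfer_eq hB fun N hN => (h N hN).1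
  refine ⟨c, fun α hα => ?_, h1, fun α hα => ?_⟩
  · obtain ⟨N, h3, h4, -⟩ := h2 α hα
    have := (h N h3).2
    rw [h4]; push_cast; omega
  · obtain ⟨N, h3, -, h5⟩ := h2 α hα
    exact ⟨N, h3, h5⟩

variable (n k) in
/-- The chains of the permutohedron as cochains on the chains of subsets. -/
noncomputable def permutohedronModel (hn : 0 < n) :
    FamilyModel (full n) (permutohedron.{w, t} k n).cx where
  coord i := transfer (full n) code ∘ₗ ((TOPartition.cells.{w, t} k n).chains i).subtype
  injective i := (injective_iff_map_eq_zero _).2 fun c hc =>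
    Subtype.ext (transfer_full_injective hn hc)
  support {i x N} h := support_transfer x.2 h
  surjective {i b} h := by
    obtain ⟨c, hc, h1, -⟩ := exists_chain (B := full n) (full_univ hn) h
    exact ⟨⟨c, hc⟩, h1⟩
  coord_d {i j} h x N hN := by
    have := (TOPartition.cells.{w, t} k n).d_apply h x
    change transfer (full n) code ((TOPartition.cells.{w, t} k n).d i j x).1 N = _
    rw [this]
    exact transfer_boundary code_injective (full_univ hn) x.1 hN

end PermutohedronModel

section OfPermutohedron
variable {n : ℕ} {k : Type w} [Field k] {B : BuildingSet n}
  {K : ChainComplex (ModuleCat.{max t w} k) ℤ}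

/-- The linear maps of the chain map from the permutohedron. -/
noncomputable def FamilyModel.transferHom (m : FamilyModel B K) (i : ℤ) :
    (TOPartition.cells.{w, t} k n).chains i →ₗ[k] K.X i :=
  (LinearEquiv.ofInjective (m.coord i) (m.injective i)).symm.toLinearMap ∘ₗ
    (transfer B code ∘ₗ ((TOPartition.cells.{w, t} k n).chains i).subtype).codRestrict
      (LinearMap.range (m.coord i)) fun c =>
        LinearMap.mem_range.2 (m.surjective fun _ hN => support_transfer c.2 hN)

theorem FamilyModel.coord_transferHom (m : FamilyModel B K) (i : ℤ)
    (c : (TOPartition.cells.{w, t} k n).chains i) :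
    m.coord i (m.transferHom i c) = transfer B code c.1 :=
  congrArg Subtype.val (LinearEquiv.apply_symm_apply
    (LinearEquiv.ofInjective (m.coord i) (m.injective i)) _)

theorem FamilyModel.transferHom_d (m : FamilyModel B K) (hB : B.mem univ) {i j : ℤ}
    (h : j + 1 = i) (c : (TOPartition.cells.{w, t} k n).chains i) :
    (K.d i j).hom (m.transferHom i c) =
      m.transferHom j ((TOPartition.cells.{w, t} k n).d i j c) := by
  refine m.injective j (funext fun N => ?_)
  rw [m.coord_transferHom, (TOPartition.cells.{w, t} k n).d_apply h c]
  by_cases hN : B.Adm N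
  · rw [m.coord_d h _ hN, m.coord_transferHom]
    exact (transfer_boundary code_injective hB c.1 hN).symm
  · rw [transfer_apply, if_neg hN]
    by_contra hne
    exact hN (m.support hne).1

/-- The chain map from the permutohedron to a complex presented by nested families. -/
noncomputable def FamilyModel.ofPermutohedron (m : FamilyModel B K) (hB : B.mem univ) :
    (permutohedron.{w, t} k n).cx ⟶ K where
  f i := ModuleCat.ofHom (m.transferHom i)
  comm' _ _ h := ModuleCat.hom_ext (LinearMap.ext fun c => m.transferHom_d hB h c)

theorem FamilyModel.exists_ofPermutohedron_eq (m : FamilyModel B K) (hB : B.mem univ) {i : ℤ}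
    (x : K.X i) : ∃ c : (TOPartition.cells.{w, t} k n).chains i,
      (m.ofPermutohedron hB).f i c = x ∧
        ∀ α, c.1 α ≠ 0 → ∃ N, m.coord i x N ≠ 0 ∧ α.leastBlock = (N.sup id)ᶜ := by
  obtain ⟨c, hc, h1, h2⟩ := exists_chain.{w, t} hB (b := m.coord i x) fun N hN => m.support hN
  exact ⟨⟨c, hc⟩, m.injective i ((m.coord_transferHom i ⟨c, hc⟩).trans h1), h2⟩

end OfPermutohedron
end

open BuildingSet

section SimplexModel
variable {n : ℕ} {k : Type w} [Field k]

open scoped Classical in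
/-- The value of a function on faces at the face with the given vertices,
    and zero at the empty set. -/
noncomputable def faceValue (c : Face.{t} n → k) (Y : Finset (Fin n)) : k :=
  if h : Y.Nonempty then c ⟨Y, h⟩ else 0

theorem faceValue_verts (c : Face.{t} n → k) (Y : Face.{t} n) : faceValue c Y.verts = c Y :=
  dif_pos Y.nonempty

variable (k) in
/-- The sign that compares a face of the simplex with the family of the vertices not in it. -/
def faceSign (Y : Finset (Fin n)) : k := (-1) ^ (Yᶜ.card).choose 2 * shuffleSign k Y

theorem faceSign_mul_self (Y : Finset (Fin n)) : faceSign k Y * faceSign k Y = 1 := by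
  rw [faceSign, shuffleSign, ← pow_add, ← mul_pow]; simp

theorem card_filter_pair_eq {P : Fin n × Fin n → Prop} {Q : Fin n → Prop} [DecidablePred P]
    [DecidablePred Q] (e : Fin n → Fin n × Fin n) (he : Function.Injective e)
    (h : ∀ p, P p ↔ ∃ x, Q x ∧ e x = p) : (univ.filter P).card = (univ.filter Q).card := by
  rw [← card_image_of_injective _ he]
  congr 1
  ext p; simp [h]

theorem faceSign_insert {Y : Finset (Fin n)} {x : Fin n} (hx : x ∉ Y) :
    faceSign k Y * (-1) ^ (Y.filter (· < x)).card =
      (-1) ^ (Yᶜ.filter (· < x)).card * faceSign k (insert x Y) := by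
  have h1 : Yᶜ.card = (Yᶜ.erase x).card + 1 := (card_erase_add_one (by simpa using hx)).symm
  have h2 : (insert x Y)ᶜ = Yᶜ.erase x := by ext z; simp
  have h3 : (Yᶜ.erase x).card = (Yᶜ.filter (· < x)).card + (Yᶜ.filter (x < ·)).card := by
    rw [← card_union_of_disjoint]
    · congr 1
      ext z
      simp only [mem_erase, mem_compl, mem_union, mem_filter, ← and_or_left, ne_iff_lt_or_gt]
      exact and_comm
    · rw [Finset.disjoint_left]
      intro z hz hz'
      exact lt_asymm (mem_filter.1 hz).2 (mem_filter.1 hz').2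
  have h4 := card_filter_add_card_filter_not (s := univ.filter fun p : Fin n × Fin n =>
    p.1 < p.2 ∧ p.1 ∈ Y ∧ p.2 ∉ Y) (fun p => p.2 = x)
  have h5 := card_filter_add_card_filter_not (s := univ.filter fun p : Fin n × Fin n =>
    p.1 < p.2 ∧ p.1 ∈ insert x Y ∧ p.2 ∉ insert x Y) (fun p => p.1 = x)
  simp only [filter_filter] at h4 h5
  have h6 : (univ.filter fun p : Fin n × Fin n =>
      (p.1 < p.2 ∧ p.1 ∈ Y ∧ p.2 ∉ Y) ∧ p.2 = x).card = (Y.filter (· < x)).card := by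
    rw [card_filter_pair_eq (Q := fun z => z ∈ Y ∧ z < x) (fun z => (z, x))
      (fun a b h => (Prod.mk.inj h).1)]
    · congr 1; ext; simp
    · rintro ⟨a, b⟩
      simp only [Prod.mk.injEq]
      constructor
      · rintro ⟨⟨h, h', -⟩, rfl⟩; exact ⟨a, ⟨h', h⟩, rfl, rfl⟩
      · rintro ⟨z, ⟨h, h'⟩, rfl, rfl⟩; exact ⟨⟨h', h, hx⟩, rfl⟩
  have h7 : (univ.filter fun p : Fin n × Fin n =>
      (p.1 < p.2 ∧ p.1 ∈ insert x Y ∧ p.2 ∉ insert x Y) ∧ p.1 = x).card =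
        (Yᶜ.filter (x < ·)).card := by
    rw [card_filter_pair_eq (Q := fun z => z ∈ Yᶜ ∧ x < z) (fun z => (x, z))
      (fun a b h => (Prod.mk.inj h).2)]
    · congr 1; ext; simp
    · rintro ⟨a, b⟩
      simp only [Prod.mk.injEq, mem_insert, mem_compl, not_or]
      constructor
      · rintro ⟨⟨h, -, h', h''⟩, rfl⟩; exact ⟨b, ⟨h'', h⟩, rfl, rfl⟩
      · rintro ⟨z, ⟨h, h'⟩, rfl, rfl⟩; exact ⟨⟨h', Or.inl rfl, h'.ne', h⟩, rfl⟩
  have h8 : (univ.filter fun p : Fin n × Fin n =>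
      (p.1 < p.2 ∧ p.1 ∈ Y ∧ p.2 ∉ Y) ∧ ¬ p.2 = x) = univ.filter fun p : Fin n × Fin n =>
      (p.1 < p.2 ∧ p.1 ∈ insert x Y ∧ p.2 ∉ insert x Y) ∧ ¬ p.1 = x := by
    ext ⟨a, b⟩
    simp only [mem_filter, mem_univ, true_and, mem_insert, not_or]
    constructor
    · rintro ⟨⟨h, h', h''⟩, hb⟩; exact ⟨⟨h, Or.inr h', hb, h''⟩, fun e => hx (e ▸ h')⟩
    · rintro ⟨⟨h, h', hb, h''⟩, ha⟩; exact ⟨⟨h, h'.resolve_left ha, h''⟩, hb⟩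
  rw [h6, h8] at h4
  rw [h7] at h5
  have h9 : (Yᶜ.card).choose 2 = (Yᶜ.erase x).card.choose 2 + (Yᶜ.erase x).card := by
    rw [h1, Nat.choose_succ_succ' _ 1, Nat.choose_one_right, add_comm]
  rw [faceSign, faceSign, shuffleSign, shuffleSign, h2, h9, h3, ← h4, ← h5]
  have h10 : ((-1 : k) ^ (Y.filter (· < x)).card) * (-1) ^ (Y.filter (· < x)).card = 1 := by
    rw [← mul_pow]; simp
  simp only [pow_add]
  linear_combination ((-1) ^ ((Yᶜ.filter (· < x)).card + (Yᶜ.filter (x < ·)).card).choose 2 *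
    (-1) ^ (Yᶜ.filter (· < x)).card * (-1) ^ (Yᶜ.filter (x < ·)).card *
    (-1) ^ (univ.filter fun p : Fin n × Fin n =>
      (p.1 < p.2 ∧ p.1 ∈ insert x Y ∧ p.2 ∉ insert x Y) ∧ ¬ p.1 = x).card) * h10

open scoped Classical in
/-- The chains of the simplex as cochains on the sets of vertices. -/
noncomputable def faceCoord : (Face.{t} n → k) →ₗ[k] (Finset (Finset (Fin n)) → k) where
  toFun c N := if (minimal n).Adm N then
    faceSign k (N.sup id)ᶜ * faceValue c (N.sup id)ᶜ else 0
  map_add' c c' := by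
    funext N
    simp only [Pi.add_apply, faceValue]
    split_ifs <;> ring
  map_smul' r c := by
    funext N
    simp only [Pi.smul_apply, smul_eq_mul, RingHom.id_apply, faceValue]
    split_ifs <;> ring

open scoped Classical in
theorem faceCoord_apply (c : Face.{t} n → k) (N : Finset (Finset (Fin n))) :
    faceCoord c N = if (minimal n).Adm N then
      faceSign k (N.sup id)ᶜ * faceValue c (N.sup id)ᶜ else 0 := rfl

theorem faceCoord_image (hn : 0 < n) (c : Face.{t} n → k) {U : Finset (Fin n)} (hU : U ≠ univ) :
    faceCoord c (U.image Singleton.singleton) = faceSign k Uᶜ * faceValue c Uᶜ := by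
  rw [faceCoord_apply, if_pos ((minimal_adm_iff hn).2 ⟨U, hU, rfl⟩), sup_image_singleton]

theorem faceCoord_face (hn : 0 < n) (c : Face.{t} n → k) (Y : Face.{t} n) :
    faceCoord c (Y.vertsᶜ.image Singleton.singleton) = faceSign k Y.verts * c Y := by
  rw [faceCoord_image hn c fun e => ?_, compl_compl, faceValue_verts]
  obtain ⟨x, hx⟩ := Y.nonempty
  exact mem_compl.1 (e ▸ mem_univ x) hx

theorem minimal_univ (hn : 0 < n) : (minimal n).mem univ :=
  ⟨⟨(⟨0, hn⟩ : Fin n), mem_univ _⟩, Or.inl rfl⟩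

theorem faceCoord_boundary (hn : 0 < n) (c : Face.{t} n → k) {N : Finset (Finset (Fin n))}
    (hN : (minimal n).Adm N) :
    faceCoord (Face.boundary k n c) N = coboundary code (faceCoord c) N := by
  classical
  obtain ⟨U, hU, rfl⟩ := (minimal_adm_iff hn).1 hN
  have hne : Uᶜ.Nonempty := by
    rw [nonempty_iff_ne_empty, Ne, compl_eq_empty_iff]; exact hU
  rw [faceCoord_image hn _ hU, faceValue, dif_pos hne, coboundary,
    sum_image fun a _ b _ h => singleton_injective h]
  change _ * ∑ x ∈ Uᶜᶜ, (-1 : k) ^ (Uᶜ.filter (· < x)).card * c (Face.adjoin ⟨Uᶜ, hne⟩ x) = _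
  rw [compl_compl, mul_sum]
  refine Finset.sum_congr rfl fun x hx => ?_
  have h1 : (U.image Singleton.singleton : Finset (Finset (Fin n))).erase {x} =
      (U.erase x).image Singleton.singleton := by
    ext M; simp only [mem_erase, mem_image]
    constructor
    · rintro ⟨h, y, hy, rfl⟩; exact ⟨y, ⟨fun e => h (e ▸ rfl), hy⟩, rfl⟩
    · rintro ⟨y, ⟨h, hy⟩, rfl⟩; exact ⟨fun e => h (singleton_injective e), y, hy, rfl⟩
  have h2 : (U.erase x)ᶜ = insert x Uᶜ := by ext z; simp
  have h3 : posSign code k {x} (U.image Singleton.singleton) =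
      (-1) ^ (Uᶜᶜ.filter (· < x)).card := by
    rw [posSign, compl_compl]
    congr 1
    rw [filter_image, card_image_of_injective _ singleton_injective]
    simp only [code_singleton_lt]
  have h4 : faceValue c (insert x Uᶜ) = c (Face.adjoin ⟨Uᶜ, hne⟩ x) :=
    faceValue_verts c (Face.adjoin ⟨Uᶜ, hne⟩ x)
  have h5 : U.erase x ≠ univ := fun e => notMem_erase x U (by rw [e]; exact mem_univ x)
  rw [h1, faceCoord_image hn _ h5, h2, h3, h4, ← mul_assoc,
    ← mul_assoc, faceSign_insert (by simpa using hx)]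

variable (n k) in
/-- The chains of the simplex as cochains on the nested families of the minimal building set. -/
noncomputable def simplexModel (hn : 0 < n) :
    FamilyModel (minimal n) (simplex.{w, t} k n).cx where
  coord i := faceCoord ∘ₗ ((Face.cells.{w, t} k n).chains i).subtype
  injective i := (injective_iff_map_eq_zero _).2 fun c hc => Subtype.ext (funext fun Y => by
    have h1 := congrFun hc (Y.vertsᶜ.image Singleton.singleton)
    have h2 : faceSign k Y.verts * c.1 Y = 0 := (faceCoord_face hn c.1 Y).symm.trans h1
    change c.1 Y = 0
    linear_combination faceSign k Y.verts * h2 - c.1 Y * faceSign_mul_self (k := k) Y.verts)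
  support {i x N} h := by
    change faceCoord x.1 N ≠ 0 at h
    have hN : (minimal n).Adm N := by
      by_contra hN; exact h (by rw [faceCoord_apply, if_neg hN])
    refine ⟨hN, ?_⟩
    obtain ⟨U, hU, rfl⟩ := (minimal_adm_iff hn).1 hN
    rw [faceCoord_image hn _ hU, faceValue] at h
    split_ifs at h with hne
    · have h1 : ((Uᶜ).card : ℤ) = i + 1 := x.2 _ (right_ne_zero_of_mul h)
      have h2 := card_add_card_compl U
      rw [Fintype.card_fin] at h2
      rw [card_image_singleton]
      omega
    · exact absurd (mul_zero _) h
  surjective {i b} h := by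
    have hb : ∀ U : Finset (Fin n), U ≠ univ → ∀ N, N = U.image Singleton.singleton →
        faceCoord (fun Y : Face.{t} n => faceSign k Y.verts *
          b (Y.vertsᶜ.image Singleton.singleton)) N = b N := by
      rintro U hU N rfl
      have hne : Uᶜ.Nonempty := by
        rw [nonempty_iff_ne_empty, Ne, compl_eq_empty_iff]; exact hU
      rw [faceCoord_image hn _ hU, faceValue, dif_pos hne, ← mul_assoc]
      dsimp only
      rw [faceSign_mul_self, one_mul, compl_compl]
    refine ⟨⟨fun Y => faceSign k Y.verts * b (Y.vertsᶜ.image Singleton.singleton), ?_⟩, ?_⟩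
    · intro Y hY
      obtain ⟨-, h1⟩ := h _ (right_ne_zero_of_mul hY)
      have h2 := card_add_card_compl Y.verts
      rw [Fintype.card_fin] at h2
      rw [card_image_singleton] at h1
      omega
    · funext N
      by_cases hN : (minimal n).Adm N
      · obtain ⟨U, hU, e⟩ := (minimal_adm_iff hn).1 hN
        exact hb U hU N e
      · have : b N = 0 := by
          by_contra hne; exact hN (h N hne).1
        rw [this]
        exact if_neg hN
  coord_d {i j} h x N hN := by
    have := (Face.cells.{w, t} k n).d_apply h x
    change faceCoord ((Face.cells.{w, t} k n).d i j x).1 N = _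
    rw [this]
    exact faceCoord_boundary hn x.1 hN

open scoped Classical in
theorem transfer_minimal (hn : 0 < n) (c : TOPartition.{t} n → k) (Y : Face.{t} n) :
    transfer (minimal n) code c (Y.vertsᶜ.image Singleton.singleton) =
      faceSign k Y.verts * permToSimplex c Y := by
  suffices h : LinearMap.proj (Y.vertsᶜ.image Singleton.singleton : Finset (Finset (Fin n))) ∘ₗ
      transfer (minimal n) code = (⟨⟨fun c => faceSign k Y.verts * permToSimplex c Y, fun c c' => by
        simp only [permToSimplex, ← mul_add, ← sum_add_distrib, Pi.add_apply]
        congr 1; refine Finset.sum_congr rfl fun α _ => ?_; split_ifs <;> ring⟩, fun r c => by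
        simp only [permToSimplex, mul_sum, Pi.smul_apply, smul_eq_mul, RingHom.id_apply]
        refine Finset.sum_congr rfl fun α _ => ?_; split_ifs <;> ring⟩ :
          (TOPartition.{t} n → k) →ₗ[k] k) from LinearMap.congr_fun h c
  refine LinearMap.pi_ext fun α r => ?_
  change transfer (minimal n) code (Pi.single α r) _ = faceSign k Y.verts *
    permToSimplex (Pi.single α r) Y
  have h1 : permToSimplex (Pi.single α r) Y = if α.IsSimplicial ∧ α.leastBlock = Y.verts then
      (-1) ^ (α.inversions + (α.numBlocks - 1).choose 2) * r else 0 := by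
    rw [permToSimplex, Finset.sum_eq_single α]
    · rw [Pi.single_eq_same]
    · intro β _ hne
      rw [Pi.single_eq_of_ne hne, mul_zero, ite_self]
    · exact fun h => absurd (mem_univ α) h
  rw [h1]
  have hY : Y.vertsᶜ ≠ univ := fun e => by
    obtain ⟨x, hx⟩ := Y.nonempty
    exact mem_compl.1 (e ▸ mem_univ x) hx
  by_cases hα : α.IsSimplicial
  · obtain ⟨L, h2, h3, h4, h5⟩ := exists_list_of_isSimplicial (minimal n) hn hα
    obtain ⟨U, hU, h6⟩ := (minimal_adm_iff hn).1 h3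
    have h7 : α.leastBlock = Uᶜ := by rw [leastBlock_eq h4 h5, h6, sup_image_singleton]
    have h8 : α.numBlocks - 1 = Uᶜᶜ.card := by
      rw [compl_compl, h4, Nat.add_sub_cancel, ← List.toFinset_card_of_nodup h2, h6,
        card_image_singleton]
    rw [transfer_single h2 h3 h4 h5, h6]
    by_cases h9 : α.leastBlock = Y.verts
    · have h10 : Y.verts = Uᶜ := h9.symm.trans h7
      have h11 := listSign_mul_shuffleSign (k := k) code_singleton_lt h2 h3 h4 h5
      have h12 : shuffleSign k Uᶜ * shuffleSign k Uᶜ = 1 := by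
        rw [shuffleSign, ← mul_pow]; simp
      have h13 : ((-1 : k) ^ (Uᶜᶜ.card).choose 2) * (-1) ^ (Uᶜᶜ.card).choose 2 = 1 := by
        rw [← mul_pow]; simp
      rw [h10, compl_compl, if_pos rfl, if_pos ⟨hα, h7⟩, pow_add, h8, ← h11, h7, faceSign]
      linear_combination (-(listSign code k L * r * (-1) ^ (Uᶜᶜ.card).choose 2 *
        (-1) ^ (Uᶜᶜ.card).choose 2)) * h12 - listSign code k L * r * h13
    · have h10 : ¬ (Y.vertsᶜ.image Singleton.singleton : Finset (Finset (Fin n))) =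
          U.image Singleton.singleton := fun h => h9 (by
        rw [h7, ← sup_image_singleton U, ← h, sup_image_singleton, compl_compl])
      rw [if_neg h10, if_neg fun h => h9 h.2, mul_zero]
  · rw [if_neg fun h => hα h.1, mul_zero]
    by_contra hne
    obtain ⟨-, β, L, h2, h3, h4, h5⟩ := exists_of_transfer hne
    have h6 : β = α := by
      by_contra hne; exact h2 (Pi.single_eq_of_ne hne _)
    subst h6
    exact hα (isSimplicial_of_card h3.1 h4 h5 (by
      rw [h3.2, card_image_singleton, sup_image_singleton]))

end SimplexModel

section TreeModel
variable {V : Type u₁} [Groupoid.{v₁} V] {C : Type u} [Category.{v} C]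
    [MonoidalCategory C] [SymmetricCategory C] {𝔉 : FeynmanCategory V C} {δ : ProperDegree 𝔉}
    {m n : ℕ} {a : Fin m → V} {v₀ : V}

namespace OrdTree
variable {φ : tens (fun i => 𝔉.ι.obj (a i)) (List.finRange m) ⟶ 𝔉.ι.obj v₀}
  (𝔠 : CubicalStructure δ) (χ : Chart δ φ n) (hφ : δ.deg φ = n) {T T' : OrdTree δ a v₀}

/-- The list of the branches of a tree. -/
noncomputable def partList (T : OrdTree δ a v₀) : List (Finset (Fin n)) :=
  (List.range T.numEdges).map (T.part χ)

variable {χ}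

theorem length_partList (T : OrdTree δ a v₀) : (T.partList χ).length = T.numEdges := by
  rw [partList, List.length_map, List.length_range]

theorem toFinset_partList (T : OrdTree δ a v₀) :
    (T.partList χ).toFinset = (Finset.range T.numEdges).image (T.part χ) := by
  ext M; simp [partList]

include 𝔠 in
theorem ComposesTo.nodup_partList (h : ComposesTo φ T) : (T.partList χ).Nodup :=
  List.Nodup.map_on (fun _ hx _ hy hxy => h.part_injective 𝔠 χ (List.mem_range.1 hx)
    (List.mem_range.1 hy) hxy) List.nodup_range

theorem sup_partList (T : OrdTree δ a v₀) :
    (T.partList χ).toFinset.sup id = (Finset.range T.numEdges).sup (T.part χ) := by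
  rw [toFinset_partList, sup_image]; rfl

theorem ComposesTo.adm (h : ComposesTo φ T) :
    (χ.buildingSet 𝔠 hφ).Adm (T.partList χ).toFinset := by
  refine ⟨by rw [toFinset_partList]; exact h.nested 𝔠 χ hφ, fun hu => ?_⟩
  have h1 := h.card_sup 𝔠 χ hφ
  have h2 : (univ : Finset (Fin n)) ⊆ (T.partList χ).toFinset.sup id := le_sup (f := id) hu
  rw [sup_partList] at h2
  have h3 := card_le_card h2
  rw [card_univ, Fintype.card_fin] at h3
  have h4 : 0 < T.width := T.lab_pos
  omega

theorem exists_partList_eq (hn : 0 < n) {N : Finset (Finset (Fin n))}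
    (hN : (χ.buildingSet 𝔠 hφ).Adm N) {L : List (Finset (Fin n))} (hL : Orders N L) :
    ∃ T : OrdTree δ a v₀, ComposesTo φ T ∧ T.partList χ = L := by
  have hget : ∀ i (hi : i < L.length), L.getD i ∅ = L[i] := fun i hi => by simp [hi]
  have himg : (Finset.range L.length).image (fun i => L.getD i ∅) = N := by
    rw [← hL.2]; ext M
    simp only [mem_image, Finset.mem_range, List.mem_toFinset, List.mem_iff_getElem]
    exact ⟨fun ⟨i, hi, e⟩ => ⟨i, hi, (hget i hi).symm.trans e⟩,
      fun ⟨i, hi, e⟩ => ⟨i, hi, (hget i hi).trans e⟩⟩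
  obtain ⟨T, h1, h2, h3⟩ := exists_part_eq 𝔠 χ hφ hn L.length (fun i => L.getD i ∅)
    (fun i hi j hj hij => by
      have hi' := Finset.mem_range.1 hi
      have hj' := Finset.mem_range.1 hj
      dsimp only at hij
      rw [hget i hi', hget j hj'] at hij
      exact (List.Nodup.getElem_inj_iff hL.1).1 hij)
    (by rw [himg]; exact hN.1)
    (fun e he hu => hN.2 (by rw [← himg]; exact mem_image.2 ⟨e, Finset.mem_range.2 he, hu⟩))
  refine ⟨T, h2, List.ext_getElem (by rw [length_partList, h1]) fun i hi hi' => ?_⟩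
  simp only [partList, List.getElem_map, List.getElem_range]
  rw [h3 i hi']; exact hget i hi'

theorem exists_partList_split {i : ℕ} (hi : i < T.numEdges) : ∃ A R,
    A.length = i ∧ T.partList χ = A ++ T.part χ i :: R ∧ (T.face i).partList χ = A ++ R := by
  obtain ⟨q, hq⟩ : ∃ q, T.numEdges = i + (1 + q) := ⟨T.numEdges - i - 1, by omega⟩
  refine ⟨(List.range i).map (T.part χ), (List.range q).map fun j => T.part χ (i + (1 + j)),
    by simp, ?_, ?_⟩
  · rw [partList, hq, List.range_add, List.range_add]
    simp [Function.comp_def]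
  · rw [partList, T.numEdges_face hi, show T.numEdges - 1 = i + q by omega, List.range_add,
      List.map_append, List.map_map]
    congr 1
    · refine List.map_congr_left fun x hx => ?_
      rw [part_face, unshift, if_pos (List.mem_range.1 hx)]
    · refine List.map_congr_left fun x _ => ?_
      rw [Function.comp, part_face, unshift, if_neg (by omega)]
      congr 1; omega

theorem Isomorphic.partList_eq (h : Isomorphic id T T') : T'.partList χ = T.partList χ := by
  rw [partList, partList, h.numEdges_eq]
  exact List.map_congr_left fun x _ => h.part_eq Function.injective_id χ x

theorem Isomorphic.exists_partList_swap {i : ℕ} (hi : i + 1 < T.numEdges)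
    (h : Isomorphic (Equiv.swap i (i + 1)) T T') : ∃ A M M' R, A.length = i ∧
      T.partList χ = A ++ M :: M' :: R ∧ T'.partList χ = A ++ M' :: M :: R := by
  obtain ⟨q, hq⟩ : ∃ q, T.numEdges = i + (2 + q) := ⟨T.numEdges - i - 2, by omega⟩
  have hp : ∀ x, T'.part χ x = T.part χ (Equiv.swap i (i + 1) x) := fun x => by
    rw [← h.part_eq (Equiv.injective _) χ, Equiv.swap_apply_self]
  have h2 : List.range 2 = [0, 1] := rfl
  refine ⟨(List.range i).map (T.part χ), T.part χ i, T.part χ (i + 1),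
    (List.range q).map fun j => T.part χ (i + (2 + j)), by simp, ?_, ?_⟩
  · rw [partList, hq, List.range_add, List.range_add, h2]
    simp [Function.comp_def]
  · rw [partList, ← h.numEdges_eq, hq, List.range_add, List.range_add, h2, List.map_append]
    congr 1
    · refine List.map_congr_left fun x hx => ?_
      have := List.mem_range.1 hx
      rw [hp, swap_eq, if_neg (by omega), if_neg (by omega)]
    · simp only [List.map_cons, List.map_map, List.cons_append,
        List.nil_append, add_zero, hp, Equiv.swap_apply_left, Equiv.swap_apply_right]
      congr 2
      refine List.map_congr_left fun x _ => ?_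
      simp only [Function.comp]
      rw [hp, swap_eq, if_neg (by omega), if_neg (by omega)]

variable {k : Type w} [Field k] (χ)

open scoped Classical in
/-- The value of a function on trees at a tree with the given list of branches,
    and zero if there is no
such tree. -/
noncomputable def listValue (c : OrdTree δ a v₀ → k) (L : List (Finset (Fin n))) : k :=
  if h : ∃ T : OrdTree δ a v₀, ComposesTo φ T ∧ T.partList χ = L then c h.choose else 0

variable {χ}

include 𝔠 in
theorem IsChain.listValue_partList {j : ℤ} {c : OrdTree δ a v₀ → k}
    (hc : IsChain (𝔉 := 𝔉) φ j c) (h : ComposesTo φ T) : listValue χ c (T.partList χ) = c T := by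
  have h' : ∃ T' : OrdTree δ a v₀, ComposesTo φ T' ∧ T'.partList χ = T.partList χ := ⟨T, h, rfl⟩
  rw [listValue, dif_pos h']
  obtain ⟨h1, h2⟩ := h'.choose_spec
  generalize h'.choose = T' at h1 h2
  have hn : T.numEdges = T'.numEdges := by
    rw [← length_partList (χ := χ), ← h2, length_partList]
  refine hc.iso (h.isomorphic 𝔠 h1 χ hn fun e he => ?_)
  rw [partList, partList, hn] at h2
  exact (List.map_inj_left.1 h2 e (List.mem_range.2 (by omega))).symm

include 𝔠 in
theorem IsChain.listValue_swap {j : ℤ} {c : OrdTree δ a v₀ → k} (hc : IsChain (𝔉 := 𝔉) φ j c)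
    (A R : List (Finset (Fin n))) (M M' : Finset (Fin n)) :
    listValue χ c (A ++ M :: M' :: R) = -listValue χ c (A ++ M' :: M :: R) := by
  have key : ∀ M M' (T : OrdTree δ a v₀), ComposesTo φ T → T.partList χ = A ++ M :: M' :: R →
      ∃ T' : OrdTree δ a v₀, ComposesTo φ T' ∧ T'.partList χ = A ++ M' :: M :: R ∧
        c T' = -c T := fun M M' T h hL => by
    have hi : A.length + 1 < T.numEdges := by
      rw [← length_partList (χ := χ), hL]; simp
    have hs := T.isomorphic_swapEdges A.length hi
    obtain ⟨A', M₁, M₂, R', h1, h2, h3⟩ := hs.exists_partList_swap (χ := χ) hi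
    refine ⟨_, (hs.composesTo_iff (Equiv.injective _)).2 h, ?_, hc.swap _ hi hs⟩
    rw [hL] at h2
    obtain ⟨rfl, h4⟩ := List.append_inj h2 h1.symm
    simp only [List.cons.injEq] at h4
    obtain ⟨rfl, rfl, rfl⟩ := h4
    exact h3
  by_cases h : ∃ T : OrdTree δ a v₀, ComposesTo φ T ∧ T.partList χ = A ++ M :: M' :: R
  · obtain ⟨T, h1, h2⟩ := h
    obtain ⟨T', h3, h4, h5⟩ := key M M' T h1 h2
    rw [← h2, ← h4, hc.listValue_partList 𝔠 h1, hc.listValue_partList 𝔠 h3, h5, neg_neg]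
  · have h' : ¬ ∃ T : OrdTree δ a v₀, ComposesTo φ T ∧ T.partList χ = A ++ M' :: M :: R :=
      fun ⟨T, h1, h2⟩ => by
        obtain ⟨T', h3, h4, -⟩ := key M' M T h1 h2
        exact h ⟨T', h3, h4⟩
    rw [listValue, dif_neg h, listValue, dif_neg h', neg_zero]

variable (k n) in
/-- The sign of the suspension for trees with `r` edges. -/
def suspSign (r : ℕ) : k := (-1) ^ (n * r + r.choose 2)

theorem suspSign_mul_self (r : ℕ) : suspSign n k r * suspSign n k r = 1 := by
  rw [suspSign, ← mul_pow]; simp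

theorem suspSign_succ (r : ℕ) : (-1) ^ n * suspSign n k (r + 1) = suspSign n k r * (-1) ^ r := by
  rw [suspSign, suspSign, ← pow_add, ← pow_add, Nat.choose_succ_succ' _ 1, Nat.choose_one_right,
    show n + (n * (r + 1) + (r + r.choose (1 + 1))) = (n * r + r.choose 2 + r) + 2 * n by ring,
    pow_add, pow_mul]
  simp

variable (χ)

/-- The functions on trees as cochains on nested families. -/
noncomputable def treeCoord : (OrdTree δ a v₀ → k) →ₗ[k] (Finset (Finset (Fin n)) → k) where
  toFun c N := suspSign n k N.card * (listSign code k N.toList * listValue χ c N.toList)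
  map_add' c c' := by
    funext N
    simp only [Pi.add_apply, listValue]
    split_ifs <;> ring
  map_smul' r c := by
    funext N
    simp only [Pi.smul_apply, smul_eq_mul, RingHom.id_apply, listValue]
    split_ifs <;> ring

variable {χ}

theorem treeCoord_apply (c : OrdTree δ a v₀ → k) (N : Finset (Finset (Fin n))) :
    treeCoord χ c N =
      suspSign n k N.card * (listSign code k N.toList * listValue χ c N.toList) := rfl

include 𝔠 in
theorem IsChain.treeCoord_partList {j : ℤ} {c : OrdTree δ a v₀ → k}
    (hc : IsChain (𝔉 := 𝔉) φ j c) (h : ComposesTo φ T) :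
    treeCoord χ c (T.partList χ).toFinset =
      suspSign n k T.numEdges * (listSign code k (T.partList χ) * c T) := by
  have h1 : Orders (T.partList χ).toFinset (T.partList χ) := ⟨h.nodup_partList 𝔠, rfl⟩
  have h2 : Orders (T.partList χ).toFinset (T.partList χ).toFinset.toList :=
    ⟨nodup_toList _, toList_toFinset _⟩
  rw [treeCoord_apply, ← h1.length_eq, length_partList,
    listSign_mul_perm code_injective (fun A M M' R _ => hc.listValue_swap 𝔠 A R M M') (h2.perm h1)
      h2.1, hc.listValue_partList 𝔠 h]

theorem exists_of_treeCoord {c : OrdTree δ a v₀ → k} {N : Finset (Finset (Fin n))}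
    (h : treeCoord χ c N ≠ 0) :
    ∃ T, c T ≠ 0 ∧ ComposesTo φ T ∧ (T.partList χ).toFinset = N := by
  rw [treeCoord_apply, listValue] at h
  split_ifs at h with h'
  · exact ⟨h'.choose, right_ne_zero_of_mul (right_ne_zero_of_mul h), h'.choose_spec.1, by
      rw [h'.choose_spec.2, toList_toFinset]⟩
  · simp at h

theorem IsChain.support_treeCoord {i : ℤ} {c : OrdTree δ a v₀ → k}
    (hc : IsChain (𝔉 := 𝔉) φ (i - n) c) {N : Finset (Finset (Fin n))} (h : treeCoord χ c N ≠ 0) :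
    (χ.buildingSet 𝔠 hφ).Adm N ∧ (N.card : ℤ) + 1 + i = n := by
  obtain ⟨T, h1, h2, rfl⟩ := exists_of_treeCoord h
  have h3 := hc.degree h1
  refine ⟨h2.adm 𝔠 hφ, ?_⟩
  rw [List.toFinset_card_of_nodup (h2.nodup_partList 𝔠), length_partList]
  omega

include 𝔠 in
theorem IsChain.treeCoord_ne_zero {j : ℤ} {c : OrdTree δ a v₀ → k}
    (hc : IsChain (𝔉 := 𝔉) φ j c) (h : c T ≠ 0) :
    treeCoord χ c (T.partList χ).toFinset ≠ 0 := by
  rw [hc.treeCoord_partList 𝔠 (hc.composesTo h)]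
  refine mul_ne_zero (fun e => ?_) (mul_ne_zero (fun e => ?_) h)
  · have := suspSign_mul_self (n := n) (k := k) T.numEdges
    rw [e, mul_zero] at this; exact zero_ne_one this
  · have := listSign_mul_self (κ := code) (k := k) (T.partList χ)
    rw [e, mul_zero] at this; exact zero_ne_one this

include 𝔠 in
theorem IsChain.treeCoord_boundary (hn : 0 < n) {j : ℤ} {c : OrdTree δ a v₀ → k}
    (hc : IsChain (𝔉 := 𝔉) φ (j + 1) c) {N : Finset (Finset (Fin n))}
    (hN : (χ.buildingSet 𝔠 hφ).Adm N) :
    (-1) ^ n * treeCoord χ (OrdTree.boundary k δ a v₀ c) N =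
      coboundary code (treeCoord χ c) N := by
  obtain ⟨T, hT, hL⟩ := exists_partList_eq 𝔠 hφ hn hN (L := N.toList)
    ⟨nodup_toList _, toList_toFinset _⟩
  obtain rfl : (T.partList χ).toFinset = N := by rw [hL, toList_toFinset]
  clear hL
  have hd := hT.nodup_partList 𝔠 (χ := χ)
  rw [(IsChain.boundary hc).treeCoord_partList 𝔠 hT, coboundary]
  rw [show ∀ f : Finset (Fin n) → k, ∑ M ∈ (T.partList χ).toFinset, f M =
    ∑ e ∈ Finset.range T.numEdges, f (T.part χ e) from fun f => by
      rw [toFinset_partList, sum_image fun x hx y hy hxy => hT.part_injective 𝔠 χ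
        (Finset.mem_range.1 hx) (Finset.mem_range.1 hy) hxy]]
  change (-1) ^ n * (suspSign n k T.numEdges * (listSign code k (T.partList χ) *
    ∑ e ∈ Finset.range T.numEdges, (-1) ^ (T.numEdges - 1 - e) * c (T.face e))) = _
  simp only [mul_sum]
  refine Finset.sum_congr rfl fun e he => ?_
  have he' := Finset.mem_range.1 he
  obtain ⟨A, R, h1, h2, h3⟩ := exists_partList_split (χ := χ) he'
  obtain ⟨r, hr⟩ : ∃ r, T.numEdges = r + 1 := ⟨T.numEdges - 1, by omega⟩
  have h4 : (T.partList χ).toFinset.erase (T.part χ e) = ((T.face e).partList χ).toFinset := by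
    rw [h3, h2]
    rw [h2] at hd
    exact erase_toFinset_append hd
  have h5 : listSign code k (T.partList χ) = (-1) ^ e *
      (posSign code k (T.part χ e) (T.partList χ).toFinset *
        listSign code k ((T.face e).partList χ)) := by
    have := listSign_append_cons (k := k) code_injective A R (T.part χ e) (h2 ▸ hd)
    rw [← h2, h1] at this
    rw [h3, this]
  have h6 := suspSign_succ (n := n) (k := k) r
  have h7 : (-1 : k) ^ r = (-1) ^ (r - e) * (-1) ^ e := by
    rw [← pow_add, Nat.sub_add_cancel (by omega)]
  have h8 : ((-1 : k) ^ e) * (-1) ^ e = 1 := by rw [← mul_pow]; simp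
  have h9 : ((-1 : k) ^ (r - e)) * (-1) ^ (r - e) = 1 := by rw [← mul_pow]; simp
  rw [h4, hc.treeCoord_partList 𝔠 (hT.face e), T.numEdges_face he', h5, hr, Nat.add_sub_cancel]
  rw [h7] at h6
  linear_combination ((-1) ^ e * posSign code k (T.part χ e) (T.partList χ).toFinset *
    listSign code k ((T.face e).partList χ) * (-1) ^ (r - e) * c (T.face e)) * h6 +
    (suspSign n k r * posSign code k (T.part χ e) (T.partList χ).toFinset *
    listSign code k ((T.face e).partList χ) * c (T.face e)) *
      ((-1) ^ (r - e) * (-1) ^ (r - e) * h8 + h9)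

open scoped Classical in
/-- The function on trees with given coordinates. -/
noncomputable def ofCoord (φ : tens (fun i => 𝔉.ι.obj (a i)) (List.finRange m) ⟶ 𝔉.ι.obj v₀)
    (χ : Chart δ φ n) (b : Finset (Finset (Fin n)) → k) (T : OrdTree δ a v₀) : k :=
  if ComposesTo φ T then suspSign n k T.numEdges *
    (listSign code k (T.partList χ) * b (T.partList χ).toFinset) else 0

include 𝔠 in
theorem isChain_ofCoord {j : ℤ} {b : Finset (Finset (Fin n)) → k}
    (hb : ∀ N, b N ≠ 0 → -((N.card : ℤ) + 1) = j) :
    IsChain (𝔉 := 𝔉) φ j (ofCoord φ χ b) where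
  iso {T T'} h := by
    have h1 : ComposesTo φ T' ↔ ComposesTo φ T := h.composesTo_iff Function.injective_id
    unfold ofCoord
    rw [h.partList_eq, h.numEdges_eq]
    by_cases hT : ComposesTo φ T
    · rw [if_pos hT, if_pos (h1.2 hT)]
    · rw [if_neg hT, if_neg fun h' => hT (h1.1 h')]
  swap {T T'} i hi h := by
    have h1 : ComposesTo φ T' ↔ ComposesTo φ T := h.composesTo_iff (Equiv.injective _)
    obtain ⟨A, M, M', R, -, h2, h3⟩ := h.exists_partList_swap (χ := χ) hi
    unfold ofCoord
    by_cases hT : ComposesTo φ T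
    · have h4 := (h1.2 hT).nodup_partList 𝔠 (χ := χ)
      rw [if_pos hT, if_pos (h1.2 hT), h2, h3, h.numEdges_eq,
        listSign_swap code_injective A R M' M (h3 ▸ h4), List.toFinset_eq_of_perm _ _
          (((List.Perm.swap M M' R)).append_left A)]
      ring
    · rw [if_neg hT, if_neg fun h' => hT (h1.1 h'), neg_zero]
  composesTo {T} h := by
    by_contra h'; exact h (if_neg h')
  degree {T} h := by
    unfold ofCoord at h
    split_ifs at h with hT
    · rw [← hb _ (right_ne_zero_of_mul (right_ne_zero_of_mul h)),
        List.toFinset_card_of_nodup (hT.nodup_partList 𝔠), length_partList]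
    · exact absurd rfl h

theorem treeCoord_ofCoord (hn : 0 < n) {b : Finset (Finset (Fin n)) → k}
    {j : ℤ} (hb : ∀ N, b N ≠ 0 → (χ.buildingSet 𝔠 hφ).Adm N ∧ -((N.card : ℤ) + 1) = j) :
    treeCoord χ (ofCoord φ χ b) = b := by
  have hc := isChain_ofCoord 𝔠 (χ := χ) fun N hN => (hb N hN).2
  funext N
  by_cases hN : (χ.buildingSet 𝔠 hφ).Adm N
  · obtain ⟨T, hT, hL⟩ := exists_partList_eq 𝔠 hφ hn hN (L := N.toList)
      ⟨nodup_toList _, toList_toFinset _⟩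
    obtain rfl : (T.partList χ).toFinset = N := by rw [hL, toList_toFinset]
    rw [hc.treeCoord_partList 𝔠 hT, ofCoord, if_pos hT]
    have h1 := suspSign_mul_self (n := n) (k := k) T.numEdges
    have h2 := listSign_mul_self (κ := code) (k := k) (T.partList χ)
    linear_combination (suspSign n k T.numEdges * suspSign n k T.numEdges *
      b (T.partList χ).toFinset) * h2 + b (T.partList χ).toFinset * h1
  · have h0 : b N = 0 := by
      by_contra hne; exact hN (hb N hne).1
    rw [h0]
    by_contra hne
    obtain ⟨T, -, hT, rfl⟩ := exists_of_treeCoord hne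
    exact hN (hT.adm 𝔠 hφ)

end OrdTree

variable {φ : 𝔉.source a ⟶ 𝔉.ι.obj v₀} (k : Type w) [Field k]

/-- The suspended chains of trees as cochains on nested families. -/
noncomputable def treeModel (𝔠 : CubicalStructure δ) (χ : Chart δ φ n) (hφ : δ.deg φ = n)
    (hn : 0 < n) : FamilyModel (χ.buildingSet 𝔠 hφ) ((fiber k δ φ).suspension n).cx where
  coord i := OrdTree.treeCoord χ ∘ₗ ((OrdTree.cells k (δ := δ) φ).chains (i - n)).subtype
  injective i := (injective_iff_map_eq_zero _).2 fun c hc => Subtype.ext (funext fun T => by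
    by_contra hne
    exact OrdTree.IsChain.treeCoord_ne_zero 𝔠 (χ := χ) c.2 hne (congrFun hc _))
  support {i x N} h := OrdTree.IsChain.support_treeCoord 𝔠 hφ x.2 h
  surjective {i b} h := by
    have hb : ∀ N, b N ≠ 0 → (χ.buildingSet 𝔠 hφ).Adm N ∧ -((N.card : ℤ) + 1) = i - n :=
      fun N hN => ⟨(h N hN).1, by have := (h N hN).2; omega⟩
    exact ⟨⟨OrdTree.ofCoord φ χ b, OrdTree.isChain_ofCoord 𝔠 fun N hN => (hb N hN).2⟩,
      OrdTree.treeCoord_ofCoord 𝔠 hφ hn hb⟩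
  coord_d {i j} h x N hN := by
    have h1 : j - n + 1 = i - (n : ℤ) := by omega
    obtain ⟨c, hc⟩ := x
    have hc' : OrdTree.IsChain φ (j - n + 1) c := by rw [h1]; exact hc
    have h2 := (OrdTree.cells k (δ := δ) φ).d_apply h1 ⟨c, hc⟩
    have h3 := hc'.treeCoord_boundary 𝔠 hφ hn hN
    change OrdTree.treeCoord χ (((n : ℤ).negOnePow • (fiber k δ φ).cx.d (i - n) (j - n)).hom
      ⟨c, hc⟩).1 N = coboundary code (OrdTree.treeCoord χ c) N
    rw [← h3]
    have h4 : OrdTree.treeCoord χ (((fiber k δ φ).cx.d (i - n) (j - n)).hom ⟨c, hc⟩).1 N =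
        OrdTree.treeCoord χ (OrdTree.boundary k δ a v₀ c) N :=
      congrArg (fun c' => OrdTree.treeCoord χ c' N) h2
    rcases Nat.even_or_odd n with he | ho
    · rw [Int.negOnePow_even _ (by exact_mod_cast he), one_smul, he.neg_one_pow, one_mul, h4]
    · rw [Int.negOnePow_odd _ (by exact_mod_cast ho), Units.neg_smul, one_smul, ho.neg_one_pow,
        neg_one_mul, ← h4]
      change OrdTree.treeCoord χ (-(((fiber k δ φ).cx.d (i - n) (j - n)).hom ⟨c, hc⟩).1) N = _
      rw [map_neg]; rfl

end TreeModel

section QuasiIso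
variable {k : Type w} [Field k]

theorem shortComplex_quasiIso {S S' : ShortComplex (ModuleCat.{t} k)} (φ : S ⟶ S')
    (hi : ∀ x : S.X₂, S.g.hom x = 0 → ∀ y : S'.X₁, S'.f.hom y = φ.τ₂.hom x →
      ∃ z : S.X₁, S.f.hom z = x)
    (hs : ∀ x : S'.X₂, S'.g.hom x = 0 → ∃ y : S.X₂, S.g.hom y = 0 ∧ φ.τ₂.hom y = x) :
    ShortComplex.QuasiIso φ := by
  obtain ⟨γ⟩ : Nonempty (ShortComplex.LeftHomologyMapData φ S.moduleCatLeftHomologyData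
    S'.moduleCatLeftHomologyData) := ⟨default⟩
  rw [γ.quasiIso_iff, ConcreteCategory.isIso_iff_bijective]
  have hi' : ∀ y, (γ.φK.hom y).1 = φ.τ₂.hom y.1 := fun y =>
    congrArg (fun f => f.hom y) γ.commi
  have hπ : ∀ y, γ.φH.hom (Submodule.Quotient.mk y) = Submodule.Quotient.mk (γ.φK.hom y) :=
    fun y => congrArg (fun f => f.hom y) γ.commπ
  constructor
  · refine (injective_iff_map_eq_zero γ.φH.hom).2 fun x hx => ?_
    obtain ⟨y, rfl⟩ := Submodule.Quotient.mk_surjective _ x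
    obtain ⟨z, hz⟩ := (Submodule.Quotient.mk_eq_zero _).1 ((hπ y).symm.trans hx)
    obtain ⟨z', hz'⟩ := hi y.1 y.2 z ((congrArg Subtype.val hz).trans (hi' y))
    exact (Submodule.Quotient.mk_eq_zero _).2 ⟨z', Subtype.ext hz'⟩
  · intro x
    obtain ⟨y, rfl⟩ := Submodule.Quotient.mk_surjective _ x
    obtain ⟨z, hz, hz'⟩ := hs y.1 y.2
    exact ⟨Submodule.Quotient.mk ⟨z, hz⟩, (hπ ⟨z, hz⟩).trans
      (congrArg Submodule.Quotient.mk (Subtype.ext ((hi' _).trans hz')))⟩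

theorem exactAt_of_forall {K : ChainComplex (ModuleCat.{t} k) ℤ} (i : ℤ)
    (h : ∀ x : K.X i, (K.d i (i - 1)).hom x = 0 → ∃ y, (K.d (i + 1) i).hom y = x) :
    K.ExactAt i := by
  rw [K.exactAt_iff' (i + 1) i (i - 1) (ChainComplex.prev ℤ i) (ChainComplex.next ℤ i),
    ShortComplex.moduleCat_exact_iff]
  exact h

end QuasiIso

namespace BuildingSet
open scoped Classical in
section
variable {n : ℕ} {B : BuildingSet n} {k : Type w} [Field k]

theorem Adm.nested_insert (hB : B.mem univ) {N : Finset (Finset (Fin n))} (h : B.Adm N) :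
    B.Cover univ (insert univ N) := by
  have key : ∀ J : Finset (Finset (Fin n)), univ ∈ J → J.sup id = univ := fun J hJ =>
    univ_subset_iff.1 (le_sup (f := id) hJ)
  refine ⟨⟨fun S hS => ?_, fun J hJ hm => ?_⟩, key _ (mem_insert_self _ _)⟩
  · rcases mem_insert.1 hS with rfl | hS
    exacts [hB, h.1.1 S hS]
  · by_cases hu : univ ∈ J
    · rw [key J hu]; exact hu
    · exact h.1.2 J (fun S hS => (mem_insert.1 (hJ hS)).resolve_left fun e => hu (e ▸ hS)) hm

theorem Cover.univ_mem (hB : B.mem univ) {N : Finset (Finset (Fin n))} (h : B.Cover univ N) :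
    univ ∈ N := by
  have := h.1.2 N subset_rfl (by rw [h.2]; exact hB)
  rwa [h.2] at this

theorem Cover.adm_erase {N : Finset (Finset (Fin n))} (h : B.Cover univ N) :
    B.Adm (N.erase univ) :=
  ⟨h.1.mono (erase_subset _ _), notMem_erase _ _⟩

variable (B k) in
/-- The cohomology of the complex of nested families that do not contain the whole set is at most
one-dimensional and concentrated in the top degree. -/
theorem exists_cocycle_adm {κ : Finset (Fin n) → ℕ} (hκ : Function.Injective κ)
    (hB : B.mem univ) : ∃ c₀ : Finset (Finset (Fin n)) → k,
      (∀ N, c₀ N ≠ 0 → B.Adm N ∧ N.card + 1 = n) ∧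
      ∀ c : Finset (Finset (Fin n)) → k, (∀ N, c N ≠ 0 → B.Adm N) →
        (∀ N, B.Adm N → coboundary κ c N = 0) → ∃ (r : k) (b : Finset (Finset (Fin n)) → k),
          ∀ N, B.Adm N → c N = r * c₀ N + coboundary κ b N := by
  obtain ⟨c₀, h1, h2⟩ := B.exists_cocycle k hκ univ
  refine ⟨fun N => if B.Adm N then posSign κ k univ (insert univ N) * c₀ (insert univ N) else 0,
    fun N hN => ?_, fun c hc hd => ?_⟩
  · dsimp only at hN
    split_ifs at hN with hA
    · have := (h1 _ (right_ne_zero_of_mul hN)).2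
      rw [card_univ, Fintype.card_fin, card_insert_of_notMem hA.2] at this
      exact ⟨hA, this⟩
    · exact absurd rfl hN
  · obtain ⟨r, b, h3, h4⟩ := h2 (extend κ univ c) (fun N hN => by
        unfold extend at hN
        split_ifs at hN with hu
        · have := (hc _ (right_ne_zero_of_mul hN)).nested_insert hB
          rwa [insert_erase hu] at this
        · exact absurd rfl hN) fun N hN => by
      rw [coboundary_extend hκ c (hN.univ_mem hB), hd _ hN.adm_erase, mul_zero, neg_zero]
    let b' : Finset (Finset (Fin n)) → k := fun M =>
      posSign κ k univ (insert univ M) * b (insert univ M)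
    have h5 : b = extend κ univ b' := funext fun N => by
      unfold extend
      split_ifs with hu
      · change _ = _ * (posSign κ k univ _ * _)
        rw [insert_erase hu, ← mul_assoc, posSign_mul_self, one_mul]
      · by_contra hne
        exact hu ((h3 N hne).univ_mem hB)
    refine ⟨r, fun M => -1 * b' M, fun N hN => ?_⟩
    have h6 := h4 _ (hN.nested_insert hB)
    rw [h5, coboundary_extend hκ b' (mem_insert_self _ _), extend, if_pos (mem_insert_self _ _),
      erase_insert hN.2] at h6
    dsimp only
    rw [if_pos hN, coboundary_smul]
    linear_combination posSign κ k univ (insert univ N) * h6 +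
      (-c N - coboundary κ b' N) * posSign_mul_self κ (k := k) univ (insert univ N)

end
end BuildingSet

namespace FamilyModel
variable {n : ℕ} {k : Type w} [Field k] {B : BuildingSet n} {K : ChainComplex (ModuleCat.{t} k) ℤ}
  (m : FamilyModel B K)
include m

open scoped Classical in
theorem exists_generator (hB : B.mem univ) : ∃ c₀ : Finset (Finset (Fin n)) → k,
    (∀ N, c₀ N ≠ 0 → B.Adm N ∧ N.card + 1 = n) ∧ ∀ (i : ℤ) (x : K.X i),
      (K.d i (i - 1)).hom x = 0 → ∃ (r : k) (y : K.X (i + 1)), ∀ N,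
        (N.card : ℤ) + 1 + i = n → m.coord i x N =
          r * c₀ N + m.coord i ((K.d (i + 1) i).hom y) N := by
  obtain ⟨c₀, h1, h2⟩ := B.exists_cocycle_adm k code_injective hB
  refine ⟨c₀, h1, fun i x hx => ?_⟩
  obtain ⟨r, b, h3⟩ := h2 (m.coord i x) (fun N hN => (m.support hN).1) fun N hN => by
    rw [← m.coord_d (by omega : i - 1 + 1 = i) x hN, hx, map_zero]; rfl
  obtain ⟨y, hy⟩ := m.surjective (i := i + 1)
    (b := fun N => if B.Adm N ∧ (N.card : ℤ) + 1 + (i + 1) = n then b N else 0) fun N hN => by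
      by_contra h; exact hN (if_neg h)
  refine ⟨r, y, fun N hN => ?_⟩
  by_cases hA : B.Adm N
  · rw [h3 N hA, m.coord_d rfl y hA, hy]
    congr 1
    refine coboundary_congr fun M hM => (if_pos ⟨hA.mono (erase_subset M N), ?_⟩).symm
    have := card_erase_add_one hM
    omega
  · have h4 : ∀ z : K.X i, m.coord i z N = 0 := fun z => by
      by_contra hne; exact hA (m.support hne).1
    have h5 : c₀ N = 0 := by
      by_contra hne; exact hA (h1 N hne).1
    rw [h4, h4, h5, mul_zero, add_zero]

theorem coord_ext {i : ℤ} {x y : K.X i}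
    (h : ∀ N, (N.card : ℤ) + 1 + i = n → m.coord i x N = m.coord i y N) : x = y := by
  refine m.injective i (funext fun N => ?_)
  by_cases hN : (N.card : ℤ) + 1 + i = n
  · exact h N hN
  · have h4 : ∀ z : K.X i, m.coord i z N = 0 := fun z => by
      by_contra hne; exact hN (m.support hne).2
    rw [h4, h4]

theorem exactAt (hB : B.mem univ) {i : ℤ} (hi : i ≠ 0) : K.ExactAt i := by
  obtain ⟨c₀, h1, h2⟩ := m.exists_generator hB
  refine exactAt_of_forall i fun x hx => ?_
  obtain ⟨r, y, h3⟩ := h2 i x hx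
  refine ⟨y, (m.coord_ext fun N hN => ?_).symm⟩
  have h4 : c₀ N = 0 := by
    by_contra hne
    have := (h1 N hne).2
    omega
  rw [h3 N hN, h4, mul_zero, zero_add]

theorem eq_zero_of_neg (hB : B.mem univ) {i : ℤ} (hi : i < 0) (x : K.X i) : x = 0 := by
  refine m.injective i (funext fun N => ?_)
  rw [map_zero]
  by_contra hne
  have h1 := m.support hne
  have := h1.1.card_lt hB
  omega

theorem exists_generator_zero (hB : B.mem univ) : ∃ e₀ : K.X 0, ∀ x : K.X 0,
    ∃ (r : k) (y : K.X (0 + 1)), x = r • e₀ + (K.d (0 + 1) 0).hom y := by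
  obtain ⟨c₀, h1, h2⟩ := m.exists_generator hB
  obtain ⟨e₀, he⟩ := m.surjective (i := 0) (b := c₀) fun N hN =>
    ⟨(h1 N hN).1, by have := (h1 N hN).2; omega⟩
  refine ⟨e₀, fun x => ?_⟩
  obtain ⟨r, y, h3⟩ := h2 0 x (m.eq_zero_of_neg hB (by omega) _)
  refine ⟨r, y, m.coord_ext fun N hN => ?_⟩
  rw [h3 N hN, map_add, map_smul, he]; rfl

omit m in
/-- A surjective chain map between complexes presented by nested families is a quasi-isomorphism if
the target has homology in degree zero. -/
theorem quasiIso (m : FamilyModel B K) (hB : B.mem univ) {B' : BuildingSet n}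
    {K' : ChainComplex (ModuleCat.{t} k) ℤ} (m' : FamilyModel B' K') (hB' : B'.mem univ)
    (f : K ⟶ K') (hf : ∀ i, Function.Surjective (f.f i))
    (hw : ∃ w : K'.X 0, ∀ y : K'.X (0 + 1), (K'.d (0 + 1) 0).hom y ≠ w) : QuasiIso f := by
  rw [quasiIso_iff]
  intro i
  by_cases hi : i = 0
  swap
  · rw [quasiIsoAt_iff_exactAt _ _ (m.exactAt hB hi)]
    exact m'.exactAt hB' hi
  subst hi
  have hcomm : ∀ y : K.X (0 + 1), (f.f 0).hom ((K.d (0 + 1) 0).hom y) =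
      (K'.d (0 + 1) 0).hom ((f.f (0 + 1)).hom y) := fun y =>
    (congrArg (fun g => g.hom y) (f.comm (0 + 1) 0)).symm
  rw [quasiIsoAt_iff' f (0 + 1) 0 (0 - 1) (ChainComplex.prev ℤ 0) (ChainComplex.next ℤ 0)]
  refine shortComplex_quasiIso _ (fun x hx y hy => ?_) fun x hx => ?_
  · change K.X 0 at x
    change K'.X (0 + 1) at y
    change (K'.d (0 + 1) 0).hom y = (f.f 0).hom x at hy
    change ∃ z : K.X (0 + 1), (K.d (0 + 1) 0).hom z = x
    obtain ⟨e₀, he⟩ := m.exists_generator_zero hB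
    obtain ⟨r, z, hz⟩ := he x
    by_cases hr : r = 0
    · exact ⟨z, by rw [hz, hr, zero_smul]; exact (zero_add _).symm⟩
    exfalso
    have h1 : (f.f 0).hom e₀ = (K'.d (0 + 1) 0).hom (r⁻¹ • (y - (f.f (0 + 1)).hom z)) := by
      rw [map_smul, map_sub, hy, hz, map_add, map_smul, hcomm, add_sub_cancel_right, smul_smul,
        inv_mul_cancel₀ hr, one_smul]
    obtain ⟨w, hw⟩ := hw
    obtain ⟨x', hx'⟩ := hf 0 w
    obtain ⟨s, z', hz'⟩ := he x'
    refine hw (s • (r⁻¹ • (y - (f.f (0 + 1)).hom z)) + (f.f (0 + 1)).hom z') ?_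
    rw [map_add, map_smul, ← h1, ← hcomm, ← map_smul, ← map_add, ← hz']
    exact hx'
  · obtain ⟨y, hy⟩ := hf 0 x
    exact ⟨y, m.eq_zero_of_neg hB (by omega : (0 : ℤ) - 1 < 0) _, hy⟩

end FamilyModel

section Augmentation
variable {n : ℕ} {k : Type w} [Field k]

theorem sum_boundary_vertices [CharZero k] (c : Face.{t} n → k) :
    ∑ x : Fin n, Face.boundary k n c ⟨{x}, singleton_nonempty x⟩ = 0 := by
  have h1 : ∀ x : Fin n, Face.boundary k n c ⟨{x}, singleton_nonempty x⟩ = ∑ y : Fin n,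
      if x < y then -c ⟨{x, y}, insert_nonempty _ _⟩
      else if y < x then c ⟨{y, x}, insert_nonempty _ _⟩ else 0 := fun x => by
    change ∑ y ∈ ({x} : Finset (Fin n))ᶜ, (-1 : k) ^ (({x} : Finset (Fin n)).filter (· < y)).card *
      c (Face.adjoin ⟨{x}, singleton_nonempty x⟩ y) = _
    rw [← Finset.sum_subset (subset_univ ({x} : Finset (Fin n))ᶜ)]
    · refine Finset.sum_congr rfl fun y hy => ?_
      rw [mem_compl, mem_singleton] at hy
      rcases lt_or_gt_of_ne hy with h | h
      · rw [if_neg h.not_gt, if_pos h, filter_singleton, if_neg h.not_gt, card_empty, pow_zero,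
          one_mul]
        rfl
      · have e : Face.adjoin ⟨{x}, singleton_nonempty x⟩ y =
            (⟨{x, y}, insert_nonempty _ _⟩ : Face.{t} n) := by
          simp only [Face.adjoin, Finset.pair_comm]
        rw [if_pos h, filter_singleton, if_pos h, card_singleton, pow_one, e, neg_one_mul]
    · intro y _ hy
      rw [mem_compl, not_not, mem_singleton] at hy
      rw [hy, if_neg (lt_irrefl _), if_neg (lt_irrefl _)]
  simp only [h1]
  have h2 : ∀ S : k, S = -S → S = 0 := fun S hS => self_eq_neg.1 hS
  refine h2 _ ?_
  conv_lhs => rw [Finset.sum_comm]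
  rw [← Finset.sum_neg_distrib]
  refine Finset.sum_congr rfl fun x _ => ?_
  rw [← Finset.sum_neg_distrib]
  refine Finset.sum_congr rfl fun y _ => ?_
  rcases lt_trichotomy x y with h | rfl | h
  · rw [if_pos h, if_neg h.not_gt, if_pos h, neg_neg]
  · simp
  · rw [if_pos h, if_neg h.not_gt, if_pos h]

theorem exists_not_boundary [CharZero k] (hn : 0 < n) :
    ∃ x : (simplex.{w, t} k n).cx.X 0, ∀ y : (simplex.{w, t} k n).cx.X (0 + 1),
      ((simplex.{w, t} k n).cx.d (0 + 1) 0).hom y ≠ x := by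
  classical
  let x₀ : Face.{t} n := ⟨{⟨0, hn⟩}, singleton_nonempty _⟩
  refine ⟨⟨Pi.single x₀ 1, fun X hX => ?_⟩, fun y hy => ?_⟩
  · have : X = x₀ := by
      by_contra hne; exact hX (Pi.single_eq_of_ne hne _)
    subst this; rfl
  · have h1 := (Face.cells.{w, t} k n).d_apply (rfl : (0 : ℤ) + 1 = 0 + 1) y
    have h2 : Face.boundary k n y.1 = Pi.single x₀ 1 := h1.symm.trans (congrArg Subtype.val hy)
    have h3 := sum_boundary_vertices y.1
    rw [h2, Finset.sum_eq_single (⟨0, hn⟩ : Fin n)] at h3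
    · rw [Pi.single_eq_same] at h3
      exact one_ne_zero h3
    · intro z _ hz
      refine Pi.single_eq_of_ne (fun e => hz ?_) _
      have : ({z} : Finset (Fin n)) = {⟨0, hn⟩} := congrArg Face.verts e
      exact singleton_injective this
    · exact fun h => absurd (mem_univ _) h

end Augmentation

section Filtrations
variable {n : ℕ} {k : Type w} [Field k] {B : BuildingSet n}

/-- The filtration of a complex corresponds to the filtration of the cochains on nested families by the
number of points that are not covered. -/
def FamilyModel.Filtered {K : FilteredComplex.{w, t} k} (m : FamilyModel B K.cx) : Prop :=
  ∀ (s : ℕ) (i : ℤ) (x : K.cx.X i),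
    x ∈ K.filt s i ↔ ∀ N, m.coord i x N ≠ 0 → ((N.sup id)ᶜ).card ≤ s

theorem simplexModel_filtered (hn : 0 < n) : (simplexModel.{w, t} n k hn).Filtered := by
  intro s i x
  constructor
  · intro h N hN
    obtain ⟨U, hU, rfl⟩ := (minimal_adm_iff hn).1 ((simplexModel n k hn).support hN).1
    change faceCoord x.1 _ ≠ 0 at hN
    rw [faceCoord_image hn _ hU, faceValue] at hN
    split_ifs at hN with hne
    · rw [sup_image_singleton]
      exact h _ (right_ne_zero_of_mul hN)
    · exact absurd (mul_zero _) hN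
  · intro h Y hY
    have h1 := h (Y.vertsᶜ.image Singleton.singleton) fun e => hY (by
      have e' : faceSign k Y.verts * x.1 Y = 0 := (faceCoord_face hn x.1 Y).symm.trans e
      linear_combination faceSign k Y.verts * e' - x.1 Y * faceSign_mul_self (k := k) Y.verts)
    rw [sup_image_singleton, compl_compl] at h1
    exact h1

theorem FamilyModel.Filtered.ofPermutohedron_mem {K : FilteredComplex.{w, max t w} k}
    {m : FamilyModel B K.cx} (hm : m.Filtered) (hB : B.mem univ) (s : ℕ) (i : ℤ)
    (c : (permutohedron.{w, t} k n).cx.X i) (hc : c ∈ (permutohedron.{w, t} k n).filt s i) :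
    (m.ofPermutohedron hB).f i c ∈ K.filt s i := by
  refine (hm s i _).2 fun N hN => ?_
  have h1 : m.coord i ((m.ofPermutohedron hB).f i c) = transfer B code c.1 :=
    m.coord_transferHom i c
  rw [h1] at hN
  obtain ⟨-, α, L, h2, h3, h4, h5⟩ := exists_of_transfer hN
  rw [← h3.2, ← leastBlock_eq h4 h5]
  exact hc α h2

theorem FamilyModel.Filtered.exists_ofPermutohedron_eq {K : FilteredComplex.{w, max t w} k}
    {m : FamilyModel B K.cx} (hm : m.Filtered) (hB : B.mem univ) (s : ℕ) (i : ℤ)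
    (x : K.cx.X i) (hx : x ∈ K.filt s i) : ∃ c ∈ (permutohedron.{w, t} k n).filt s i,
      (m.ofPermutohedron hB).f i c = x := by
  obtain ⟨c, h1, h2⟩ := m.exists_ofPermutohedron_eq.{w, t} hB x
  refine ⟨c, fun α hα => ?_, h1⟩
  obtain ⟨N, h3, h4⟩ := h2 α hα
  change α.leastBlock.card ≤ s
  rw [h4]
  exact (hm s i x).1 hx N h3

theorem permToSimplex_eq (hn : 0 < n) {i : ℤ} (c : (permutohedron.{w, t} k n).cx.X i) :
    (Face.cells.{w, t} k n).coeff
      (((simplexModel.{w, t} n k hn).ofPermutohedron (minimal_univ hn)).f i c) =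
      permToSimplex ((TOPartition.cells.{w, t} k n).coeff c) := by
  funext Y
  have h1 : faceCoord ((Face.cells.{w, t} k n).coeff
      (((simplexModel.{w, t} n k hn).ofPermutohedron (minimal_univ hn)).f i c)) =
      transfer (minimal n) code ((TOPartition.cells.{w, t} k n).coeff c) :=
    (simplexModel n k hn).coord_transferHom i c
  have h2 := congrFun h1 (Y.vertsᶜ.image Singleton.singleton)
  rw [faceCoord_face hn, transfer_minimal hn] at h2
  linear_combination faceSign k Y.verts * h2 +
    (permToSimplex ((TOPartition.cells.{w, t} k n).coeff c) Y -
      (Face.cells.{w, t} k n).coeff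
        (((simplexModel.{w, t} n k hn).ofPermutohedron (minimal_univ hn)).f i c) Y) *
      faceSign_mul_self (k := k) Y.verts

end Filtrations

section Factor
variable {k : Type w} [Field k] {P K D : ChainComplex (ModuleCat.{t} k) ℤ}

/-- A chain map that vanishes on the kernel of a surjective chain map factors through it. -/
theorem exists_factor (f : P ⟶ K) (p : P ⟶ D) (hf : ∀ i, Function.Surjective (f.f i))
    (h : ∀ i c, f.f i c = 0 → p.f i c = 0) : ∃ g : K ⟶ D, f ≫ g = p := by
  choose σ hσ using hf
  have key : ∀ i c c', f.f i c = f.f i c' → p.f i c = p.f i c' := fun i c c' hc => by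
    have := h i (c - c') (by rw [map_sub, hc, sub_self])
    rwa [map_sub, sub_eq_zero] at this
  let G : ∀ i, K.X i →ₗ[k] D.X i := fun i =>
    { toFun := fun x => p.f i (σ i x)
      map_add' := fun x y => by
        rw [← map_add]; apply key; rw [map_add, hσ, hσ, hσ]
      map_smul' := fun r x => by
        rw [RingHom.id_apply, ← map_smul]; apply key; rw [map_smul, hσ, hσ] }
  have hG : ∀ i c, G i (f.f i c) = p.f i c := fun i c => key i _ _ (hσ i _)
  refine ⟨⟨fun i => ModuleCat.ofHom (G i), fun i j _ => ModuleCat.hom_ext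
    (LinearMap.ext fun x => ?_)⟩, ?_⟩
  · obtain ⟨c, rfl⟩ : ∃ c, f.f i c = x := ⟨_, hσ i x⟩
    have h1 : (D.d i j).hom ((p.f i).hom c) = (p.f j).hom ((P.d i j).hom c) :=
      congrArg (fun q => q.hom c) (p.comm i j)
    have h2 : (K.d i j).hom ((f.f i).hom c) = (f.f j).hom ((P.d i j).hom c) :=
      congrArg (fun q => q.hom c) (f.comm i j)
    change (D.d i j).hom (G i (f.f i c)) = G j ((K.d i j).hom ((f.f i).hom c))
    rw [hG, h2]
    exact h1.trans (hG j _).symm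
  · ext i c
    exact hG i c

end Factor

section Tree
variable {V : Type u₁} [Groupoid.{v₁} V] {C : Type u} [Category.{v} C]
    [MonoidalCategory C] [SymmetricCategory C] {𝔉 : FeynmanCategory V C} {δ : ProperDegree 𝔉}
    {m n : ℕ} {a : Fin m → V} {v₀ : V}

namespace OrdTree
variable {φ : tens (fun i => 𝔉.ι.obj (a i)) (List.finRange m) ⟶ 𝔉.ι.obj v₀}

theorem IsChain.width_le_iff (𝔠 : CubicalStructure δ) {χ : Chart δ φ n} (hφ : δ.deg φ = n)
    {k : Type w} [Field k] {j : ℤ} {c : OrdTree δ a v₀ → k} (hc : IsChain (𝔉 := 𝔉) φ j c) (s : ℕ) :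
    (∀ T, c T ≠ 0 → T.width ≤ s) ↔
      ∀ N, treeCoord χ c N ≠ 0 → ((N.sup id)ᶜ).card ≤ s := by
  have key : ∀ T : OrdTree δ a v₀, ComposesTo φ T →
      (((T.partList χ).toFinset.sup id)ᶜ).card = T.width := fun T hT => by
    have h1 := hT.card_sup 𝔠 χ hφ
    rw [card_compl, Fintype.card_fin, sup_partList]
    omega
  constructor
  · intro h N hN
    obtain ⟨T, h1, h2, rfl⟩ := exists_of_treeCoord hN
    exact (key T h2).trans_le (h T h1)
  · intro h T hT
    exact (key T (hc.composesTo hT)).symm.trans_le (h _ (hc.treeCoord_ne_zero 𝔠 hT))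

end OrdTree

theorem treeModel_filtered {φ : 𝔉.source a ⟶ 𝔉.ι.obj v₀} (k : Type w) [Field k]
    (𝔠 : CubicalStructure δ) (χ : Chart δ φ n) (hφ : δ.deg φ = n) (hn : 0 < n) :
    (treeModel k 𝔠 χ hφ hn).Filtered (K := (fiber k δ φ).suspension n) :=
  fun s _ x => OrdTree.IsChain.width_le_iff 𝔠 hφ x.2 s

theorem Chart.buildingSet_univ (𝔠 : CubicalStructure δ) {φ : 𝔉.source a ⟶ 𝔉.ι.obj v₀}
    (χ : Chart δ φ n) (hφ : δ.deg φ = n) (hn : 0 < n) : (χ.buildingSet 𝔠 hφ).mem univ :=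
  ⟨_, φ, 𝟙 _, Category.comp_id φ, connected_of_target (by omega), χ.ground_eq_univ hφ⟩

end Tree

end Feyn

open Feyn in
theorem lemma5p1 {V : Type u₁} [Groupoid.{v₁} V] {C : Type u} [Category.{v} C]
    [MonoidalCategory C] [SymmetricCategory C] (𝔉 : FeynmanCategory V C) (δ : ProperDegree 𝔉)
    (𝔠 : CubicalStructure δ) (k : Type w) [Field k] [CharZero k]
    {m : ℕ} (a : Fin m → V) (v₀ : V) (φ : 𝔉.source a ⟶ 𝔉.ι.obj v₀)
    (n : ℕ) (hn : 1 ≤ n) (hφ : δ.deg φ = n) :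
    ∃ (f : (permutohedron.{w, max u₁ v} k n).cx ⟶ ((fiber k δ φ).suspension n).cx)
      (g : ((fiber k δ φ).suspension n).cx ⟶ (simplex.{w, max u₁ v} k n).cx),
      (∀ t i c, c ∈ (permutohedron.{w, max u₁ v} k n).filt t i →
        f.f i c ∈ ((fiber k δ φ).suspension n).filt t i) ∧
      (∀ t i c, c ∈ ((fiber k δ φ).suspension n).filt t i →
        g.f i c ∈ (simplex.{w, max u₁ v} k n).filt t i) ∧
      (∀ i, Function.Surjective (f.f i)) ∧ (∀ i, Function.Surjective (g.f i)) ∧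
      QuasiIso f ∧ QuasiIso g ∧
      ∀ (i : ℤ) (c : (permutohedron.{w, max u₁ v} k n).cx.X i),
        (Face.cells.{w, max u₁ v} k n).coeff ((f ≫ g).f i c) =
          permToSimplex ((TOPartition.cells.{w, max u₁ v} k n).coeff c) := by
  obtain ⟨χ⟩ := 𝔠.exists_chart φ hφ
  have hB := χ.buildingSet_univ 𝔠 hφ hn
  have hB' := minimal_univ hn
  let mT := treeModel k 𝔠 χ hφ hn
  let mD := simplexModel.{w, max u₁ v} n k hn
  let mP := permutohedronModel.{w, max u₁ v} n k hn
  have hT : mT.Filtered (K := (fiber k δ φ).suspension n) := treeModel_filtered k 𝔠 χ hφ hn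
  have hD : mD.Filtered := simplexModel_filtered hn
  let f := mT.ofPermutohedron hB
  let p := mD.ofPermutohedron hB'
  have hf : ∀ i, Function.Surjective (f.f i) := fun i x =>
    (mT.exists_ofPermutohedron_eq hB x).imp fun _ h => h.1
  have hp : ∀ i, Function.Surjective (p.f i) := fun i x =>
    (mD.exists_ofPermutohedron_eq hB' x).imp fun _ h => h.1
  obtain ⟨g, hg⟩ : ∃ g, f ≫ g = p := exists_factor f p hf fun i c hc => by
    refine mD.injective i ?_
    have h1 : mT.coord i (f.f i c) = BuildingSet.transfer _ code c.1 := mT.coord_transferHom i c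
    have h2 : mD.coord i (p.f i c) = BuildingSet.transfer _ code c.1 := mD.coord_transferHom i c
    rw [hc, map_zero] at h1
    rw [h2, map_zero, ← BuildingSet.collapse_transfer (B := χ.buildingSet 𝔠 hφ) code_injective hn,
      ← h1, map_zero]
  have hgf : ∀ i c, g.f i (f.f i c) = p.f i c := fun i c =>
    congrArg (fun q => (q.f i).hom c) hg
  have hgs : ∀ i, Function.Surjective (g.f i) := fun i x =>
    (hp i x).elim fun c hc => ⟨f.f i c, (hgf i c).trans hc⟩
  obtain ⟨x, hx⟩ := exists_not_boundary.{w, max u₁ v} (k := k) hn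
  refine ⟨f, g, fun t i c => hT.ofPermutohedron_mem hB t i c, fun t i c hc => ?_, hf, hgs,
    mP.quasiIso (full_univ hn) mT hB f hf ?_, mT.quasiIso hB mD hB' g hgs ⟨x, hx⟩, fun i c => ?_⟩
  · obtain ⟨b, hb, rfl⟩ := hT.exists_ofPermutohedron_eq hB t i c hc
    have := hD.ofPermutohedron_mem hB' t i b hb
    exact (hgf i b).symm ▸ this
  · obtain ⟨y, hy⟩ := hgs 0 x
    refine ⟨y, fun z hz => hx ((g.f (0 + 1)).hom z) ?_⟩
    have h1 : ((simplex.{w, max u₁ v} k n).cx.d (0 + 1) 0).hom ((g.f (0 + 1)).hom z) =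
        (g.f 0).hom ((((fiber k δ φ).suspension n).cx.d (0 + 1) 0).hom z) :=
      congrArg (fun q => q.hom z) (g.comm (0 + 1) 0)
    rw [h1, hz]
    exact hy
  · rw [hg]
    exact permToSimplex_eq hn c
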